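/- Let $V$ be a three-dimensional complex vector space and let $\Lambda$ be the quiver algebra of $T^*\mathbb P(V)=T^*\mathbb P^2$: the path algebra over $\mathbb C$ of the quiver with nodes $0,1,2$ (idempotents $e_0,e_1,e_2$), arrows $z^1,z^2,z^3$ from $0$ to $1$ and from $1$ to $2$, and arrows $w_1,w_2,w_3$ from $1$ to $0$ and from $2$ to $1$ (paths are read from right to left), modulo the relations $$e_2z^iz^je_0=e_2z^jz^ie_0,\quad e_0w_iw_je_2=e_0w_jw_ie_2,\quad e_1z^iw_je_1=e_1w_jz^ie_1,$$ $$\textstyle\sum_i e_az^iw_ie_a=0\ (a=1,2),\qquad \sum_i e_aw_iz^ie_a=0\ (a=0,1).$$ $\Lambda$ is graded by path length. Let $S=\langle e_0,e_1,e_2\rangle$, let $\mathrm{HH}^2(\Lambda)$ be the second Hochschild cohomology (computed by the bar complex over $S$), and let $\mathrm{HH}^2|_{u^k}$ be its part represented by cochains that raise the path length by $k$. $SL(3)=SL(V)$ acts on $\Lambda$ by automorphisms fixing the $e_a$, the $w_i$ transforming as a basis of $V$ and the $z^i$ as the dual basis of $V^*$, and hence on $\mathrm{HH}^2(\Lambda)$.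 Let $\mathsf T_1$ be the span of the arrows, $\mathsf T_2$ the space of quadratic relations and $\mathsf T_3=(\mathsf T_1\otimes_S\mathsf T_2)\cap(\mathsf T_2\otimes_S\mathsf T_1)$, so that the minimal bimodule resolution of $\Lambda$ begins with $\Lambda\otimes_S\mathsf T_3\otimes_S\Lambda\to\Lambda\otimes_S\mathsf T_2\otimes_S\Lambda\to\Lambda\otimes_S\mathsf T_1\otimes_S\Lambda\to\Lambda\otimes_S\Lambda$. The space $\mathsf T_2$ is spanned by $[z\cdot w]_{11}=\sum_i e_1z^iw_ie_1$, $[w\cdot z]_{11}$, $[z\cdot w]_{22}$, $[w\cdot z]_{00}$ (defined likewise), $[z^{[i}z^{j]}]_{20}=e_2(z^iz^j-z^jz^i)e_0$, $[w_{[i}w_{j]}]_{02}=e_0(w_iw_j-w_jw_i)e_2$ and $[w_i,z^j]_{tf,11}=e_1(w_iz^j-z^jw_i)e_1-\tfrac13\delta_i^j\big([w\cdot z]_{11}-[z\cdot w]_{11}\big)$. Evaluating a Hochschild 2-cocycle on $\mathsf T_2$ defines a map from $\mathrm{HH}^2|_{u^k}$ to the part of degree $k$ of the second cohomology of the complex $\mathrm{Hom}_{S^e}(\mathsf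 T_\bullet,\Lambda)$; for $k=-2$ and $k=0$ this map is bijective. Through it: **Order $u^{-2}$.** $\mathrm{HH}^2|_{u^{-2}}$ has dimension $2$, with a basis given by the classes of the cocycles $g_{\emptyset,0}$ and $g_{\emptyset,1}$ on $\mathsf T_2$ with values $$\begin{array}{c|cccc} & [z\cdot w]_{11} & [w\cdot z]_{11} & [z\cdot w]_{22} & [w\cdot z]_{00}\\ \hline g_{\emptyset,0} & e_1 & -e_1 & \tfrac13e_2 & -\tfrac13e_0\\ g_{\emptyset,1} & e_1 & e_1 & e_2 & e_0\end{array}$$ and with value $0$ on $[z^{[i}z^{j]}]_{20}$, $[w_{[i}w_{j]}]_{02}$ and $[w_i,z^j]_{tf,11}$. **Order $u^0$.** As a representation of $SL(3)$, $\mathrm{HH}^2|_{u^0}\cong\mathbf{10}\oplus\mathbf{10}^*\oplus 2\cdot\mathbf 8$, where $\mathbf{10}=S^3V^*$ (totally symmetric tensors $D_{ijk}$), $\mathbf{10}^*=S^3V$ (totally symmetric tensors $\bar D^{ijk}$) and $\mathbf 8=(V\otimes V^*)_{tf}$ (traceless tensors $U^i_j$). An isomorphism sends $D$, $\bar D$ and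 a pair $(U,X)$ of traceless tensors to the classes of the cocycles on $\mathsf T_2$ with the following values (repeated indices are summed, $\epsilon$ is the Levi-Civita symbol, and the values not listed are $0$): * $\mathbf{10}$: $[z^{[i}z^{j]}]_{20}\mapsto\epsilon^{ijr}D_{rkl}[z^kz^l]_{20}$ and $[w_i,z^j]_{tf,11}\mapsto\epsilon^{jlr}D_{rik}[w_lz^k]_{11}$; * $\mathbf{10}^*$: $[w_{[i}w_{j]}]_{02}\mapsto-\epsilon_{ijr}\bar D^{rkl}[w_kw_l]_{02}$ and $[w_i,z^j]_{tf,11}\mapsto\epsilon_{rik}\bar D^{rjl}[w_lz^k]_{11}$; * $2\cdot\mathbf 8$: $[z\cdot w]_{11}\mapsto U^i_j[w_iz^j]_{11}$, $[w\cdot z]_{11}\mapsto-U^i_j[w_iz^j]_{11}$, $[z\cdot w]_{22}\mapsto X^i_j[z^jw_i]_{22}$, $[w\cdot z]_{00}\mapsto-X^i_j[w_iz^j]_{00}$ and $[w_i,z^j]_{tf,11}\mapsto(3X-U)^k_i[w_kz^j]_{11}+(3X-U)^j_l[w_iz^l]_{11}-(2X-\tfrac23U)^k_l\,\delta^j_i[w_kz^l]_{11}$.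 -/

import Mathlib

/-!
The quiver algebra of the cotangent bundle of the projective plane, its Hochschild cohomology in
degree two (bar complex, graded by path length), the beginning of its minimal bimodule resolution,
and the natural actions of `SL(3)`.
-/

set_option maxSynthPendingDepth 3

open scoped Matrix

noncomputable section

namespace TP2

/-! ### The quiver -/

/-- The arrows of the quiver with nodes `0, 1, 2`. The arrow `Sum.inl (a, i)` is the arrow `z^i`
from the node `a` to the node `a + 1`, and `Sum.inr (a, i)` is the arrow `w_i` from the node
`a + 1` to the node `a`; here `a = 0, 1` and `i = 0, 1, 2`. -/
abbrev Arrow : Type := (Fin 2 × Fin 3) ⊕ (Fin 2 × Fin 3)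

/-- The source of an arrow. -/
def src : Arrow → Fin 3
  | Sum.inl p => p.1.castSucc
  | Sum.inr p => p.1.succ

/-- The target of an arrow. -/
def tgt : Arrow → Fin 3
  | Sum.inl p => p.1.succ
  | Sum.inr p => p.1.castSucc

/-- The arrow `z^i` from `0` to `1`. -/
abbrev z10 (i : Fin 3) : Arrow := Sum.inl (0, i)
/-- The arrow `z^i` from `1` to `2`. -/
abbrev z21 (i : Fin 3) : Arrow := Sum.inl (1, i)
/-- The arrow `w_i` from `1` to `0`. -/
abbrev w01 (i : Fin 3) : Arrow := Sum.inr (0, i)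
/-- The arrow `w_i` from `2` to `1`. -/
abbrev w12 (i : Fin 3) : Arrow := Sum.inr (1, i)

/-! ### The quadratic relations

Words are read from right to left: the word `x y` is a path if `src x = tgt y`. A combination of
words of length two is given by its coefficients `r x y`. -/

/-- Combinations of words of length two in the arrows. -/
abbrev Word2 : Type := Arrow → Arrow → ℂ

/-- The word `x y`. -/
def pair (x y : Arrow) : Word2 := Pi.single x (Pi.single y 1)

/-- `e_2 (z^i z^j - z^j z^i) e_0`. -/
def zzRel (i j : Fin 3) : Word2 := pair (z21 i) (z10 j) - pair (z21 j) (z10 i)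
/-- `e_0 (w_i w_j - w_j w_i) e_2`. -/
def wwRel (i j : Fin 3) : Word2 := pair (w01 i) (w12 j) - pair (w01 j) (w12 i)
/-- `e_1 (w_i z^j - z^j w_i) e_1`. -/
def wzRel (i j : Fin 3) : Word2 := pair (w12 i) (z21 j) - pair (z10 j) (w01 i)
/-- `e_1 (z · w) e_1`. -/
def zwRel11 : Word2 := ∑ i, pair (z10 i) (w01 i)
/-- `e_1 (w · z) e_1`. -/
def wzRel11 : Word2 := ∑ i, pair (w12 i) (z21 i)
/-- `e_2 (z · w) e_2`. -/
def zwRel22 : Word2 := ∑ i, pair (z21 i) (w12 i)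
/-- `e_0 (w · z) e_0`. -/
def wzRel00 : Word2 := ∑ i, pair (w01 i) (z10 i)

/-- The trace-free part of `e_1 [w_i, z^j] e_1`. -/
def tfRel (i j : Fin 3) : Word2 :=
  wzRel i j - (if i = j then (1 / 3 : ℂ) else 0) • (wzRel11 - zwRel11)

/-- The defining relations of the quiver algebra. -/
def relSet : Set Word2 :=
  {r | (∃ i j, r = zzRel i j) ∨ (∃ i j, r = wwRel i j) ∨ (∃ i j, r = wzRel i j) ∨
    r = zwRel11 ∨ r = wzRel11 ∨ r = zwRel22 ∨ r = wzRel00}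

/-! ### The quiver algebra -/

/-- The free algebra on the nodes (trivial paths) and the arrows. -/
abbrev Free : Type := FreeAlgebra ℂ (Fin 3 ⊕ Arrow)

/-- The trivial path at a node, in the free algebra. -/
def fe (a : Fin 3) : Free := FreeAlgebra.ι ℂ (Sum.inl a)
/-- An arrow, in the free algebra. -/
def fa (x : Arrow) : Free := FreeAlgebra.ι ℂ (Sum.inr x)

/-- The relations: the first five present the path algebra of the quiver (the trivial paths are
orthogonal idempotents with sum `1`, and `x = e_{tgt x} x e_{src x}` for every arrow `x`), the last
one imposes the quadratic relations. -/
inductive Rel : Free → Free → Prop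
  | orth (a b : Fin 3) (h : a ≠ b) : Rel (fe a * fe b) 0
  | idem (a : Fin 3) : Rel (fe a * fe a) (fe a)
  | sum_one : Rel (∑ a, fe a) 1
  | at_tgt (x : Arrow) : Rel (fe (tgt x) * fa x) (fa x)
  | at_src (x : Arrow) : Rel (fa x * fe (src x)) (fa x)
  | quad (r : Word2) (hr : r ∈ relSet) : Rel (∑ x, ∑ y, r x y • (fa x * fa y)) 0

/-- The quiver algebra `Λ` of the cotangent bundle of the projective plane. -/
def Lam : Type := RingQuot Rel

instance : Ring Lam := inferInstanceAs (Ring (RingQuot Rel))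
instance : Algebra ℂ Lam := inferInstanceAs (Algebra ℂ (RingQuot Rel))

/-- The quotient map. -/
def toLam : Free →ₐ[ℂ] Lam := RingQuot.mkAlgHom ℂ Rel

theorem toLam_rel {a b : Free} (h : Rel a b) : toLam a = toLam b := RingQuot.mkAlgHom_rel ℂ h

/-- The idempotent `e_a` of `Λ`. -/
def e (a : Fin 3) : Lam := toLam (fe a)
/-- The class of an arrow in `Λ`. -/
def ar (x : Arrow) : Lam := toLam (fa x)

/-- The span of the paths of length `n` in `Λ`. -/
def lenPart (n : ℕ) : Submodule ℂ Lam :=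
  Submodule.span ℂ (Set.range e) * Submodule.span ℂ (Set.range ar) ^ n

/-- The part of `Λ` of path length `k`, which is zero if `k < 0`. -/
def homog (k : ℤ) : Submodule ℂ Lam := if 0 ≤ k then lenPart k.toNat else ⊥

/-! ### Hochschild cohomology, from the bar complex over the span of the idempotents -/

/-- Hochschild 1-cochains of weight `w`: bimodule maps over the span of the idempotents which
raise the path length by `w`. -/
def C1 (w : ℤ) : Submodule ℂ (Lam →ₗ[ℂ] Lam) where
  carrier := {h | (∀ a x, h (e a * x) = e a * h x) ∧ (∀ a x, h (x * e a) = h x * e a) ∧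
    ∀ n : ℕ, ∀ x ∈ lenPart n, h x ∈ homog (n + w)}
  add_mem' := by
    rintro f g ⟨f1, f2, f3⟩ ⟨g1, g2, g3⟩
    refine ⟨fun a x => ?_, fun a x => ?_, fun n x hx => ?_⟩
    · simp [f1, g1, mul_add]
    · simp [f2, g2, add_mul]
    · exact Submodule.add_mem _ (f3 n x hx) (g3 n x hx)
  zero_mem' := by
    refine ⟨fun a x => ?_, fun a x => ?_, fun n x hx => ?_⟩
    · simp
    · simp
    · exact Submodule.zero_mem _
  smul_mem' := by
    rintro c f ⟨f1, f2, f3⟩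
    refine ⟨fun a x => ?_, fun a x => ?_, fun n x hx => ?_⟩
    · simp [f1]
    · simp [f2]
    · exact Submodule.smul_mem _ _ (f3 n x hx)

/-- Hochschild 2-cochains of weight `w`: balanced bimodule maps over the span of the idempotents
which raise the path length by `w`. -/
def C2 (w : ℤ) : Submodule ℂ (Lam →ₗ[ℂ] Lam →ₗ[ℂ] Lam) where
  carrier := {f | (∀ a x y, f (e a * x) y = e a * f x y) ∧
    (∀ a x y, f (x * e a) y = f x (e a * y)) ∧ (∀ a x y, f x (y * e a) = f x y * e a) ∧
    ∀ m n : ℕ, ∀ x ∈ lenPart m, ∀ y ∈ lenPart n, f x y ∈ homog (m + n + w)}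
  add_mem' := by
    rintro f g ⟨f1, f2, f3, f4⟩ ⟨g1, g2, g3, g4⟩
    refine ⟨fun a x y => ?_, fun a x y => ?_, fun a x y => ?_, fun m n x hx y hy => ?_⟩
    · simp [f1, g1, mul_add]
    · simp [f2, g2]
    · simp [f3, g3, add_mul]
    · exact Submodule.add_mem _ (f4 m n x hx y hy) (g4 m n x hx y hy)
  zero_mem' := by
    refine ⟨fun a x y => ?_, fun a x y => ?_, fun a x y => ?_, fun m n x hx y hy => ?_⟩
    · simp
    · simp
    · simp
    · exact Submodule.zero_mem _
  smul_mem' := by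
    rintro c f ⟨f1, f2, f3, f4⟩
    refine ⟨fun a x y => ?_, fun a x y => ?_, fun a x y => ?_, fun m n x hx y hy => ?_⟩
    · simp [f1]
    · simp [f2]
    · simp [f3]
    · exact Submodule.smul_mem _ _ (f4 m n x hx y hy)

/-- The Hochschild differential on 1-cochains: `(x, y) ↦ x h(y) - h(x y) + h(x) y`. -/
def d1 : (Lam →ₗ[ℂ] Lam) →ₗ[ℂ] (Lam →ₗ[ℂ] Lam →ₗ[ℂ] Lam) where
  toFun h := (LinearMap.mul ℂ Lam).compl₂ h - (LinearMap.mul ℂ Lam).compr₂ h +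
    (LinearMap.mul ℂ Lam).comp h
  map_add' f g := by
    ext x y
    simp [mul_add]
    abel
  map_smul' c f := by
    ext x y
    simp [smul_add, smul_sub]

theorem d1_apply (h : Lam →ₗ[ℂ] Lam) (x y : Lam) :
    d1 h x y = x * h y - h (x * y) + h x * y := by
  simp [d1]

/-- Hochschild 2-cocycles of weight `w`. -/
def Z2 (w : ℤ) : Submodule ℂ (Lam →ₗ[ℂ] Lam →ₗ[ℂ] Lam) where
  carrier := {f | f ∈ C2 w ∧ ∀ x y z, x * f y z - f (x * y) z + f x (y * z) - f x y * z = 0}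
  add_mem' := by
    rintro f g ⟨f1, f2⟩ ⟨g1, g2⟩
    refine ⟨Submodule.add_mem _ f1 g1, fun x y z => ?_⟩
    have := congrArg₂ (· + ·) (f2 x y z) (g2 x y z)
    simp only [LinearMap.add_apply, mul_add, add_mul]
    simp only [add_zero] at this
    rw [← this]
    abel
  zero_mem' := ⟨Submodule.zero_mem _, fun x y z => by simp⟩
  smul_mem' := by
    rintro c f ⟨f1, f2⟩
    refine ⟨Submodule.smul_mem _ c f1, fun x y z => ?_⟩
    have := congrArg (c • ·) (f2 x y z)
    simpa [smul_add, smul_sub] using this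

/-- Hochschild 2-coboundaries of weight `w`. -/
def B2 (w : ℤ) : Submodule ℂ (Lam →ₗ[ℂ] Lam →ₗ[ℂ] Lam) := (C1 w).map d1

/-- The part of weight `w` of the second Hochschild cohomology of `Λ`. -/
abbrev HH2 (w : ℤ) : Type := ↥(Z2 w) ⧸ (B2 w).submoduleOf (Z2 w)

/-! ### The minimal resolution in low degrees

For `T_1` the span of the arrows, `T_2` the space of quadratic relations and `T_3` the cubic
elements lying in (arrows)(relations) as well as in (relations)(arrows), the spaces of bimodule
maps from `Λ ⊗ T_n ⊗ Λ` to `Λ` are the spaces of bimodule maps from `T_n` to `Λ` over the span of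
the idempotents. -/

/-- The space `T_2` of quadratic relations. -/
def T2 : Submodule ℂ Word2 := Submodule.span ℂ relSet

/-- The space `T_3` of cubic elements `p` such that `p = ∑ x r_x` and `p = ∑ r'_z z` with arrows
`x`, `z` and with `r_x`, `r'_z` in `T_2`. -/
def T3 : Submodule ℂ (Arrow → Arrow → Arrow → ℂ) where
  carrier := {p | (∀ x, p x ∈ T2) ∧ ∀ z, (fun x y => p x y z) ∈ T2}
  add_mem' := by
    rintro p q ⟨p1, p2⟩ ⟨q1, q2⟩
    exact ⟨fun x => T2.add_mem (p1 x) (q1 x), fun z => T2.add_mem (p2 z) (q2 z)⟩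
  zero_mem' := ⟨fun x => T2.zero_mem, fun z => T2.zero_mem⟩
  smul_mem' := by
    rintro c p ⟨p1, p2⟩
    exact ⟨fun x => T2.smul_mem c (p1 x), fun z => T2.smul_mem c (p2 z)⟩

/-- Cochains of weight `w` on `T_1`. -/
def M1 (w : ℤ) : Submodule ℂ (Arrow → Lam) where
  carrier := {h | ∀ x, e (tgt x) * h x = h x ∧ h x * e (src x) = h x ∧ h x ∈ homog (1 + w)}
  add_mem' := by
    intro f g hf hg x
    refine ⟨?_, ?_, Submodule.add_mem _ (hf x).2.2 (hg x).2.2⟩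
    · simp [mul_add, (hf x).1, (hg x).1]
    · simp [add_mul, (hf x).2.1, (hg x).2.1]
  zero_mem' := fun x => ⟨by simp, by simp, Submodule.zero_mem _⟩
  smul_mem' := by
    intro c f hf x
    refine ⟨?_, ?_, Submodule.smul_mem _ c (hf x).2.2⟩
    · simp [(hf x).1]
    · simp [(hf x).2.1]

/-- Cochains of weight `w` on `T_2`: relations between paths from `b` to `a` are sent to
`e_a Λ e_b`, and the path length is raised by `w`. -/
def M2 (w : ℤ) : Submodule ℂ (↥T2 →ₗ[ℂ] Lam) where
  carrier := {g | (∀ (a b : Fin 3) (r : T2),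
      (∀ x y, r.1 x y ≠ 0 → tgt x = a ∧ src y = b) → e a * g r = g r ∧ g r * e b = g r) ∧
    ∀ r, g r ∈ homog (2 + w)}
  add_mem' := by
    rintro f g ⟨f1, f2⟩ ⟨g1, g2⟩
    refine ⟨fun a b r h => ⟨?_, ?_⟩, fun r => Submodule.add_mem _ (f2 r) (g2 r)⟩
    · simp [mul_add, (f1 a b r h).1, (g1 a b r h).1]
    · simp [add_mul, (f1 a b r h).2, (g1 a b r h).2]
  zero_mem' := ⟨fun a b r h => ⟨by simp, by simp⟩, fun r => Submodule.zero_mem _⟩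
  smul_mem' := by
    rintro c f ⟨f1, f2⟩
    refine ⟨fun a b r h => ⟨?_, ?_⟩, fun r => Submodule.smul_mem _ c (f2 r)⟩
    · simp [(f1 a b r h).1]
    · simp [(f1 a b r h).2]

/-- The differential dual to `∂(1 ⊗ x y ⊗ 1) = x ⊗ y ⊗ 1 + 1 ⊗ x ⊗ y` on `T_2`. -/
def dM1 : (Arrow → Lam) →ₗ[ℂ] (↥T2 →ₗ[ℂ] Lam) where
  toFun h :=
    { toFun := fun r => ∑ x, ∑ y, r.1 x y • (ar x * h y + h x * ar y)
      map_add' := fun r s => by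
        simp only [Submodule.coe_add, Pi.add_apply, add_smul, Finset.sum_add_distrib]
      map_smul' := fun c r => by
        simp only [Submodule.coe_smul, Pi.smul_apply, smul_eq_mul, mul_smul, Finset.smul_sum,
          RingHom.id_apply] }
  map_add' f g := by
    ext r
    simp only [LinearMap.coe_mk, AddHom.coe_mk, LinearMap.add_apply, Pi.add_apply,
      ← Finset.sum_add_distrib, ← smul_add]
    refine Finset.sum_congr rfl fun x _ => Finset.sum_congr rfl fun y _ => ?_
    congr 1
    rw [mul_add, add_mul]
    abel
  map_smul' c f := by
    ext r
    simp only [LinearMap.coe_mk, AddHom.coe_mk, LinearMap.smul_apply, Pi.smul_apply,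
      Finset.smul_sum, RingHom.id_apply]
    refine Finset.sum_congr rfl fun x _ => Finset.sum_congr rfl fun y _ => ?_
    rw [smul_comm c]
    congr 1
    simp

/-- Cocycles of weight `w` on `T_2`: they vanish on `∂(1 ⊗ p ⊗ 1) = ∑ x ⊗ r_x ⊗ 1 - ∑ 1 ⊗ r'_z ⊗ z`
for every `p = ∑ x r_x = ∑ r'_z z` in `T_3`. -/
def MZ2 (w : ℤ) : Submodule ℂ (↥T2 →ₗ[ℂ] Lam) where
  carrier := {g | g ∈ M2 w ∧ ∀ p : T3,
    ∑ x, ar x * g ⟨p.1 x, p.2.1 x⟩ - ∑ z, g ⟨fun x y => p.1 x y z, p.2.2 z⟩ * ar z = 0}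
  add_mem' := by
    rintro f g ⟨f1, f2⟩ ⟨g1, g2⟩
    refine ⟨Submodule.add_mem _ f1 g1, fun p => ?_⟩
    have := congrArg₂ (· + ·) (f2 p) (g2 p)
    simp only [LinearMap.add_apply, mul_add, add_mul, Finset.sum_add_distrib]
    simp only [add_zero] at this
    rw [← this]
    abel
  zero_mem' := ⟨Submodule.zero_mem _, fun p => by simp⟩
  smul_mem' := by
    rintro c f ⟨f1, f2⟩
    refine ⟨Submodule.smul_mem _ c f1, fun p => ?_⟩
    have := congrArg (c • ·) (f2 p)
    simpa [smul_sub, Finset.smul_sum] using this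

/-- Coboundaries of weight `w` on `T_2`. -/
def MB2 (w : ℤ) : Submodule ℂ (↥T2 →ₗ[ℂ] Lam) := (M1 w).map dM1

/-- The part of weight `w` of the second cohomology of the complex of bimodule maps from the
minimal resolution to `Λ`. -/
abbrev MH2 (w : ℤ) : Type := ↥(MZ2 w) ⧸ (MB2 w).submoduleOf (MZ2 w)

/-! ### Comparison of the two complexes -/

theorem e_mul_e_of_ne {a b : Fin 3} (h : a ≠ b) : e a * e b = 0 := by
  have := toLam_rel (Rel.orth a b h)
  rwa [map_mul, map_zero] at this

theorem e_mul_self (a : Fin 3) : e a * e a = e a := by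
  have := toLam_rel (Rel.idem a)
  rwa [map_mul] at this

theorem sum_e : ∑ a, e a = 1 := by
  have := toLam_rel Rel.sum_one
  rwa [map_sum, map_one] at this

theorem e_tgt_mul_ar (x : Arrow) : e (tgt x) * ar x = ar x := by
  simp only [e, ar, ← map_mul]
  exact toLam_rel (Rel.at_tgt x)

theorem ar_mul_e_src (x : Arrow) : ar x * e (src x) = ar x := by
  simp only [e, ar, ← map_mul]
  exact toLam_rel (Rel.at_src x)

theorem quad_rel (r : Word2) (hr : r ∈ relSet) : ∑ x, ∑ y, r x y • (ar x * ar y) = 0 := by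
  have h := toLam_rel (Rel.quad r hr)
  simp only [map_sum, map_smul, map_mul, map_zero] at h
  exact h

theorem quad_rel_T2 (r : Word2) (hr : r ∈ T2) : ∑ x, ∑ y, r x y • (ar x * ar y) = 0 := by
  induction hr using Submodule.span_induction with
  | mem r hr => exact quad_rel r hr
  | zero => simp only [Pi.zero_apply, zero_smul, Finset.sum_const_zero]
  | add r s _ _ hr hs =>
    simp only [Pi.add_apply, add_smul, Finset.sum_add_distrib, hr, hs, add_zero]
  | smul c r _ hr =>
    simp only [Pi.smul_apply, smul_eq_mul, mul_smul, ← Finset.smul_sum, hr, smul_zero]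

theorem ar_mem_lenPart (x : Arrow) : ar x ∈ lenPart 1 := by
  rw [← e_tgt_mul_ar x, lenPart, pow_one]
  exact Submodule.mul_mem_mul (Submodule.subset_span ⟨_, rfl⟩) (Submodule.subset_span ⟨_, rfl⟩)

theorem lenPart_mul (m n : ℕ) : lenPart m * lenPart n ≤ lenPart (m + n) := by
  have hS : (1 : Submodule ℂ Lam) ≤ Submodule.span ℂ (Set.range e) := by
    rw [Submodule.one_le, ← sum_e]
    exact Submodule.sum_mem _ fun a _ => Submodule.subset_span ⟨a, rfl⟩
  have hSS : Submodule.span ℂ (Set.range e) * Submodule.span ℂ (Set.range e) ≤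
      Submodule.span ℂ (Set.range e) := by
    rw [Submodule.span_mul_span, Submodule.span_le]
    rintro _ ⟨_, ⟨a, rfl⟩, _, ⟨b, rfl⟩, rfl⟩
    by_cases h : a = b
    · subst h
      change e a * e a ∈ _
      rw [e_mul_self]
      exact Submodule.subset_span ⟨a, rfl⟩
    · change e a * e b ∈ _
      rw [e_mul_e_of_ne h]
      exact Submodule.zero_mem _
  have hVS : Submodule.span ℂ (Set.range ar) * Submodule.span ℂ (Set.range e) ≤
      Submodule.span ℂ (Set.range ar) := by
    rw [Submodule.span_mul_span, Submodule.span_le]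
    rintro _ ⟨_, ⟨x, rfl⟩, _, ⟨b, rfl⟩, rfl⟩
    change ar x * e b ∈ _
    rw [← ar_mul_e_src x, mul_assoc]
    by_cases h : src x = b
    · rw [← h, e_mul_self, ar_mul_e_src]
      exact Submodule.subset_span ⟨x, rfl⟩
    · rw [e_mul_e_of_ne h, mul_zero]
      exact Submodule.zero_mem _
  have hnS : Submodule.span ℂ (Set.range ar) ^ m * Submodule.span ℂ (Set.range e) ≤
      Submodule.span ℂ (Set.range e) * Submodule.span ℂ (Set.range ar) ^ m := by
    cases m with
    | zero => rw [pow_zero, one_mul, mul_one]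
    | succ k =>
      calc Submodule.span ℂ (Set.range ar) ^ (k + 1) * Submodule.span ℂ (Set.range e)
          = Submodule.span ℂ (Set.range ar) ^ k *
            (Submodule.span ℂ (Set.range ar) * Submodule.span ℂ (Set.range e)) := by
            rw [pow_succ, mul_assoc]
        _ ≤ Submodule.span ℂ (Set.range ar) ^ k * Submodule.span ℂ (Set.range ar) :=
            mul_le_mul' le_rfl hVS
        _ = 1 * Submodule.span ℂ (Set.range ar) ^ (k + 1) := by rw [one_mul, pow_succ]
        _ ≤ _ := mul_le_mul' hS le_rfl
  calc lenPart m * lenPart n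
      = Submodule.span ℂ (Set.range e) * (Submodule.span ℂ (Set.range ar) ^ m *
          Submodule.span ℂ (Set.range e)) * Submodule.span ℂ (Set.range ar) ^ n := by
        simp only [lenPart, mul_assoc]
    _ ≤ Submodule.span ℂ (Set.range e) * (Submodule.span ℂ (Set.range e) *
          Submodule.span ℂ (Set.range ar) ^ m) * Submodule.span ℂ (Set.range ar) ^ n :=
        mul_le_mul' (mul_le_mul' le_rfl hnS) le_rfl
    _ = (Submodule.span ℂ (Set.range e) * Submodule.span ℂ (Set.range e)) *
          Submodule.span ℂ (Set.range ar) ^ (m + n) := by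
        simp only [pow_add, mul_assoc]
    _ ≤ lenPart (m + n) := mul_le_mul' hSS le_rfl

theorem mul_mem_homog {m n : ℤ} {x y : Lam} (hx : x ∈ homog m) (hy : y ∈ homog n) :
    x * y ∈ homog (m + n) := by
  unfold homog at hx hy ⊢
  split_ifs at hx with h1
  · split_ifs at hy with h2
    · rw [if_pos (add_nonneg h1 h2), Int.toNat_add h1 h2]
      exact lenPart_mul _ _ (Submodule.mul_mem_mul hx hy)
    · rw [(Submodule.mem_bot ℂ).1 hy, mul_zero]
      exact Submodule.zero_mem _
  · rw [(Submodule.mem_bot ℂ).1 hx, zero_mul]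
    exact Submodule.zero_mem _

theorem lenPart_eq_homog (n : ℕ) : lenPart n = homog n := by simp [homog]

/-- Coboundaries are cocycles. -/
theorem B2_le_Z2 (w : ℤ) : B2 w ≤ Z2 w := by
  rintro _ ⟨h, ⟨h1, h2, h3⟩, rfl⟩
  refine ⟨⟨fun a x y => ?_, fun a x y => ?_, fun a x y => ?_, fun m n x hx y hy => ?_⟩,
    fun x y z => ?_⟩
  · simp only [d1_apply, mul_assoc, h1, mul_add, mul_sub]
  · simp only [d1_apply, mul_assoc, h1, h2]
  · simp only [d1_apply, ← mul_assoc, h2, add_mul, sub_mul]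
  · rw [d1_apply]
    have a1 := h3 m x hx
    have a2 := h3 n y hy
    have a3 := h3 (m + n) (x * y) (lenPart_mul m n (Submodule.mul_mem_mul hx hy))
    rw [lenPart_eq_homog] at hx hy
    have b1 := mul_mem_homog hx a2
    have b2 := mul_mem_homog a1 hy
    rw [← add_assoc] at b1
    rw [add_right_comm] at b2
    rw [Nat.cast_add] at a3
    exact Submodule.add_mem _ (Submodule.sub_mem _ b1 a3) b2
  · simp only [d1_apply, mul_add, mul_sub, add_mul, sub_mul, mul_assoc]
    abel

/-- The evaluation of a Hochschild 2-cochain on `T_2`. It is induced by the map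
`1 ⊗ x y ⊗ 1 ↦ 1 [x | y] 1` from the minimal resolution to the bar complex. -/
def evalT2 : (Lam →ₗ[ℂ] Lam →ₗ[ℂ] Lam) →ₗ[ℂ] (↥T2 →ₗ[ℂ] Lam) where
  toFun f :=
    { toFun := fun r => ∑ x, ∑ y, r.1 x y • f (ar x) (ar y)
      map_add' := fun r s => by
        simp only [Submodule.coe_add, Pi.add_apply, add_smul, Finset.sum_add_distrib]
      map_smul' := fun c r => by
        simp only [Submodule.coe_smul, Pi.smul_apply, smul_eq_mul, mul_smul, Finset.smul_sum,
          RingHom.id_apply] }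
  map_add' f g := by
    ext r
    simp only [LinearMap.coe_mk, AddHom.coe_mk, LinearMap.add_apply, smul_add,
      Finset.sum_add_distrib]
  map_smul' c f := by
    ext r
    simp only [LinearMap.coe_mk, AddHom.coe_mk, LinearMap.smul_apply, Finset.smul_sum,
      RingHom.id_apply]
    refine Finset.sum_congr rfl fun x _ => Finset.sum_congr rfl fun y _ => ?_
    rw [smul_comm]

theorem evalT2_apply (f : Lam →ₗ[ℂ] Lam →ₗ[ℂ] Lam) (r : T2) :
    evalT2 f r = ∑ x, ∑ y, r.1 x y • f (ar x) (ar y) := rfl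

theorem evalT2_mem {w : ℤ} {f : Lam →ₗ[ℂ] Lam →ₗ[ℂ] Lam} (hf : f ∈ Z2 w) :
    evalT2 f ∈ MZ2 w := by
  obtain ⟨⟨h1, h2, h3, h4⟩, hc⟩ := hf
  refine ⟨⟨fun a b r h => ⟨?_, ?_⟩, fun r => ?_⟩, fun p => ?_⟩
  · simp only [evalT2_apply, Finset.mul_sum, mul_smul_comm]
    refine Finset.sum_congr rfl fun x _ => Finset.sum_congr rfl fun y _ => ?_
    by_cases h0 : r.1 x y = 0
    · simp [h0]
    · rw [← h1, ← (h x y h0).1, e_tgt_mul_ar]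
  · simp only [evalT2_apply, Finset.sum_mul, smul_mul_assoc]
    refine Finset.sum_congr rfl fun x _ => Finset.sum_congr rfl fun y _ => ?_
    by_cases h0 : r.1 x y = 0
    · simp [h0]
    · rw [← h3, ← (h x y h0).2, ar_mul_e_src]
  · rw [evalT2_apply]
    refine Submodule.sum_mem _ fun x _ => Submodule.sum_mem _ fun y _ =>
      Submodule.smul_mem _ _ ?_
    have := h4 1 1 _ (ar_mem_lenPart x) _ (ar_mem_lenPart y)
    simpa using this
  · have A : ∀ x y z, ar x * f (ar y) (ar z) - f (ar x) (ar y) * ar z =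
        f (ar x * ar y) (ar z) - f (ar x) (ar y * ar z) := fun x y z => by
      have := hc (ar x) (ar y) (ar z)
      rw [← sub_eq_zero, ← this]
      abel
    have B1 : ∑ x, ∑ y, ∑ z, p.1 x y z • f (ar x) (ar y * ar z) = 0 := by
      refine Finset.sum_eq_zero fun x _ => ?_
      have := congrArg (f (ar x)) (quad_rel_T2 _ (p.2.1 x))
      simpa only [map_sum, map_smul, map_zero] using this
    have B3 : ∑ x, ∑ y, ∑ z, p.1 x y z • f (ar x * ar y) (ar z) = 0 := by
      have : ∀ z, ∑ x, ∑ y, p.1 x y z • f (ar x * ar y) (ar z) = 0 := fun z => by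
        have := congrArg (fun t => f t (ar z)) (quad_rel_T2 _ (p.2.2 z))
        simpa only [map_sum, map_smul, map_zero, LinearMap.sum_apply, LinearMap.smul_apply,
          LinearMap.zero_apply] using this
      have h' := Finset.sum_eq_zero fun z (_ : z ∈ Finset.univ) => this z
      rw [Finset.sum_comm] at h'
      rw [← h']
      exact Finset.sum_congr rfl fun x _ => Finset.sum_comm
    have C1 : ∑ z, (∑ x, ∑ y, p.1 x y z • f (ar x) (ar y)) * ar z =
        ∑ x, ∑ y, ∑ z, p.1 x y z • (f (ar x) (ar y) * ar z) := by
      simp only [Finset.sum_mul, smul_mul_assoc]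
      rw [Finset.sum_comm]
      exact Finset.sum_congr rfl fun x _ => Finset.sum_comm
    simp only [evalT2_apply]
    rw [C1]
    simp only [Finset.mul_sum, mul_smul_comm, ← Finset.sum_sub_distrib, ← smul_sub, A]
    simp only [smul_sub, Finset.sum_sub_distrib, B1, B3, sub_zero]

theorem evalT2_d1_mem {w : ℤ} {h : Lam →ₗ[ℂ] Lam} (hh : h ∈ C1 w) :
    evalT2 (d1 h) ∈ MB2 w := by
  obtain ⟨h1, h2, h3⟩ := hh
  refine ⟨fun x => h (ar x), fun x => ⟨?_, ?_, ?_⟩, ?_⟩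
  · rw [← h1, e_tgt_mul_ar]
  · rw [← h2, ar_mul_e_src]
  · simpa using h3 1 _ (ar_mem_lenPart x)
  · ext r
    have B : ∑ x, ∑ y, r.1 x y • h (ar x * ar y) = 0 := by
      have := congrArg h (quad_rel_T2 _ r.2)
      simpa only [map_sum, map_smul, map_zero] using this
    have : evalT2 (d1 h) r = ∑ x, ∑ y, r.1 x y • (ar x * h (ar y) + h (ar x) * ar y) -
        ∑ x, ∑ y, r.1 x y • h (ar x * ar y) := by
      simp only [evalT2_apply, d1_apply, ← Finset.sum_sub_distrib, ← smul_sub]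
      refine Finset.sum_congr rfl fun x _ => Finset.sum_congr rfl fun y _ => ?_
      congr 1
      abel
    rw [this, B, sub_zero]
    rfl

/-- The evaluation on `T_2`, on cocycles. -/
def evalZ (w : ℤ) : ↥(Z2 w) →ₗ[ℂ] ↥(MZ2 w) :=
  evalT2.restrict fun _ hf => evalT2_mem hf

/-- The map in cohomology given by the evaluation of Hochschild 2-cocycles on `T_2`. -/
def cmp (w : ℤ) : HH2 w →ₗ[ℂ] MH2 w :=
  Submodule.mapQ _ _ (evalZ w) <| by
    rintro ⟨f, hf⟩ ⟨h, hh, hfh⟩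
    have : evalT2 (d1 h) ∈ MB2 w := evalT2_d1_mem hh
    change evalT2 f ∈ MB2 w
    rwa [← show d1 h = f from hfh]

/-- The class of a cocycle on `T_2`. -/
def mclass {w : ℤ} (g : MZ2 w) : MH2 w := Submodule.Quotient.mk g

/-! ### The action of `SL(3)` on the quiver algebra -/

/-- The group `SL(3)` of the three-dimensional space `V`. -/
abbrev SL3 : Type := Matrix.SpecialLinearGroup (Fin 3) ℂ

/-- The matrix of an element of `SL(3)`. -/
def mat (g : SL3) : Matrix (Fin 3) (Fin 3) ℂ := (g : Matrix (Fin 3) (Fin 3) ℂ)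

theorem mat_one : mat 1 = 1 := Matrix.SpecialLinearGroup.coe_one

theorem mat_mul (g h : SL3) : mat (g * h) = mat g * mat h := Matrix.SpecialLinearGroup.coe_mul g h

theorem sum_mat_mul_inv (g : SL3) (k j : Fin 3) :
    ∑ i, mat g k i * mat g⁻¹ i j = if k = j then 1 else 0 := by
  rw [← Matrix.mul_apply, ← mat_mul, mul_inv_cancel, mat_one, Matrix.one_apply]

/-- The action on the arrows: the `w_i` transform as the standard basis of `V` and the `z^i` as
the coordinates on `V`. -/
def slArrow (g : SL3) : Arrow → Lam
  | Sum.inl p => ∑ j, mat g⁻¹ p.2 j • ar (Sum.inl (p.1, j))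
  | Sum.inr p => ∑ j, mat g j p.2 • ar (Sum.inr (p.1, j))

/-- The images of the generators of the free algebra. -/
def slGen (g : SL3) : Fin 3 ⊕ Arrow → Lam := Sum.elim e (slArrow g)

theorem e_tgt_mul_slArrow (g : SL3) (x : Arrow) : e (tgt x) * slArrow g x = slArrow g x := by
  rcases x with p | p
  · simp only [slArrow, Finset.mul_sum, mul_smul_comm]
    exact Finset.sum_congr rfl fun j _ => congrArg _ (e_tgt_mul_ar (Sum.inl (p.1, j)))
  · simp only [slArrow, Finset.mul_sum, mul_smul_comm]
    exact Finset.sum_congr rfl fun j _ => congrArg _ (e_tgt_mul_ar (Sum.inr (p.1, j)))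

theorem slArrow_mul_e_src (g : SL3) (x : Arrow) : slArrow g x * e (src x) = slArrow g x := by
  rcases x with p | p
  · simp only [slArrow, Finset.sum_mul, smul_mul_assoc]
    exact Finset.sum_congr rfl fun j _ => congrArg _ (ar_mul_e_src (Sum.inl (p.1, j)))
  · simp only [slArrow, Finset.sum_mul, smul_mul_assoc]
    exact Finset.sum_congr rfl fun j _ => congrArg _ (ar_mul_e_src (Sum.inr (p.1, j)))

theorem sum_pair (F : Arrow → Arrow → Lam) (x y : Arrow) :
    ∑ a, ∑ b, pair x y a b • F a b = F x y := by
  rw [Finset.sum_eq_single x]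
  · rw [Finset.sum_eq_single y]
    · simp [pair]
    · intro b _ hb
      simp [pair, hb]
    · simp
  · intro a _ ha
    simp [pair, ha]
  · simp

/-- Evaluation of a combination of words. -/
def evalWord (F : Arrow → Arrow → Lam) : Word2 →ₗ[ℂ] Lam where
  toFun r := ∑ x, ∑ y, r x y • F x y
  map_add' r s := by simp only [Pi.add_apply, add_smul, Finset.sum_add_distrib]
  map_smul' c r := by
    simp only [Pi.smul_apply, smul_eq_mul, mul_smul, Finset.smul_sum, RingHom.id_apply]

theorem evalWord_pair (F : Arrow → Arrow → Lam) (x y : Arrow) :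
    evalWord F (pair x y) = F x y := sum_pair F x y

theorem rel_zz (i j : Fin 3) : ar (z21 i) * ar (z10 j) = ar (z21 j) * ar (z10 i) := by
  have h : evalWord (fun x y => ar x * ar y) (zzRel i j) = 0 :=
    quad_rel _ (Or.inl ⟨i, j, rfl⟩)
  rw [zzRel, map_sub, evalWord_pair, evalWord_pair] at h
  exact sub_eq_zero.1 h

theorem rel_ww (i j : Fin 3) : ar (w01 i) * ar (w12 j) = ar (w01 j) * ar (w12 i) := by
  have h : evalWord (fun x y => ar x * ar y) (wwRel i j) = 0 :=
    quad_rel _ (Or.inr (Or.inl ⟨i, j, rfl⟩))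
  rw [wwRel, map_sub, evalWord_pair, evalWord_pair] at h
  exact sub_eq_zero.1 h

theorem rel_wz (i j : Fin 3) : ar (w12 i) * ar (z21 j) = ar (z10 j) * ar (w01 i) := by
  have h : evalWord (fun x y => ar x * ar y) (wzRel i j) = 0 :=
    quad_rel _ (Or.inr (Or.inr (Or.inl ⟨i, j, rfl⟩)))
  rw [wzRel, map_sub, evalWord_pair, evalWord_pair] at h
  exact sub_eq_zero.1 h

theorem rel_zw11 : ∑ i, ar (z10 i) * ar (w01 i) = 0 := by
  have h : evalWord (fun x y => ar x * ar y) zwRel11 = 0 :=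
    quad_rel _ (by simp [relSet])
  simpa only [zwRel11, map_sum, evalWord_pair] using h

theorem rel_wz11 : ∑ i, ar (w12 i) * ar (z21 i) = 0 := by
  have h : evalWord (fun x y => ar x * ar y) wzRel11 = 0 :=
    quad_rel _ (by simp [relSet])
  simpa only [wzRel11, map_sum, evalWord_pair] using h

theorem rel_zw22 : ∑ i, ar (z21 i) * ar (w12 i) = 0 := by
  have h : evalWord (fun x y => ar x * ar y) zwRel22 = 0 :=
    quad_rel _ (by simp [relSet])
  simpa only [zwRel22, map_sum, evalWord_pair] using h

theorem rel_wz00 : ∑ i, ar (w01 i) * ar (z10 i) = 0 := by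
  have h : evalWord (fun x y => ar x * ar y) wzRel00 = 0 :=
    quad_rel _ (by simp [relSet])
  simpa only [wzRel00, map_sum, evalWord_pair] using h

theorem sl_contract (g : SL3) (P Q : Fin 3 → Lam) :
    ∑ i, (∑ j, mat g⁻¹ i j • P j) * (∑ k, mat g k i • Q k) = ∑ j, P j * Q j := by
  calc ∑ i, (∑ j, mat g⁻¹ i j • P j) * (∑ k, mat g k i • Q k)
      = ∑ i, ∑ j, ∑ k, (mat g k i * mat g⁻¹ i j) • (P j * Q k) := by
        refine Finset.sum_congr rfl fun i _ => ?_
        rw [Finset.sum_mul]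
        refine Finset.sum_congr rfl fun j _ => ?_
        rw [Finset.mul_sum]
        refine Finset.sum_congr rfl fun k _ => ?_
        rw [smul_mul_smul_comm, mul_comm (mat g k i)]
    _ = ∑ j, ∑ k, ∑ i, (mat g k i * mat g⁻¹ i j) • (P j * Q k) := by
        rw [Finset.sum_comm]
        exact Finset.sum_congr rfl fun j _ => Finset.sum_comm
    _ = ∑ j, P j * Q j := by
        simp only [← Finset.sum_smul, sum_mat_mul_inv, ite_smul, one_smul, zero_smul,
          Finset.sum_ite_eq', Finset.mem_univ, if_true]

theorem sl_contract' (g : SL3) (P Q : Fin 3 → Lam) :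
    ∑ i, (∑ k, mat g k i • Q k) * (∑ j, mat g⁻¹ i j • P j) = ∑ j, Q j * P j := by
  calc ∑ i, (∑ k, mat g k i • Q k) * (∑ j, mat g⁻¹ i j • P j)
      = ∑ i, ∑ k, ∑ j, (mat g k i * mat g⁻¹ i j) • (Q k * P j) := by
        refine Finset.sum_congr rfl fun i _ => ?_
        rw [Finset.sum_mul]
        refine Finset.sum_congr rfl fun j _ => ?_
        rw [Finset.mul_sum]
        refine Finset.sum_congr rfl fun k _ => ?_
        rw [smul_mul_smul_comm]
    _ = ∑ k, ∑ j, ∑ i, (mat g k i * mat g⁻¹ i j) • (Q k * P j) := by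
        rw [Finset.sum_comm]
        exact Finset.sum_congr rfl fun j _ => Finset.sum_comm
    _ = ∑ j, Q j * P j := by
        simp only [← Finset.sum_smul, sum_mat_mul_inv, ite_smul, one_smul, zero_smul,
          Finset.sum_ite_eq, Finset.mem_univ, if_true]

theorem sl_exchange (c d : Fin 3 → ℂ) (P Q P' Q' : Fin 3 → Lam)
    (h : ∀ k l, P k * Q l = P' l * Q' k) :
    (∑ k, c k • P k) * (∑ l, d l • Q l) = (∑ l, d l • P' l) * (∑ k, c k • Q' k) := by
  rw [Finset.sum_mul_sum, Finset.sum_mul_sum, Finset.sum_comm]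
  refine Finset.sum_congr rfl fun l _ => Finset.sum_congr rfl fun k _ => ?_
  rw [smul_mul_smul_comm, smul_mul_smul_comm, h, mul_comm]

theorem slArrow_quad (g : SL3) (r : Word2) (hr : r ∈ relSet) :
    ∑ x, ∑ y, r x y • (slArrow g x * slArrow g y) = 0 := by
  change evalWord (fun x y => slArrow g x * slArrow g y) r = 0
  rcases hr with ⟨i, j, rfl⟩ | ⟨i, j, rfl⟩ | ⟨i, j, rfl⟩ | rfl | rfl | rfl | rfl
  · rw [zzRel, map_sub, evalWord_pair, evalWord_pair, sub_eq_zero]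
    exact sl_exchange _ _ _ _ _ _ fun k l => rel_zz k l
  · rw [wwRel, map_sub, evalWord_pair, evalWord_pair, sub_eq_zero]
    exact sl_exchange _ _ _ _ _ _ fun k l => rel_ww k l
  · rw [wzRel, map_sub, evalWord_pair, evalWord_pair, sub_eq_zero]
    exact sl_exchange _ _ _ _ _ _ fun k l => rel_wz k l
  · simp only [zwRel11, map_sum, evalWord_pair, slArrow]
    rw [sl_contract g (fun j => ar (Sum.inl (0, j))) (fun j => ar (Sum.inr (0, j)))]
    exact rel_zw11
  · simp only [wzRel11, map_sum, evalWord_pair, slArrow]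
    rw [sl_contract' g (fun j => ar (Sum.inl (1, j))) (fun j => ar (Sum.inr (1, j)))]
    exact rel_wz11
  · simp only [zwRel22, map_sum, evalWord_pair, slArrow]
    rw [sl_contract g (fun j => ar (Sum.inl (1, j))) (fun j => ar (Sum.inr (1, j)))]
    exact rel_zw22
  · simp only [wzRel00, map_sum, evalWord_pair, slArrow]
    rw [sl_contract' g (fun j => ar (Sum.inl (0, j))) (fun j => ar (Sum.inr (0, j)))]
    exact rel_wz00

theorem slGen_rel (g : SL3) {x y : Free} (h : Rel x y) :
    FreeAlgebra.lift ℂ (slGen g) x = FreeAlgebra.lift ℂ (slGen g) y := by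
  have he : ∀ a, FreeAlgebra.lift ℂ (slGen g) (fe a) = e a := fun a =>
    FreeAlgebra.lift_ι_apply _ _
  have ha : ∀ x, FreeAlgebra.lift ℂ (slGen g) (fa x) = slArrow g x := fun x =>
    FreeAlgebra.lift_ι_apply _ _
  cases h with
  | orth a b h => rw [map_mul, map_zero, he, he, e_mul_e_of_ne h]
  | idem a => rw [map_mul, he, e_mul_self]
  | sum_one =>
    rw [map_sum, map_one, ← sum_e]
    exact Finset.sum_congr rfl fun a _ => he a
  | at_tgt x => rw [map_mul, he, ha, e_tgt_mul_slArrow]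
  | at_src x => rw [map_mul, he, ha, slArrow_mul_e_src]
  | quad r hr =>
    have := slArrow_quad g r hr
    simp only [map_sum, map_smul, map_mul, map_zero, ha]
    exact this

/-- The algebra endomorphism of `Λ` given by an element of `SL(3)`; it fixes the idempotents. -/
def slHom (g : SL3) : Lam →ₐ[ℂ] Lam :=
  RingQuot.liftAlgHom ℂ ⟨FreeAlgebra.lift ℂ (slGen g), fun _ _ h => slGen_rel g h⟩

theorem slHom_toLam (g : SL3) (x : Free) :
    slHom g (toLam x) = FreeAlgebra.lift ℂ (slGen g) x :=
  RingQuot.liftAlgHom_mkAlgHom_apply ℂ (FreeAlgebra.lift ℂ (slGen g))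
    (fun _ _ h => slGen_rel g h) x

theorem slHom_e (g : SL3) (a : Fin 3) : slHom g (e a) = e a := by
  rw [e, slHom_toLam]
  exact FreeAlgebra.lift_ι_apply _ _

theorem slHom_ar (g : SL3) (x : Arrow) : slHom g (ar x) = slArrow g x := by
  rw [ar, slHom_toLam]
  exact FreeAlgebra.lift_ι_apply _ _

theorem lam_hom_ext {f f' : Lam →ₐ[ℂ] Lam} (he : ∀ a, f (e a) = f' (e a))
    (ha : ∀ x, f (ar x) = f' (ar x)) : f = f' := by
  refine RingQuot.ringQuot_ext' ℂ (s := Rel) f f' (FreeAlgebra.hom_ext (funext fun t => ?_))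
  rcases t with a | x
  · exact he a
  · exact ha x

theorem slHom_one : slHom 1 = AlgHom.id ℂ Lam := by
  refine lam_hom_ext (fun a => ?_) (fun x => ?_)
  · rw [slHom_e]
    rfl
  · rw [slHom_ar]
    rcases x with p | p
    · simp only [slArrow, inv_one, mat_one, Matrix.one_apply, ite_smul, one_smul, zero_smul,
        Finset.sum_ite_eq, Finset.mem_univ, if_true]
      rfl
    · simp only [slArrow, mat_one, Matrix.one_apply, ite_smul, one_smul, zero_smul,
        Finset.sum_ite_eq', Finset.mem_univ, if_true]
      rfl

theorem slHom_mul (g h : SL3) : slHom (g * h) = (slHom g).comp (slHom h) := by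
  refine lam_hom_ext (fun a => ?_) (fun x => ?_)
  · rw [AlgHom.comp_apply, slHom_e, slHom_e, slHom_e]
  · rw [AlgHom.comp_apply, slHom_ar, slHom_ar]
    rcases x with p | p
    · simp only [slArrow, map_sum, map_smul, slHom_ar, Finset.smul_sum, smul_smul, mul_inv_rev,
        mat_mul, Matrix.mul_apply, Finset.sum_smul]
      exact Finset.sum_comm
    · simp only [slArrow, map_sum, map_smul, slHom_ar, Finset.smul_sum, smul_smul,
        mat_mul, Matrix.mul_apply, Finset.sum_smul]
      rw [Finset.sum_comm]
      simp only [mul_comm]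

/-- The representation of `SL(3)` on `Λ`. -/
def slRep : Representation ℂ SL3 Lam where
  toFun g := (slHom g).toLinearMap
  map_one' := by
    rw [slHom_one]
    rfl
  map_mul' g h := by
    rw [slHom_mul]
    rfl

theorem slRep_apply (g : SL3) (x : Lam) : slRep g x = slHom g x := rfl

theorem slHom_inv_apply (g : SL3) (x : Lam) : slHom g (slHom g⁻¹ x) = x := by
  rw [← AlgHom.comp_apply, ← slHom_mul, mul_inv_cancel, slHom_one, AlgHom.id_apply]

theorem slHom_lenPart (g : SL3) (n : ℕ) {x : Lam} (hx : x ∈ lenPart n) :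
    slHom g x ∈ lenPart n := by
  have h1 : (Submodule.span ℂ (Set.range e)).map (slHom g).toLinearMap ≤
      Submodule.span ℂ (Set.range e) := by
    rw [Submodule.map_span_le]
    rintro _ ⟨a, rfl⟩
    exact Submodule.subset_span ⟨a, (slHom_e g a).symm⟩
  have h2 : (Submodule.span ℂ (Set.range ar)).map (slHom g).toLinearMap ≤
      Submodule.span ℂ (Set.range ar) := by
    rw [Submodule.map_span_le]
    rintro _ ⟨y, rfl⟩
    change slHom g (ar y) ∈ _
    rw [slHom_ar]
    rcases y with p | p
    · exact Submodule.sum_mem _ fun j _ => Submodule.smul_mem _ _ (Submodule.subset_span ⟨_, rfl⟩)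
    · exact Submodule.sum_mem _ fun j _ => Submodule.smul_mem _ _ (Submodule.subset_span ⟨_, rfl⟩)
  have h3 : (lenPart n).map (slHom g).toLinearMap ≤ lenPart n := by
    rw [lenPart, Submodule.map_mul, Submodule.map_pow]
    exact mul_le_mul' h1 (pow_le_pow_left' h2 n)
  exact h3 ⟨x, hx, rfl⟩

theorem slHom_homog (g : SL3) (k : ℤ) {x : Lam} (hx : x ∈ homog k) : slHom g x ∈ homog k := by
  unfold homog at hx ⊢
  split_ifs with h
  · rw [if_pos h] at hx
    exact slHom_lenPart g _ hx
  · rw [if_neg h, Submodule.mem_bot] at hx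
    rw [hx, map_zero]
    exact Submodule.zero_mem _

/-- The representation of `SL(3)` on bilinear maps: `(g f)(x, y) = g (f (g⁻¹ x, g⁻¹ y))`. -/
def cochainRep : Representation ℂ SL3 (Lam →ₗ[ℂ] Lam →ₗ[ℂ] Lam) :=
  slRep.linHom (slRep.linHom slRep)

theorem cochainRep_apply (g : SL3) (f : Lam →ₗ[ℂ] Lam →ₗ[ℂ] Lam) (x y : Lam) :
    cochainRep g f x y = slHom g (f (slHom g⁻¹ x) (slHom g⁻¹ y)) := rfl

theorem cochainRep_Z2 (w : ℤ) (g : SL3) : Z2 w ≤ (Z2 w).comap (cochainRep g) := by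
  rintro f ⟨⟨h1, h2, h3, h4⟩, hc⟩
  refine ⟨⟨fun a x y => ?_, fun a x y => ?_, fun a x y => ?_, fun m n x hx y hy => ?_⟩,
    fun x y z => ?_⟩
  · rw [cochainRep_apply, cochainRep_apply, map_mul, slHom_e, h1, map_mul, slHom_e]
  · rw [cochainRep_apply, cochainRep_apply, map_mul (slHom g⁻¹), slHom_e, h2,
      map_mul (slHom g⁻¹), slHom_e]
  · rw [cochainRep_apply, cochainRep_apply, map_mul, slHom_e, h3, map_mul, slHom_e]
  · exact slHom_homog g _ (h4 m n _ (slHom_lenPart _ _ hx) _ (slHom_lenPart _ _ hy))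
  · have := congrArg (slHom g) (hc (slHom g⁻¹ x) (slHom g⁻¹ y) (slHom g⁻¹ z))
    simp only [map_add, map_sub, map_mul, slHom_inv_apply, map_zero] at this
    simp only [cochainRep_apply, map_mul]
    exact this

theorem cochainRep_B2 (w : ℤ) (g : SL3) : B2 w ≤ (B2 w).comap (cochainRep g) := by
  rintro _ ⟨h, ⟨h1, h2, h3⟩, rfl⟩
  refine ⟨slRep.linHom slRep g h, ⟨fun a x => ?_, fun a x => ?_, fun n x hx => ?_⟩, ?_⟩
  · change slHom g (h (slHom g⁻¹ (e a * x))) = e a * slHom g (h (slHom g⁻¹ x))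
    rw [map_mul, slHom_e, h1, map_mul, slHom_e]
  · change slHom g (h (slHom g⁻¹ (x * e a))) = slHom g (h (slHom g⁻¹ x)) * e a
    rw [map_mul, slHom_e, h2, map_mul, slHom_e]
  · exact slHom_homog g _ (h3 n _ (slHom_lenPart _ _ hx))
  · refine LinearMap.ext fun x => LinearMap.ext fun y => ?_
    rw [d1_apply, cochainRep_apply, d1_apply, map_add, map_sub, map_mul (slHom g),
      map_mul (slHom g), slHom_inv_apply, slHom_inv_apply, ← map_mul (slHom g⁻¹)]
    rfl

/-- The representation of `SL(3)` on the part of weight `w` of the second Hochschild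
cohomology. -/
def hhRep (w : ℤ) : Representation ℂ SL3 (HH2 w) :=
  (cochainRep.subrepresentation (Z2 w) (cochainRep_Z2 w)).quotient
    ((B2 w).submoduleOf (Z2 w)) fun g _ hf => cochainRep_B2 w g hf

/-! ### The irreducible representations occurring in the statement -/

/-- The space `V`, and also its dual in the dual basis. -/
abbrev Vec : Type := Fin 3 → ℂ

/-- Symmetric trilinear forms on a three-dimensional coordinate space. -/
def SymForm : Submodule ℂ (MultilinearMap ℂ (fun _ : Fin 3 => Vec) ℂ) where
  carrier := {D | ∀ (σ : Equiv.Perm (Fin 3)) (v : Fin 3 → Vec), D (fun i => v (σ i)) = D v}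
  add_mem' := by
    intro D E hD hE σ v
    rw [add_apply, add_apply, hD, hE]
  zero_mem' := fun σ v => rfl
  smul_mem' := by
    intro c D hD σ v
    rw [smul_apply, smul_apply, hD]

/-- The components of a trilinear form in the standard basis. -/
def coeff (D : SymForm) (i j k : Fin 3) : ℂ :=
  D.1 ![Pi.single i 1, Pi.single j 1, Pi.single k 1]

/-- Pullback of trilinear forms along a matrix. -/
def pullback (M : Matrix (Fin 3) (Fin 3) ℂ) : ↥SymForm →ₗ[ℂ] ↥SymForm where
  toFun D := ⟨D.1.compLinearMap fun _ => M.mulVecLin, fun σ v => by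
    rw [MultilinearMap.compLinearMap_apply, MultilinearMap.compLinearMap_apply]
    exact D.2 σ fun i => M.mulVecLin (v i)⟩
  map_add' D E := by
    ext v
    rfl
  map_smul' c D := by
    ext v
    rfl

theorem pullback_one : pullback 1 = LinearMap.id := by
  ext D v
  simp [pullback]

theorem pullback_mul (M N : Matrix (Fin 3) (Fin 3) ℂ) :
    pullback (M * N) = pullback N * pullback M := by
  ext D v
  simp [pullback]

/-- The representation `10`, the symmetric cube of the dual of `V`: symmetric trilinear forms
`D` on `V`, with `(g D)(u, v, w) = D (g⁻¹ u, g⁻¹ v, g⁻¹ w)`. -/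
def rep10 : Representation ℂ SL3 SymForm where
  toFun g := pullback (mat g⁻¹)
  map_one' := by
    rw [inv_one, mat_one, pullback_one]
    rfl
  map_mul' g h := by rw [mul_inv_rev, mat_mul, pullback_mul]

/-- The representation `10*`, the symmetric cube of `V`: symmetric trilinear forms `D` on the
dual of `V`, with `(g D)(ξ, η, ζ) = D (gᵀ ξ, gᵀ η, gᵀ ζ)`. -/
def rep10dual : Representation ℂ SL3 SymForm where
  toFun g := pullback (mat g)ᵀ
  map_one' := by
    rw [mat_one, Matrix.transpose_one, pullback_one]
    rfl
  map_mul' g h := by rw [mat_mul, Matrix.transpose_mul, pullback_mul]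

/-- The traceless matrices. The entry in row `i` and column `j` is the component with upper
index `i` and lower index `j`. -/
def Traceless : Submodule ℂ (Matrix (Fin 3) (Fin 3) ℂ) :=
  LinearMap.ker (Matrix.traceLinearMap (Fin 3) ℂ ℂ)

/-- The representation `8`: traceless endomorphisms `U` of `V`, with `g U = g U g⁻¹`. -/
def rep8 : Representation ℂ SL3 Traceless where
  toFun g :=
    { toFun := fun U => ⟨mat g * U.1 * mat g⁻¹, by
        have hU : Matrix.trace U.1 = 0 := U.2
        change Matrix.trace (mat g * U.1 * mat g⁻¹) = 0
        rw [Matrix.trace_mul_comm, ← mul_assoc, ← mat_mul, inv_mul_cancel, mat_one, one_mul, hU]⟩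
      map_add' := fun U W => Subtype.ext <| by
        simp only [Submodule.coe_add, mul_add, add_mul]
      map_smul' := fun c U => Subtype.ext <| by
        simp only [Submodule.coe_smul, Matrix.mul_smul, Matrix.smul_mul, RingHom.id_apply] }
  map_one' := by
    refine LinearMap.ext fun U => Subtype.ext ?_
    change mat 1 * U.1 * mat 1⁻¹ = U.1
    rw [inv_one, mat_one, one_mul, mul_one]
  map_mul' g h := by
    refine LinearMap.ext fun U => Subtype.ext ?_
    change mat (g * h) * U.1 * mat (g * h)⁻¹ = mat g * (mat h * U.1 * mat h⁻¹) * mat g⁻¹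
    rw [mul_inv_rev, mat_mul, mat_mul]
    simp only [mul_assoc]

/-! ### Tables of values on `T_2` -/

theorem mem_T2 {r : Word2} (hr : r ∈ relSet) : r ∈ T2 := Submodule.subset_span hr

/-- `e_1 (z · w) e_1` in `T_2`. -/
def zwT11 : T2 := ⟨zwRel11, mem_T2 (by simp [relSet])⟩
/-- `e_1 (w · z) e_1` in `T_2`. -/
def wzT11 : T2 := ⟨wzRel11, mem_T2 (by simp [relSet])⟩
/-- `e_2 (z · w) e_2` in `T_2`. -/
def zwT22 : T2 := ⟨zwRel22, mem_T2 (by simp [relSet])⟩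
/-- `e_0 (w · z) e_0` in `T_2`. -/
def wzT00 : T2 := ⟨wzRel00, mem_T2 (by simp [relSet])⟩
/-- `e_2 (z^i z^j - z^j z^i) e_0` in `T_2`. -/
def zzT (i j : Fin 3) : T2 := ⟨zzRel i j, mem_T2 (Or.inl ⟨i, j, rfl⟩)⟩
/-- `e_0 (w_i w_j - w_j w_i) e_2` in `T_2`. -/
def wwT (i j : Fin 3) : T2 := ⟨wwRel i j, mem_T2 (Or.inr (Or.inl ⟨i, j, rfl⟩))⟩
/-- The trace-free part of `e_1 [w_i, z^j] e_1` in `T_2`. -/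
def tfT (i j : Fin 3) : T2 :=
  ⟨tfRel i j, T2.sub_mem (mem_T2 (Or.inr (Or.inr (Or.inl ⟨i, j, rfl⟩))))
    (T2.smul_mem _ (T2.sub_mem wzT11.2 zwT11.2))⟩

/-- The values of a cochain on the elements `e_1 (z · w) e_1`, `e_1 (w · z) e_1`,
`e_2 (z · w) e_2`, `e_0 (w · z) e_0`, `e_2 (z^i z^j - z^j z^i) e_0`, `e_0 (w_i w_j - w_j w_i) e_2`
and `e_1 [w_i, z^j] e_1` (trace-free part), which span `T_2`. -/
structure HasValues (g : ↥T2 →ₗ[ℂ] Lam) (zw11 wz11 zw22 wz00 : Lam)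
    (zz ww tf : Fin 3 → Fin 3 → Lam) : Prop where
  on_zw11 : g zwT11 = zw11
  on_wz11 : g wzT11 = wz11
  on_zw22 : g zwT22 = zw22
  on_wz00 : g wzT00 = wz00
  on_zz : ∀ i j, g (zzT i j) = zz i j
  on_ww : ∀ i j, g (wwT i j) = ww i j
  on_tf : ∀ i j, g (tfT i j) = tf i j

/-- The Levi-Civita symbol. -/
def eps (i j k : Fin 3) : ℂ := ((1 : Matrix (Fin 3) (Fin 3) ℂ).submatrix ![i, j, k] id).det

/-- The path `[z^k z^l]_{20}` in `Λ`. -/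
def zzP (k l : Fin 3) : Lam := ar (z21 k) * ar (z10 l)
/-- The path `[w_k w_l]_{02}` in `Λ`. -/
def wwP (k l : Fin 3) : Lam := ar (w01 k) * ar (w12 l)
/-- The path `[w_i z^j]_{11}` in `Λ`. -/
def wzP11 (i j : Fin 3) : Lam := ar (w12 i) * ar (z21 j)
/-- The path `[w_i z^j]_{00}` in `Λ`. -/
def wzP00 (i j : Fin 3) : Lam := ar (w01 i) * ar (z10 j)
/-- The path `[z^j w_i]_{22}` in `Λ`. -/
def zwP22 (j i : Fin 3) : Lam := ar (z21 j) * ar (w12 i)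

/-- The values of `g_{∅,0}`. -/
def IsG0 (g : ↥T2 →ₗ[ℂ] Lam) : Prop :=
  HasValues g (e 1) (-e 1) ((1 / 3 : ℂ) • e 2) (-((1 / 3 : ℂ) • e 0)) 0 0 0

/-- The values of `g_{∅,1}`. -/
def IsG1 (g : ↥T2 →ₗ[ℂ] Lam) : Prop :=
  HasValues g (e 1) (e 1) (e 2) (e 0) 0 0 0

/-- The values of the component `10` with symmetric tensor `D_{ijk}`. -/
def IsG10 (D : SymForm) (g : ↥T2 →ₗ[ℂ] Lam) : Prop :=
  HasValues g 0 0 0 0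
    (fun i j => ∑ r, ∑ k, ∑ l, (eps i j r * coeff D r k l) • zzP k l)
    0
    (fun i j => ∑ r, ∑ k, ∑ l, (eps j l r * coeff D r i k) • wzP11 l k)

/-- The values of the component `10*` with symmetric tensor `D^{ijk}`. -/
def IsG10dual (D : SymForm) (g : ↥T2 →ₗ[ℂ] Lam) : Prop :=
  HasValues g 0 0 0 0
    0
    (fun i j => -∑ r, ∑ k, ∑ l, (eps i j r * coeff D r k l) • wwP k l)
    (fun i j => ∑ r, ∑ k, ∑ l, (eps r i k * coeff D r j l) • wzP11 l k)

/-- The values of the two components `8` with traceless tensors `U^i_j` and `X^i_j`. -/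
def IsG8 (U X : Traceless) (g : ↥T2 →ₗ[ℂ] Lam) : Prop :=
  HasValues g
    (∑ i, ∑ j, U.1 i j • wzP11 i j)
    (-∑ i, ∑ j, U.1 i j • wzP11 i j)
    (∑ i, ∑ j, X.1 i j • zwP22 j i)
    (-∑ i, ∑ j, X.1 i j • wzP00 i j)
    0 0
    (fun i j => ∑ k, (3 * X.1 k i - U.1 k i) • wzP11 k j
      + ∑ l, (3 * X.1 j l - U.1 j l) • wzP11 i l
      - (if i = j then (1 : ℂ) else 0) •
          ∑ k, ∑ l, (2 * X.1 k l - 2 / 3 * U.1 k l) • wzP11 k l)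

end TP2

end

/-! The comparison map is injective for a formal reason and surjective by explicit construction; the
cohomology of the small complex is then linear algebra on the cone `∑ zⁱ wᵢ = 0`. Exactness of the
bimodule resolution is never used.

Injectivity (`cmp_injective`) holds in every weight. A Hochschild 2-cocycle `f` defines a
square-zero extension of `Λ` by `Λ`, realised by the operators `twOp`. If `f` restricts on `T_2` to
the coboundary of `h`, the lifts `(x, -h x)` of the arrows still satisfy the relations of `Λ` in the
extension. The extension therefore splits, and the splitting exhibits `f` as a coboundary.

For surjectivity, a cochain `g` on `T_2` has to be lifted to a Hochschild cocycle. Suppose that `Λ`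
is embedded in an algebra `N` and that the arrows have a first order deformation `D` in `N` which
changes each relation `r` by `g r`. A homogeneous linear section of the projection from the free
algebra turns `D` into a linear map `Λ → N` whose Hochschild coboundary takes values in `Λ`; this
coboundary is the cocycle (`DefData.exists_cocycle`). Here `N` consists of 3 by 3 matrices of linear
operators on the functions on the chart `z⁰ = 1` of the cotangent bundle. The arrows act by
multiplication with coordinates, faithfully by `opRep_injective`, and `D` consists of first order
differential operators (`exists_chart_cocycle`).

In weight `-2`, shifting the value of `∑ zⁱ wᵢ` yields `g_{∅,1}`, and replacing `wᵢ` by the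
derivative along `zⁱ` yields `g_{∅,0}`. In weight `0`, adding a vector field to one coordinate
yields one cube in `10` or in `10*`; the liftable tables are stable under `SL(3)` and the orbit of
one cube spans (`eq_top_of_pullback`). The two octets come from multiplying `g_{∅,0}` by central
elements `w_i z^j` and from the cup product of the length derivation with the infinitesimal action
of matrices.

For the upper bound, three families of elements of `T_3` give conditions on a cocycle, which are
evaluated at points of the cone (`ev_MZ2_z10`, `ev_MZ2_z21`, `ev_MZ2_w01`). In weight `0` the values
on the commutators of the `z` and of the `w` split into a symmetric form and a coboundary
(`exists_quadratic_decomposition`). The four contractions then reduce to two traceless matrices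
(`MZ2_reduce_sums`), and what remains is a coboundary by `eq_rank_one_of_cone`. This gives
`exists_sub_table_mem`; `table_eq_zero` shows that no nonzero table is a coboundary. In weight `-2`
there are no coboundaries, and the same conditions leave two parameters (`exists_sub_tableG_mem`).

Equivariance holds because evaluation on `T_2` commutes with `SL(3)` (`tabAct_evalT2`) and so does
the passage from tensors to tables (`tabAct_table`). -/

noncomputable section

namespace TP2

/-! ### Universal property of the quiver algebra -/

/-- The value of a balanced function of two arrows on a combination of words. -/
def wordSum {M : Type*} [AddCommGroup M] [Module ℂ M] (F : Arrow → Arrow → M) : Word2 →ₗ[ℂ] M where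
  toFun r := ∑ x, ∑ y, r x y • F x y
  map_add' r s := by simp only [Pi.add_apply, add_smul, Finset.sum_add_distrib]
  map_smul' c r := by
    simp only [Pi.smul_apply, smul_eq_mul, mul_smul, Finset.smul_sum, RingHom.id_apply]

theorem wordSum_apply {M : Type*} [AddCommGroup M] [Module ℂ M] (F : Arrow → Arrow → M)
    (r : Word2) : wordSum F r = ∑ x, ∑ y, r x y • F x y := rfl

theorem wordSum_pair {M : Type*} [AddCommGroup M] [Module ℂ M] (F : Arrow → Arrow → M)
    (x y : Arrow) : wordSum F (pair x y) = F x y := by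
  rw [wordSum_apply, Finset.sum_eq_single x, Finset.sum_eq_single y]
  · simp [pair]
  · intro b _ hb
    simp [pair, hb]
  · simp
  · intro a _ ha
    simp [pair, ha]
  · simp

theorem wordSum_add {M : Type*} [AddCommGroup M] [Module ℂ M] (F G : Arrow → Arrow → M)
    (r : Word2) : wordSum (fun x y => F x y + G x y) r = wordSum F r + wordSum G r := by
  simp only [wordSum_apply, smul_add, Finset.sum_add_distrib]

theorem wordSum_map {M M' : Type*} [AddCommGroup M] [Module ℂ M] [AddCommGroup M'] [Module ℂ M']
    (L : M →ₗ[ℂ] M') (F : Arrow → Arrow → M) (r : Word2) :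
    L (wordSum F r) = wordSum (fun x y => L (F x y)) r := by
  simp only [wordSum_apply, map_sum, map_smul]

/-- A function of two arrows vanishes on the relations if it has the symmetries which the
relations express. -/
theorem wordSum_eq_zero {M : Type*} [AddCommGroup M] [Module ℂ M] (F : Arrow → Arrow → M)
    (zz : ∀ i j, F (z21 i) (z10 j) = F (z21 j) (z10 i))
    (ww : ∀ i j, F (w01 i) (w12 j) = F (w01 j) (w12 i))
    (wz : ∀ i j, F (w12 i) (z21 j) = F (z10 j) (w01 i))
    (zw1 : ∑ i, F (z10 i) (w01 i) = 0) (wz1 : ∑ i, F (w12 i) (z21 i) = 0)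
    (zw2 : ∑ i, F (z21 i) (w12 i) = 0) (wz0 : ∑ i, F (w01 i) (z10 i) = 0)
    (r : Word2) (hr : r ∈ relSet) : wordSum F r = 0 := by
  rcases hr with ⟨i, j, rfl⟩ | ⟨i, j, rfl⟩ | ⟨i, j, rfl⟩ | rfl | rfl | rfl | rfl
  · rw [zzRel, map_sub, wordSum_pair, wordSum_pair, zz, sub_self]
  · rw [wwRel, map_sub, wordSum_pair, wordSum_pair, ww, sub_self]
  · rw [wzRel, map_sub, wordSum_pair, wordSum_pair, wz, sub_self]
  · simpa only [zwRel11, map_sum, wordSum_pair] using zw1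
  · simpa only [wzRel11, map_sum, wordSum_pair] using wz1
  · simpa only [zwRel22, map_sum, wordSum_pair] using zw2
  · simpa only [wzRel00, map_sum, wordSum_pair] using wz0

section Lift

variable {A : Type*} [Ring A] [Algebra ℂ A]

/-- Images of the generators of `Λ` which respect the relations. -/
structure LamData (E : Fin 3 → A) (X : Arrow → A) : Prop where
  orth : ∀ a b, a ≠ b → E a * E b = 0
  idem : ∀ a, E a * E a = E a
  sum_one : ∑ a, E a = 1
  at_tgt : ∀ x, E (tgt x) * X x = X x
  at_src : ∀ x, X x * E (src x) = X x
  quad : ∀ r ∈ relSet, wordSum (fun x y => X x * X y) r = 0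

/-- The homomorphism from the free algebra with given values on the generators. -/
def freeLift (E : Fin 3 → A) (X : Arrow → A) : Free →ₐ[ℂ] A := FreeAlgebra.lift ℂ (Sum.elim E X)

theorem freeLift_fe (E : Fin 3 → A) (X : Arrow → A) (a : Fin 3) : freeLift E X (fe a) = E a :=
  FreeAlgebra.lift_ι_apply _ _

theorem freeLift_fa (E : Fin 3 → A) (X : Arrow → A) (x : Arrow) : freeLift E X (fa x) = X x :=
  FreeAlgebra.lift_ι_apply _ _

theorem freeLift_rel {E : Fin 3 → A} {X : Arrow → A} (H : LamData E X) {u v : Free}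
    (h : Rel u v) : freeLift E X u = freeLift E X v := by
  cases h with
  | orth a b h => rw [map_mul, map_zero, freeLift_fe, freeLift_fe, H.orth a b h]
  | idem a => rw [map_mul, freeLift_fe, H.idem]
  | sum_one =>
    rw [map_sum, map_one, ← H.sum_one]
    exact Finset.sum_congr rfl fun a _ => freeLift_fe E X a
  | at_tgt x => rw [map_mul, freeLift_fe, freeLift_fa, H.at_tgt]
  | at_src x => rw [map_mul, freeLift_fe, freeLift_fa, H.at_src]
  | quad r hr =>
    have := H.quad r hr
    simp only [map_sum, map_smul, map_mul, map_zero, freeLift_fa]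
    exact this

/-- The homomorphism from `Λ` with given values on the generators. -/
def lamLift {E : Fin 3 → A} {X : Arrow → A} (H : LamData E X) : Lam →ₐ[ℂ] A :=
  RingQuot.liftAlgHom ℂ ⟨freeLift E X, fun _ _ h => freeLift_rel H h⟩

theorem lamLift_toLam {E : Fin 3 → A} {X : Arrow → A} (H : LamData E X) (u : Free) :
    lamLift H (toLam u) = freeLift E X u :=
  RingQuot.liftAlgHom_mkAlgHom_apply ℂ (freeLift E X) (fun _ _ h => freeLift_rel H h) u

theorem lamLift_e {E : Fin 3 → A} {X : Arrow → A} (H : LamData E X) (a : Fin 3) :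
    lamLift H (e a) = E a := by rw [e, lamLift_toLam, freeLift_fe]

theorem lamLift_ar {E : Fin 3 → A} {X : Arrow → A} (H : LamData E X) (x : Arrow) :
    lamLift H (ar x) = X x := by rw [ar, lamLift_toLam, freeLift_fa]

end Lift

theorem toLam_surjective : Function.Surjective toLam := RingQuot.mkAlgHom_surjective ℂ Rel

/-- Equality in `Λ` is generated by the relations. -/
theorem toLam_eq_induction {P : Free → Free → Prop} (rel : ∀ u v, Rel u v → P u v)
    (add : ∀ u v c, toLam u = toLam v → P u v → P (u + c) (v + c))
    (mul_left : ∀ u v c, toLam u = toLam v → P u v → P (u * c) (v * c))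
    (mul_right : ∀ u v c, toLam u = toLam v → P u v → P (c * u) (c * v))
    (refl : ∀ u, P u u) (symm : ∀ u v, P u v → P v u) (trans : ∀ u v w, P u v → P v w → P u w)
    {u v : Free} (h : toLam u = toLam v) : P u v := by
  have h1 : RingQuot.mkRingHom Rel u = RingQuot.mkRingHom Rel v := by
    rw [← RingQuot.mkAlgHom_coe ℂ]
    exact h
  simp only [RingQuot.mkRingHom_def] at h1
  have h2 : Relation.EqvGen (RingQuot.Rel Rel) u v :=
    Quot.eqvGen_exact (congrArg RingQuot.toQuot h1)
  -- Equality in `Λ` is carried along with `P`, since the closure hypotheses take it as a premise.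
  have key : ∀ u v, RingQuot.Rel Rel u v → toLam u = toLam v ∧ P u v := by
    intro u v h
    induction h with
    | of h => exact ⟨toLam_rel h, rel _ _ h⟩
    | add_left _ ih => exact ⟨by rw [map_add, map_add, ih.1], add _ _ _ ih.1 ih.2⟩
    | mul_left _ ih => exact ⟨by rw [map_mul, map_mul, ih.1], mul_left _ _ _ ih.1 ih.2⟩
    | mul_right _ ih => exact ⟨by rw [map_mul, map_mul, ih.1], mul_right _ _ _ ih.1 ih.2⟩
  clear h h1
  induction h2 with
  | rel u v h => exact (key u v h).2
  | refl u => exact refl u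
  | symm u v _ ih => exact symm _ _ ih
  | trans u v w _ _ ih1 ih2 => exact trans _ _ _ ih1 ih2

/-- A subspace of `Λ` which contains `1` and is stable under left multiplication by the generators
is everything. -/
theorem lam_induction {P : Lam → Prop} (one : P 1) (add : ∀ x y, P x → P y → P (x + y))
    (smul : ∀ (c : ℂ) x, P x → P (c • x)) (e_mul : ∀ a x, P x → P (e a * x))
    (ar_mul : ∀ a x, P x → P (ar a * x)) (x : Lam) : P x := by
  obtain ⟨u, rfl⟩ := toLam_surjective x
  suffices h : ∀ y, P y → P (toLam u * y) by simpa using h 1 one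
  induction u using FreeAlgebra.induction with
  | grade0 c =>
    intro y hy
    rw [AlgHom.commutes, Algebra.algebraMap_eq_smul_one, smul_mul_assoc, one_mul]
    exact smul c y hy
  | grade1 t =>
    intro y hy
    rcases t with a | x
    · exact e_mul a y hy
    · exact ar_mul x y hy
  | mul a b ha hb =>
    intro y hy
    rw [map_mul, mul_assoc]
    exact ha _ (hb _ hy)
  | add a b ha hb =>
    intro y hy
    rw [map_add, add_mul]
    exact add _ _ (ha _ hy) (hb _ hy)

/-! ### Derivations -/

section Der

variable {A : Type*} [Ring A] [Algebra ℂ A]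

/-- The first component of a dual number, as a linear map. -/
def dualFst : DualNumber A →ₗ[ℂ] A where
  toFun := TrivSqZeroExt.fst
  map_add' _ _ := TrivSqZeroExt.fst_add _ _
  map_smul' _ _ := TrivSqZeroExt.fst_smul _ _

/-- The second component of a dual number, as a linear map. -/
def dualSnd : DualNumber A →ₗ[ℂ] A where
  toFun := TrivSqZeroExt.snd
  map_add' _ _ := TrivSqZeroExt.snd_add _ _
  map_smul' _ _ := TrivSqZeroExt.snd_smul _ _

theorem dual_ext {u v : DualNumber A} (h1 : dualFst u = dualFst v) (h2 : dualSnd u = dualSnd v) :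
    u = v := TrivSqZeroExt.ext h1 h2

/-- The dual number with the given components. -/
def dualMk (a b : A) : DualNumber A := TrivSqZeroExt.inl a + TrivSqZeroExt.inr b

@[simp] theorem dualFst_mk (a b : A) : dualFst (dualMk a b) = a := by
  simp [dualFst, dualMk]

@[simp] theorem dualSnd_mk (a b : A) : dualSnd (dualMk a b) = b := by
  simp [dualSnd, dualMk]

@[simp] theorem dualFst_one : dualFst (1 : DualNumber A) = 1 := rfl

@[simp] theorem dualSnd_one : dualSnd (1 : DualNumber A) = 0 := rfl

@[simp] theorem dualFst_mul (u v : DualNumber A) : dualFst (u * v) = dualFst u * dualFst v := rfl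

@[simp] theorem dualSnd_mul (u v : DualNumber A) :
    dualSnd (u * v) = dualFst u * dualSnd v + dualSnd u * dualFst v :=
  TrivSqZeroExt.snd_mul _ _

/-- The derivation on the free algebra, along a homomorphism, with given values on the arrows
and value zero on the nodes. -/
def freeDer (E : Fin 3 → A) (X D : Arrow → A) : Free →ₗ[ℂ] A :=
  dualSnd ∘ₗ (freeLift (fun a => dualMk (E a) 0) (fun x => dualMk (X x) (D x))).toLinearMap

theorem freeDer_fe (E : Fin 3 → A) (X D : Arrow → A) (a : Fin 3) : freeDer E X D (fe a) = 0 := by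
  simp [freeDer, freeLift_fe]

theorem freeDer_fa (E : Fin 3 → A) (X D : Arrow → A) (x : Arrow) :
    freeDer E X D (fa x) = D x := by
  simp [freeDer, freeLift_fa]

theorem freeDer_one (E : Fin 3 → A) (X D : Arrow → A) : freeDer E X D 1 = 0 := by
  simp [freeDer]

/-- The first component of the lift to dual numbers is the undeformed homomorphism, so the second
component of a product is the Leibniz rule. -/
theorem freeDer_mul (E : Fin 3 → A) (X D : Arrow → A) (u v : Free) :
    freeDer E X D (u * v) =
      freeLift E X u * freeDer E X D v + freeDer E X D u * freeLift E X v := by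
  have h : ∀ u, dualFst (freeLift (fun a => dualMk (E a) 0) (fun x => dualMk (X x) (D x)) u) =
      freeLift E X u := by
    intro u
    induction u using FreeAlgebra.induction with
    | grade0 c =>
      rw [AlgHom.commutes, AlgHom.commutes, Algebra.algebraMap_eq_smul_one,
        Algebra.algebraMap_eq_smul_one, map_smul, dualFst_one]
    | grade1 t =>
      rcases t with a | x
      · change dualFst (freeLift _ _ (fe a)) = freeLift _ _ (fe a)
        rw [freeLift_fe, freeLift_fe, dualFst_mk]
      · change dualFst (freeLift _ _ (fa x)) = freeLift _ _ (fa x)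
        rw [freeLift_fa, freeLift_fa, dualFst_mk]
    | mul a b ha hb => rw [map_mul (freeLift _ _), map_mul (freeLift E X), dualFst_mul, ha, hb]
    | add a b ha hb => rw [map_add, map_add, map_add, ha, hb]
  simp only [freeDer, LinearMap.comp_apply, AlgHom.toLinearMap_apply, map_mul, dualSnd_mul, h]

/-- Infinitesimal deformations of a representation of `Λ` which respect the relations. -/
structure DerData (E : Fin 3 → A) (X D : Arrow → A) : Prop where
  at_tgt : ∀ x, E (tgt x) * D x = D x
  at_src : ∀ x, D x * E (src x) = D x
  quad : ∀ r ∈ relSet, wordSum (fun x y => X x * D y + D x * X y) r = 0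

/-- The relations over the dual numbers split by order: order zero is `LamData` for the undeformed
values, order one is `DerData`. -/
theorem DerData.lamData {E : Fin 3 → A} {X D : Arrow → A} (H : LamData E X)
    (K : DerData E X D) :
    LamData (fun a => dualMk (E a) 0) (fun x => dualMk (X x) (D x)) where
  orth a b h := dual_ext (by simp [H.orth a b h]) (by simp)
  idem a := dual_ext (by simp [H.idem]) (by simp)
  sum_one := dual_ext (by simp [H.sum_one]) (by simp)
  at_tgt x := dual_ext (by simp [H.at_tgt]) (by simp [K.at_tgt])
  at_src x := dual_ext (by simp [H.at_src]) (by simp [K.at_src])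
  quad r hr := dual_ext
    (by rw [wordSum_map, map_zero, ← H.quad r hr]; simp only [dualFst_mul, dualFst_mk])
    (by rw [wordSum_map, map_zero, ← K.quad r hr]; simp only [dualSnd_mul, dualFst_mk, dualSnd_mk])

end Der

theorem lamData_self : LamData e ar where
  orth _ _ h := e_mul_e_of_ne h
  idem := e_mul_self
  sum_one := sum_e
  at_tgt := e_tgt_mul_ar
  at_src := ar_mul_e_src
  quad r hr := quad_rel r hr

/-- The derivation of `Λ` with given values on the arrows and value zero on the nodes. -/
def lamDer {h : Arrow → Lam} (H : DerData e ar h) : Lam →ₗ[ℂ] Lam :=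
  dualSnd ∘ₗ (lamLift (H.lamData lamData_self)).toLinearMap

theorem lamDer_e {h : Arrow → Lam} (H : DerData e ar h) (a : Fin 3) : lamDer H (e a) = 0 := by
  simp [lamDer, lamLift_e]

theorem lamDer_ar {h : Arrow → Lam} (H : DerData e ar h) (x : Arrow) :
    lamDer H (ar x) = h x := by
  simp [lamDer, lamLift_ar]

theorem lamDer_mul {h : Arrow → Lam} (H : DerData e ar h) (x y : Lam) :
    lamDer H (x * y) = x * lamDer H y + lamDer H x * y := by
  have h : ∀ x, dualFst (lamLift (H.lamData lamData_self) x) = x := by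
    intro x
    induction x using lam_induction with
    | one => simp
    | add x y hx hy => rw [map_add, map_add, hx, hy]
    | smul c x hx => rw [map_smul, map_smul, hx]
    | e_mul a x hx => rw [map_mul, dualFst_mul, hx, lamLift_e, dualFst_mk]
    | ar_mul a x hx => rw [map_mul, dualFst_mul, hx, lamLift_ar, dualFst_mk]
  simp only [lamDer, LinearMap.comp_apply, AlgHom.toLinearMap_apply, map_mul, dualSnd_mul, h]

/-! ### The grading -/

/-- All relations are homogeneous when nodes have degree `0` and arrows degree `1`, so the path
length can be recorded as a power of a polynomial variable. -/
theorem gradeData : LamData (fun a => Polynomial.C (e a)) (fun x => Polynomial.monomial 1 (ar x)) where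
  orth a b h := by rw [← Polynomial.C_mul, e_mul_e_of_ne h, Polynomial.C_0]
  idem a := by rw [← Polynomial.C_mul, e_mul_self]
  sum_one := by rw [← map_sum, sum_e, Polynomial.C_1]
  at_tgt x := by rw [Polynomial.C_mul_monomial, e_tgt_mul_ar]
  at_src x := by rw [Polynomial.monomial_mul_C, ar_mul_e_src]
  quad r hr := by
    have h := quad_rel r hr
    simp only [Polynomial.monomial_mul_monomial, wordSum_apply, Polynomial.smul_monomial]
    rw [← map_zero (Polynomial.monomial (1 + 1)), ← h]
    simp only [map_sum]

/-- The homomorphism `x ↦ x tⁿ` for `x` of path length `n`. -/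
def grade : Lam →ₐ[ℂ] Polynomial Lam := lamLift gradeData

/-- The component of path length `n`. -/
def comp (n : ℕ) : Lam →ₗ[ℂ] Lam where
  toFun x := (grade x).coeff n
  map_add' x y := by rw [map_add, Polynomial.coeff_add]
  map_smul' c x := by rw [map_smul, Polynomial.coeff_smul, RingHom.id_apply]

theorem comp_apply (n : ℕ) (x : Lam) : comp n x = (grade x).coeff n := rfl

theorem grade_e (a : Fin 3) : grade (e a) = Polynomial.C (e a) := lamLift_e _ a

theorem grade_ar (x : Arrow) : grade (ar x) = Polynomial.monomial 1 (ar x) := lamLift_ar _ x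

theorem comp_e_mul (n : ℕ) (a : Fin 3) (x : Lam) : comp n (e a * x) = e a * comp n x := by
  rw [comp_apply, map_mul, grade_e, Polynomial.coeff_C_mul, comp_apply]

theorem comp_ar_mul_zero (a : Arrow) (x : Lam) : comp 0 (ar a * x) = 0 := by
  rw [comp_apply, map_mul, grade_ar, ← Polynomial.C_mul_X_eq_monomial, mul_assoc,
    Polynomial.coeff_C_mul, Polynomial.coeff_X_mul_zero, mul_zero]

theorem comp_ar_mul_succ (n : ℕ) (a : Arrow) (x : Lam) :
    comp (n + 1) (ar a * x) = ar a * comp n x := by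
  rw [comp_apply, map_mul, grade_ar, ← Polynomial.C_mul_X_eq_monomial, mul_assoc,
    Polynomial.coeff_C_mul, Polynomial.coeff_X_mul, comp_apply]

theorem one_mem_lenPart : (1 : Lam) ∈ lenPart 0 := by
  rw [lenPart, pow_zero, mul_one, ← sum_e]
  exact Submodule.sum_mem _ fun a _ => Submodule.subset_span ⟨a, rfl⟩

theorem e_mem_lenPart (a : Fin 3) : e a ∈ lenPart 0 := by
  rw [lenPart, pow_zero, mul_one]
  exact Submodule.subset_span ⟨a, rfl⟩

theorem e_mul_mem {n : ℕ} (a : Fin 3) {x : Lam} (hx : x ∈ lenPart n) : e a * x ∈ lenPart n := by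
  simpa using lenPart_mul 0 n (Submodule.mul_mem_mul (e_mem_lenPart a) hx)

theorem ar_mul_mem {n : ℕ} (a : Arrow) {x : Lam} (hx : x ∈ lenPart n) :
    ar a * x ∈ lenPart (n + 1) := by
  rw [add_comm]
  exact lenPart_mul 1 n (Submodule.mul_mem_mul (ar_mem_lenPart a) hx)

theorem comp_mem (n : ℕ) (x : Lam) : comp n x ∈ lenPart n := by
  induction x using lam_induction generalizing n with
  | one =>
    rw [comp_apply, map_one, Polynomial.coeff_one]
    split_ifs with h
    · rw [h]
      exact one_mem_lenPart
    · exact Submodule.zero_mem _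
  | add x y hx hy =>
    rw [map_add]
    exact Submodule.add_mem _ (hx n) (hy n)
  | smul c x hx =>
    rw [map_smul]
    exact Submodule.smul_mem _ c (hx n)
  | e_mul a x hx =>
    rw [comp_e_mul]
    exact e_mul_mem a (hx n)
  | ar_mul a x hx =>
    cases n with
    | zero =>
      rw [comp_ar_mul_zero]
      exact Submodule.zero_mem _
    | succ n =>
      rw [comp_ar_mul_succ]
      exact ar_mul_mem a (hx n)

/-- Setting the grading variable to `1` undoes `grade`. -/
theorem sum_comp (x : Lam) : x = ∑ n ∈ (grade x).support, comp n x := by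
  have h : ∀ x, (grade x).eval 1 = x := by
    intro x
    induction x using lam_induction with
    | one => simp
    | add x y hx hy => rw [map_add, Polynomial.eval_add, hx, hy]
    | smul c x hx => rw [map_smul, Polynomial.eval_smul, hx]
    | e_mul a x hx => rw [map_mul, grade_e, Polynomial.eval_C_mul, hx]
    | ar_mul a x hx =>
      rw [map_mul, grade_ar, ← Polynomial.C_mul_X_eq_monomial, mul_assoc, Polynomial.eval_C_mul,
        Polynomial.X_mul, Polynomial.eval_mul_X, mul_one, hx]
  conv_lhs => rw [← h x, Polynomial.eval_eq_sum]
  simp only [one_pow, mul_one]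
  rfl

/-- Every element of `Λ` is a sum of homogeneous ones. -/
theorem lam_homog_induction {P : Lam → Prop} (add : ∀ x y, P x → P y → P (x + y)) (zero : P 0)
    (mem : ∀ n : ℕ, ∀ x ∈ lenPart n, P x) (x : Lam) : P x := by
  rw [sum_comp x]
  exact Finset.sum_induction _ P add zero fun n _ => mem n _ (comp_mem n x)

/-- The derivation which is the identity on arrows doubles every quadratic relation. -/
theorem lenData : DerData e ar ar where
  at_tgt := e_tgt_mul_ar
  at_src := ar_mul_e_src
  quad r hr := by
    have h : wordSum (fun x y => ar x * ar y) r = 0 := quad_rel r hr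
    rw [wordSum_add, h, add_zero]

/-- The derivation `x ↦ n x` for `x` of path length `n`. -/
def len : Lam →ₗ[ℂ] Lam := lamDer lenData

theorem len_mul (x y : Lam) : len (x * y) = x * len y + len x * y := lamDer_mul _ x y

theorem len_e (a : Fin 3) : len (e a) = 0 := lamDer_e _ a

theorem len_ar (x : Arrow) : len (ar x) = ar x := lamDer_ar _ x

theorem comp_len (n : ℕ) (x : Lam) : comp n (len x) = (n : ℂ) • comp n x := by
  induction x using lam_induction generalizing n with
  | one =>
    have : len 1 = 0 := by rw [← sum_e, map_sum]; exact Finset.sum_eq_zero fun a _ => len_e a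
    rw [this, map_zero, comp_apply, map_one, Polynomial.coeff_one]
    split_ifs with h
    · rw [h, Nat.cast_zero, zero_smul]
    · rw [smul_zero]
  | add x y hx hy => rw [map_add, map_add, hx, hy, map_add, smul_add]
  | smul c x hx => rw [map_smul, map_smul, hx, map_smul, smul_comm]
  | e_mul a x hx =>
    rw [len_mul, len_e, zero_mul, add_zero, comp_e_mul, hx, comp_e_mul, mul_smul_comm]
  | ar_mul a x hx =>
    rw [len_mul, len_ar, map_add]
    cases n with
    | zero => simp [comp_ar_mul_zero]
    | succ n =>
      rw [comp_ar_mul_succ, comp_ar_mul_succ, hx, mul_smul_comm, Nat.cast_succ, add_smul, one_smul]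

theorem len_of_mem {n : ℕ} {x : Lam} (hx : x ∈ lenPart n) : len x = (n : ℂ) • x := by
  have h : ∀ n : ℕ, ∀ y ∈ Submodule.span ℂ (Set.range ar) ^ n, len y = (n : ℂ) • y := by
    intro n
    induction n with
    | zero =>
      intro y hy
      rw [pow_zero, Submodule.mem_one] at hy
      obtain ⟨c, rfl⟩ := hy
      rw [Algebra.algebraMap_eq_smul_one, map_smul, ← sum_e, map_sum,
        Finset.sum_eq_zero fun a _ => len_e a]
      simp
    | succ n ih =>
      intro y hy
      rw [pow_succ] at hy
      induction hy using Submodule.mul_induction_on' with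
      | mem_mul_mem a ha b hb =>
        have hb' : len b = b := by
          induction hb using Submodule.span_induction with
          | mem x hx =>
            obtain ⟨x, rfl⟩ := hx
            exact len_ar x
          | zero => rw [map_zero]
          | add x y _ _ hx hy => rw [map_add, hx, hy]
          | smul c x _ hx => rw [map_smul, hx]
        rw [len_mul, hb', ih a ha, smul_mul_assoc, Nat.cast_succ, add_smul, one_smul, add_comm]
      | add x _ y _ hx hy => rw [map_add, hx, hy, smul_add]
  rw [lenPart] at hx
  induction hx using Submodule.mul_induction_on' with
  | mem_mul_mem a ha b hb =>
    have ha' : len a = 0 := by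
      induction ha using Submodule.span_induction with
      | mem x hx =>
        obtain ⟨x, rfl⟩ := hx
        exact len_e x
      | zero => rw [map_zero]
      | add x y _ _ hx hy => rw [map_add, hx, hy, add_zero]
      | smul c x _ hx => rw [map_smul, hx, smul_zero]
    rw [len_mul, ha', h n b hb, zero_mul, add_zero, mul_smul_comm]
  | add x _ y _ hx hy => rw [map_add, hx, hy, smul_add]

/-- The homogeneous parts are the eigenspaces of the length derivation. -/
theorem mem_homog_iff (k : ℤ) (x : Lam) : x ∈ homog k ↔ len x = (k : ℂ) • x := by
  constructor
  · intro h
    unfold homog at h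
    split_ifs at h with hk
    · rw [len_of_mem h]
      congr 1
      exact_mod_cast congrArg (Int.cast : ℤ → ℂ) (Int.toNat_of_nonneg hk)
    · rw [(Submodule.mem_bot ℂ).1 h, map_zero, smul_zero]
  · intro h
    rw [sum_comp x]
    refine Submodule.sum_mem _ fun n _ => ?_
    have h1 := comp_len n x
    rw [h, map_smul] at h1
    by_cases hn : k = n
    · rw [hn, ← lenPart_eq_homog]
      exact comp_mem n x
    -- The component of length `n` is an eigenvector for both `k` and `n`, hence zero when they
    -- differ.
    · have h2 : ((k : ℂ) - n) • comp n x = 0 := by rw [sub_smul, h1, sub_self]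
      rcases smul_eq_zero.1 h2 with h3 | h3
      · exact absurd (by exact_mod_cast sub_eq_zero.1 h3) hn
      · rw [h3]
        exact Submodule.zero_mem _

/-! ### The comparison map is injective -/

/-- With `len` as the Euler derivation, the weight condition becomes an identity valid for all
arguments, which can be checked by induction on products of generators; `mem_C2_of_len` is the
converse. -/
theorem len_C2 {w : ℤ} {f : Lam →ₗ[ℂ] Lam →ₗ[ℂ] Lam} (hf : f ∈ C2 w) (x y : Lam) :
    len (f x y) = f (len x) y + f x (len y) + (w : ℂ) • f x y := by
  induction x using lam_homog_induction with
  | add x x' hx hx' =>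
    simp only [map_add, LinearMap.add_apply, hx, hx', smul_add]
    abel
  | zero => simp
  | mem m x hx =>
    induction y using lam_homog_induction with
    | add y y' hy hy' =>
      simp only [map_add, hy, hy', smul_add]
      abel
    | zero => simp
    | mem n y hy =>
      rw [(mem_homog_iff _ _).1 (hf.2.2.2 m n x hx y hy), len_of_mem hx, len_of_mem hy]
      simp only [map_smul, LinearMap.smul_apply, ← add_smul]
      push_cast
      rfl

theorem mem_C2_of_len {w : ℤ} {f : Lam →ₗ[ℂ] Lam →ₗ[ℂ] Lam}
    (h1 : ∀ a x y, f (e a * x) y = e a * f x y) (h2 : ∀ a x y, f (x * e a) y = f x (e a * y))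
    (h3 : ∀ a x y, f x (y * e a) = f x y * e a)
    (h4 : ∀ x y, len (f x y) = f (len x) y + f x (len y) + (w : ℂ) • f x y) : f ∈ C2 w := by
  refine ⟨h1, h2, h3, fun m n x hx y hy => ?_⟩
  rw [mem_homog_iff, h4, len_of_mem hx, len_of_mem hy]
  simp only [map_smul, LinearMap.smul_apply, ← add_smul]
  push_cast
  rfl

/-- Left multiplication by `(a, b)` in the extension of `Λ` by `Λ` given by a bilinear map. -/
def twOp (f : Lam →ₗ[ℂ] Lam →ₗ[ℂ] Lam) : Lam × Lam →ₗ[ℂ] Module.End ℂ (Lam × Lam) where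
  toFun p := LinearMap.prod (LinearMap.mulLeft ℂ p.1 ∘ₗ LinearMap.fst ℂ Lam Lam)
    (LinearMap.mulLeft ℂ p.1 ∘ₗ LinearMap.snd ℂ Lam Lam +
      (LinearMap.mulLeft ℂ p.2 + f p.1) ∘ₗ LinearMap.fst ℂ Lam Lam)
  map_add' p q := by
    refine LinearMap.ext fun u => Prod.ext ?_ ?_
    · simp [add_mul]
    · simp [add_mul]
      abel
  map_smul' c p := by
    refine LinearMap.ext fun u => Prod.ext ?_ ?_
    · simp
    · simp [smul_add]

theorem twOp_apply (f : Lam →ₗ[ℂ] Lam →ₗ[ℂ] Lam) (a b u v : Lam) :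
    twOp f (a, b) (u, v) = (a * u, a * v + (b * u + f a u)) := rfl

/-- The second component of the value at `(1, 0)` is `b + f a 1`. -/
theorem twOp_injective {f : Lam →ₗ[ℂ] Lam →ₗ[ℂ] Lam} {a b b' : Lam}
    (h : twOp f (a, b) = twOp f (a, b')) : b = b' := by
  have := congrArg (fun t => (t (1, 0)).2) h
  simpa [twOp_apply] using this

/-- The cocycle identity is what makes these operators closed under composition. They form the
square-zero extension of `Λ` by `Λ` with class `f`, so associativity comes from composition of maps.
-/
theorem twOp_mul {w : ℤ} {f : Lam →ₗ[ℂ] Lam →ₗ[ℂ] Lam} (hf : f ∈ Z2 w) (a b a' b' : Lam) :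
    twOp f (a, b) * twOp f (a', b') = twOp f (a * a', a * b' + b * a' + f a a') := by
  refine LinearMap.ext fun ⟨u, v⟩ => ?_
  rw [Module.End.mul_apply, twOp_apply, twOp_apply, twOp_apply, mul_assoc]
  refine Prod.ext rfl ?_
  have := hf.2 a a' u
  rw [sub_eq_zero, sub_add_eq_add_sub, sub_eq_iff_eq_add] at this
  simp only [mul_add, add_mul, mul_assoc]
  rw [show a * (a' * v) + (a * (b' * u) + a * f a' u) + (b * (a' * u) + f a (a' * u)) =
    a * (a' * v) + (a * (b' * u) + b * (a' * u)) + (a * f a' u + f a (a' * u)) by abel, this]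
  abel

/-- Cocycles are not assumed normalised: the unit of the extension is `(1, -f 1 1)`, and the value
`f 1 1` controls `f` whenever one argument is an idempotent. -/
theorem Z2_one_left {w : ℤ} {f : Lam →ₗ[ℂ] Lam →ₗ[ℂ] Lam} (hf : f ∈ Z2 w)
    (x : Lam) : f 1 x = f 1 1 * x := by
  have := hf.2 1 1 x
  simp only [one_mul, sub_self, zero_add] at this
  exact sub_eq_zero.1 this

theorem Z2_one_right {w : ℤ} {f : Lam →ₗ[ℂ] Lam →ₗ[ℂ] Lam} (hf : f ∈ Z2 w)
    (x : Lam) : f x 1 = x * f 1 1 := by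
  have := hf.2 x 1 1
  simp only [mul_one, sub_add_cancel] at this
  exact (sub_eq_zero.1 this).symm

theorem Z2_e_left {w : ℤ} {f : Lam →ₗ[ℂ] Lam →ₗ[ℂ] Lam} (hf : f ∈ Z2 w)
    (a : Fin 3) (x : Lam) : f (e a) x = e a * f 1 1 * x := by
  have := hf.1.1 a 1 x
  rwa [mul_one, Z2_one_left hf, ← mul_assoc] at this

theorem Z2_e_right {w : ℤ} {f : Lam →ₗ[ℂ] Lam →ₗ[ℂ] Lam} (hf : f ∈ Z2 w)
    (a : Fin 3) (x : Lam) : f x (e a) = x * (f 1 1 * e a) := by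
  have := hf.1.2.2.1 a x 1
  rwa [one_mul, Z2_one_right hf, mul_assoc] at this

theorem Z2_e_comm {w : ℤ} {f : Lam →ₗ[ℂ] Lam →ₗ[ℂ] Lam} (hf : f ∈ Z2 w)
    (a : Fin 3) : e a * f 1 1 = f 1 1 * e a := by
  have := hf.1.2.1 a 1 1
  rwa [one_mul, mul_one, Z2_e_left hf, Z2_e_right hf, mul_one, one_mul] at this

theorem twOp_e {w : ℤ} {f : Lam →ₗ[ℂ] Lam →ₗ[ℂ] Lam} (hf : f ∈ Z2 w)
    (a : Fin 3) (u v : Lam) :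
    twOp f (e a, -(e a * f 1 1)) (u, v) = (e a * u, e a * v) := by
  rw [twOp_apply, Z2_e_left hf, neg_mul, neg_add_cancel, add_zero]

/-- The correction `-(e a * f 1 1)` makes the lift of `e a` act diagonally by `e a`, which settles
the path algebra relations. In a quadratic relation the second component is `evalT2 f - dM1 h`,
which is zero. -/
theorem twData {w : ℤ} {f : Lam →ₗ[ℂ] Lam →ₗ[ℂ] Lam} (hf : f ∈ Z2 w)
    {h : Arrow → Lam} (hh : h ∈ M1 w) (hfh : evalT2 f = dM1 h) :
    LamData (fun a => twOp f (e a, -(e a * f 1 1))) (fun x => twOp f (ar x, -h x)) where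
  orth a b hab := LinearMap.ext fun ⟨u, v⟩ => by
    rw [Module.End.mul_apply, twOp_e hf, twOp_e hf, ← mul_assoc, ← mul_assoc, e_mul_e_of_ne hab,
      zero_mul, zero_mul]
    rfl
  idem a := LinearMap.ext fun ⟨u, v⟩ => by
    rw [Module.End.mul_apply, twOp_e hf, twOp_e hf, ← mul_assoc, ← mul_assoc, e_mul_self]
  sum_one := LinearMap.ext fun ⟨u, v⟩ => by
    simp only [LinearMap.sum_apply, twOp_e hf]
    refine Prod.ext ?_ ?_
    · rw [Prod.fst_sum, ← Finset.sum_mul, sum_e, one_mul]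
      rfl
    · rw [Prod.snd_sum, ← Finset.sum_mul, sum_e, one_mul]
      rfl
  at_tgt x := LinearMap.ext fun ⟨u, v⟩ => by
    rw [Module.End.mul_apply, twOp_apply f (ar x), twOp_e hf, ← mul_assoc, e_tgt_mul_ar, mul_add, mul_add,
      ← mul_assoc, e_tgt_mul_ar, ← hf.1.1, e_tgt_mul_ar, ← mul_assoc, mul_neg, (hh x).1]
  at_src x := LinearMap.ext fun ⟨u, v⟩ => by
    rw [Module.End.mul_apply, twOp_e hf, twOp_apply, twOp_apply, ← mul_assoc, ar_mul_e_src,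
      ← mul_assoc, ar_mul_e_src, ← mul_assoc, neg_mul, (hh x).2.1, ← hf.1.2.1, ar_mul_e_src]
  quad r hr := by
    simp only [twOp_mul hf]
    rw [← wordSum_map (twOp f) (fun x y =>
      (ar x * ar y, ar x * -h y + -h x * ar y + f (ar x) (ar y)))]
    have h1 := quad_rel r hr
    have h2 := congrArg (fun t => t ⟨r, mem_T2 hr⟩) hfh
    have h3 : wordSum (fun x y =>
        (ar x * ar y, ar x * -h y + -h x * ar y + f (ar x) (ar y))) r = 0 := by
      refine Prod.ext ?_ ?_
      · rw [wordSum_apply]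
        simp only [Prod.fst_sum, Prod.smul_fst]
        exact h1
      · have h4 : ∑ x, ∑ y, r x y • f (ar x) (ar y) =
          ∑ x, ∑ y, r x y • (ar x * h y + h x * ar y) := h2
        rw [wordSum_apply]
        simp only [Prod.snd_sum, Prod.smul_snd, smul_add, Finset.sum_add_distrib, h4, mul_neg,
          neg_mul, smul_neg, Finset.sum_neg_distrib, Prod.snd_zero]
        abel
    rw [h3, map_zero]

/-- A Hochschild cocycle whose restriction to `T_2` is a coboundary is a coboundary. -/
theorem mem_B2_of_eval {w : ℤ} {f : Lam →ₗ[ℂ] Lam →ₗ[ℂ] Lam} (hf : f ∈ Z2 w)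
    {h : Arrow → Lam} (hh : h ∈ M1 w) (hfh : evalT2 f = dM1 h) :
    f ∈ B2 w := by
  -- The splitting stays inside the extension and lifts the identity of `Λ`, because this is so on
  -- generators and `twOp_mul` preserves it.
  have ex : ∀ y, ∃ b, lamLift (twData hf hh hfh) y = twOp f (y, b) := by
    intro y
    induction y using lam_induction with
    | one =>
      refine ⟨-(f 1 1), ?_⟩
      rw [map_one]
      refine LinearMap.ext fun ⟨u, v⟩ => ?_
      rw [twOp_apply, Z2_one_left hf u, neg_mul, neg_add_cancel, one_mul, one_mul, add_zero]
      rfl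
    | add x y hx hy =>
      obtain ⟨b, hb⟩ := hx
      obtain ⟨b', hb'⟩ := hy
      exact ⟨b + b', by rw [map_add, hb, hb', ← map_add]; rfl⟩
    | smul c x hx =>
      obtain ⟨b, hb⟩ := hx
      exact ⟨c • b, by rw [map_smul, hb, ← map_smul]; rfl⟩
    | e_mul a x hx =>
      obtain ⟨b, hb⟩ := hx
      exact ⟨_, by rw [map_mul, hb, lamLift_e, twOp_mul hf]⟩
    | ar_mul a x hx =>
      obtain ⟨b, hb⟩ := hx
      exact ⟨_, by rw [map_mul, hb, lamLift_ar, twOp_mul hf]⟩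
  choose b hb using ex
  have b_eq : ∀ {y c}, lamLift (twData hf hh hfh) y = twOp f (y, c) → b y = c := fun {y c} hc =>
    twOp_injective ((hb y).symm.trans hc)
  have b_add : ∀ x y, b (x + y) = b x + b y := fun x y => b_eq (by
    rw [map_add, hb, hb, ← map_add]
    rfl)
  have b_smul : ∀ (c : ℂ) x, b (c • x) = c • b x := fun c x => b_eq (by
    rw [map_smul, hb, ← map_smul]
    rfl)
  have b_mul : ∀ x y, b (x * y) = x * b y + b x * y + f x y := fun x y => b_eq (by
    rw [map_mul, hb, hb, twOp_mul hf])
  have b_e : ∀ a, b (e a) = -(e a * f 1 1) := fun a => b_eq (lamLift_e _ a)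
  have b_ar : ∀ x, b (ar x) = -h x := fun x => b_eq (lamLift_ar _ x)
  have b_e_mul : ∀ a x, b (e a * x) = e a * b x := fun a x => by
    rw [b_mul, b_e, Z2_e_left hf, neg_mul, neg_add_cancel_right]
  have b_mul_e : ∀ a x, b (x * e a) = b x * e a := fun a x => by
    rw [b_mul, b_e, Z2_e_right hf, Z2_e_comm hf, mul_neg]
    abel
  let B : Lam →ₗ[ℂ] Lam := ⟨⟨b, b_add⟩, b_smul⟩
  have B_apply : ∀ x, B x = b x := fun _ => rfl
  have b_one : b 1 = -(f 1 1) := by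
    change B 1 = _
    conv_lhs => rw [← sum_e]
    rw [map_sum]
    simp only [B_apply, b_e, Finset.sum_neg_distrib, ← Finset.sum_mul, sum_e, one_mul]
  -- The splitting has weight `w`. It is enough to check this on generators: `h` has weight `w` by
  -- `M1`, and the cocycle term is handled by `len_C2`.
  have len_b : ∀ x, len (B x) = B (len x) + (w : ℂ) • B x := by
    intro x
    induction x using lam_induction with
    | one =>
      have h1 := (mem_homog_iff _ _).1 (hf.1.2.2.2 0 0 1 one_mem_lenPart 1 one_mem_lenPart)
      have h2 : len 1 = 0 := by
        rw [← sum_e, map_sum]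
        exact Finset.sum_eq_zero fun a _ => len_e a
      rw [h2, map_zero, zero_add, B_apply, b_one, map_neg, h1]
      simp
    | add x y hx hy =>
      simp only [map_add, hx, hy, smul_add]
      abel
    | smul c x hx => simp only [map_smul, hx, smul_add, smul_comm c]
    | e_mul a x hx =>
      rw [B_apply, b_e_mul, len_mul, len_e, zero_mul, add_zero, ← B_apply, hx, len_mul, len_e,
        zero_mul, add_zero, B_apply (e a * _), b_e_mul, mul_add, mul_smul_comm]
      rfl
    | ar_mul a x hx =>
      have h1 := (mem_homog_iff _ _).1 (hh a).2.2
      rw [B_apply, b_mul, b_ar, map_add, map_add, len_mul, len_mul, len_ar, ← B_apply, hx, map_neg,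
        h1, len_C2 hf.1, len_ar, len_mul, len_ar, map_add, B_apply (ar a * _), B_apply (ar a * _),
        b_mul, b_mul, b_ar, ← B_apply, ← B_apply]
      push_cast
      simp only [mul_add, add_mul, smul_add, add_smul, neg_mul, smul_neg, mul_smul_comm,
        smul_mul_assoc, one_smul]
      abel
  -- The sign: multiplicativity of the splitting reads `B (x * y) = x * B y + B x * y + f x y`, so
  -- that `f` is `d1 (-B)`.
  refine ⟨-B, ⟨fun a x => ?_, fun a x => ?_, fun n x hx => ?_⟩, ?_⟩
  · rw [LinearMap.neg_apply, LinearMap.neg_apply, B_apply, b_e_mul, mul_neg, B_apply]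
  · rw [LinearMap.neg_apply, LinearMap.neg_apply, B_apply, b_mul_e, neg_mul, B_apply]
  · rw [LinearMap.neg_apply]
    refine Submodule.neg_mem _ ((mem_homog_iff _ _).2 ?_)
    rw [len_b, len_of_mem hx, map_smul, ← add_smul]
    push_cast
    rfl
  · refine LinearMap.ext fun x => LinearMap.ext fun y => ?_
    rw [d1_apply]
    simp only [LinearMap.neg_apply, B_apply, b_mul]
    noncomm_ring

theorem cmp_injective (w : ℤ) : Function.Injective (cmp w) := by
  rw [← LinearMap.ker_eq_bot, LinearMap.ker_eq_bot']
  intro c hc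
  obtain ⟨f, rfl⟩ := Submodule.Quotient.mk_surjective _ c
  have h1 : (Submodule.Quotient.mk (evalZ w f) : MH2 w) = 0 := hc
  rw [Submodule.Quotient.mk_eq_zero] at h1
  obtain ⟨h, hh, hfh⟩ : evalT2 f.1 ∈ MB2 w := h1
  rw [Submodule.Quotient.mk_eq_zero]
  exact mem_B2_of_eval f.2 hh hfh.symm

/-! ### Cocycles from deformations of faithful representations -/

section Extension

variable {N : Type*} [Ring N] [Algebra ℂ N]

/-- Deformation data for a graded representation `φ` of `Λ`: the element `Eu` induces the grading,
the first order deformation of the arrows is given by `D` and has weight `w`, and it changes the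
relations by `φ ∘ g`. -/
structure DefData (φ : Lam →ₐ[ℂ] N) (Eu : N) (w : ℤ) (D : Arrow → N) (g : ↥T2 →ₗ[ℂ] Lam) :
    Prop where
  inj : Function.Injective φ
  eu_e : ∀ a, Eu * φ (e a) = φ (e a) * Eu
  eu_ar : ∀ x, Eu * φ (ar x) - φ (ar x) * Eu = φ (ar x)
  at_tgt : ∀ x, φ (e (tgt x)) * D x = D x
  at_src : ∀ x, D x * φ (e (src x)) = D x
  eu_D : ∀ x, Eu * D x - D x * Eu = (1 + w : ℂ) • D x
  quad : ∀ r : T2, wordSum (fun x y => φ (ar x) * D y + D x * φ (ar y)) r.1 = φ (g r)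

namespace DefData

variable {φ : Lam →ₐ[ℂ] N} {Eu : N} {w : ℤ} {D : Arrow → N} {g : ↥T2 →ₗ[ℂ] Lam}

/-- The derivation on the free algebra. -/
def der (φ : Lam →ₐ[ℂ] N) (D : Arrow → N) : Free →ₗ[ℂ] N :=
  freeDer (fun a => φ (e a)) (fun x => φ (ar x)) D

theorem der_mul (φ : Lam →ₐ[ℂ] N) (D : Arrow → N) (u v : Free) :
    der φ D (u * v) = φ (toLam u) * der φ D v + der φ D u * φ (toLam v) := by
  have h : ∀ u, freeLift (fun a => φ (e a)) (fun x => φ (ar x)) u = φ (toLam u) := by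
    have : freeLift (fun a => φ (e a)) (fun x => φ (ar x)) = φ.comp toLam :=
      FreeAlgebra.hom_ext (funext fun t => by
        rcases t with a | x
        · exact freeLift_fe _ _ a
        · exact freeLift_fa _ _ x)
    intro u
    rw [this, AlgHom.comp_apply]
  rw [der, freeDer_mul, h, h]

theorem der_fe (φ : Lam →ₐ[ℂ] N) (D : Arrow → N) (a : Fin 3) : der φ D (fe a) = 0 :=
  freeDer_fe _ _ _ a

theorem der_fa (φ : Lam →ₐ[ℂ] N) (D : Arrow → N) (x : Arrow) : der φ D (fa x) = D x :=
  freeDer_fa _ _ _ x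

theorem der_one (φ : Lam →ₐ[ℂ] N) (D : Arrow → N) : der φ D 1 = 0 := freeDer_one _ _ _

/-- The derivation does not descend to `Λ`, but its failure to do so stays in `φ(Λ)`. It respects
the path algebra relations, takes the value `φ (g r)` on a quadratic relation `r`, and `φ(Λ)` is
stable under multiplication by itself on either side. -/
theorem der_sub_mem (H : DefData φ Eu w D g) {u v : Free} (h : toLam u = toLam v) :
    der φ D u - der φ D v ∈ LinearMap.range φ.toLinearMap := by
  refine toLam_eq_induction (P := fun u v => der φ D u - der φ D v ∈ LinearMap.range φ.toLinearMap)
    ?_ ?_ ?_ ?_ ?_ ?_ ?_ h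
  · intro u v h
    have ok : ∀ n : N, n = 0 → n ∈ LinearMap.range φ.toLinearMap := fun n hn => by
      rw [hn]
      exact Submodule.zero_mem _
    cases h with
    | orth a b h => exact ok _ (by simp [der_mul, der_fe])
    | idem a => exact ok _ (by simp [der_mul, der_fe])
    | sum_one => exact ok _ (by simp [der_one, der_fe])
    | at_tgt x =>
      refine ok _ ?_
      rw [der_mul, der_fe, der_fa, zero_mul, add_zero]
      exact sub_eq_zero.2 (H.at_tgt x)
    | at_src x =>
      refine ok _ ?_
      rw [der_mul, der_fe, der_fa, mul_zero, zero_add]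
      exact sub_eq_zero.2 (H.at_src x)
    | quad r hr =>
      refine ⟨g ⟨r, mem_T2 hr⟩, ?_⟩
      rw [map_zero, sub_zero, AlgHom.toLinearMap_apply, ← H.quad]
      simp only [map_sum, map_smul, der_mul, der_fa]
      rfl
  · intro u v c _ h
    rwa [map_add, map_add, add_sub_add_right_eq_sub]
  · rintro u v c huv ⟨y, hy⟩
    refine ⟨y * toLam c, ?_⟩
    rw [der_mul, der_mul, huv, add_sub_add_left_eq_sub, ← sub_mul, ← hy]
    exact map_mul φ _ _
  · rintro u v c huv ⟨y, hy⟩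
    refine ⟨toLam c * y, ?_⟩
    rw [der_mul, der_mul, huv, add_sub_add_right_eq_sub, ← mul_sub, ← hy]
    exact map_mul φ _ _
  · intro u
    rw [sub_self]
    exact Submodule.zero_mem _
  · intro u v h
    rw [← neg_sub]
    exact Submodule.neg_mem _ h
  · intro u v w h1 h2
    rw [← sub_add_sub_cancel _ (der φ D v)]
    exact Submodule.add_mem _ h1 h2

/-- Both sides are derivations along `φ` which agree on the generators. -/
theorem eu_len (H : DefData φ Eu w D g) (x : Lam) : Eu * φ x - φ x * Eu = φ (len x) := by
  induction x using lam_induction with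
  | one =>
    have h2 : len 1 = 0 := by
      rw [← sum_e, map_sum]
      exact Finset.sum_eq_zero fun a _ => len_e a
    rw [h2]
    simp
  | add x y hx hy =>
    rw [map_add, map_add, map_add, ← hx, ← hy, mul_add, add_mul]
    abel
  | smul c x hx =>
    rw [map_smul, map_smul, map_smul, ← hx, smul_sub, mul_smul_comm, smul_mul_assoc]
  | e_mul a x hx =>
    rw [len_mul, len_e, zero_mul, add_zero, map_mul, map_mul, ← hx, ← mul_assoc, H.eu_e, mul_sub,
      mul_assoc, mul_assoc]
  | ar_mul a x hx =>
    rw [len_mul, len_ar, map_add, map_mul, map_mul, ← hx]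
    have h1 := H.eu_ar a
    rw [sub_eq_iff_eq_add] at h1
    rw [← mul_assoc, h1, add_mul, mul_sub]
    simp only [mul_assoc]
    abel

/-- Lifts of homogeneous elements of `Λ` to the free algebra whose derivative is homogeneous. -/
structure IsHom (φ : Lam →ₐ[ℂ] N) (Eu : N) (w : ℤ) (D : Arrow → N) (a b : Fin 3) (n : ℂ)
    (u : Free) : Prop where
  left : e a * toLam u = toLam u
  right : toLam u * e b = toLam u
  len : len (toLam u) = n • toLam u
  der_left : φ (e a) * der φ D u = der φ D u
  der_right : der φ D u * φ (e b) = der φ D u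
  der_len : Eu * der φ D u - der φ D u * Eu = (n + w) • der φ D u

theorem isHom_fe (a : Fin 3) : IsHom φ Eu w D a a 0 (fe a) where
  left := e_mul_self a
  right := e_mul_self a
  len := by
    rw [zero_smul]
    exact len_e a
  der_left := by rw [der_fe, mul_zero]
  der_right := by rw [der_fe, zero_mul]
  der_len := by rw [der_fe, mul_zero, zero_mul, smul_zero, sub_zero]

theorem IsHom.cons (H : DefData φ Eu w D g) {b : Fin 3} {n : ℂ} {u : Free} (x : Arrow)
    (h : IsHom φ Eu w D (src x) b n u) : IsHom φ Eu w D (tgt x) b (n + 1) (fa x * u) where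
  left := by
    rw [map_mul, ← mul_assoc]
    exact congrArg (· * _) (e_tgt_mul_ar x)
  right := by rw [map_mul, mul_assoc, h.right]
  len := by
    have : TP2.len (toLam (fa x)) = toLam (fa x) := len_ar x
    rw [map_mul, len_mul, h.len, this, mul_smul_comm, add_smul, one_smul]
  der_left := by
    have h1 : φ (e (tgt x)) * φ (toLam (fa x)) = φ (toLam (fa x)) := by
      rw [← map_mul]
      exact congrArg φ (e_tgt_mul_ar x)
    rw [der_mul, mul_add, ← mul_assoc, ← mul_assoc, der_fa, H.at_tgt, h1]
  der_right := by
    have h1 : φ (toLam u) * φ (e b) = φ (toLam u) := by rw [← map_mul, h.right]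
    rw [der_mul, add_mul, mul_assoc, mul_assoc, h.der_right, h1]
  der_len := by
    have h1 := H.eu_ar x
    have h2 := H.eu_D x
    have h3 := H.eu_len (toLam u)
    have h4 := h.der_len
    rw [h.len, map_smul] at h3
    rw [sub_eq_iff_eq_add] at h1 h2 h3 h4
    rw [der_mul, der_fa, mul_add, ← mul_assoc, ← mul_assoc, show toLam (fa x) = ar x from rfl, h1,
      h2, add_mul, mul_assoc, h4, add_mul (_ • D x), mul_assoc (D x), h3]
    simp only [mul_add, add_mul, add_smul, smul_mul_assoc, mul_smul_comm, mul_assoc, smul_add,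
      one_smul]
    abel

/-- Composable words in the arrows are lifts of the required kind by `IsHom.cons`, and every product
of generators reduces to such a word or to zero. -/
theorem span_isHom (H : DefData φ Eu w D g) :
    ⊤ ≤ Submodule.span ℂ {x | ∃ a b n u, IsHom φ Eu w D a b n u ∧ toLam u = x} := by
  rintro x -
  induction x using lam_induction with
  | one =>
    rw [← sum_e]
    exact Submodule.sum_mem _ fun a _ => Submodule.subset_span ⟨a, a, 0, fe a, isHom_fe a, rfl⟩
  | add x y hx hy => exact Submodule.add_mem _ hx hy
  | smul c x hx => exact Submodule.smul_mem _ c hx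
  | e_mul c x hx =>
    induction hx using Submodule.span_induction with
    | mem x hx =>
      obtain ⟨a, b, n, u, hu, rfl⟩ := hx
      by_cases hc : c = a
      · rw [hc, hu.left]
        exact Submodule.subset_span ⟨a, b, n, u, hu, rfl⟩
      · rw [← hu.left, ← mul_assoc, e_mul_e_of_ne hc, zero_mul]
        exact Submodule.zero_mem _
    | zero =>
      rw [mul_zero]
      exact Submodule.zero_mem _
    | add x y _ _ hx hy =>
      rw [mul_add]
      exact Submodule.add_mem _ hx hy
    | smul c x _ hx =>
      rw [mul_smul_comm]
      exact Submodule.smul_mem _ _ hx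
  | ar_mul c x hx =>
    induction hx using Submodule.span_induction with
    | mem x hx =>
      obtain ⟨a, b, n, u, hu, rfl⟩ := hx
      by_cases hc : src c = a
      · subst hc
        refine Submodule.subset_span ⟨_, b, _, fa c * u, IsHom.cons H c hu, ?_⟩
        rw [map_mul]
        rfl
      · rw [← hu.left, ← ar_mul_e_src, mul_assoc, ← mul_assoc (e _), e_mul_e_of_ne hc, zero_mul,
          mul_zero]
        exact Submodule.zero_mem _
    | zero =>
      rw [mul_zero]
      exact Submodule.zero_mem _
    | add x y _ _ hx hy =>
      rw [mul_add]
      exact Submodule.add_mem _ hx hy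
    | smul c x _ hx =>
      rw [mul_smul_comm]
      exact Submodule.smul_mem _ _ hx

/-- There is a homogeneous linear section of the projection from the free algebra. -/
theorem exists_section (H : DefData φ Eu w D g) : ∃ s : Lam →ₗ[ℂ] Free,
    (∀ x, toLam (s x) = x) ∧
    (∀ a x, der φ D (s (e a * x)) = φ (e a) * der φ D (s x)) ∧
    (∀ a x, der φ D (s (x * e a)) = der φ D (s x) * φ (e a)) ∧
    ∀ x, Eu * der φ D (s x) - der φ D (s x) * Eu =
      der φ D (s (len x)) + (w : ℂ) • der φ D (s x) := by
  -- The basis is chosen among classes of homogeneous lifts, so the section may be defined by those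
  -- lifts; the four properties then need to be checked on basis elements only.
  let B := Module.Basis.ofSpan H.span_isHom
  have hB : ∀ i, ∃ a b n u, IsHom φ Eu w D a b n u ∧ toLam u = B i := fun i =>
    Module.Basis.ofSpan_subset H.span_isHom ⟨i, rfl⟩
  choose a b n u hu hB using hB
  let s : Lam →ₗ[ℂ] Free := B.constr ℂ u
  have hs : ∀ i, s (B i) = u i := fun i => B.constr_basis ℂ u i
  refine ⟨s, fun x => ?_, fun c x => ?_, fun c x => ?_, fun x => ?_⟩
  · have : toLam.toLinearMap ∘ₗ s = LinearMap.id := B.ext fun i => by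
      rw [LinearMap.comp_apply, hs]
      exact hB i
    exact congrArg (fun t => t x) this
  · have : der φ D ∘ₗ s ∘ₗ LinearMap.mulLeft ℂ (e c) =
        LinearMap.mulLeft ℂ (φ (e c)) ∘ₗ der φ D ∘ₗ s := B.ext fun i => by
      simp only [LinearMap.comp_apply, LinearMap.mulLeft_apply, hs]
      by_cases hc : c = a i
      · rw [hc, (hu i).der_left, ← hB, (hu i).left, hB, hs]
      · rw [← hB, ← (hu i).left, ← mul_assoc, e_mul_e_of_ne hc, ← (hu i).der_left, ← mul_assoc,
          ← map_mul, e_mul_e_of_ne hc]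
        simp
    exact congrArg (fun t => t x) this
  · have : der φ D ∘ₗ s ∘ₗ LinearMap.mulRight ℂ (e c) =
        LinearMap.mulRight ℂ (φ (e c)) ∘ₗ der φ D ∘ₗ s := B.ext fun i => by
      simp only [LinearMap.comp_apply, LinearMap.mulRight_apply, hs]
      by_cases hc : b i = c
      · rw [← hc, (hu i).der_right, ← hB, (hu i).right, hB, hs]
      · rw [← hB, ← (hu i).right, mul_assoc, e_mul_e_of_ne hc, ← (hu i).der_right, mul_assoc,
          ← map_mul, e_mul_e_of_ne hc]
        simp
    exact congrArg (fun t => t x) this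
  · have : LinearMap.mulLeft ℂ Eu ∘ₗ der φ D ∘ₗ s - LinearMap.mulRight ℂ Eu ∘ₗ der φ D ∘ₗ s =
        der φ D ∘ₗ s ∘ₗ len + (w : ℂ) • der φ D ∘ₗ s := B.ext fun i => by
      simp only [LinearMap.comp_apply, LinearMap.mulRight_apply, LinearMap.mulLeft_apply, hs,
        LinearMap.sub_apply, LinearMap.add_apply, LinearMap.smul_apply]
      rw [(hu i).der_len, ← hB, (hu i).len, hB, map_smul, map_smul, hs, add_smul]
    exact congrArg (fun t => t x) this

/-- A deformation of the relations by a cochain on `T_2` is induced by a Hochschild cocycle. -/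
theorem exists_cocycle (H : DefData φ Eu w D g) : ∃ f ∈ Z2 w, evalT2 f - g ∈ MB2 w := by
  obtain ⟨s, hs, hsl, hsr, hslen⟩ := H.exists_section
  set h : Lam →ₗ[ℂ] N := der φ D ∘ₗ s with hh
  have h_apply : ∀ x, der φ D (s x) = h x := fun _ => rfl
  simp only [h_apply] at hsl hsr hslen
  -- The words `s x * s y` and `s (x * y)` have the same class, and the right-hand side is the
  -- difference of their derivatives. Hence it lies in `φ(Λ)`.
  have hF : ∀ x y, ∃ t, φ t = φ x * h y + h x * φ y - h (x * y) := fun x y => by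
    obtain ⟨t, ht⟩ := H.der_sub_mem (u := s x * s y) (v := s (x * y)) (by
      rw [map_mul, hs, hs, hs])
    refine ⟨t, ht.trans ?_⟩
    rw [der_mul, hs, hs]
    rfl
  choose F hF using hF
  have key : ∀ {s t : Lam}, φ s = φ t → s = t := fun h => H.inj h
  let f : Lam →ₗ[ℂ] Lam →ₗ[ℂ] Lam := LinearMap.mk₂ ℂ F
    (fun x x' y => key (by
      simp only [map_add, hF, add_mul]
      abel))
    (fun c x y => key (by
      simp only [map_smul, hF, smul_mul_assoc, smul_sub, smul_add]))
    (fun x y y' => key (by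
      simp only [map_add, hF, mul_add]
      abel))
    (fun c x y => key (by
      simp only [map_smul, hF, mul_smul_comm, smul_sub, smul_add]))
  have hf : ∀ x y, φ (f x y) = φ x * h y + h x * φ y - h (x * y) := hF
  refine ⟨f, ⟨mem_C2_of_len (fun a x y => key ?_) (fun a x y => key ?_) (fun a x y => key ?_)
    (fun x y => key ?_), fun x y z => key ?_⟩, ?_⟩
  · rw [map_mul φ, hf, hf, map_mul φ, hsl, mul_assoc (e a), hsl]
    simp only [mul_add, mul_sub, mul_assoc]
  · rw [hf, hf, map_mul φ, map_mul φ, hsl, hsr, mul_assoc x]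
    simp only [mul_assoc]
  · rw [map_mul φ, hf, hf, map_mul φ, hsr, ← mul_assoc x, hsr]
    simp only [add_mul, sub_mul, mul_assoc]
  -- Weight: `Eu` implements `len` on `φ(Λ)`, and `hslen` says that `h` has weight `w`.
  · have e1 := H.eu_len (f x y)
    have e2 := H.eu_len x
    have e3 := H.eu_len y
    have e4 := hslen x
    have e5 := hslen y
    have e6 := hslen (x * y)
    rw [hf] at e1
    simp only [map_add, map_smul, ← e1, hf, ← e2, ← e3]
    rw [sub_eq_iff_eq_add] at e2 e3 e4 e5 e6
    rw [len_mul, map_add] at e6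
    rw [mul_sub, mul_add, ← mul_assoc, ← mul_assoc, e2, e4, e6]
    simp only [mul_add, add_mul, mul_sub, sub_mul, smul_add, smul_sub, mul_assoc, e3, e5,
      smul_mul_assoc, mul_smul_comm]
    rw [eq_sub_of_add_eq e2.symm, eq_sub_of_add_eq e3.symm]
    simp only [mul_add, mul_sub, sub_mul, mul_assoc, e3]
    abel
  -- Inside `N` the map `f` is the Hochschild coboundary of `h`, so the cocycle identity is `d² =
  -- 0`.
  · simp only [map_add, map_sub, map_mul, hf, map_zero, mul_assoc]
    noncomm_ring
  -- The section need not send an arrow to its generator. The resulting discrepancy between `h` and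
  -- `D` lies in `Λ`, and its coboundary is the difference between `evalT2 f` and `g`.
  · have hk : ∀ x, ∃ t, φ t = h (ar x) - D x := fun x => by
      obtain ⟨t, ht⟩ := H.der_sub_mem (u := s (ar x)) (v := fa x) (hs _)
      refine ⟨t, ht.trans ?_⟩
      rw [der_fa]
      rfl
    choose k hk using hk
    refine ⟨k, fun x => ⟨key ?_, key ?_, (mem_homog_iff _ _).2 (key ?_)⟩, LinearMap.ext fun r =>
      key ?_⟩
    · rw [map_mul, hk, mul_sub, ← hsl, e_tgt_mul_ar, H.at_tgt]
    · rw [map_mul, hk, sub_mul, ← hsr, ar_mul_e_src, H.at_src]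
    · have e1 := hslen (ar x)
      have e2 := H.eu_D x
      rw [len_ar] at e1
      rw [← H.eu_len, hk, mul_sub, sub_mul, map_smul, hk]
      push_cast
      rw [smul_sub, ← e2, add_smul, one_smul, ← e1]
      abel
    · have e1 : h (∑ x, ∑ y, r.1 x y • (ar x * ar y)) = 0 := by
        rw [quad_rel_T2 _ r.2, map_zero]
      have e2 := H.quad r
      rw [LinearMap.sub_apply, map_sub, ← e2, evalT2_apply, wordSum_apply]
      simp only [map_sum, map_smul] at e1
      change φ (∑ x, ∑ y, r.1 x y • (ar x * k y + k x * ar y)) = _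
      simp only [map_sum, map_smul, map_add, map_mul, hk, hf, smul_sub, smul_add,
        Finset.sum_sub_distrib, Finset.sum_add_distrib, e1, mul_sub, sub_mul]
      abel

end DefData

end Extension

/-! ### Representations by matrices -/

section MatRep

variable {B : Type*} [Ring B] [Algebra ℂ B]

/-- The entry of the matrix representing an arrow. -/
def arrowVal (z w : Fin 3 → B) : Arrow → B
  | Sum.inl p => z p.2
  | Sum.inr p => w p.2

/-- The matrix representing an arrow. -/
def arrowMat (z w : Fin 3 → B) (x : Arrow) : Matrix (Fin 3) (Fin 3) B :=
  Matrix.single (tgt x) (src x) (arrowVal z w x)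

/-- Points of the cone `∑ zⁱ wᵢ = 0`. -/
structure ConePoint (z w : Fin 3 → B) : Prop where
  zz : ∀ i j, z i * z j = z j * z i
  ww : ∀ i j, w i * w j = w j * w i
  wz : ∀ i j, w i * z j = z j * w i
  sum : ∑ i, z i * w i = 0

/-- A path goes to a matrix unit times the product of its coordinates. As the coordinates commute,
the four contraction relations all reduce to the one equation of the cone. -/
theorem matData {z w : Fin 3 → B} (H : ConePoint z w) :
    LamData (fun a => Matrix.single a a (1 : B)) (arrowMat z w) where
  orth a b h := Matrix.single_mul_single_of_ne _ _ _ _ h _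
  idem a := by rw [Matrix.single_mul_single_same, one_mul]
  sum_one := by
    rw [← Matrix.diagonal_one]
    exact (Matrix.sum_single_eq_diagonal (fun _ => (1 : B)))
  at_tgt x := by rw [arrowMat, Matrix.single_mul_single_same, one_mul]
  at_src x := by rw [arrowMat, Matrix.single_mul_single_same, mul_one]
  quad r hr := by
    have h1 : ∀ (a b c : Fin 3) (s t : B),
      Matrix.single a b s * Matrix.single b c t = Matrix.single a c (s * t) := fun a b c s t =>
        Matrix.single_mul_single_same _ _ _ _ _
    have h2 : ∀ (a b : Fin 3), ∑ i, Matrix.single a b (z i * w i) = 0 := fun a b => by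
      rw [← Matrix.single_zero a b, ← H.sum]
      exact (map_sum (Matrix.singleAddMonoidHom (α := B) a b) _ _).symm
    refine wordSum_eq_zero _ (fun i j => ?_) (fun i j => ?_) (fun i j => ?_) ?_ ?_ ?_ ?_ r hr
    · change Matrix.single _ 1 (z i) * Matrix.single 1 _ (z j) =
        Matrix.single _ 1 (z j) * Matrix.single 1 _ (z i)
      rw [h1, h1, H.zz]
      rfl
    · change Matrix.single _ 1 (w i) * Matrix.single 1 _ (w j) =
        Matrix.single _ 1 (w j) * Matrix.single 1 _ (w i)
      rw [h1, h1, H.ww]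
      rfl
    · change Matrix.single 1 2 (w i) * Matrix.single 2 1 (z j) =
        Matrix.single 1 0 (z j) * Matrix.single 0 1 (w i)
      rw [h1, h1, H.wz]
    · change ∑ i, Matrix.single 1 0 (z i) * Matrix.single 0 1 (w i) = 0
      simpa only [h1] using h2 _ _
    · change ∑ i, Matrix.single 1 2 (w i) * Matrix.single 2 1 (z i) = 0
      simpa only [h1, H.wz] using h2 _ _
    · change ∑ i, Matrix.single 2 1 (z i) * Matrix.single 1 2 (w i) = 0
      simpa only [h1] using h2 _ _
    · change ∑ i, Matrix.single 0 1 (w i) * Matrix.single 1 0 (z i) = 0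
      simpa only [h1, H.wz] using h2 _ _

/-- The representation of `Λ` at a point of the cone. -/
def matRep {z w : Fin 3 → B} (H : ConePoint z w) : Lam →ₐ[ℂ] Matrix (Fin 3) (Fin 3) B :=
  lamLift (matData H)

theorem matRep_e {z w : Fin 3 → B} (H : ConePoint z w) (a : Fin 3) :
    matRep H (e a) = Matrix.single a a 1 := lamLift_e _ a

theorem matRep_ar {z w : Fin 3 → B} (H : ConePoint z w) (x : Arrow) :
    matRep H (ar x) = arrowMat z w x := lamLift_ar _ x

end MatRep

/-! ### Monomials in the quiver algebra -/

/-- The path with target `a` composed of arrows `z` and `w` with given indices; it is zero if there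
is no such path. -/
def psi : Fin 3 → List (Fin 3) → List (Fin 3) → Lam
  | 0, s, i :: t => ar (w01 i) * psi 1 s t
  | 0, [], [] => e 0
  | 0, _ :: _, [] => 0
  | 1, s, i :: t => ar (w12 i) * psi 2 s t
  | 1, j :: s, [] => ar (z10 j) * psi 0 s []
  | 1, [], [] => e 1
  | 2, j :: s, t => ar (z21 j) * psi 1 s t
  | 2, [], [] => e 2
  | 2, [], _ :: _ => 0
termination_by _ s t => s.length + t.length

theorem psi_z21 (j : Fin 3) (s t : List (Fin 3)) :
    psi 2 (j :: s) t = ar (z21 j) * psi 1 s t := by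
  rw [psi]

/-- At node `1` the recursion removes a `w` first; by `rel_wz` a `z` may be removed instead. -/
theorem psi_z10 (j : Fin 3) (s t : List (Fin 3)) :
    psi 1 (j :: s) t = ar (z10 j) * psi 0 s t := by
  cases t with
  | nil => rw [psi]
  | cons i t =>
    rw [psi, psi, psi, ← mul_assoc, ← mul_assoc, rel_wz]

theorem psi_swap_w (i k : Fin 3) (a : Fin 3) (s t : List (Fin 3)) :
    psi a s (i :: k :: t) = psi a s (k :: i :: t) := by
  have h0 : ∀ s t, psi 0 s (i :: k :: t) = psi 0 s (k :: i :: t) := fun s t => by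
    rw [psi, psi, psi, psi, ← mul_assoc, ← mul_assoc, rel_ww]
  have h1 : ∀ s t, psi 1 s (i :: k :: t) = psi 1 s (k :: i :: t) := fun s t => by
    cases s with
    | nil => rw [psi, psi, psi, psi, mul_zero, mul_zero]
    | cons j s => rw [psi_z10, psi_z10, h0]
  fin_cases a
  · exact h0 s t
  · exact h1 s t
  · cases s with
    | nil =>
      change psi 2 [] _ = psi 2 [] _
      rw [psi, psi]
    | cons j s =>
      change psi 2 (j :: s) _ = psi 2 (j :: s) _
      rw [psi_z21, psi_z21, h1]

theorem psi_swap_z (j l : Fin 3) (a : Fin 3) (s t : List (Fin 3)) :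
    psi a (j :: l :: s) t = psi a (l :: j :: s) t := by
  have h2 : ∀ s t, psi 2 (j :: l :: s) t = psi 2 (l :: j :: s) t := fun s t => by
    rw [psi, psi, psi_z10, psi_z10, ← mul_assoc, ← mul_assoc, rel_zz]
  have h1 : ∀ s t, psi 1 (j :: l :: s) t = psi 1 (l :: j :: s) t := fun s t => by
    cases t with
    | nil => rw [psi, psi, psi, psi, mul_zero, mul_zero]
    | cons i t => rw [psi, psi, h2]
  fin_cases a
  · cases t with
    | nil =>
      change psi 0 _ [] = psi 0 _ []
      rw [psi, psi]
    | cons i t =>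
      change psi 0 _ (i :: t) = psi 0 _ (i :: t)
      rw [psi, psi, h1]
  · exact h1 s t
  · exact h2 s t

/-- Together with `psi_perm_z`: a path depends only on its target and on the commutative monomial of
its indices. -/
theorem psi_perm_w {t t' : List (Fin 3)} (h : t.Perm t') (a : Fin 3) (s : List (Fin 3)) :
    psi a s t = psi a s t' := by
  induction h generalizing a s with
  | nil => rfl
  | cons i h ih =>
    fin_cases a
    · change psi 0 _ _ = psi 0 _ _
      rw [psi, psi, ih]
    · change psi 1 _ _ = psi 1 _ _
      rw [psi, psi, ih]
    · change psi 2 _ _ = psi 2 _ _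
      cases s with
      | nil => rw [psi, psi]
      | cons j s => rw [psi, psi, psi, psi, ih]
  | swap i k t => exact psi_swap_w k i a s t
  | trans _ _ ih1 ih2 => rw [ih1, ih2]

theorem psi_perm_z {s s' : List (Fin 3)} (h : s.Perm s') (a : Fin 3) (t : List (Fin 3)) :
    psi a s t = psi a s' t := by
  induction h generalizing a t with
  | nil => rfl
  | cons j h ih =>
    fin_cases a
    · change psi 0 _ _ = psi 0 _ _
      cases t with
      | nil => rw [psi, psi]
      | cons i t => rw [psi, psi, psi_z10, psi_z10, ih]
    · change psi 1 _ _ = psi 1 _ _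
      rw [psi_z10, psi_z10, ih]
    · change psi 2 _ _ = psi 2 _ _
      rw [psi, psi, ih]
  | swap i k t => exact psi_swap_z k i a _ _
  | trans _ _ ih1 ih2 => rw [ih1, ih2]

theorem e_mul_psi (a : Fin 3) (s t : List (Fin 3)) : e a * psi a s t = psi a s t := by
  have h : ∀ x y, e (tgt x) * (ar x * y) = ar x * y := fun x y => by
    rw [← mul_assoc, e_tgt_mul_ar]
  fin_cases a
  · change e 0 * psi 0 s t = psi 0 s t
    rcases s with _ | ⟨j, s⟩ <;> rcases t with _ | ⟨i, t⟩ <;> rw [psi]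
    · exact e_mul_self 0
    · exact h (w01 i) _
    · exact mul_zero _
    · exact h (w01 i) _
  · change e 1 * psi 1 s t = psi 1 s t
    rcases s with _ | ⟨j, s⟩ <;> rcases t with _ | ⟨i, t⟩ <;> rw [psi]
    · exact e_mul_self 1
    · exact h (w12 i) _
    · exact h (z10 j) _
    · exact h (w12 i) _
  · change e 2 * psi 2 s t = psi 2 s t
    rcases s with _ | ⟨j, s⟩ <;> rcases t with _ | ⟨i, t⟩ <;> rw [psi]
    · exact e_mul_self 2
    · exact mul_zero _
    · exact h (z21 j) _
    · exact h (z21 j) _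

/-! ### Paths as polynomials modulo the equation of the cone. -/

/-- The polynomial ring in the variables `zⁱ` and `wᵢ`. -/
abbrev ZW : Type := MvPolynomial (Fin 3 ⊕ Fin 3) ℂ

/-- The list of the factors `zⁱ` of a monomial. -/
def zList (d : Fin 3 ⊕ Fin 3 →₀ ℕ) : List (Fin 3) :=
  (∑ j, d (Sum.inl j) • ({j} : Multiset (Fin 3))).toList

/-- The list of the factors `wᵢ` of a monomial. -/
def wList (d : Fin 3 ⊕ Fin 3 →₀ ℕ) : List (Fin 3) :=
  (∑ j, d (Sum.inr j) • ({j} : Multiset (Fin 3))).toList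

theorem zList_z (d : Fin 3 ⊕ Fin 3 →₀ ℕ) (i : Fin 3) :
    (zList (Finsupp.single (Sum.inl i) 1 + d)).Perm (i :: zList d) := by
  rw [← Multiset.coe_eq_coe, ← Multiset.cons_coe, zList, zList, Multiset.coe_toList,
    Multiset.coe_toList]
  simp [add_smul, Finset.sum_add_distrib, Finsupp.single_apply, ite_smul]

theorem wList_w (d : Fin 3 ⊕ Fin 3 →₀ ℕ) (i : Fin 3) :
    (wList (Finsupp.single (Sum.inr i) 1 + d)).Perm (i :: wList d) := by
  rw [← Multiset.coe_eq_coe, ← Multiset.cons_coe, wList, wList, Multiset.coe_toList,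
    Multiset.coe_toList]
  simp [add_smul, Finset.sum_add_distrib, Finsupp.single_apply, ite_smul]

theorem zList_w (d : Fin 3 ⊕ Fin 3 →₀ ℕ) (i : Fin 3) :
    zList (Finsupp.single (Sum.inr i) 1 + d) = zList d := by
  simp [zList]

theorem wList_z (d : Fin 3 ⊕ Fin 3 →₀ ℕ) (i : Fin 3) :
    wList (Finsupp.single (Sum.inl i) 1 + d) = wList d := by
  simp [wList]

/-- The linear map which sends a monomial to the corresponding path with target `a`. -/
def psiLin (a : Fin 3) : ZW →ₗ[ℂ] Lam :=
  (MvPolynomial.basisMonomials (Fin 3 ⊕ Fin 3) ℂ).constr ℂ fun d => psi a (zList d) (wList d)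

theorem psiLin_monomial (a : Fin 3) (d : Fin 3 ⊕ Fin 3 →₀ ℕ) :
    psiLin a (MvPolynomial.monomial d 1) = psi a (zList d) (wList d) := by
  have := (MvPolynomial.basisMonomials (Fin 3 ⊕ Fin 3) ℂ).constr_basis ℂ
    (fun d => psi a (zList d) (wList d)) d
  rwa [MvPolynomial.coe_basisMonomials] at this

/-- The variable of the polynomial ring which corresponds to an arrow. -/
def arrowVar : Arrow → Fin 3 ⊕ Fin 3
  | Sum.inl p => Sum.inl p.2
  | Sum.inr p => Sum.inr p.2

/-- Multiplying a monomial by the variable of an arrow prepends that arrow to the path; `psi_perm_z`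
and `psi_perm_w` absorb the reordering of the lists. -/
theorem psiLin_X_mul (x : Arrow) (p : ZW) :
    psiLin (tgt x) (MvPolynomial.X (arrowVar x) * p) = ar x * psiLin (src x) p := by
  have : psiLin (tgt x) ∘ₗ LinearMap.mulLeft ℂ (MvPolynomial.X (arrowVar x)) =
      LinearMap.mulLeft ℂ (ar x) ∘ₗ psiLin (src x) := by
    refine (MvPolynomial.basisMonomials (Fin 3 ⊕ Fin 3) ℂ).ext fun d => ?_
    simp only [LinearMap.comp_apply, LinearMap.mulLeft_apply, MvPolynomial.coe_basisMonomials,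
      psiLin_monomial, MvPolynomial.X, MvPolynomial.monomial_mul, one_mul]
    rcases x with ⟨a, i⟩ | ⟨a, i⟩
    · change psi a.succ (zList (Finsupp.single (Sum.inl i) 1 + d))
        (wList (Finsupp.single (Sum.inl i) 1 + d)) = _
      rw [wList_z, psi_perm_z (zList_z d i)]
      fin_cases a
      · exact psi_z10 _ _ _
      · change psi 2 _ _ = ar (z21 i) * psi 1 _ _
        rw [psi]
    · change psi a.castSucc (zList (Finsupp.single (Sum.inr i) 1 + d))
        (wList (Finsupp.single (Sum.inr i) 1 + d)) = _
      rw [zList_w, psi_perm_w (wList_w d i)]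
      fin_cases a
      · change psi 0 _ _ = ar (w01 i) * psi 1 _ _
        rw [psi]
      · change psi 1 _ _ = ar (w12 i) * psi 2 _ _
        rw [psi]
  exact congrArg (fun t => t p) this

theorem e_mul_psiLin (a b : Fin 3) (p : ZW) :
    e a * psiLin b p = if a = b then psiLin b p else 0 := by
  have h : e b * psiLin b p = psiLin b p := by
    have : LinearMap.mulLeft ℂ (e b) ∘ₗ psiLin b = psiLin b := by
      refine (MvPolynomial.basisMonomials (Fin 3 ⊕ Fin 3) ℂ).ext fun d => ?_
      simp only [LinearMap.comp_apply, LinearMap.mulLeft_apply, MvPolynomial.coe_basisMonomials,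
        psiLin_monomial, e_mul_psi]
    exact congrArg (fun t => t p) this
  split_ifs with hab
  · rw [hab, h]
  · rw [← h, ← mul_assoc, e_mul_e_of_ne hab, zero_mul]

theorem psiLin_one (a : Fin 3) : psiLin a 1 = e a := by
  rw [← MvPolynomial.C_1, ← MvPolynomial.monomial_zero', psiLin_monomial]
  have h1 : zList 0 = [] := by simp [zList]
  have h2 : wList 0 = [] := by simp [wList]
  rw [h1, h2]
  fin_cases a
  · change psi 0 [] [] = _
    rw [psi]
    rfl
  · change psi 1 [] [] = _
    rw [psi]
    rfl
  · change psi 2 [] [] = _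
    rw [psi]
    rfl

/-- The equation of the cone. -/
def coneEq : ZW := ∑ i, MvPolynomial.X (Sum.inl i) * MvPolynomial.X (Sum.inr i)

/-- At every node the equation of the cone prepends a contraction relation to the path. -/
theorem psiLin_coneEq_mul (a : Fin 3) (p : ZW) : psiLin a (coneEq * p) = 0 := by
  have h : ∀ x y : Arrow, src x = tgt y → psiLin (tgt x)
      (MvPolynomial.X (arrowVar x) * MvPolynomial.X (arrowVar y) * p) =
      ar x * ar y * psiLin (src y) p := fun x y hxy => by
    rw [mul_assoc, psiLin_X_mul, hxy, psiLin_X_mul, mul_assoc]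
  rw [coneEq, Finset.sum_mul, map_sum]
  fin_cases a
  · refine Eq.trans (Finset.sum_congr rfl fun i _ => ?_) ((Finset.sum_mul _ _ _).symm.trans
      ((congrArg (· * psiLin 0 p) rel_wz00).trans (zero_mul _)))
    rw [mul_comm (MvPolynomial.X _)]
    exact h (w01 i) (z10 i) rfl
  · refine Eq.trans (Finset.sum_congr rfl fun i _ => ?_) ((Finset.sum_mul _ _ _).symm.trans
      ((congrArg (· * psiLin 1 p) rel_zw11).trans (zero_mul _)))
    exact h (z10 i) (w01 i) rfl
  · refine Eq.trans (Finset.sum_congr rfl fun i _ => ?_) ((Finset.sum_mul _ _ _).symm.trans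
      ((congrArg (· * psiLin 2 p) rel_zw22).trans (zero_mul _)))
    exact h (z21 i) (w12 i) rfl

/-- The matrices over the polynomial ring representing the generators of the free algebra. -/
def polyRep : Free →ₐ[ℂ] Matrix (Fin 3) (Fin 3) ZW :=
  freeLift (fun a => Matrix.single a a 1) fun x =>
    Matrix.single (tgt x) (src x) (MvPolynomial.X (arrowVar x))

theorem polyRep_fe (a : Fin 3) : polyRep (fe a) = Matrix.single a a 1 := freeLift_fe _ _ a

theorem polyRep_fa (x : Arrow) :
    polyRep (fa x) = Matrix.single (tgt x) (src x) (MvPolynomial.X (arrowVar x)) :=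
  freeLift_fa _ _ x

/-- For `M = 1` this recovers `toLam u * e b` from column `b` of the polynomial matrix of `u`. A
general `M` is needed to pass through products. -/
theorem psiLin_polyRep (u : Free) (M : Matrix (Fin 3) (Fin 3) ZW) (b : Fin 3) :
    ∑ a, psiLin a ((polyRep u * M) a b) = toLam u * ∑ a, psiLin a (M a b) := by
  have hs : ∀ (M : Matrix (Fin 3) (Fin 3) ZW) (i j a : Fin 3) (t : ZW),
      (Matrix.single i j t * M) a b = if i = a then t * M j b else 0 := fun M i j a t => by
    split_ifs with h
    · rw [h, Matrix.single_mul_apply_same]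
    · rw [Matrix.single_mul_apply_of_ne _ _ _ _ _ (Ne.symm h)]
  induction u using FreeAlgebra.induction generalizing M with
  | grade0 c =>
    rw [AlgHom.commutes, AlgHom.commutes, Algebra.algebraMap_eq_smul_one,
      Algebra.algebraMap_eq_smul_one, smul_mul_assoc, smul_mul_assoc, one_mul, one_mul,
      Finset.smul_sum]
    exact Finset.sum_congr rfl fun a _ => map_smul (psiLin a) c _
  | grade1 t =>
    rcases t with c | x
    · change ∑ a, psiLin a ((polyRep (fe c) * M) a b) = e c * _
      simp only [polyRep_fe, hs, Finset.mul_sum, e_mul_psiLin, one_mul]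
      refine Finset.sum_congr rfl fun a _ => ?_
      split_ifs with h
      · rw [h]
      · exact map_zero _
    · change ∑ a, psiLin a ((polyRep (fa x) * M) a b) = ar x * _
      simp only [polyRep_fa, hs]
      rw [← ar_mul_e_src, mul_assoc, Finset.mul_sum]
      simp only [e_mul_psiLin, Finset.sum_ite_eq, Finset.mem_univ, if_true]
      rw [Finset.sum_eq_single (tgt x)]
      · rw [if_pos rfl, psiLin_X_mul]
      · intro a _ h
        rw [if_neg (Ne.symm h), map_zero]
      · simp
  | mul u v hu hv => rw [map_mul, map_mul, mul_assoc, hu, hv, mul_assoc]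
  | add u v hu hv =>
    rw [map_add, map_add, add_mul, add_mul, ← hu, ← hv, ← Finset.sum_add_distrib]
    exact Finset.sum_congr rfl fun a _ => map_add (psiLin a) _ _

theorem toLam_eq_zero_of_polyRep (u : Free) (h : ∀ a b, coneEq ∣ polyRep u a b) :
    toLam u = 0 := by
  have h1 : ∀ b, toLam u * e b = 0 := fun b => by
    have h2 := psiLin_polyRep u 1 b
    rw [mul_one, Finset.sum_eq_zero, Finset.sum_eq_single b] at h2
    · rw [Matrix.one_apply_eq, psiLin_one] at h2
      exact h2.symm
    · intro a _ hab
      rw [Matrix.one_apply_ne hab, map_zero]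
    · simp
    · intro a _
      obtain ⟨p, hp⟩ := h a b
      rw [hp, psiLin_coneEq_mul]
  rw [← mul_one (toLam u), ← sum_e, Finset.mul_sum, Finset.sum_eq_zero fun b _ => h1 b]

/-! ### An affine chart of the cone -/

/-- The field of fractions of the polynomial ring. -/
abbrev FracZW : Type := FractionRing ZW

/-- The coordinates `zⁱ` in the field of fractions. -/
def fracZ (i : Fin 3) : FracZW := algebraMap ZW FracZW (MvPolynomial.X (Sum.inl i))

/-- The coordinates `wᵢ`, where `w₀` is determined by the equation of the cone. -/
def fracW : Fin 3 → FracZW :=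
  ![-(fracZ 1 * algebraMap ZW FracZW (MvPolynomial.X (Sum.inr 1)) +
      fracZ 2 * algebraMap ZW FracZW (MvPolynomial.X (Sum.inr 2))) / fracZ 0,
    algebraMap ZW FracZW (MvPolynomial.X (Sum.inr 1)),
    algebraMap ZW FracZW (MvPolynomial.X (Sum.inr 2))]

theorem fracZ_ne_zero (i : Fin 3) : fracZ i ≠ 0 := by
  rw [fracZ, Ne, IsFractionRing.to_map_eq_zero_iff]
  exact MvPolynomial.X_ne_zero _

theorem fracZ_mul_fracW : fracZ 0 * fracW 0 = -(fracZ 1 * fracW 1 + fracZ 2 * fracW 2) := by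
  change fracZ 0 * (-(fracZ 1 * fracW 1 + fracZ 2 * fracW 2) / fracZ 0) = _
  rw [mul_div_cancel₀ _ (fracZ_ne_zero 0)]

theorem frac_conePoint : ConePoint fracZ fracW where
  zz _ _ := mul_comm _ _
  ww _ _ := mul_comm _ _
  wz _ _ := mul_comm _ _
  sum := by
    rw [Fin.sum_univ_three, fracZ_mul_fracW]
    ring

/-- The generic point of the cone. -/
def genPoint : ZW →ₐ[ℂ] FracZW := MvPolynomial.aeval (Sum.elim fracZ fracW)

theorem genPoint_X (t : Fin 3 ⊕ Fin 3) :
    genPoint (MvPolynomial.X t) = Sum.elim fracZ fracW t := MvPolynomial.aeval_X _ _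

theorem genPoint_coneEq : genPoint coneEq = 0 := by
  rw [coneEq, map_sum]
  simp only [map_mul, genPoint_X, Sum.elim_inl, Sum.elim_inr]
  exact frac_conePoint.sum

/-- Elimination of the variable `w₀`. -/
theorem exists_elimination (F : ZW) : ∃ (n : ℕ) (G : ZW),
    genPoint G = algebraMap ZW FracZW G ∧
      coneEq ∣ MvPolynomial.X (Sum.inl 0) ^ n * F - G := by
  have hz : ∀ i, genPoint (MvPolynomial.X (Sum.inl i)) =
      algebraMap ZW FracZW (MvPolynomial.X (Sum.inl i)) := fun i => genPoint_X _
  have hw1 : genPoint (MvPolynomial.X (Sum.inr 1)) =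
      algebraMap ZW FracZW (MvPolynomial.X (Sum.inr 1)) := genPoint_X _
  have hw2 : genPoint (MvPolynomial.X (Sum.inr 2)) =
      algebraMap ZW FracZW (MvPolynomial.X (Sum.inr 2)) := genPoint_X _
  induction F using MvPolynomial.induction_on with
  | C a =>
    refine ⟨0, MvPolynomial.C a, ?_, by simp⟩
    rw [← MvPolynomial.algebraMap_eq, AlgHom.commutes, ← IsScalarTower.algebraMap_apply]
  | add p q hp hq =>
    obtain ⟨m, G, hG, P, hP⟩ := hp
    obtain ⟨n, H, hH, Q, hQ⟩ := hq
    refine ⟨m + n, MvPolynomial.X (Sum.inl 0) ^ n * G + MvPolynomial.X (Sum.inl 0) ^ m * H, ?_,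
      MvPolynomial.X (Sum.inl 0) ^ n * P + MvPolynomial.X (Sum.inl 0) ^ m * Q, ?_⟩
    · simp only [map_add, map_mul, map_pow, hz, hG, hH]
    · linear_combination MvPolynomial.X (Sum.inl 0) ^ n * hP + MvPolynomial.X (Sum.inl 0) ^ m * hQ
  | mul_X p t hp =>
    obtain ⟨n, G, hG, P, hP⟩ := hp
    have ok : ∀ t, genPoint (MvPolynomial.X t) = algebraMap ZW FracZW (MvPolynomial.X t) →
        ∃ (n : ℕ) (G : ZW), genPoint G = algebraMap ZW FracZW G ∧
          coneEq ∣ MvPolynomial.X (Sum.inl 0) ^ n * (p * MvPolynomial.X t) - G := fun t ht =>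
      ⟨n, G * MvPolynomial.X t, by rw [map_mul, map_mul, hG, ht], P * MvPolynomial.X t, by
        linear_combination MvPolynomial.X t * hP⟩
    rcases t with i | i
    · exact ok _ (hz i)
    · fin_cases i
      -- Modulo `coneEq`, `z⁰ w₀` is `-(z¹ w₁ + z² w₂)`; each occurrence of `w₀` costs one factor
      -- `z⁰`.
      · refine ⟨n + 1, -G * (MvPolynomial.X (Sum.inl 1) * MvPolynomial.X (Sum.inr 1) +
          MvPolynomial.X (Sum.inl 2) * MvPolynomial.X (Sum.inr 2)), ?_,
          MvPolynomial.X (Sum.inl 0) * MvPolynomial.X (Sum.inr 0) * P + G, ?_⟩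
        · simp only [map_mul, map_add, map_neg, hz, hw1, hw2, hG]
        · change MvPolynomial.X (Sum.inl 0) ^ (n + 1) * (p * MvPolynomial.X (Sum.inr 0)) - _ = _
          have : coneEq = MvPolynomial.X (Sum.inl 0) * MvPolynomial.X (Sum.inr 0) +
            MvPolynomial.X (Sum.inl 1) * MvPolynomial.X (Sum.inr 1) +
            MvPolynomial.X (Sum.inl 2) * MvPolynomial.X (Sum.inr 2) := Fin.sum_univ_three _
          linear_combination MvPolynomial.X (Sum.inl 0) * MvPolynomial.X (Sum.inr 0) * hP - G * this
      · exact ok _ hw1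
      · exact ok _ hw2

theorem not_X_dvd_coneEq : ¬ (MvPolynomial.X (Sum.inl 0) : ZW) ∣ coneEq := by
  rintro ⟨p, hp⟩
  -- At this point `z⁰` vanishes while `coneEq` is `1`.
  have h := congrArg (MvPolynomial.eval (Sum.elim ![0, 1, 0] ![0, 1, 0])) hp
  simp [coneEq, Fin.sum_univ_three] at h

/-- After elimination of `w₀` the generic point acts on `G` as the inclusion into the fraction
field, so `G = 0` and `coneEq` divides a power of `z⁰` times `F`. That power can be cancelled, since
`z⁰` is prime and does not divide `coneEq`. -/
theorem coneEq_dvd_of_genPoint (F : ZW) (h : genPoint F = 0) : coneEq ∣ F := by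
  obtain ⟨n, G, hG, hF⟩ := exists_elimination F
  have h1 : genPoint G = 0 := by
    obtain ⟨P, hP⟩ := hF
    have := congrArg genPoint hP
    rwa [map_sub, map_mul, map_mul, h, genPoint_coneEq, mul_zero, zero_mul, zero_sub,
      neg_eq_zero] at this
  rw [hG, IsFractionRing.to_map_eq_zero_iff] at h1
  rw [h1, sub_zero] at hF
  clear h hG h1
  induction n with
  | zero => simpa using hF
  | succ n ih =>
    apply ih
    obtain ⟨P, hP⟩ := hF
    have hX : Prime (MvPolynomial.X (Sum.inl 0) : ZW) := MvPolynomial.X_prime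
    have h2 : (MvPolynomial.X (Sum.inl 0) : ZW) ∣ coneEq * P := ⟨_, by
      rw [← hP, pow_succ']
      exact mul_assoc _ _ _⟩
    rcases hX.dvd_or_dvd h2 with h3 | ⟨R, rfl⟩
    · exact absurd h3 not_X_dvd_coneEq
    · refine ⟨R, mul_left_cancel₀ hX.ne_zero ?_⟩
      rw [← mul_assoc, ← pow_succ', hP]
      ring

/-- The coordinate ring of the affine chart `z⁰ = 1` of the cotangent bundle, with coordinates
`x = z¹`, `y = z²`, `p = w₁`, `q = w₂`. -/
abbrev Chart : Type := MvPolynomial (Fin 4) ℂ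

/-- The functions `zⁱ` on the chart. -/
def chartZ : Fin 3 → Chart := ![1, MvPolynomial.X 0, MvPolynomial.X 1]

/-- The functions `wᵢ` on the chart. -/
def chartW : Fin 3 → Chart :=
  ![-(MvPolynomial.X 0 * MvPolynomial.X 2 + MvPolynomial.X 1 * MvPolynomial.X 3),
    MvPolynomial.X 2, MvPolynomial.X 3]

theorem chart_conePoint : ConePoint chartZ chartW where
  zz _ _ := mul_comm _ _
  ww _ _ := mul_comm _ _
  wz _ _ := mul_comm _ _
  sum := by
    rw [Fin.sum_univ_three]
    simp [chartZ, chartW]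

/-- The map from functions on the chart to rational functions. -/
def chartFrac : Chart →ₐ[ℂ] FracZW :=
  MvPolynomial.aeval ![fracZ 1 / fracZ 0, fracZ 2 / fracZ 0, fracZ 0 * fracW 1, fracZ 0 * fracW 2]

/-- The chart sees the functions `zⁱ / z⁰` and, by `chartFrac_W`, `z⁰ wᵢ`. The missing powers of
`z⁰` are supplied by a rescaling at each node. -/
theorem chartFrac_Z (i : Fin 3) : fracZ 0 * chartFrac (chartZ i) = fracZ i := by
  have h0 := fracZ_ne_zero 0
  fin_cases i
  · simp [chartZ]
  · simp [chartZ, chartFrac, mul_div_cancel₀, h0]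
  · simp [chartZ, chartFrac, mul_div_cancel₀, h0]

theorem chartFrac_W (i : Fin 3) : chartFrac (chartW i) = fracZ 0 * fracW i := by
  have h0 := fracZ_ne_zero 0
  fin_cases i
  · change _ = fracZ 0 * fracW 0
    rw [fracZ_mul_fracW]
    simp [chartW, chartFrac]
    field_simp
  · simp [chartW, chartFrac]
  · simp [chartW, chartFrac]

theorem single_mul_diagonal {K : Type*} [CommRing K] (i j : Fin 3) (s : K) (d : Fin 3 → K) :
    Matrix.single i j s * Matrix.diagonal d = Matrix.single i j (s * d j) := by
  ext a b
  rw [Matrix.mul_diagonal, Matrix.single_apply, Matrix.single_apply]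
  by_cases h : i = a ∧ j = b
  · rw [if_pos h, if_pos h, h.2]
  · rw [if_neg h, if_neg h, zero_mul]

theorem diagonal_mul_single {K : Type*} [CommRing K] (i j : Fin 3) (s : K) (d : Fin 3 → K) :
    Matrix.diagonal d * Matrix.single i j s = Matrix.single i j (d i * s) := by
  ext a b
  rw [Matrix.diagonal_mul, Matrix.single_apply, Matrix.single_apply]
  by_cases h : i = a ∧ j = b
  · rw [if_pos h, if_pos h, h.1]
  · rw [if_neg h, if_neg h, mul_zero]

/-- The representation of `Λ` on the generic point is conjugate to the one on the chart. -/
theorem matRep_conj (x : Lam) :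
    matRep frac_conePoint x * Matrix.diagonal (fun a : Fin 3 => fracZ 0 ^ (a : ℕ)) =
      Matrix.diagonal (fun a : Fin 3 => fracZ 0 ^ (a : ℕ)) *
        (matRep chart_conePoint x).map chartFrac := by
  induction x using lam_induction with
  | one => simp
  | add x y hx hy =>
    rw [map_add, map_add, add_mul, hx, hy, Matrix.map_add _ (map_add chartFrac), mul_add]
  | smul c x hx =>
    rw [map_smul, map_smul, smul_mul_assoc, hx, Matrix.map_smul _ _ (map_smul chartFrac c),
      mul_smul_comm]
  | e_mul a x hx =>
    rw [map_mul, map_mul, mul_assoc, hx, Matrix.map_mul, ← mul_assoc, ← mul_assoc, matRep_e,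
      matRep_e]
    congr 1
    rw [Matrix.map_single, map_one, single_mul_diagonal, diagonal_mul_single, one_mul, mul_one]
  | ar_mul a x hx =>
    rw [map_mul, map_mul, mul_assoc, hx, Matrix.map_mul, ← mul_assoc, ← mul_assoc, matRep_ar,
      matRep_ar]
    congr 1
    rw [arrowMat, arrowMat, Matrix.map_single, single_mul_diagonal, diagonal_mul_single]
    congr 1
    rcases a with ⟨a, i⟩ | ⟨a, i⟩
    · change fracZ i * fracZ 0 ^ (a.castSucc : ℕ) =
        fracZ 0 ^ (a.succ : ℕ) * chartFrac (chartZ i)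
      rw [Fin.val_succ, pow_succ, mul_assoc, chartFrac_Z, mul_comm]
      rfl
    · change fracW i * fracZ 0 ^ (a.succ : ℕ) =
        fracZ 0 ^ (a.castSucc : ℕ) * chartFrac (chartW i)
      rw [Fin.val_succ, chartFrac_W, pow_succ]
      change _ = fracZ 0 ^ (a : ℕ) * _
      ring

/-- An element killed on the chart is killed at the generic point, because the two representations
are conjugate. The entries of its polynomial matrix are then divisible by `coneEq`, and such an
element is zero. -/
theorem matRep_chart_injective : Function.Injective (matRep chart_conePoint) := by
  rw [injective_iff_map_eq_zero]
  intro x hx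
  have h1 := matRep_conj x
  rw [hx] at h1
  have h2 : matRep frac_conePoint x = 0 := by
    ext a b
    have := congrArg (fun M => M a b) h1
    simpa [Matrix.mul_diagonal, fracZ_ne_zero] using this
  obtain ⟨u, rfl⟩ := toLam_surjective x
  refine toLam_eq_zero_of_polyRep u fun a b => coneEq_dvd_of_genPoint _ ?_
  have h3 : (AlgHom.mapMatrix genPoint).comp polyRep = (matRep frac_conePoint).comp toLam := by
    refine FreeAlgebra.hom_ext (funext fun t => ?_)
    rcases t with a | x
    · change (polyRep (fe a)).map genPoint = matRep frac_conePoint (e a)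
      rw [polyRep_fe, matRep_e, Matrix.map_single, map_one]
    · change (polyRep (fa x)).map genPoint = matRep frac_conePoint (ar x)
      rw [polyRep_fa, matRep_ar, Matrix.map_single, genPoint_X]
      rcases x with x | x <;> rfl
  have h4 := congrArg (fun f => f u a b) h3
  exact h4.trans (congrArg (fun M => M a b) h2)

/-- The representation of `Λ` by matrices of operators on the chart. -/
def opRep : Lam →ₐ[ℂ] Matrix (Fin 3) (Fin 3) (Module.End ℂ Chart) :=
  (AlgHom.mapMatrix (Algebra.lmul ℂ Chart)).comp (matRep chart_conePoint)

theorem opRep_injective : Function.Injective opRep := by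
  rw [injective_iff_map_eq_zero]
  intro x hx
  refine (injective_iff_map_eq_zero _).1 matRep_chart_injective x (Matrix.ext fun a b => ?_)
  have := congrArg (fun M => M a b) hx
  exact (injective_iff_map_eq_zero _).1 (Algebra.lmul_injective (R := ℂ) (A := Chart)) _ this

theorem opRep_e (a : Fin 3) : opRep (e a) = Matrix.single a a 1 := by
  rw [opRep, AlgHom.comp_apply, matRep_e]
  change (Matrix.single a a 1).map _ = _
  rw [Matrix.map_single, map_one]

theorem opRep_ar (x : Arrow) : opRep (ar x) = Matrix.single (tgt x) (src x)
    (Algebra.lmul ℂ Chart (arrowVal chartZ chartW x)) := by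
  rw [opRep, AlgHom.comp_apply, matRep_ar]
  change (Matrix.single _ _ _).map _ = _
  rw [Matrix.map_single]

/-! ### Cochains on `T_2` given by tables of values -/

/-- `e_1 (w_i z^j - z^j w_i) e_1` in `T_2`. -/
def wzT (i j : Fin 3) : T2 := ⟨wzRel i j, mem_T2 (Or.inr (Or.inr (Or.inl ⟨i, j, rfl⟩)))⟩

theorem tfT_eq (i j : Fin 3) :
    tfT i j = wzT i j - (if i = j then (1 / 3 : ℂ) else 0) • (wzT11 - zwT11) := rfl

theorem wzT_eq (i j : Fin 3) :
    wzT i j = tfT i j + (if i = j then (1 / 3 : ℂ) else 0) • (wzT11 - zwT11) := by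
  rw [tfT_eq, sub_add_cancel]

theorem T2_hom_ext {M : Type*} [AddCommGroup M] [Module ℂ M] {g g' : ↥T2 →ₗ[ℂ] M}
    (h1 : g zwT11 = g' zwT11) (h2 : g wzT11 = g' wzT11) (h3 : g zwT22 = g' zwT22)
    (h4 : g wzT00 = g' wzT00) (h5 : ∀ i j, g (zzT i j) = g' (zzT i j))
    (h6 : ∀ i j, g (wwT i j) = g' (wwT i j)) (h7 : ∀ i j, g (wzT i j) = g' (wzT i j)) :
    g = g' := by
  refine LinearMap.ext fun ⟨r, hr⟩ => ?_
  induction hr using Submodule.span_induction with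
  | mem r hr =>
    rcases hr with ⟨i, j, rfl⟩ | ⟨i, j, rfl⟩ | ⟨i, j, rfl⟩ | rfl | rfl | rfl | rfl
    exacts [h5 i j, h6 i j, h7 i j, h1, h2, h3, h4]
  | zero => exact (map_zero g).trans (map_zero g').symm
  | add r s hr hs h h' =>
    have : (⟨r + s, T2.add_mem hr hs⟩ : T2) = ⟨r, hr⟩ + ⟨s, hs⟩ := rfl
    rw [this, map_add, map_add]
    exact congrArg₂ (· + ·) h h'
  | smul c r hr h =>
    have : (⟨c • r, T2.smul_mem c hr⟩ : T2) = c • ⟨r, hr⟩ := rfl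
    rw [this, map_smul, map_smul]
    exact congrArg (c • ·) h

/-- Values on the relations determined by a balanced function of two arrows. -/
def wordMap {M : Type*} [AddCommGroup M] [Module ℂ M] (F : Arrow → Arrow → M) : ↥T2 →ₗ[ℂ] M :=
  wordSum F ∘ₗ T2.subtype

theorem wordMap_zz {M : Type*} [AddCommGroup M] [Module ℂ M] (F : Arrow → Arrow → M)
    (i j : Fin 3) : wordMap F (zzT i j) = F (z21 i) (z10 j) - F (z21 j) (z10 i) := by
  change wordSum F (zzRel i j) = _
  rw [zzRel, map_sub, wordSum_pair, wordSum_pair]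

theorem wordMap_ww {M : Type*} [AddCommGroup M] [Module ℂ M] (F : Arrow → Arrow → M)
    (i j : Fin 3) : wordMap F (wwT i j) = F (w01 i) (w12 j) - F (w01 j) (w12 i) := by
  change wordSum F (wwRel i j) = _
  rw [wwRel, map_sub, wordSum_pair, wordSum_pair]

theorem wordMap_wz {M : Type*} [AddCommGroup M] [Module ℂ M] (F : Arrow → Arrow → M)
    (i j : Fin 3) : wordMap F (wzT i j) = F (w12 i) (z21 j) - F (z10 j) (w01 i) := by
  change wordSum F (wzRel i j) = _
  rw [wzRel, map_sub, wordSum_pair, wordSum_pair]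

theorem wordMap_zw11 {M : Type*} [AddCommGroup M] [Module ℂ M] (F : Arrow → Arrow → M) :
    wordMap F zwT11 = ∑ i, F (z10 i) (w01 i) := by
  change wordSum F zwRel11 = _
  simp only [zwRel11, map_sum, wordSum_pair]

theorem wordMap_wz11 {M : Type*} [AddCommGroup M] [Module ℂ M] (F : Arrow → Arrow → M) :
    wordMap F wzT11 = ∑ i, F (w12 i) (z21 i) := by
  change wordSum F wzRel11 = _
  simp only [wzRel11, map_sum, wordSum_pair]

theorem wordMap_zw22 {M : Type*} [AddCommGroup M] [Module ℂ M] (F : Arrow → Arrow → M) :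
    wordMap F zwT22 = ∑ i, F (z21 i) (w12 i) := by
  change wordSum F zwRel22 = _
  simp only [zwRel22, map_sum, wordSum_pair]

theorem wordMap_wz00 {M : Type*} [AddCommGroup M] [Module ℂ M] (F : Arrow → Arrow → M) :
    wordMap F wzT00 = ∑ i, F (w01 i) (z10 i) := by
  change wordSum F wzRel00 = _
  simp only [wzRel00, map_sum, wordSum_pair]

theorem wordMap_tf {M : Type*} [AddCommGroup M] [Module ℂ M] (F : Arrow → Arrow → M)
    (i j : Fin 3) : wordMap F (tfT i j) = F (w12 i) (z21 j) - F (z10 j) (w01 i) -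
      (if i = j then (1 / 3 : ℂ) else 0) •
        (∑ k, F (w12 k) (z21 k) - ∑ k, F (z10 k) (w01 k)) := by
  rw [tfT_eq, map_sub, map_smul, map_sub, wordMap_wz, wordMap_wz11, wordMap_zw11]

theorem evalT2_eq_wordMap (f : Lam →ₗ[ℂ] Lam →ₗ[ℂ] Lam) :
    evalT2 f = wordMap fun x y => f (ar x) (ar y) := rfl

theorem dM1_eq_wordMap (h : Arrow → Lam) :
    dM1 h = wordMap fun x y => ar x * h y + h x * ar y := rfl

namespace HasValues

variable {g g' : ↥T2 →ₗ[ℂ] Lam} {c d b a c' d' b' a' : Lam}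
  {Z W T Z' W' T' : Fin 3 → Fin 3 → Lam}

theorem unique (h : HasValues g c d b a Z W T) (h' : HasValues g' c d b a Z W T) : g = g' := by
  refine T2_hom_ext (h.on_zw11.trans h'.on_zw11.symm) (h.on_wz11.trans h'.on_wz11.symm)
    (h.on_zw22.trans h'.on_zw22.symm) (h.on_wz00.trans h'.on_wz00.symm)
    (fun i j => (h.on_zz i j).trans (h'.on_zz i j).symm)
    (fun i j => (h.on_ww i j).trans (h'.on_ww i j).symm) fun i j => ?_
  rw [wzT_eq, map_add, map_add, map_smul, map_smul, map_sub, map_sub, h.on_tf, h'.on_tf,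
    h.on_zw11, h'.on_zw11, h.on_wz11, h'.on_wz11]

theorem add (h : HasValues g c d b a Z W T) (h' : HasValues g' c' d' b' a' Z' W' T') :
    HasValues (g + g') (c + c') (d + d') (b + b') (a + a') (Z + Z') (W + W') (T + T') where
  on_zw11 := by rw [LinearMap.add_apply, h.on_zw11, h'.on_zw11]
  on_wz11 := by rw [LinearMap.add_apply, h.on_wz11, h'.on_wz11]
  on_zw22 := by rw [LinearMap.add_apply, h.on_zw22, h'.on_zw22]
  on_wz00 := by rw [LinearMap.add_apply, h.on_wz00, h'.on_wz00]
  on_zz i j := by rw [LinearMap.add_apply, h.on_zz, h'.on_zz]; rfl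
  on_ww i j := by rw [LinearMap.add_apply, h.on_ww, h'.on_ww]; rfl
  on_tf i j := by rw [LinearMap.add_apply, h.on_tf, h'.on_tf]; rfl

theorem smul (s : ℂ) (h : HasValues g c d b a Z W T) :
    HasValues (s • g) (s • c) (s • d) (s • b) (s • a) (s • Z) (s • W) (s • T) where
  on_zw11 := by rw [LinearMap.smul_apply, h.on_zw11]
  on_wz11 := by rw [LinearMap.smul_apply, h.on_wz11]
  on_zw22 := by rw [LinearMap.smul_apply, h.on_zw22]
  on_wz00 := by rw [LinearMap.smul_apply, h.on_wz00]
  on_zz i j := by rw [LinearMap.smul_apply, h.on_zz]; rfl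
  on_ww i j := by rw [LinearMap.smul_apply, h.on_ww]; rfl
  on_tf i j := by rw [LinearMap.smul_apply, h.on_tf]; rfl

end HasValues

/-- A function of two arrows which induces given values on the relations. -/
def tableFun (c d b a : Lam) (Z W T : Fin 3 → Fin 3 → Lam) : Arrow → Arrow → Lam
  | Sum.inl (1, i), Sum.inl (0, j) => (1 / 2 : ℂ) • Z i j
  | Sum.inr (0, i), Sum.inr (1, j) => (1 / 2 : ℂ) • W i j
  | Sum.inl (0, j), Sum.inr (0, i) =>
    (if i = j then (1 / 3 : ℂ) else 0) • c - (1 / 2 : ℂ) • T i j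
  | Sum.inr (1, i), Sum.inl (1, j) =>
    (if i = j then (1 / 3 : ℂ) else 0) • d + (1 / 2 : ℂ) • T i j
  | Sum.inl (1, j), Sum.inr (1, i) => (if i = j then (1 / 3 : ℂ) else 0) • b
  | Sum.inr (0, i), Sum.inl (0, j) => (if i = j then (1 / 3 : ℂ) else 0) • a
  | _, _ => 0

/-- The cochain on `T_2` with given values. -/
def tableMap (c d b a : Lam) (Z W T : Fin 3 → Fin 3 → Lam) : ↥T2 →ₗ[ℂ] Lam :=
  wordMap (tableFun c d b a Z W T)

/-- The three hypotheses are linear relations which hold among the listed elements of `T_2`. The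
values are distributed over the words: `1/2` for each word of a commutator, `1/3` for each term of a
contraction. -/
theorem tableMap_hasValues (c d b a : Lam) {Z W T : Fin 3 → Fin 3 → Lam}
    (hZ : ∀ i j, Z i j = -Z j i) (hW : ∀ i j, W i j = -W j i) (hT : ∑ i, T i i = 0) :
    HasValues (tableMap c d b a Z W T) c d b a Z W T := by
  rw [Fin.sum_univ_three] at hT
  have hT' : T 0 0 = -(T 1 1 + T 2 2) := by
    rw [eq_neg_iff_add_eq_zero, ← hT, add_assoc]
  have h1 : ∑ i, tableFun c d b a Z W T (z10 i) (w01 i) = c := by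
    simp only [tableFun, if_true, Fin.sum_univ_three]
    rw [hT']
    module
  have h2 : ∑ i, tableFun c d b a Z W T (w12 i) (z21 i) = d := by
    simp only [tableFun, if_true, Fin.sum_univ_three]
    rw [hT']
    module
  refine ⟨?_, ?_, ?_, ?_, fun i j => ?_, fun i j => ?_, fun i j => ?_⟩
  · rw [tableMap, wordMap_zw11, h1]
  · rw [tableMap, wordMap_wz11, h2]
  · rw [tableMap, wordMap_zw22]
    simp only [tableFun, if_true]
    rw [Fin.sum_univ_three]
    module
  · rw [tableMap, wordMap_wz00]
    simp only [tableFun, if_true]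
    rw [Fin.sum_univ_three]
    module
  · rw [tableMap, wordMap_zz]
    simp only [tableFun]
    rw [hZ j i, smul_neg, sub_neg_eq_add, ← add_smul]
    norm_num
  · rw [tableMap, wordMap_ww]
    simp only [tableFun]
    rw [hW j i, smul_neg, sub_neg_eq_add, ← add_smul]
    norm_num
  · rw [tableMap, wordMap_tf, h1, h2]
    simp only [tableFun]
    module

theorem eps_eq (i j k : Fin 3) :
    eps i j k = if i = j ∨ j = k ∨ i = k then 0 else if j = i + 1 then 1 else -1 := by
  rw [eps, Matrix.det_fin_three]
  fin_cases i <;> fin_cases j <;> fin_cases k <;> simp [Matrix.one_apply]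

/-! ### Cocycles from first order operators on the chart -/

/-- The first order operator `f ↦ ∑ V k ∂_k f + c f` on the chart. -/
def firstOrder (p : (Fin 4 → Chart) × Chart) : Module.End ℂ Chart :=
  (MvPolynomial.mkDerivation ℂ p.1 : Derivation ℂ Chart Chart).toLinearMap + Algebra.lmul ℂ Chart p.2

theorem mkDerivation_add (V V' : Fin 4 → Chart) (f : Chart) :
    MvPolynomial.mkDerivation ℂ (V + V') f =
      MvPolynomial.mkDerivation ℂ V f + MvPolynomial.mkDerivation ℂ V' f := by
  have h : MvPolynomial.mkDerivation ℂ (V + V') =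
      MvPolynomial.mkDerivation ℂ V + MvPolynomial.mkDerivation ℂ V' :=
    MvPolynomial.derivation_ext fun i => by simp
  rw [h]; rfl

theorem mkDerivation_smul (a : Chart) (V : Fin 4 → Chart) (f : Chart) :
    MvPolynomial.mkDerivation ℂ (a • V) f = a * MvPolynomial.mkDerivation ℂ V f := by
  have h : MvPolynomial.mkDerivation ℂ (a • V) = a • MvPolynomial.mkDerivation ℂ V :=
    MvPolynomial.derivation_ext fun i => by simp
  rw [h]; rfl

theorem firstOrder_apply (p : (Fin 4 → Chart) × Chart) (f : Chart) :
    firstOrder p f = MvPolynomial.mkDerivation ℂ p.1 f + p.2 * f := rfl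

theorem firstOrder_add (p q : (Fin 4 → Chart) × Chart) :
    firstOrder (p + q) = firstOrder p + firstOrder q := by
  refine LinearMap.ext fun f => ?_
  rw [LinearMap.add_apply, firstOrder_apply, firstOrder_apply, firstOrder_apply, Prod.fst_add,
    mkDerivation_add, Prod.snd_add]
  ring

/-- First order operators, linearly in their coefficients. -/
def firstOrderHom : (Fin 4 → Chart) × Chart →+ Module.End ℂ Chart :=
  AddMonoidHom.mk' firstOrder firstOrder_add

theorem firstOrder_zero_left (c : Chart) : firstOrder (0, c) = Algebra.lmul ℂ Chart c := by
  refine LinearMap.ext fun f => ?_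
  have h := mkDerivation_smul 0 0 f
  rw [zero_smul, zero_mul] at h
  rw [firstOrder_apply, h, zero_add]
  rfl

/-- The coefficients of `x D_y + D_x y` for two arrows `x` and `y` of the chart. -/
def chartPair (P : Arrow → (Fin 4 → Chart) × Chart) (x y : Arrow) : (Fin 4 → Chart) × Chart :=
  (arrowVal chartZ chartW x • (P y).1 + arrowVal chartZ chartW y • (P x).1,
    arrowVal chartZ chartW x * (P y).2 +
      MvPolynomial.mkDerivation ℂ (P x).1 (arrowVal chartZ chartW y) +
      (P x).2 * arrowVal chartZ chartW y)

/-- Leibniz rule: the vector field of `x` also differentiates the coordinate of `y`, which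
contributes to the order zero part. -/
theorem chartPair_spec (P : Arrow → (Fin 4 → Chart) × Chart) (x y : Arrow) :
    Algebra.lmul ℂ Chart (arrowVal chartZ chartW x) * firstOrder (P y) +
      firstOrder (P x) * Algebra.lmul ℂ Chart (arrowVal chartZ chartW y) =
    firstOrder (chartPair P x y) := by
  refine LinearMap.ext fun f => ?_
  rw [LinearMap.add_apply, Module.End.mul_apply, Module.End.mul_apply, firstOrder_apply,
    firstOrder_apply, firstOrder_apply]
  change _ * (_ + _) + (MvPolynomial.mkDerivation ℂ (P x).1 (_ * f) + _ * (_ * f)) = _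
  rw [Derivation.leibniz, chartPair, mkDerivation_add, mkDerivation_smul, mkDerivation_smul]
  simp only [smul_eq_mul]
  ring

/-- The derivation of the chart which multiplies the two last coordinates by `2`. -/
def chartEuler : Derivation ℂ Chart Chart :=
  MvPolynomial.mkDerivation ℂ ![0, 0, 2 * MvPolynomial.X 2, 2 * MvPolynomial.X 3]

/-- The operator matrix whose commutator with `opRep` is the length derivation. -/
def opEuler : Matrix (Fin 3) (Fin 3) (Module.End ℂ Chart) :=
  Matrix.diagonal fun a => chartEuler.toLinearMap + ((a : ℕ) : ℂ) • 1

theorem diagonal_commutator {K : Type*} [Ring K] (d : Fin 3 → K) (i j : Fin 3) (s : K) :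
    Matrix.diagonal d * Matrix.single i j s - Matrix.single i j s * Matrix.diagonal d =
      Matrix.single i j (d i * s - s * d j) := by
  ext a b
  rw [Matrix.sub_apply, Matrix.diagonal_mul, Matrix.mul_diagonal, Matrix.single_apply,
    Matrix.single_apply]
  by_cases h : i = a ∧ j = b
  · rw [if_pos h, if_pos h, h.1, h.2]
  · rw [if_neg h, if_neg h, mul_zero, zero_mul, sub_zero]

/-- The length of an arrow as seen by `chartEuler`. -/
def fibreDeg : Arrow → ℂ
  | Sum.inl _ => 0
  | Sum.inr _ => 2

/-- Path length is the rise of the node index plus the degree in the fibre coordinates counted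
twice: `1 + 0` for a `z` and `-1 + 2` for a `w`. -/
theorem opEuler_single (x : Arrow) (k : ℂ) (s : Module.End ℂ Chart)
    (h : chartEuler.toLinearMap * s - s * chartEuler.toLinearMap = (fibreDeg x + k) • s) :
    opEuler * Matrix.single (tgt x) (src x) s - Matrix.single (tgt x) (src x) s * opEuler =
      (1 + k) • Matrix.single (tgt x) (src x) s := by
  rw [opEuler, diagonal_commutator, Matrix.smul_single]
  congr 1
  have h2 : (((tgt x : ℕ) : ℂ) - ((src x : ℕ) : ℂ)) = 1 - fibreDeg x := by
    rcases x with ⟨a, i⟩ | ⟨a, i⟩ <;> simp [tgt, src, fibreDeg]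
    ring
  rw [add_mul, mul_add, smul_mul_assoc, mul_smul_comm, one_mul, mul_one, add_sub_add_comm, h,
    ← sub_smul, h2, ← add_smul]
  congr 1
  ring

/-- The commutator of two derivations is a derivation, so the identity of vector fields needs to be
checked on the four coordinates only. -/
theorem commutator_firstOrder (p : (Fin 4 → Chart) × Chart) (k : ℂ)
    (h1 : ∀ i, chartEuler (p.1 i) - MvPolynomial.mkDerivation ℂ p.1 (chartEuler (MvPolynomial.X i)) = k • p.1 i)
    (h2 : chartEuler p.2 = k • p.2) :
    chartEuler.toLinearMap * firstOrder p - firstOrder p * chartEuler.toLinearMap =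
      k • firstOrder p := by
  have h3 : ⁅chartEuler, MvPolynomial.mkDerivation ℂ p.1⁆ = k • MvPolynomial.mkDerivation ℂ p.1 := by
    refine MvPolynomial.derivation_ext fun i => ?_
    rw [Derivation.commutator_apply, MvPolynomial.mkDerivation_X, h1, Derivation.smul_apply,
      MvPolynomial.mkDerivation_X]
  refine LinearMap.ext fun f => ?_
  have h4 := congrArg (fun d => d f) h3
  simp only [Derivation.commutator_apply, Derivation.smul_apply] at h4
  rw [LinearMap.sub_apply, Module.End.mul_apply, Module.End.mul_apply, LinearMap.smul_apply,
    firstOrder_apply, firstOrder_apply]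
  change chartEuler (_ + _) - (MvPolynomial.mkDerivation ℂ p.1 (chartEuler f) + p.2 * chartEuler f) = _
  rw [map_add, Derivation.leibniz, h2, smul_add, ← h4]
  simp only [smul_eq_mul, mul_smul_comm]
  rw [mul_comm f]
  ring

/-- The hypotheses on `chartPair` say that in each deformed relation the vector fields cancel and a
function remains; the last seven say that this function is the value of `g` seen on the chart. These
are the data required by `DefData.exists_cocycle`. -/
theorem exists_chart_cocycle {w : ℤ} {P : Arrow → (Fin 4 → Chart) × Chart}
    (hP1 : ∀ x i, chartEuler ((P x).1 i) -
      MvPolynomial.mkDerivation ℂ (P x).1 (chartEuler (MvPolynomial.X i)) =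
        (fibreDeg x + w) • (P x).1 i)
    (hP2 : ∀ x, chartEuler (P x).2 = (fibreDeg x + w) • (P x).2)
    {g : ↥T2 →ₗ[ℂ] Lam} {c d b a : Chart} {Z W T : Fin 3 → Fin 3 → Chart}
    (hzw11 : ∑ i, chartPair P (z10 i) (w01 i) = (0, c))
    (hwz11 : ∑ i, chartPair P (w12 i) (z21 i) = (0, d))
    (hzw22 : ∑ i, chartPair P (z21 i) (w12 i) = (0, b))
    (hwz00 : ∑ i, chartPair P (w01 i) (z10 i) = (0, a))
    (hzz : ∀ i j, chartPair P (z21 i) (z10 j) - chartPair P (z21 j) (z10 i) = (0, Z i j))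
    (hww : ∀ i j, chartPair P (w01 i) (w12 j) - chartPair P (w01 j) (w12 i) = (0, W i j))
    (hwz : ∀ i j, chartPair P (w12 i) (z21 j) - chartPair P (z10 j) (w01 i) = (0, T i j))
    (gc : opRep (g zwT11) = Matrix.single 1 1 (Algebra.lmul ℂ Chart c))
    (gd : opRep (g wzT11) = Matrix.single 1 1 (Algebra.lmul ℂ Chart d))
    (gb : opRep (g zwT22) = Matrix.single 2 2 (Algebra.lmul ℂ Chart b))
    (ga : opRep (g wzT00) = Matrix.single 0 0 (Algebra.lmul ℂ Chart a))
    (gZ : ∀ i j, opRep (g (zzT i j)) = Matrix.single 2 0 (Algebra.lmul ℂ Chart (Z i j)))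
    (gW : ∀ i j, opRep (g (wwT i j)) = Matrix.single 0 2 (Algebra.lmul ℂ Chart (W i j)))
    (gT : ∀ i j, opRep (g (wzT i j)) = Matrix.single 1 1 (Algebra.lmul ℂ Chart (T i j))) :
    ∃ f ∈ Z2 w, evalT2 f - g ∈ MB2 w := by
  set D : Arrow → Matrix (Fin 3) (Fin 3) (Module.End ℂ Chart) := fun x =>
    Matrix.single (tgt x) (src x) (firstOrder (P x)) with hD
  have hpair : ∀ x y, src x = tgt y → opRep (ar x) * D y + D x * opRep (ar y) =
      Matrix.single (tgt x) (src y) (firstOrderHom (chartPair P x y)) := fun x y h => by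
    rw [hD]
    simp only [opRep_ar]
    rw [h, Matrix.single_mul_single_same, Matrix.single_mul_single_same, ← Matrix.single_add,
      chartPair_spec]
    rfl
  have hsum : ∀ (i j : Fin 3) (F : Fin 3 → (Fin 4 → Chart) × Chart) (s : Chart),
      ∑ k, F k = (0, s) → ∑ k, Matrix.single i j (firstOrderHom (F k)) =
        Matrix.single i j (Algebra.lmul ℂ Chart s) := fun i j F s h => by
    rw [← firstOrder_zero_left, ← h]
    change _ = Matrix.single i j (firstOrderHom (∑ k, F k))
    simp only [Fin.sum_univ_three, map_add, Matrix.single_add]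
  have hsub : ∀ (i j : Fin 3) (p q : (Fin 4 → Chart) × Chart) (s : Chart),
      p - q = (0, s) → Matrix.single i j (firstOrderHom p) - Matrix.single i j (firstOrderHom q) =
        Matrix.single i j (Algebra.lmul ℂ Chart s) := fun i j p q s h => by
    rw [← firstOrder_zero_left, ← h]
    change _ = Matrix.single i j (firstOrderHom (p - q))
    rw [sub_eq_iff_eq_add, ← Matrix.single_add, ← map_add, sub_add_cancel]
  have key : wordMap (fun x y => opRep (ar x) * D y + D x * opRep (ar y)) =
      opRep.toLinearMap ∘ₗ g := by
    refine T2_hom_ext ?_ ?_ ?_ ?_ (fun i j => ?_) (fun i j => ?_) fun i j => ?_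
    · rw [wordMap_zw11]
      exact (Finset.sum_congr rfl fun i _ => hpair _ _ rfl).trans ((hsum 1 1 _ _ hzw11).trans gc.symm)
    · rw [wordMap_wz11]
      exact (Finset.sum_congr rfl fun i _ => hpair _ _ rfl).trans ((hsum 1 1 _ _ hwz11).trans gd.symm)
    · rw [wordMap_zw22]
      exact (Finset.sum_congr rfl fun i _ => hpair _ _ rfl).trans ((hsum 2 2 _ _ hzw22).trans gb.symm)
    · rw [wordMap_wz00]
      exact (Finset.sum_congr rfl fun i _ => hpair _ _ rfl).trans ((hsum 0 0 _ _ hwz00).trans ga.symm)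
    · rw [wordMap_zz, hpair _ _ rfl, hpair _ _ rfl]
      exact (hsub 2 0 _ _ _ (hzz i j)).trans (gZ i j).symm
    · rw [wordMap_ww, hpair _ _ rfl, hpair _ _ rfl]
      exact (hsub 0 2 _ _ _ (hww i j)).trans (gW i j).symm
    · rw [wordMap_wz, hpair _ _ rfl, hpair _ _ rfl]
      exact (hsub 1 1 _ _ _ (hwz i j)).trans (gT i j).symm
  have H : DefData opRep opEuler w D g := by
    refine ⟨opRep_injective, fun a => ?_, fun x => ?_, fun x => ?_, fun x => ?_, fun x => ?_,
      fun r => congrArg (fun f => f r) key⟩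
    · rw [opRep_e, ← sub_eq_zero, opEuler, diagonal_commutator, mul_one, one_mul, sub_self,
        Matrix.single_zero]
    · rw [opRep_ar]
      have := opEuler_single x 0 (Algebra.lmul ℂ Chart (arrowVal chartZ chartW x)) ?_
      · rw [this, add_zero, one_smul]
      · rw [← firstOrder_zero_left, add_zero]
        refine commutator_firstOrder _ _ (fun i => ?_) ?_
        · have h := mkDerivation_smul 0 0 (chartEuler (MvPolynomial.X i))
          rw [zero_smul, zero_mul] at h
          simp [h]
        · rcases x with ⟨s, i⟩ | ⟨s, i⟩
          · fin_cases i <;> simp [arrowVal, chartZ, fibreDeg, chartEuler]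
          · fin_cases i <;> simp [arrowVal, chartW, fibreDeg, chartEuler, two_smul] <;> ring
    · rw [hD, opRep_e, Matrix.single_mul_single_same, one_mul]
    · rw [hD, opRep_e, Matrix.single_mul_single_same, mul_one]
    · have := opEuler_single x w (firstOrder (P x)) (commutator_firstOrder _ _ (hP1 x) (hP2 x))
      exact this
  exact H.exists_cocycle

theorem opRep_single (x : Arrow) (y : Arrow) (h : src x = tgt y) :
    opRep (ar x * ar y) = Matrix.single (tgt x) (src y)
      (Algebra.lmul ℂ Chart (arrowVal chartZ chartW x * arrowVal chartZ chartW y)) := by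
  rw [map_mul, opRep_ar, opRep_ar, h, Matrix.single_mul_single_same, map_mul]

theorem opRep_zzP (k l : Fin 3) : opRep (zzP k l) =
    Matrix.single 2 0 (Algebra.lmul ℂ Chart (chartZ k * chartZ l)) := opRep_single _ _ rfl
theorem opRep_wwP (k l : Fin 3) : opRep (wwP k l) =
    Matrix.single 0 2 (Algebra.lmul ℂ Chart (chartW k * chartW l)) := opRep_single _ _ rfl
theorem opRep_wzP11 (k l : Fin 3) : opRep (wzP11 k l) =
    Matrix.single 1 1 (Algebra.lmul ℂ Chart (chartW k * chartZ l)) := opRep_single _ _ rfl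

theorem opRep_e' (a : Fin 3) :
    opRep (e a) = Matrix.single a a (Algebra.lmul ℂ Chart 1) := by
  rw [opRep_e, map_one]

theorem mkDerivation_zero_apply (f : Chart) :
    MvPolynomial.mkDerivation ℂ (0 : Fin 4 → Chart) f = 0 := by
  simpa using mkDerivation_smul 0 0 f

theorem chartEuler_X (i : Fin 4) : chartEuler (MvPolynomial.X i) =
    ![0, 0, 2 * MvPolynomial.X 2, 2 * MvPolynomial.X 3] i :=
  MvPolynomial.mkDerivation_X _ _ _

theorem derivation_two (d : Derivation ℂ Chart Chart) : d 2 = 0 := d.map_natCast 2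

theorem derivation_three (d : Derivation ℂ Chart Chart) : d 3 = 0 := d.map_natCast 3

theorem exists_cocycle_smul {w : ℤ} {g : ↥T2 →ₗ[ℂ] Lam} (s : ℂ) (hs : s ≠ 0)
    (h : ∃ f ∈ Z2 w, evalT2 f - s • g ∈ MB2 w) : ∃ f ∈ Z2 w, evalT2 f - g ∈ MB2 w := by
  obtain ⟨f, hf, h⟩ := h
  refine ⟨s⁻¹ • f, (Z2 w).smul_mem _ hf, ?_⟩
  have := (MB2 w).smul_mem s⁻¹ h
  rwa [smul_sub, inv_smul_smul₀ hs, ← map_smul] at this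

theorem HasValues.on_wz {g : ↥T2 →ₗ[ℂ] Lam} {c d b a : Lam} {Z W T : Fin 3 → Fin 3 → Lam}
    (h : HasValues g c d b a Z W T) (i j : Fin 3) :
    g (wzT i j) = T i j + (if i = j then (1 / 3 : ℂ) else 0) • (d - c) := by
  rw [wzT_eq, map_add, map_smul, map_sub, h.on_wz11, h.on_zw11, h.on_tf]

/-! ### Explicit operators for weight `-2` and for the components `10` and `10*`. -/

/-- Coefficients of the operators which yield `g_{∅,1}`. -/
def opG1 : Arrow → (Fin 4 → Chart) × Chart
  | Sum.inl _ => 0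
  | Sum.inr (_, i) => (0, if i = 0 then 1 else 0)

/-- Only `w₀` moves, by the constant `1`. As `z⁰ = 1`, this changes every contraction by `1`; the
deformed coordinates still commute. -/
theorem exists_cocycle_G1 {g : ↥T2 →ₗ[ℂ] Lam} (hg : IsG1 g) :
    ∃ f ∈ Z2 (-2), evalT2 f - g ∈ MB2 (-2) := by
  refine exists_chart_cocycle (P := opG1) (c := 1) (d := 1) (b := 1) (a := 1) (Z := 0) (W := 0)
    (T := 0) ?_ ?_ ?_ ?_ ?_ ?_ ?_ ?_ ?_ ?_ ?_ ?_ ?_ ?_ ?_ ?_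
  · rintro (⟨s, i⟩ | ⟨s, i⟩) k
    · fin_cases i <;> fin_cases k <;>
        simp [opG1, mkDerivation_zero_apply, chartEuler_X, fibreDeg, derivation_two, two_smul]
    · fin_cases i <;> fin_cases k <;>
        simp [opG1, mkDerivation_zero_apply, chartEuler_X, fibreDeg, derivation_two, two_smul]
  · rintro (⟨s, i⟩ | ⟨s, i⟩)
    · fin_cases i <;> simp [opG1]
    · fin_cases i <;> fin_cases s <;> simp [opG1, fibreDeg, derivation_three]
  · rw [Fin.sum_univ_three]
    refine Prod.ext (funext fun k => ?_) ?_
    · fin_cases k <;> simp [chartPair, opG1, arrowVal, chartZ, chartW]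
    · simp [chartPair, opG1, arrowVal, chartZ, chartW, mkDerivation_zero_apply]
  · rw [Fin.sum_univ_three]
    refine Prod.ext (funext fun k => ?_) ?_
    · fin_cases k <;> simp [chartPair, opG1, arrowVal, chartZ, chartW]
    · simp [chartPair, opG1, arrowVal, chartZ, chartW, mkDerivation_zero_apply]
  · rw [Fin.sum_univ_three]
    refine Prod.ext (funext fun k => ?_) ?_
    · fin_cases k <;> simp [chartPair, opG1, arrowVal, chartZ, chartW]
    · simp [chartPair, opG1, arrowVal, chartZ, chartW, mkDerivation_zero_apply]
  · rw [Fin.sum_univ_three]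
    refine Prod.ext (funext fun k => ?_) ?_
    · fin_cases k <;> simp [chartPair, opG1, arrowVal, chartZ, chartW]
    · simp [chartPair, opG1, arrowVal, chartZ, chartW, mkDerivation_zero_apply]
  · intro i j
    refine Prod.ext (funext fun k => ?_) ?_
    · fin_cases i <;> fin_cases j <;> fin_cases k <;>
        simp [chartPair, opG1, arrowVal, chartZ, chartW]
    · fin_cases i <;> fin_cases j <;>
        simp [chartPair, opG1, arrowVal, chartZ, chartW, mkDerivation_zero_apply]
  · intro i j
    refine Prod.ext (funext fun k => ?_) ?_
    · fin_cases i <;> fin_cases j <;> fin_cases k <;>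
        simp [chartPair, opG1, arrowVal, chartZ, chartW]
    · fin_cases i <;> fin_cases j <;>
        simp [chartPair, opG1, arrowVal, chartZ, chartW, mkDerivation_zero_apply]
  · intro i j
    refine Prod.ext (funext fun k => ?_) ?_
    · fin_cases i <;> fin_cases j <;> fin_cases k <;>
        simp [chartPair, opG1, arrowVal, chartZ, chartW]
    · fin_cases i <;> fin_cases j <;>
        simp [chartPair, opG1, arrowVal, chartZ, chartW, mkDerivation_zero_apply]
  · rw [hg.on_zw11, opRep_e']
  · rw [hg.on_wz11, opRep_e']
  · rw [hg.on_zw22, opRep_e']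
  · rw [hg.on_wz00, opRep_e']
  · intro i j
    rw [hg.on_zz]; simp
  · intro i j
    rw [hg.on_ww]; simp
  · intro i j
    rw [hg.on_wz]; simp

/-- Coefficients of the operators which yield `-3 g_{∅,0}`. -/
def opG0 : Arrow → (Fin 4 → Chart) × Chart
  | Sum.inl _ => 0
  | Sum.inr (s, i) => ![(![-2 * MvPolynomial.X 0, -2 * MvPolynomial.X 1, 0, 0], ![-3, -1] s),
      (![2, 0, 0, 0], 0), (![0, 2, 0, 0], 0)] i

/-- The first order term of `wᵢ` is `2 ∂/∂zⁱ` on homogeneous functions of `z`, written in the chart.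
By Euler's formula the one for `w₀` is `2 d - 2 (x ∂_x + y ∂_y)` in degree `d`, with `d = -3/2` at
node `1` and `d = -1/2` at node `2`; this is the source of the constants `-3` and `-1`. -/
theorem exists_cocycle_G0 {g : ↥T2 →ₗ[ℂ] Lam} (hg : IsG0 g) :
    ∃ f ∈ Z2 (-2), evalT2 f - g ∈ MB2 (-2) := by
  have hg' := HasValues.smul (-3) hg
  have hs : ∀ (a : Fin 3) (n : ℤ), opRep ((n : ℂ) • e a) =
      Matrix.single a a (Algebra.lmul ℂ Chart (n : Chart)) := fun a n => by
    rw [map_smul, opRep_e, Matrix.smul_single, map_intCast]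
    congr 1
    exact (Algebra.algebraMap_eq_smul_one (n : ℂ)).symm.trans (map_intCast _ n)
  refine exists_cocycle_smul (-3) (by norm_num) (exists_chart_cocycle (P := opG0)
    (c := (-3 : ℤ)) (d := (3 : ℤ)) (b := (-1 : ℤ)) (a := (1 : ℤ)) (Z := 0) (W := 0)
    (T := fun i j => if i = j then (2 : ℤ) else 0)
    ?_ ?_ ?_ ?_ ?_ ?_ ?_ ?_ ?_ ?_ ?_ ?_ ?_ ?_ ?_ ?_)
  · rintro (⟨s, i⟩ | ⟨s, i⟩) k
    · fin_cases i <;> fin_cases k <;>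
        simp [opG0, mkDerivation_zero_apply, chartEuler_X, fibreDeg, derivation_two, two_smul]
    · fin_cases i <;> fin_cases k <;>
        simp [opG0, mkDerivation_zero_apply, chartEuler_X, fibreDeg, derivation_two, two_smul]
  · rintro (⟨s, i⟩ | ⟨s, i⟩)
    · fin_cases i <;> simp [opG0]
    · fin_cases i <;> fin_cases s <;> simp [opG0, fibreDeg, derivation_three]
  · rw [Fin.sum_univ_three]
    refine Prod.ext (funext fun k => ?_) ?_
    · fin_cases k <;> simp [chartPair, opG0, arrowVal, chartZ, chartW] <;> ring
    · simp [chartPair, opG0, arrowVal, chartZ, chartW, mkDerivation_zero_apply]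
  · rw [Fin.sum_univ_three]
    refine Prod.ext (funext fun k => ?_) ?_
    · fin_cases k <;> simp [chartPair, opG0, arrowVal, chartZ, chartW] <;> ring
    · simp [chartPair, opG0, arrowVal, chartZ, chartW, mkDerivation_zero_apply] <;> ring
  · rw [Fin.sum_univ_three]
    refine Prod.ext (funext fun k => ?_) ?_
    · fin_cases k <;> simp [chartPair, opG0, arrowVal, chartZ, chartW] <;> ring
    · simp [chartPair, opG0, arrowVal, chartZ, chartW, mkDerivation_zero_apply]
  · rw [Fin.sum_univ_three]
    refine Prod.ext (funext fun k => ?_) ?_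
    · fin_cases k <;> simp [chartPair, opG0, arrowVal, chartZ, chartW] <;> ring
    · simp [chartPair, opG0, arrowVal, chartZ, chartW, mkDerivation_zero_apply] <;> ring
  · intro i j
    refine Prod.ext (funext fun k => ?_) ?_
    · fin_cases i <;> fin_cases j <;> fin_cases k <;>
        simp [chartPair, opG0, arrowVal, chartZ, chartW]
    · fin_cases i <;> fin_cases j <;>
        simp [chartPair, opG0, arrowVal, chartZ, chartW, mkDerivation_zero_apply]
  · intro i j
    refine Prod.ext (funext fun k => ?_) ?_
    · fin_cases i <;> fin_cases j <;> fin_cases k <;>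
        simp [chartPair, opG0, arrowVal, chartZ, chartW] <;> ring
    · fin_cases i <;> fin_cases j <;>
        simp [chartPair, opG0, arrowVal, chartZ, chartW, mkDerivation_zero_apply] <;> ring
  · intro i j
    refine Prod.ext (funext fun k => ?_) ?_
    · fin_cases i <;> fin_cases j <;> fin_cases k <;>
        simp [chartPair, opG0, arrowVal, chartZ, chartW]
    · fin_cases i <;> fin_cases j <;>
        simp [chartPair, opG0, arrowVal, chartZ, chartW, mkDerivation_zero_apply] <;> ring
  · rw [hg'.on_zw11, ← hs]
    congr 1
    module
  · rw [hg'.on_wz11, ← hs]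
    congr 1
    module
  · rw [hg'.on_zw22, ← hs]
    congr 1
    module
  · rw [hg'.on_wz00, ← hs]
    congr 1
    module
  · intro i j
    rw [hg'.on_zz]; simp
  · intro i j
    rw [hg'.on_ww]; simp
  · intro i j
    rw [hg'.on_wz]
    split_ifs with h
    · rw [← hs]
      congr 1
      simp only [smul_zero, Pi.zero_apply, Pi.smul_apply]
      module
    · simp

/-- Coefficients of the operators which yield the component `10` with `D` the cube of the
coordinate with index `0`. -/
def opG10 : Arrow → (Fin 4 → Chart) × Chart
  | Sum.inl (_, i) => (![0, ![0, 1, 0] i, 0, 0], 0)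
  | Sum.inr (_, i) => (![0, ![-MvPolynomial.X 2, 0, 0] i, 0, 0], 0)

/-- The coordinate `x = z¹` is deformed by `∂_y`, and `w₀ = -(x p + y q)` accordingly by `-p ∂_y`.
The coordinates `z¹` and `z²` then cease to commute, with commutator `(z⁰)²`. -/
theorem exists_cocycle_G10 {D : SymForm}
    (hD : ∀ i j k, coeff D i j k = if i = 0 ∧ j = 0 ∧ k = 0 then 1 else 0)
    {g : ↥T2 →ₗ[ℂ] Lam} (hg : IsG10 D g) : ∃ f ∈ Z2 0, evalT2 f - g ∈ MB2 0 := by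
  have h0 : ∀ a : Fin 3, (0 : Matrix (Fin 3) (Fin 3) (Module.End ℂ Chart)) =
      Matrix.single a a (Algebra.lmul ℂ Chart 0) := fun a => by
    rw [map_zero, Matrix.single_zero]
  refine exists_chart_cocycle (P := opG10) (c := 0) (d := 0) (b := 0) (a := 0)
    (Z := ![![0, 0, 0], ![0, 0, 1], ![0, -1, 0]]) (W := 0)
    (T := ![![0, MvPolynomial.X 3, -MvPolynomial.X 2], ![0, 0, 0], ![0, 0, 0]])
    ?_ ?_ ?_ ?_ ?_ ?_ ?_ ?_ ?_ ?_ ?_ ?_ ?_ ?_ ?_ ?_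
  · rintro (⟨s, i⟩ | ⟨s, i⟩) k
    · fin_cases i <;> fin_cases k <;>
        simp [opG10, mkDerivation_zero_apply, chartEuler_X, fibreDeg, derivation_two, two_smul] <;> ring
    · fin_cases i <;> fin_cases k <;>
        simp [opG10, mkDerivation_zero_apply, chartEuler_X, fibreDeg, derivation_two, two_smul] <;> ring
  · rintro (⟨s, i⟩ | ⟨s, i⟩)
    · fin_cases i <;> simp [opG10]
    · fin_cases i <;> fin_cases s <;> simp [opG10, fibreDeg, derivation_three]
  · rw [Fin.sum_univ_three]
    refine Prod.ext (funext fun k => ?_) ?_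
    · fin_cases k <;> simp [chartPair, opG10, arrowVal, chartZ, chartW] <;> ring
    · simp [chartPair, opG10, arrowVal, chartZ, chartW, mkDerivation_zero_apply] <;> ring
  · rw [Fin.sum_univ_three]
    refine Prod.ext (funext fun k => ?_) ?_
    · fin_cases k <;> simp [chartPair, opG10, arrowVal, chartZ, chartW] <;> ring
    · simp [chartPair, opG10, arrowVal, chartZ, chartW, mkDerivation_zero_apply] <;> ring
  · rw [Fin.sum_univ_three]
    refine Prod.ext (funext fun k => ?_) ?_
    · fin_cases k <;> simp [chartPair, opG10, arrowVal, chartZ, chartW] <;> ring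
    · simp [chartPair, opG10, arrowVal, chartZ, chartW, mkDerivation_zero_apply] <;> ring
  · rw [Fin.sum_univ_three]
    refine Prod.ext (funext fun k => ?_) ?_
    · fin_cases k <;> simp [chartPair, opG10, arrowVal, chartZ, chartW] <;> ring
    · simp [chartPair, opG10, arrowVal, chartZ, chartW, mkDerivation_zero_apply] <;> ring
  · intro i j
    refine Prod.ext (funext fun k => ?_) ?_
    · fin_cases i <;> fin_cases j <;> fin_cases k <;>
        simp [chartPair, opG10, arrowVal, chartZ, chartW] <;> ring
    · fin_cases i <;> fin_cases j <;>
        simp [chartPair, opG10, arrowVal, chartZ, chartW, mkDerivation_zero_apply] <;> ring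
  · intro i j
    refine Prod.ext (funext fun k => ?_) ?_
    · fin_cases i <;> fin_cases j <;> fin_cases k <;>
        simp [chartPair, opG10, arrowVal, chartZ, chartW] <;> ring
    · fin_cases i <;> fin_cases j <;>
        simp [chartPair, opG10, arrowVal, chartZ, chartW, mkDerivation_zero_apply] <;> ring
  · intro i j
    refine Prod.ext (funext fun k => ?_) ?_
    · fin_cases i <;> fin_cases j <;> fin_cases k <;>
        simp [chartPair, opG10, arrowVal, chartZ, chartW] <;> ring
    · fin_cases i <;> fin_cases j <;>
        simp [chartPair, opG10, arrowVal, chartZ, chartW, mkDerivation_zero_apply] <;> ring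
  · rw [hg.on_zw11, map_zero, h0]
  · rw [hg.on_wz11, map_zero, h0]
  · rw [hg.on_zw22, map_zero, h0]
  · rw [hg.on_wz00, map_zero, h0]
  · intro i j
    rw [hg.on_zz]
    have : ∑ r, ∑ k, ∑ l, (eps i j r * coeff D r k l) • zzP k l = eps i j 0 • zzP 0 0 := by
      simp [hD, ite_and]
    rw [this, map_smul, opRep_zzP, eps_eq]
    fin_cases i <;> fin_cases j <;> simp [chartZ, ← Matrix.single_neg]
  · intro i j
    rw [hg.on_ww]; simp
  · intro i j
    rw [hg.on_wz]
    have : ∑ r, ∑ k, ∑ l, (eps j l r * coeff D r i k) • wzP11 l k =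
        if i = 0 then ∑ l, eps j l 0 • wzP11 l 0 else 0 := by
      simp [hD, ite_and]
    rw [this, sub_zero, smul_zero, add_zero]
    fin_cases i
    · simp only [Fin.zero_eta, if_true, map_sum, map_smul, opRep_wzP11, eps_eq, Fin.sum_univ_three]
      fin_cases j <;> simp [opRep_wzP11, chartZ, chartW, ← Matrix.single_neg]
    · fin_cases j <;> simp
    · fin_cases j <;> simp

/-- Coefficients of the operators which yield the component `10*` with `D` the cube of the
coordinate with index `1`. -/
def opG10dual : Arrow → (Fin 4 → Chart) × Chart
  | Sum.inl _ => 0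
  | Sum.inr (_, i) =>
    (![![-(MvPolynomial.X 1 * MvPolynomial.X 2), 0, MvPolynomial.X 2] i, 0, 0, 0], 0)

/-- The coordinate `q = w₂` is deformed by `p ∂_x`, and `w₀ = -(x p + y q)` accordingly by `-y p
∂_x`. The commutator of `w₀` and `w₂` becomes `w₁²`. -/
theorem exists_cocycle_G10dual {D : SymForm}
    (hD : ∀ i j k, coeff D i j k = if i = 1 ∧ j = 1 ∧ k = 1 then 1 else 0)
    {g : ↥T2 →ₗ[ℂ] Lam} (hg : IsG10dual D g) : ∃ f ∈ Z2 0, evalT2 f - g ∈ MB2 0 := by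
  have h0 : ∀ a : Fin 3, (0 : Matrix (Fin 3) (Fin 3) (Module.End ℂ Chart)) =
      Matrix.single a a (Algebra.lmul ℂ Chart 0) := fun a => by
    rw [map_zero, Matrix.single_zero]
  refine exists_chart_cocycle (P := opG10dual) (c := 0) (d := 0) (b := 0) (a := 0)
    (Z := 0) (W := ![![0, 0, MvPolynomial.X 2 * MvPolynomial.X 2], ![0, 0, 0],
      ![-(MvPolynomial.X 2 * MvPolynomial.X 2), 0, 0]])
    (T := ![![0, -(MvPolynomial.X 2 * MvPolynomial.X 1), 0], ![0, 0, 0],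
      ![0, MvPolynomial.X 2, 0]])
    ?_ ?_ ?_ ?_ ?_ ?_ ?_ ?_ ?_ ?_ ?_ ?_ ?_ ?_ ?_ ?_
  · rintro (⟨s, i⟩ | ⟨s, i⟩) k
    · fin_cases i <;> fin_cases k <;>
        simp [opG10dual, mkDerivation_zero_apply, chartEuler_X, fibreDeg, derivation_two, two_smul] <;> ring
    · fin_cases i <;> fin_cases k <;>
        simp [opG10dual, mkDerivation_zero_apply, chartEuler_X, fibreDeg, derivation_two, two_smul] <;> ring
  · rintro (⟨s, i⟩ | ⟨s, i⟩)
    · fin_cases i <;> simp [opG10dual]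
    · fin_cases i <;> fin_cases s <;> simp [opG10dual, fibreDeg, derivation_three]
  · rw [Fin.sum_univ_three]
    refine Prod.ext (funext fun k => ?_) ?_
    · fin_cases k <;> simp [chartPair, opG10dual, arrowVal, chartZ, chartW] <;> ring
    · simp [chartPair, opG10dual, arrowVal, chartZ, chartW, mkDerivation_zero_apply] <;> ring
  · rw [Fin.sum_univ_three]
    refine Prod.ext (funext fun k => ?_) ?_
    · fin_cases k <;> simp [chartPair, opG10dual, arrowVal, chartZ, chartW] <;> ring
    · simp [chartPair, opG10dual, arrowVal, chartZ, chartW, mkDerivation_zero_apply] <;> ring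
  · rw [Fin.sum_univ_three]
    refine Prod.ext (funext fun k => ?_) ?_
    · fin_cases k <;> simp [chartPair, opG10dual, arrowVal, chartZ, chartW] <;> ring
    · simp [chartPair, opG10dual, arrowVal, chartZ, chartW, mkDerivation_zero_apply] <;> ring
  · rw [Fin.sum_univ_three]
    refine Prod.ext (funext fun k => ?_) ?_
    · fin_cases k <;> simp [chartPair, opG10dual, arrowVal, chartZ, chartW] <;> ring
    · simp [chartPair, opG10dual, arrowVal, chartZ, chartW, mkDerivation_zero_apply] <;> ring
  · intro i j
    refine Prod.ext (funext fun k => ?_) ?_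
    · fin_cases i <;> fin_cases j <;> fin_cases k <;>
        simp [chartPair, opG10dual, arrowVal, chartZ, chartW] <;> ring
    · fin_cases i <;> fin_cases j <;>
        simp [chartPair, opG10dual, arrowVal, chartZ, chartW, mkDerivation_zero_apply] <;> ring
  · intro i j
    refine Prod.ext (funext fun k => ?_) ?_
    · fin_cases i <;> fin_cases j <;> fin_cases k <;>
        simp [chartPair, opG10dual, arrowVal, chartZ, chartW] <;> ring
    · fin_cases i <;> fin_cases j <;>
        simp [chartPair, opG10dual, arrowVal, chartZ, chartW, mkDerivation_zero_apply] <;> ring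
  · intro i j
    refine Prod.ext (funext fun k => ?_) ?_
    · fin_cases i <;> fin_cases j <;> fin_cases k <;>
        simp [chartPair, opG10dual, arrowVal, chartZ, chartW] <;> ring
    · fin_cases i <;> fin_cases j <;>
        simp [chartPair, opG10dual, arrowVal, chartZ, chartW, mkDerivation_zero_apply] <;> ring
  · rw [hg.on_zw11, map_zero, h0]
  · rw [hg.on_wz11, map_zero, h0]
  · rw [hg.on_zw22, map_zero, h0]
  · rw [hg.on_wz00, map_zero, h0]
  · intro i j
    rw [hg.on_zz]; simp
  · intro i j
    rw [hg.on_ww]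
    have : ∑ r, ∑ k, ∑ l, (eps i j r * coeff D r k l) • wwP k l = eps i j 1 • wwP 1 1 := by
      simp [hD, ite_and]
    rw [this, map_neg, map_smul, opRep_wwP, eps_eq]
    fin_cases i <;> fin_cases j <;> simp [chartW, ← Matrix.single_neg]
  · intro i j
    rw [hg.on_wz]
    have : ∑ r, ∑ k, ∑ l, (eps r i k * coeff D r j l) • wzP11 l k =
        if j = 1 then ∑ k, eps 1 i k • wzP11 1 k else 0 := by
      simp [hD, ite_and]
    rw [this, sub_zero, smul_zero, add_zero]
    fin_cases j
    · fin_cases i <;> simp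
    · simp only [Fin.mk_one, if_true, map_sum, map_smul, opRep_wzP11, eps_eq, Fin.sum_univ_three]
      fin_cases i <;> simp [opRep_wzP11, chartZ, chartW, ← Matrix.single_neg]
    · fin_cases i <;> simp

/-! ### The cocycles of the components `8` -/

theorem ar_mul_ar_of_ne {x y : Arrow} (h : src x ≠ tgt y) : ar x * ar y = 0 := by
  rw [← ar_mul_e_src x, ← e_tgt_mul_ar y, mul_assoc, ← mul_assoc (e (src x)), e_mul_e_of_ne h,
    zero_mul, mul_zero]

theorem ar_mul_e_of_ne {x : Arrow} {a : Fin 3} (h : src x ≠ a) : ar x * e a = 0 := by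
  rw [← ar_mul_e_src x, mul_assoc, e_mul_e_of_ne h, mul_zero]

theorem e_mul_ar_of_ne {x : Arrow} {a : Fin 3} (h : a ≠ tgt x) : e a * ar x = 0 := by
  rw [← e_tgt_mul_ar x, ← mul_assoc, e_mul_e_of_ne h, zero_mul]

/-- The element `w_i z^j` of the centre of `Λ`, without its correction by the trace. -/
def cent (i j : Fin 3) : Lam := wzP00 i j + wzP11 i j + zwP22 j i

theorem e_mul_cent (i j a : Fin 3) : e a * cent i j = ![wzP00 i j, wzP11 i j, zwP22 j i] a ∧
    cent i j * e a = ![wzP00 i j, wzP11 i j, zwP22 j i] a := by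
  have h0 : ∀ x y : Arrow, e a * (ar x * ar y) = if a = tgt x then ar x * ar y else 0 := by
    intro x y
    split_ifs with h
    · rw [h, ← mul_assoc, e_tgt_mul_ar]
    · rw [← mul_assoc, e_mul_ar_of_ne h, zero_mul]
  have h1 : ∀ x y : Arrow, (ar x * ar y) * e a = if src y = a then ar x * ar y else 0 := by
    intro x y
    split_ifs with h
    · rw [← h, mul_assoc, ar_mul_e_src]
    · rw [mul_assoc, ar_mul_e_of_ne h, mul_zero]
  simp only [cent, wzP00, wzP11, zwP22, mul_add, add_mul, h0, h1]
  fin_cases a <;> simp [tgt, src]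

/-- At every node this element is the loop representing the function `w_i z^j` on the cone, and the
relations let such a loop slide past an arrow. -/
theorem cent_mul_ar (i j : Fin 3) (x : Arrow) : cent i j * ar x = ar x * cent i j := by
  have h1 : cent i j * ar x = ![wzP00 i j, wzP11 i j, zwP22 j i] (tgt x) * ar x := by
    rw [← (e_mul_cent i j _).2, mul_assoc, e_tgt_mul_ar]
  have h2 : ar x * cent i j = ar x * ![wzP00 i j, wzP11 i j, zwP22 j i] (src x) := by
    rw [← (e_mul_cent i j _).1, ← mul_assoc, ar_mul_e_src]
  rw [h1, h2]
  rcases x with ⟨s, k⟩ | ⟨s, k⟩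
  · fin_cases s
    · change wzP11 i j * ar (z10 k) = ar (z10 k) * wzP00 i j
      rw [wzP11, wzP00, mul_assoc, rel_zz, ← mul_assoc, rel_wz, mul_assoc]
    · change zwP22 j i * ar (z21 k) = ar (z21 k) * wzP11 i j
      rw [zwP22, wzP11, mul_assoc, rel_wz, ← mul_assoc, rel_zz, mul_assoc, ← rel_wz]
  · fin_cases s
    · change wzP00 i j * ar (w01 k) = ar (w01 k) * wzP11 i j
      rw [wzP00, wzP11, ← mul_assoc, rel_ww, mul_assoc, mul_assoc, rel_wz]
    · change wzP11 i j * ar (w12 k) = ar (w12 k) * zwP22 j i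
      rw [zwP22, wzP11, ← mul_assoc, rel_wz k, rel_wz, mul_assoc, rel_ww, mul_assoc]

theorem cent_mul (i j : Fin 3) (x : Lam) : cent i j * x = x * cent i j := by
  induction x using lam_induction with
  | one => rw [mul_one, one_mul]
  | add x y hx hy => rw [mul_add, add_mul, hx, hy]
  | smul c x hx => rw [mul_smul_comm, smul_mul_assoc, hx]
  | e_mul a x hx =>
    rw [mul_assoc, ← hx, ← mul_assoc, ← mul_assoc, (e_mul_cent i j a).1, (e_mul_cent i j a).2]
  | ar_mul a x hx => rw [mul_assoc, ← hx, ← mul_assoc, ← mul_assoc, cent_mul_ar]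

/-- The central element `∑ U^i_j w_i z^j`. -/
def centU (U : Matrix (Fin 3) (Fin 3) ℂ) : Lam := ∑ i, ∑ j, U i j • cent i j

theorem centU_mul (U : Matrix (Fin 3) (Fin 3) ℂ) (x : Lam) : centU U * x = x * centU U := by
  simp only [centU, Finset.sum_mul, Finset.mul_sum, smul_mul_assoc, mul_smul_comm, cent_mul]

theorem centU_mem (U : Matrix (Fin 3) (Fin 3) ℂ) : centU U ∈ homog 2 := by
  rw [mem_homog_iff]
  simp only [centU, cent, wzP00, wzP11, zwP22, map_sum, map_smul, map_add, len_mul, len_ar,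
    Finset.smul_sum]
  refine Finset.sum_congr rfl fun i _ => Finset.sum_congr rfl fun j _ => ?_
  push_cast
  module

theorem mem_homog_of_eq {k l : ℤ} (h : k = l) {x : Lam} (hx : x ∈ homog k) : x ∈ homog l := h ▸ hx

/-- Multiplication of cocycles by a central element of length two. -/
theorem exists_cocycle_cent {w : ℤ} {A : Lam} (hA : ∀ x, A * x = x * A) (hA2 : A ∈ homog 2)
    {g : ↥T2 →ₗ[ℂ] Lam} (h : ∃ f ∈ Z2 w, evalT2 f - g ∈ MB2 w) :
    ∃ f ∈ Z2 (w + 2), evalT2 f - LinearMap.mulLeft ℂ A ∘ₗ g ∈ MB2 (w + 2) := by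
  obtain ⟨f, ⟨⟨h1, h2, h3, h4⟩, hc⟩, h, hh, hfg⟩ := h
  refine ⟨f.compr₂ (LinearMap.mulLeft ℂ A), ⟨⟨fun a x y => ?_, fun a x y => ?_, fun a x y => ?_,
    fun m n x hx y hy => ?_⟩, fun x y z => ?_⟩, fun x => A * h x, fun x => ⟨?_, ?_, ?_⟩, ?_⟩
  · change A * f _ _ = e a * (A * f x y)
    rw [h1, ← mul_assoc, hA, mul_assoc]
  · change A * f _ _ = A * f _ _
    rw [h2]
  · change A * f _ _ = A * f _ _ * e a
    rw [h3, mul_assoc]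
  · change A * f x y ∈ _
    exact mem_homog_of_eq (by ring) (mul_mem_homog hA2 (h4 m n x hx y hy))
  · change x * (A * f y z) - A * f (x * y) z + A * f x (y * z) - A * f x y * z = 0
    rw [← mul_assoc x, ← hA, mul_assoc A, mul_assoc A, ← mul_sub, ← mul_add, ← mul_sub, hc, mul_zero]
  · rw [← mul_assoc, ← hA, mul_assoc, (hh x).1]
  · rw [mul_assoc, (hh x).2.1]
  · exact mem_homog_of_eq (by ring) (mul_mem_homog hA2 (hh x).2.2)
  · refine LinearMap.ext fun r => ?_
    have := congrArg (fun g => A * g r) hfg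
    change A * dM1 h r = A * (evalT2 f r - g r) at this
    change dM1 (fun x => A * h x) r = evalT2 (f.compr₂ (LinearMap.mulLeft ℂ A)) r - A * g r
    rw [mul_sub] at this
    have h1 : evalT2 (f.compr₂ (LinearMap.mulLeft ℂ A)) r = A * evalT2 f r := by
      simp only [evalT2_apply, Finset.mul_sum, mul_smul_comm]
      rfl
    rw [h1, ← this]
    -- A central factor commutes with the differential `dM1`.
    change wordSum _ r.1 = LinearMap.mulLeft ℂ A (wordSum _ r.1)
    rw [wordSum_map]
    congr 2
    ext x y
    rw [LinearMap.mulLeft_apply, mul_add, ← mul_assoc, ← mul_assoc, ← mul_assoc, hA]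

/-! ### Derivations given by matrices and their cup product with the length. -/

/-- The infinitesimal action of a matrix on the arrows. -/
def slDer (Y : Matrix (Fin 3) (Fin 3) ℂ) : Arrow → Lam
  | Sum.inl p => -∑ l, Y p.2 l • ar (Sum.inl (p.1, l))
  | Sum.inr p => ∑ k, Y k p.2 • ar (Sum.inr (p.1, k))

theorem e_tgt_mul_slDer (Y : Matrix (Fin 3) (Fin 3) ℂ) (x : Arrow) :
    e (tgt x) * slDer Y x = slDer Y x := by
  rcases x with p | p
  · simp only [slDer, mul_neg, Finset.mul_sum, mul_smul_comm]
    exact congrArg _ (Finset.sum_congr rfl fun j _ => congrArg _ (e_tgt_mul_ar (Sum.inl (p.1, j))))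
  · simp only [slDer, Finset.mul_sum, mul_smul_comm]
    exact Finset.sum_congr rfl fun j _ => congrArg _ (e_tgt_mul_ar (Sum.inr (p.1, j)))

theorem slDer_mul_e_src (Y : Matrix (Fin 3) (Fin 3) ℂ) (x : Arrow) :
    slDer Y x * e (src x) = slDer Y x := by
  rcases x with p | p
  · simp only [slDer, neg_mul, Finset.sum_mul, smul_mul_assoc]
    exact congrArg _ (Finset.sum_congr rfl fun j _ => congrArg _ (ar_mul_e_src (Sum.inl (p.1, j))))
  · simp only [slDer, Finset.sum_mul, smul_mul_assoc]
    exact Finset.sum_congr rfl fun j _ => congrArg _ (ar_mul_e_src (Sum.inr (p.1, j)))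

theorem len_slDer (Y : Matrix (Fin 3) (Fin 3) ℂ) (x : Arrow) : len (slDer Y x) = slDer Y x := by
  rcases x with p | p <;> simp only [slDer, map_neg, map_sum, map_smul, len_ar]

/-- The infinitesimal form of the invariance of the relations under linear substitutions;
tracelessness of `Y` plays no role. -/
theorem slDerData (Y : Matrix (Fin 3) (Fin 3) ℂ) : DerData e ar (slDer Y) where
  at_tgt := e_tgt_mul_slDer Y
  at_src := slDer_mul_e_src Y
  quad r hr := by
    refine wordSum_eq_zero _ (fun i j => ?_) (fun i j => ?_) (fun i j => ?_) ?_ ?_ ?_ ?_ r hr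
    all_goals simp only [slDer, mul_neg, neg_mul, Finset.mul_sum, Finset.sum_mul, mul_smul_comm,
      smul_mul_assoc]
    · rw [add_comm]
      exact congrArg₂ (fun u v => -u + -v)
        (Finset.sum_congr rfl fun l _ => congrArg _ (rel_zz l j))
        (Finset.sum_congr rfl fun l _ => congrArg _ (rel_zz i l))
    · rw [add_comm]
      exact congrArg₂ (fun u v => u + v)
        (Finset.sum_congr rfl fun l _ => congrArg _ (rel_ww l j))
        (Finset.sum_congr rfl fun l _ => congrArg _ (rel_ww i l))
    · rw [add_comm]
      exact congrArg₂ (fun u v => u + -v)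
        (Finset.sum_congr rfl fun l _ => congrArg _ (rel_wz l j))
        (Finset.sum_congr rfl fun l _ => congrArg _ (rel_wz i l))
    · rw [Finset.sum_add_distrib, Finset.sum_neg_distrib, add_neg_eq_zero, Finset.sum_comm]
    · rw [Finset.sum_add_distrib, Finset.sum_neg_distrib, neg_add_eq_zero, Finset.sum_comm]
    · rw [Finset.sum_add_distrib, Finset.sum_neg_distrib, add_neg_eq_zero, Finset.sum_comm]
    · rw [Finset.sum_add_distrib, Finset.sum_neg_distrib, neg_add_eq_zero, Finset.sum_comm]

/-- The derivation of `Λ` given by a matrix. -/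
def slDeriv (Y : Matrix (Fin 3) (Fin 3) ℂ) : Lam →ₗ[ℂ] Lam := lamDer (slDerData Y)

theorem slDeriv_mul (Y : Matrix (Fin 3) (Fin 3) ℂ) (x y : Lam) :
    slDeriv Y (x * y) = x * slDeriv Y y + slDeriv Y x * y := lamDer_mul _ x y

theorem slDeriv_e (Y : Matrix (Fin 3) (Fin 3) ℂ) (a : Fin 3) : slDeriv Y (e a) = 0 := lamDer_e _ a

theorem slDeriv_ar (Y : Matrix (Fin 3) (Fin 3) ℂ) (x : Arrow) : slDeriv Y (ar x) = slDer Y x :=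
  lamDer_ar _ x

theorem len_slDeriv (Y : Matrix (Fin 3) (Fin 3) ℂ) (x : Lam) :
    len (slDeriv Y x) = slDeriv Y (len x) := by
  induction x using lam_induction with
  | one =>
    have h1 : slDeriv Y 1 = 0 := by rw [← sum_e, map_sum]; simp only [slDeriv_e, Finset.sum_const_zero]
    have h2 : len 1 = 0 := by rw [← sum_e, map_sum]; simp only [len_e, Finset.sum_const_zero]
    rw [h1, h2, map_zero, map_zero]
  | add x y hx hy => simp only [map_add, hx, hy]
  | smul c x hx => simp only [map_smul, hx]
  | e_mul a x hx =>
    simp only [slDeriv_mul, len_mul, slDeriv_e, len_e, zero_mul, add_zero, hx]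
  | ar_mul a x hx =>
    simp only [slDeriv_mul, len_mul, slDeriv_ar, len_ar, len_slDer, map_add, hx]
    abel

/-- The cup product of the length derivation and of the derivation given by a matrix. -/
def lenCup (Y : Matrix (Fin 3) (Fin 3) ℂ) : Lam →ₗ[ℂ] Lam →ₗ[ℂ] Lam :=
  (LinearMap.mul ℂ Lam).compl₁₂ len (slDeriv Y)

theorem lenCup_apply (Y : Matrix (Fin 3) (Fin 3) ℂ) (x y : Lam) :
    lenCup Y x y = len x * slDeriv Y y := rfl

/-- The cup product of two derivations is a cocycle; both derivations preserve the path length. -/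
theorem lenCup_mem (Y : Matrix (Fin 3) (Fin 3) ℂ) : lenCup Y ∈ Z2 0 := by
  refine ⟨mem_C2_of_len (fun a x y => ?_) (fun a x y => ?_) (fun a x y => ?_) (fun x y => ?_),
    fun x y z => ?_⟩
  · simp only [lenCup_apply, len_mul, len_e, zero_mul, add_zero, mul_assoc]
  · simp only [lenCup_apply, len_mul, len_e, mul_zero, zero_add, slDeriv_mul, slDeriv_e, zero_mul,
      add_zero, mul_assoc]
  · simp only [lenCup_apply, slDeriv_mul, slDeriv_e, mul_zero, zero_add, mul_assoc]
  · simp only [lenCup_apply, len_mul, len_slDeriv, Int.cast_zero, zero_smul, add_zero]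
    rw [add_comm]
  · simp only [lenCup_apply, len_mul, slDeriv_mul, mul_add, add_mul, mul_assoc]
    abel

/-- A cochain on the arrows which makes the values of `lenCup` symmetric. -/
def slHalf (Y : Matrix (Fin 3) (Fin 3) ℂ) : Arrow → Lam
  | Sum.inl p => (![-(1 / 2), 1 / 2] p.1 : ℂ) • slDer Y (Sum.inl p)
  | Sum.inr p => (![1 / 2, -(1 / 2)] p.1 : ℂ) • slDer Y (Sum.inr p)

theorem slHalf_mem (Y : Matrix (Fin 3) (Fin 3) ℂ) : slHalf Y ∈ M1 0 := by
  intro x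
  have : ∃ c : ℂ, slHalf Y x = c • slDer Y x := by
    rcases x with x | x <;> exact ⟨_, rfl⟩
  obtain ⟨c, hc⟩ := this
  rw [hc, mul_smul_comm, smul_mul_assoc, e_tgt_mul_slDer, slDer_mul_e_src, mem_homog_iff, map_smul,
    len_slDer]
  simp

theorem HasValues.of_wz {g : ↥T2 →ₗ[ℂ] Lam} {c d b a : Lam} {Z W T : Fin 3 → Fin 3 → Lam}
    (h1 : g zwT11 = c) (h2 : g wzT11 = d) (h3 : g zwT22 = b) (h4 : g wzT00 = a)
    (h5 : ∀ i j, g (zzT i j) = Z i j) (h6 : ∀ i j, g (wwT i j) = W i j)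
    (h7 : ∀ i j, g (wzT i j) = T i j + (if i = j then (1 / 3 : ℂ) else 0) • (d - c)) :
    HasValues g c d b a Z W T :=
  ⟨h1, h2, h3, h4, h5, h6, fun i j => by
    rw [tfT_eq, map_sub, map_smul, map_sub, h1, h2, h7, add_sub_cancel_right]⟩

theorem fold_zz (k l : Fin 3) : ar (Sum.inl (1, k)) * ar (Sum.inl (0, l)) = zzP k l := rfl
theorem fold_ww (k l : Fin 3) : ar (Sum.inr (0, k)) * ar (Sum.inr (1, l)) = wwP k l := rfl
theorem fold_wz11 (i j : Fin 3) : ar (Sum.inr (1, i)) * ar (Sum.inl (1, j)) = wzP11 i j := rfl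
theorem fold_zw11 (i j : Fin 3) : ar (Sum.inl (0, j)) * ar (Sum.inr (0, i)) = wzP11 i j :=
  (rel_wz i j).symm
theorem fold_wz00 (i j : Fin 3) : ar (Sum.inr (0, i)) * ar (Sum.inl (0, j)) = wzP00 i j := rfl
theorem fold_zw22 (i j : Fin 3) : ar (Sum.inl (1, j)) * ar (Sum.inr (1, i)) = zwP22 j i := rfl

/-- The opposite signs in `slHalf` make its coboundary cancel the contractions at the nodes `0` and
`2` and double those at node `1`; hence `U = 2 Y` and `X = 0`. -/
theorem lenCup_values (Y : Traceless) {g : ↥T2 →ₗ[ℂ] Lam} (hg : IsG8 ((2 : ℂ) • Y) 0 g) :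
    evalT2 (lenCup Y.1) + dM1 (slHalf Y.1) = g := by
  have hz : ∀ k l, zzP k l = zzP l k := rel_zz
  have hw : ∀ k l, wwP k l = wwP l k := rel_ww
  rw [evalT2_eq_wordMap, dM1_eq_wordMap]
  refine HasValues.unique (HasValues.of_wz ?_ ?_ ?_ ?_ (fun i j => ?_) (fun i j => ?_) fun i j => ?_) hg
  · rw [LinearMap.add_apply, wordMap_zw11, wordMap_zw11]
    simp only [lenCup_apply, len_ar, slDeriv_ar, slHalf, slDer, Fin.sum_univ_three, mul_add, add_mul,
      mul_neg, neg_mul, mul_smul_comm, smul_mul_assoc, smul_add, smul_neg, fold_zw11]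
    simp
    module
  · rw [LinearMap.add_apply, wordMap_wz11, wordMap_wz11]
    simp only [lenCup_apply, len_ar, slDeriv_ar, slHalf, slDer, Fin.sum_univ_three, mul_add, add_mul,
      mul_neg, neg_mul, mul_smul_comm, smul_mul_assoc, smul_add, smul_neg, fold_wz11]
    simp
    module
  · rw [LinearMap.add_apply, wordMap_zw22, wordMap_zw22]
    simp only [lenCup_apply, len_ar, slDeriv_ar, slHalf, slDer, Fin.sum_univ_three, mul_add, add_mul,
      mul_neg, neg_mul, mul_smul_comm, smul_mul_assoc, smul_add, smul_neg, fold_zw22]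
    simp
    module
  · rw [LinearMap.add_apply, wordMap_wz00, wordMap_wz00]
    simp only [lenCup_apply, len_ar, slDeriv_ar, slHalf, slDer, Fin.sum_univ_three, mul_add, add_mul,
      mul_neg, neg_mul, mul_smul_comm, smul_mul_assoc, smul_add, smul_neg, fold_wz00]
    simp
    module
  · rw [LinearMap.add_apply, wordMap_zz, wordMap_zz]
    simp only [lenCup_apply, len_ar, slDeriv_ar, slHalf, slDer, Fin.sum_univ_three, mul_add, add_mul,
      mul_neg, neg_mul, mul_smul_comm, smul_mul_assoc, smul_add, smul_neg, fold_zz]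
    rw [hz j 0, hz j 1, hz j 2, hz 0 i, hz 1 i, hz 2 i]
    simp
    module
  · rw [LinearMap.add_apply, wordMap_ww, wordMap_ww]
    simp only [lenCup_apply, len_ar, slDeriv_ar, slHalf, slDer, Fin.sum_univ_three, mul_add, add_mul,
      mul_neg, neg_mul, mul_smul_comm, smul_mul_assoc, smul_add, smul_neg, fold_ww]
    rw [hw j 0, hw j 1, hw j 2, hw 0 i, hw 1 i, hw 2 i]
    simp
    module
  · rw [LinearMap.add_apply, wordMap_wz, wordMap_wz]
    simp only [lenCup_apply, len_ar, slDeriv_ar, slHalf, slDer, Fin.sum_univ_three, mul_add, add_mul,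
      mul_neg, neg_mul, mul_smul_comm, smul_mul_assoc, smul_add, smul_neg, fold_wz11, fold_zw11]
    split_ifs
    · simp
      module
    · simp
      module

/-- Multiplying `g_{∅,0}` by the central element `∑ 3 X^i_j w_i z^j` raises the weight from `-2` to
`0`. For `U = 3 X` the trace-free part of the table vanishes, as it does for `g_{∅,0}`. -/
theorem exists_cocycle_G8_center (X : Traceless) {g : ↥T2 →ₗ[ℂ] Lam}
    (hg : IsG8 ((3 : ℂ) • X) X g) : ∃ f ∈ Z2 0, evalT2 f - g ∈ MB2 0 := by
  have h0 : IsG0 (tableMap (e 1) (-e 1) ((1 / 3 : ℂ) • e 2) (-((1 / 3 : ℂ) • e 0)) 0 0 0) :=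
    tableMap_hasValues _ _ _ _ (by simp) (by simp) (by simp)
  obtain ⟨f, hf, h⟩ := exists_cocycle_cent (centU_mul ((3 : ℂ) • X.1)) (centU_mem _)
    (exists_cocycle_G0 h0)
  have hz : ∀ a, centU ((3 : ℂ) • X.1) * e a =
      ∑ i, ∑ j, (3 * X.1 i j) • ![wzP00 i j, wzP11 i j, zwP22 j i] a := fun a => by
    simp only [centU, Finset.sum_mul, smul_mul_assoc, (e_mul_cent _ _ a).2]
    rfl
  refine ⟨f, hf, ?_⟩
  rw [HasValues.unique hg (g' := LinearMap.mulLeft ℂ (centU ((3 : ℂ) • X.1)) ∘ₗ tableMap (e 1) (-e 1)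
    ((1 / 3 : ℂ) • e 2) (-((1 / 3 : ℂ) • e 0)) 0 0 0)
    ⟨?_, ?_, ?_, ?_, fun i j => ?_, fun i j => ?_, fun i j => ?_⟩]
  · exact h
  · rw [LinearMap.comp_apply, h0.on_zw11, LinearMap.mulLeft_apply, hz]
    rfl
  · rw [LinearMap.comp_apply, h0.on_wz11, LinearMap.mulLeft_apply, mul_neg, hz]
    rfl
  · rw [LinearMap.comp_apply, h0.on_zw22, LinearMap.mulLeft_apply, mul_smul_comm, hz]
    simp [Finset.smul_sum, smul_smul]
  · rw [LinearMap.comp_apply, h0.on_wz00, LinearMap.mulLeft_apply, mul_neg, mul_smul_comm, hz]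
    simp [Finset.smul_sum, smul_smul]
  · rw [LinearMap.comp_apply, h0.on_zz]
    simp
  · rw [LinearMap.comp_apply, h0.on_ww]
    simp
  · rw [LinearMap.comp_apply, h0.on_tf]
    have h1 : ∀ k l, 3 * X.1 k l - ((3 : ℂ) • X).1 k l = 0 := fun k l => sub_self _
    have h2 : ∀ k l, 2 * X.1 k l - 2 / 3 * ((3 : ℂ) • X).1 k l = 0 := fun k l => by
      change 2 * X.1 k l - 2 / 3 * (3 * X.1 k l) = 0
      ring
    simp only [h1, h2, zero_smul, Finset.sum_const_zero, smul_zero, sub_zero, add_zero]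
    simp

theorem exists_cocycle_G8_noncentral (U : Traceless) {g : ↥T2 →ₗ[ℂ] Lam} (hg : IsG8 U 0 g) :
    ∃ f ∈ Z2 0, evalT2 f - g ∈ MB2 0 := by
  have h2 : (2 : ℂ) • ((1 / 2 : ℂ) • U) = U := by rw [smul_smul]; norm_num
  rw [← h2] at hg
  refine ⟨lenCup ((1 / 2 : ℂ) • U).1, lenCup_mem _, ?_⟩
  rw [← lenCup_values _ hg, sub_add_cancel_left]
  exact (MB2 0).neg_mem ⟨_, slHalf_mem _, rfl⟩

/-! ### The tables of values as linear maps -/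

theorem coeff_swap01 (D : SymForm) (i j k : Fin 3) : coeff D i j k = coeff D j i k := by
  have h := D.2 (Equiv.swap 0 1) ![Pi.single j 1, Pi.single i 1, Pi.single k 1]
  rw [coeff, coeff, ← h]
  congr 1
  ext t
  fin_cases t <;> rfl

theorem coeff_swap12 (D : SymForm) (i j k : Fin 3) : coeff D i j k = coeff D i k j := by
  have h := D.2 (Equiv.swap 1 2) ![Pi.single i 1, Pi.single k 1, Pi.single j 1]
  rw [coeff, coeff, ← h]
  congr 1
  ext t
  fin_cases t <;> rfl

theorem coeff_add (D E : SymForm) (i j k : Fin 3) :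
    coeff (D + E) i j k = coeff D i j k + coeff E i j k := rfl

theorem coeff_smul (c : ℂ) (D : SymForm) (i j k : Fin 3) :
    coeff (c • D) i j k = c * coeff D i j k := rfl

theorem SymForm.ext_coeff {D E : SymForm} (h : ∀ i j k, coeff D i j k = coeff E i j k) : D = E := by
  refine Subtype.ext (Module.Basis.ext_multilinear (fun _ => Pi.basisFun ℂ (Fin 3)) fun v => ?_)
  have := h (v 0) (v 1) (v 2)
  rw [coeff, coeff] at this
  have hv : (fun i => (Pi.basisFun ℂ (Fin 3)) (v i)) =
      ![Pi.single (v 0) 1, Pi.single (v 1) 1, Pi.single (v 2) (1 : ℂ)] := by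
    ext i
    fin_cases i <;> simp
  rw [hv, this]

theorem eps_swap01 (i j k : Fin 3) : eps i j k = -eps j i k := by
  rw [eps_eq, eps_eq]
  fin_cases i <;> fin_cases j <;> fin_cases k <;> simp

theorem eps_swap12 (i j k : Fin 3) : eps i j k = -eps i k j := by
  rw [eps_eq, eps_eq]
  fin_cases i <;> fin_cases j <;> fin_cases k <;> simp

theorem eps_rotate (i j k : Fin 3) : eps i j k = eps j k i := by
  rw [eps_swap12 j, eps_swap01 j, neg_neg]

theorem sum_eps_symm {M : Type*} [AddCommGroup M] [Module ℂ M] (F : Fin 3 → Fin 3 → M)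
    (hF : ∀ i j, F i j = F j i) (k : Fin 3) : ∑ i, ∑ j, eps i j k • F i j = 0 := by
  have h : ∑ i, ∑ j, eps i j k • F i j = -∑ i, ∑ j, eps i j k • F i j := by
    conv_lhs => rw [Finset.sum_comm]
    simp only [← Finset.sum_neg_distrib, ← neg_smul]
    exact Finset.sum_congr rfl fun i _ => Finset.sum_congr rfl fun j _ => by
      rw [eps_swap01 j i, hF]
  have h2 : (2 : ℂ) • ∑ i, ∑ j, eps i j k • F i j = 0 := by
    rw [two_smul]
    nth_rewrite 1 [h]
    rw [neg_add_cancel]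
  exact (smul_eq_zero_iff_right two_ne_zero).1 h2

/-- The table of the component `10`. -/
def table10 (D : SymForm) : ↥T2 →ₗ[ℂ] Lam :=
  tableMap 0 0 0 0
    (fun i j => ∑ r, ∑ k, ∑ l, (eps i j r * coeff D r k l) • zzP k l) 0
    (fun i j => ∑ r, ∑ k, ∑ l, (eps j l r * coeff D r i k) • wzP11 l k)

theorem table10_spec (D : SymForm) : IsG10 D (table10 D) := by
  refine tableMap_hasValues _ _ _ _ (fun i j => ?_) (by simp) ?_
  · simp only [← Finset.sum_neg_distrib, ← neg_smul, ← neg_mul, ← eps_swap01]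
  -- The trace contracts the antisymmetric symbol with the symmetric form in the indices `r` and
  -- `i`.
  · have h : ∀ k l, ∑ i, ∑ r, (eps i l r * coeff D r i k) • wzP11 l k = 0 := fun k l => by
      rw [Finset.sum_comm]
      have := sum_eps_symm (fun r i => coeff D r i k • wzP11 l k)
        (fun i j => by rw [coeff_swap01]) l
      rw [← this]
      refine Finset.sum_congr rfl fun r _ => Finset.sum_congr rfl fun i _ => ?_
      rw [smul_smul, ← eps_rotate]
    calc _ = ∑ k, ∑ l, ∑ i, ∑ r, (eps i l r * coeff D r i k) • wzP11 l k := by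
          simp only [Fin.sum_univ_three]
          abel
      _ = 0 := Finset.sum_eq_zero fun k _ => Finset.sum_eq_zero fun l _ => h k l

/-- The table of the component `10*`. -/
def table10dual (D : SymForm) : ↥T2 →ₗ[ℂ] Lam :=
  tableMap 0 0 0 0 0
    (fun i j => -∑ r, ∑ k, ∑ l, (eps i j r * coeff D r k l) • wwP k l)
    (fun i j => ∑ r, ∑ k, ∑ l, (eps r i k * coeff D r j l) • wzP11 l k)

theorem table10dual_spec (D : SymForm) : IsG10dual D (table10dual D) := by
  refine tableMap_hasValues _ _ _ _ (by simp) (fun i j => ?_) ?_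
  · simp only [← Finset.sum_neg_distrib, ← neg_smul, ← neg_mul, ← eps_swap01]
  · have h : ∀ k l, ∑ i, ∑ r, (eps r i k * coeff D r i l) • wzP11 l k = 0 := fun k l => by
      rw [Finset.sum_comm]
      have := sum_eps_symm (fun r i => coeff D r i l • wzP11 l k)
        (fun i j => by rw [coeff_swap01]) k
      rw [← this]
      refine Finset.sum_congr rfl fun r _ => Finset.sum_congr rfl fun i _ => ?_
      rw [smul_smul]
    calc _ = ∑ k, ∑ l, ∑ i, ∑ r, (eps r i k * coeff D r i l) • wzP11 l k := by
          simp only [Fin.sum_univ_three]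
          abel
      _ = 0 := Finset.sum_eq_zero fun k _ => Finset.sum_eq_zero fun l _ => h k l

/-- The table of the components `8`. -/
def table8 (U X : Traceless) : ↥T2 →ₗ[ℂ] Lam :=
  tableMap (∑ i, ∑ j, U.1 i j • wzP11 i j) (-∑ i, ∑ j, U.1 i j • wzP11 i j)
    (∑ i, ∑ j, X.1 i j • zwP22 j i) (-∑ i, ∑ j, X.1 i j • wzP00 i j) 0 0
    (fun i j => ∑ k, (3 * X.1 k i - U.1 k i) • wzP11 k j
      + ∑ l, (3 * X.1 j l - U.1 j l) • wzP11 i l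
      - (if i = j then (1 : ℂ) else 0) •
          ∑ k, ∑ l, (2 * X.1 k l - 2 / 3 * U.1 k l) • wzP11 k l)

/-- The coefficient `2 X - (2/3) U` is what makes the trace vanish: the first two terms of the table
contribute `2 (3 X - U)`, the last one three times this coefficient. -/
theorem table8_spec (U X : Traceless) : IsG8 U X (table8 U X) := by
  refine tableMap_hasValues _ _ _ _ (by simp) (by simp) ?_
  simp only [Fin.sum_univ_three, if_true]
  module

theorem table10_add (D E : SymForm) : table10 (D + E) = table10 D + table10 E := by
  refine HasValues.unique (table10_spec _) ?_
  convert (table10_spec D).add (table10_spec E) using 1 <;>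
    simp [funext_iff, coeff_add, mul_add, add_smul, Finset.sum_add_distrib]

theorem table10_smul (c : ℂ) (D : SymForm) : table10 (c • D) = c • table10 D := by
  refine HasValues.unique (table10_spec _) ?_
  convert (table10_spec D).smul c using 1 <;>
    simp [funext_iff, coeff_smul, Finset.smul_sum, smul_smul, mul_left_comm _ c]

theorem table10dual_add (D E : SymForm) :
    table10dual (D + E) = table10dual D + table10dual E := by
  refine HasValues.unique (table10dual_spec _) ?_
  convert (table10dual_spec D).add (table10dual_spec E) using 1 <;>
    simp [funext_iff, coeff_add, mul_add, add_smul, Finset.sum_add_distrib, neg_add]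
  exact fun _ _ => add_comm _ _

theorem table10dual_smul (c : ℂ) (D : SymForm) : table10dual (c • D) = c • table10dual D := by
  refine HasValues.unique (table10dual_spec _) ?_
  convert (table10dual_spec D).smul c using 1 <;>
    simp [funext_iff, coeff_smul, Finset.smul_sum, smul_smul, mul_left_comm _ c]

theorem table8_add (U X U' X' : Traceless) :
    table8 (U + U') (X + X') = table8 U X + table8 U' X' := by
  refine HasValues.unique (table8_spec _ _) ?_
  convert (table8_spec U X).add (table8_spec U' X') using 1
  · simp [add_smul, Finset.sum_add_distrib]
  · simp [add_smul, Finset.sum_add_distrib, add_comm]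
  · simp [add_smul, Finset.sum_add_distrib]
  · simp [add_smul, Finset.sum_add_distrib, add_comm]
  · simp
  · simp
  · funext i j
    simp only [Fin.sum_univ_three, Pi.add_apply, Submodule.coe_add, Matrix.add_apply]
    module

theorem table8_smul (c : ℂ) (U X : Traceless) : table8 (c • U) (c • X) = c • table8 U X := by
  refine HasValues.unique (table8_spec _ _) ?_
  convert (table8_spec U X).smul c using 1
  · simp [Finset.smul_sum, smul_smul]
  · simp [Finset.smul_sum, smul_smul]
  · simp [Finset.smul_sum, smul_smul]
  · simp [Finset.smul_sum, smul_smul]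
  · simp
  · simp
  · funext i j
    simp only [Fin.sum_univ_three, Pi.smul_apply, Submodule.coe_smul, Matrix.smul_apply, smul_eq_mul]
    module

/-- The sum of the representations occurring in weight zero. -/
abbrev Sum4 : Type := SymForm × SymForm × Traceless × Traceless

/-- All tables together. -/
def table : Sum4 →ₗ[ℂ] (↥T2 →ₗ[ℂ] Lam) where
  toFun v := table10 v.1 + table10dual v.2.1 + table8 v.2.2.1 v.2.2.2
  map_add' u v := by
    simp only [Prod.fst_add, Prod.snd_add, table10_add, table10dual_add, table8_add]
    abel
  map_smul' c v := by
    simp only [Prod.smul_fst, Prod.smul_snd, table10_smul, table10dual_smul, table8_smul, smul_add,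
      RingHom.id_apply]

theorem table_apply (v : Sum4) :
    table v = table10 v.1 + table10dual v.2.1 + table8 v.2.2.1 v.2.2.2 := rfl

/-! ### The action of `SL(3)` on cochains on `T_2` -/

section Action

variable {M : Type*} [AddCommGroup M] [Module ℂ M]

/-- The action on the arrows, applied to any family indexed by the arrows. -/
def slSub (s : SL3) (h : Arrow → M) : Arrow → M
  | Sum.inl p => ∑ j, mat s⁻¹ p.2 j • h (Sum.inl (p.1, j))
  | Sum.inr p => ∑ j, mat s j p.2 • h (Sum.inr (p.1, j))

theorem slSub_ar (s : SL3) (x : Arrow) : slSub s ar x = slArrow s x := by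
  rcases x with x | x <;> rfl

theorem map_slSub {M' : Type*} [AddCommGroup M'] [Module ℂ M'] (L : M →ₗ[ℂ] M') (s : SL3)
    (h : Arrow → M) (x : Arrow) : L (slSub s h x) = slSub s (fun y => L (h y)) x := by
  rcases x with x | x <;> simp only [slSub, map_sum, map_smul]

theorem sum_swap {ι ι' : Type*} [Fintype ι] [Fintype ι'] (a : ι → ℂ) (b : ι' → ℂ)
    (F : ι → ι' → M) : ∑ k, ∑ l, (a k * b l) • F k l = ∑ l, ∑ k, (b l * a k) • F k l := by
  rw [Finset.sum_comm]
  exact Finset.sum_congr rfl fun _ _ => Finset.sum_congr rfl fun _ _ => by rw [mul_comm]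

/-- A single arrow as a coefficient vector. -/
def arrowVec (x : Arrow) : Arrow → ℂ := Pi.single x 1

/-- The product of two coefficient vectors. -/
def outer : (Arrow → ℂ) →ₗ[ℂ] (Arrow → ℂ) →ₗ[ℂ] Word2 :=
  LinearMap.mk₂ ℂ (fun u v x y => u x * v y)
    (fun u u' v => by ext x y; exact add_mul _ _ _)
    (fun c u v => by ext x y; exact mul_assoc _ _ _)
    (fun u v v' => by ext x y; exact mul_add _ _ _)
    (fun c u v => by ext x y; exact mul_left_comm _ _ _)

theorem outer_arrowVec (x y : Arrow) : outer (arrowVec x) (arrowVec y) = pair x y := by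
  ext a b
  change arrowVec x a * arrowVec y b = pair x y a b
  simp only [arrowVec, pair, Pi.single_apply]
  split_ifs with h1 h2 <;> simp [*, Pi.single_apply]

/-- Linear extension of a family indexed by the arrows. -/
def arrowLin (h : Arrow → M) : (Arrow → ℂ) →ₗ[ℂ] M where
  toFun u := ∑ x, u x • h x
  map_add' u v := by simp only [Pi.add_apply, add_smul, Finset.sum_add_distrib]
  map_smul' c u := by simp only [Pi.smul_apply, smul_eq_mul, mul_smul, Finset.smul_sum, RingHom.id_apply]

theorem arrowLin_arrowVec (h : Arrow → M) (x : Arrow) : arrowLin h (arrowVec x) = h x := by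
  change ∑ y, arrowVec x y • h y = _
  rw [Finset.sum_eq_single x] <;> simp +contextual [arrowVec]

theorem arrowLin_slSub (s : SL3) (h : Arrow → M) (x : Arrow) :
    arrowLin h (slSub s arrowVec x) = slSub s h x := by
  rw [map_slSub]
  simp only [arrowLin_arrowVec]

theorem wordSum_outer (B : Lam →ₗ[ℂ] Lam →ₗ[ℂ] M) (h h' : Arrow → Lam) (u v : Arrow → ℂ) :
    wordSum (fun x y => B (h x) (h' y)) (outer u v) = B (arrowLin h u) (arrowLin h' v) := by
  rw [wordSum_apply]
  change ∑ x, ∑ y, (u x * v y) • B (h x) (h' y) = B (∑ x, u x • h x) (∑ y, v y • h' y)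
  simp only [map_sum, map_smul, LinearMap.sum_apply, LinearMap.smul_apply, Finset.smul_sum, smul_smul]
  exact sum_swap u v fun x y => B (h x) (h' y)

end Action

/-! ### The action on relations and on their cochains. -/

/-- The action of `SL(3)` on combinations of words. -/
def wordAct (s : SL3) : Word2 →ₗ[ℂ] Word2 :=
  wordSum fun x y => outer (slSub s arrowVec x) (slSub s arrowVec y)

theorem wordAct_pair (s : SL3) (x y : Arrow) :
    wordAct s (pair x y) = outer (slSub s arrowVec x) (slSub s arrowVec y) := wordSum_pair _ _ _

theorem outer_sum (a b : Fin 3 → ℂ) (x y : Fin 3 → Arrow) :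
    outer (∑ k, a k • arrowVec (x k)) (∑ l, b l • arrowVec (y l)) =
      ∑ k, ∑ l, (a k * b l) • pair (x k) (y l) := by
  simp only [map_sum, map_smul, LinearMap.sum_apply, LinearMap.smul_apply, outer_arrowVec,
    Finset.smul_sum, smul_smul]
  exact sum_swap b a fun l k => pair (x k) (y l)

theorem wordAct_zz (s : SL3) (i j : Fin 3) : wordAct s (zzRel i j) =
    ∑ k, ∑ l, (mat s⁻¹ i k * mat s⁻¹ j l) • zzRel k l := by
  simp only [zzRel, map_sub, wordAct_pair, slSub]
  rw [outer_sum (mat s⁻¹ i) (mat s⁻¹ j) z21 z10, outer_sum (mat s⁻¹ j) (mat s⁻¹ i) z21 z10]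
  simp only [smul_sub, Finset.sum_sub_distrib]
  exact congrArg (_ - ·) (sum_swap (mat s⁻¹ j) (mat s⁻¹ i) fun k l => pair (z21 k) (z10 l))

theorem wordAct_ww (s : SL3) (i j : Fin 3) : wordAct s (wwRel i j) =
    ∑ k, ∑ l, (mat s k i * mat s l j) • wwRel k l := by
  simp only [wwRel, map_sub, wordAct_pair, slSub]
  rw [outer_sum (fun k => mat s k i) (fun k => mat s k j) w01 w12,
    outer_sum (fun k => mat s k j) (fun k => mat s k i) w01 w12]
  simp only [smul_sub, Finset.sum_sub_distrib]
  exact congrArg (_ - ·) (sum_swap (fun k => mat s k j) (fun k => mat s k i) fun k l => pair (w01 k) (w12 l))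

theorem wordAct_wz (s : SL3) (i j : Fin 3) : wordAct s (wzRel i j) =
    ∑ k, ∑ l, (mat s k i * mat s⁻¹ j l) • wzRel k l := by
  simp only [wzRel, map_sub, wordAct_pair, slSub]
  rw [outer_sum (fun k => mat s k i) (mat s⁻¹ j) w12 z21,
    outer_sum (mat s⁻¹ j) (fun k => mat s k i) z10 w01]
  simp only [smul_sub, Finset.sum_sub_distrib]
  exact congrArg (_ - ·) (sum_swap (mat s⁻¹ j) (fun k => mat s k i) fun k l => pair (z10 k) (w01 l))

theorem sum_contract {M : Type*} [AddCommGroup M] [Module ℂ M] (s : SL3) (F : Fin 3 → Fin 3 → M) :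
    ∑ i, ∑ k, ∑ l, (mat s k i * mat s⁻¹ i l) • F k l = ∑ k, F k k := by
  rw [Finset.sum_comm]
  refine Finset.sum_congr rfl fun k _ => ?_
  rw [Finset.sum_comm]
  simp only [← Finset.sum_smul, sum_mat_mul_inv, ite_smul, one_smul, zero_smul,
    Finset.sum_ite_eq, Finset.mem_univ, if_true]

theorem wordAct_contract (s : SL3) (a : Fin 2) :
    wordAct s (∑ i, pair (Sum.inl (a, i)) (Sum.inr (a, i))) =
      ∑ i, pair (Sum.inl (a, i)) (Sum.inr (a, i)) := by
  rw [map_sum]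
  simp only [wordAct_pair, slSub]
  have h : ∀ i, outer (∑ k, mat s⁻¹ i k • arrowVec (Sum.inl (a, k)))
      (∑ k, mat s k i • arrowVec (Sum.inr (a, k))) = ∑ k, ∑ l, (mat s k i * mat s⁻¹ i l) •
        pair (Sum.inl (a, l)) (Sum.inr (a, k)) := fun i => by
    rw [outer_sum (mat s⁻¹ i) (fun k => mat s k i) (fun k => Sum.inl (a, k))
      (fun k => Sum.inr (a, k))]
    exact sum_swap _ _ fun l k => pair (Sum.inl (a, l)) (Sum.inr (a, k))
  refine (Finset.sum_congr rfl fun i _ => h i).trans ?_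
  exact sum_contract s fun k l => pair (Sum.inl (a, l)) (Sum.inr (a, k))

theorem wordAct_contract' (s : SL3) (a : Fin 2) :
    wordAct s (∑ i, pair (Sum.inr (a, i)) (Sum.inl (a, i))) =
      ∑ i, pair (Sum.inr (a, i)) (Sum.inl (a, i)) := by
  rw [map_sum]
  simp only [wordAct_pair, slSub]
  have h : ∀ i, outer (∑ k, mat s k i • arrowVec (Sum.inr (a, k)))
      (∑ k, mat s⁻¹ i k • arrowVec (Sum.inl (a, k))) = ∑ k, ∑ l, (mat s k i * mat s⁻¹ i l) •
        pair (Sum.inr (a, k)) (Sum.inl (a, l)) := fun i =>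
    outer_sum (fun k => mat s k i) (mat s⁻¹ i) (fun k => Sum.inr (a, k)) (fun k => Sum.inl (a, k))
  refine (Finset.sum_congr rfl fun i _ => h i).trans ?_
  exact sum_contract s fun k l => pair (Sum.inr (a, k)) (Sum.inl (a, l))

theorem mem_of_eq {r r' : Word2} (h : r = r') (hr : r' ∈ T2) : r ∈ T2 := h ▸ hr

theorem wordAct_mem (s : SL3) : ∀ r ∈ T2, wordAct s r ∈ T2 := by
  intro r hr
  refine (Submodule.span_le (p := T2.comap (wordAct s))).2 ?_ hr
  rintro r (⟨i, j, rfl⟩ | ⟨i, j, rfl⟩ | ⟨i, j, rfl⟩ | rfl | rfl | rfl | rfl)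
  · change wordAct s _ ∈ T2
    rw [wordAct_zz]
    exact T2.sum_mem fun k _ => T2.sum_mem fun l _ => T2.smul_mem _ (zzT k l).2
  · change wordAct s _ ∈ T2
    rw [wordAct_ww]
    exact T2.sum_mem fun k _ => T2.sum_mem fun l _ => T2.smul_mem _ (wwT k l).2
  · change wordAct s _ ∈ T2
    rw [wordAct_wz]
    exact T2.sum_mem fun k _ => T2.sum_mem fun l _ => T2.smul_mem _ (wzT k l).2
  · exact mem_of_eq (wordAct_contract s 0) zwT11.2
  · exact mem_of_eq (wordAct_contract' s 1) wzT11.2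
  · exact mem_of_eq (wordAct_contract s 1) zwT22.2
  · exact mem_of_eq (wordAct_contract' s 0) wzT00.2

/-- The action of `SL(3)` on `T_2`. -/
def relAct (s : SL3) : ↥T2 →ₗ[ℂ] ↥T2 := (wordAct s).restrict (wordAct_mem s)

theorem relAct_zw11 (s : SL3) : relAct s zwT11 = zwT11 := Subtype.ext (wordAct_contract s 0)
theorem relAct_wz11 (s : SL3) : relAct s wzT11 = wzT11 := Subtype.ext (wordAct_contract' s 1)
theorem relAct_zw22 (s : SL3) : relAct s zwT22 = zwT22 := Subtype.ext (wordAct_contract s 1)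
theorem relAct_wz00 (s : SL3) : relAct s wzT00 = wzT00 := Subtype.ext (wordAct_contract' s 0)

theorem relAct_zz (s : SL3) (i j : Fin 3) :
    relAct s (zzT i j) = ∑ k, ∑ l, (mat s⁻¹ i k * mat s⁻¹ j l) • zzT k l := by
  refine Subtype.ext ((wordAct_zz s i j).trans ?_)
  simp only [AddSubmonoidClass.coe_finset_sum, Submodule.coe_smul]
  rfl

theorem relAct_ww (s : SL3) (i j : Fin 3) :
    relAct s (wwT i j) = ∑ k, ∑ l, (mat s k i * mat s l j) • wwT k l := by
  refine Subtype.ext ((wordAct_ww s i j).trans ?_)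
  simp only [AddSubmonoidClass.coe_finset_sum, Submodule.coe_smul]
  rfl

theorem relAct_wz (s : SL3) (i j : Fin 3) :
    relAct s (wzT i j) = ∑ k, ∑ l, (mat s k i * mat s⁻¹ j l) • wzT k l := by
  refine Subtype.ext ((wordAct_wz s i j).trans ?_)
  simp only [AddSubmonoidClass.coe_finset_sum, Submodule.coe_smul]
  rfl

theorem relAct_tf (s : SL3) (i j : Fin 3) :
    relAct s (tfT i j) = ∑ k, ∑ l, (mat s k i * mat s⁻¹ j l) • tfT k l := by
  have h : ∀ k l, tfT k l = wzT k l - (if k = l then (1 / 3 : ℂ) else 0) • (wzT11 - zwT11) :=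
    fun _ _ => rfl
  simp only [h, map_sub, map_smul, relAct_wz, relAct_wz11, relAct_zw11, smul_sub,
    Finset.sum_sub_distrib]
  have h2 : ∀ y : T2, ∑ k, ∑ l, (mat s k i * mat s⁻¹ j l) • (if k = l then (1 / 3 : ℂ) else 0) • y =
      (if i = j then (1 / 3 : ℂ) else 0) • y := fun y => by
    have h3 := sum_mat_mul_inv s⁻¹ j i
    rw [inv_inv] at h3
    have h4 : ∀ k, ∑ l, (mat s k i * mat s⁻¹ j l) • (if k = l then (1 / 3 : ℂ) else 0) • y =
        (mat s⁻¹ j k * mat s k i) • (1 / 3 : ℂ) • y := fun k => by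
      rw [Finset.sum_eq_single k]
      · rw [if_pos rfl, mul_comm]
      · intro l _ hl
        rw [if_neg (Ne.symm hl), zero_smul, smul_zero]
      · simp
    simp only [h4]
    rw [← Finset.sum_smul, h3]
    by_cases hij : i = j
    · rw [if_pos hij, if_pos hij.symm, one_smul]
    · rw [if_neg hij, if_neg (Ne.symm hij), zero_smul, zero_smul]
  rw [h2, h2]

/-- The action of `SL(3)` on cochains on `T_2`. -/
def tabAct (s : SL3) : (↥T2 →ₗ[ℂ] Lam) →ₗ[ℂ] (↥T2 →ₗ[ℂ] Lam) :=
  LinearMap.lcomp ℂ Lam (relAct s⁻¹) ∘ₗ LinearMap.llcomp ℂ T2 Lam Lam (slHom s).toLinearMap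

theorem tabAct_apply (s : SL3) (g : ↥T2 →ₗ[ℂ] Lam) (r : T2) :
    tabAct s g r = slHom s (g (relAct s⁻¹ r)) := rfl

/-- Transporting the words amounts to transporting the families to which they are applied;
`tabAct_evalT2` and `tabAct_dM1` follow formally. -/
theorem wordSum_wordAct {M : Type*} [AddCommGroup M] [Module ℂ M] (B : Lam →ₗ[ℂ] Lam →ₗ[ℂ] M)
    (h h' : Arrow → Lam) (s : SL3) (r : Word2) :
    wordSum (fun x y => B (h x) (h' y)) (wordAct s r) =
      wordSum (fun x y => B (slSub s h x) (slSub s h' y)) r := by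
  rw [wordAct, wordSum_map]
  simp only [wordSum_outer, arrowLin_slSub]

theorem tabAct_evalT2 (s : SL3) (f : Lam →ₗ[ℂ] Lam →ₗ[ℂ] Lam) :
    tabAct s (evalT2 f) = evalT2 (cochainRep s f) := by
  refine LinearMap.ext fun r => ?_
  rw [tabAct_apply]
  change (slHom s).toLinearMap (wordSum (fun x y => f (ar x) (ar y)) (wordAct s⁻¹ r.1)) =
    wordSum (fun x y => cochainRep s f (ar x) (ar y)) r.1
  rw [wordSum_wordAct, wordSum_map]
  congr 2
  ext x y
  rw [cochainRep_apply, slHom_ar, slHom_ar, slSub_ar, slSub_ar]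
  rfl

theorem slHom_slSub_inv (s : SL3) (x : Arrow) : slHom s (slSub s⁻¹ ar x) = ar x := by
  rw [slSub_ar, ← slHom_ar, slHom_inv_apply]

theorem tabAct_dM1 (s : SL3) (h : Arrow → Lam) :
    tabAct s (dM1 h) = dM1 fun x => slHom s (slSub s⁻¹ h x) := by
  refine LinearMap.ext fun r => ?_
  rw [tabAct_apply]
  change (slHom s).toLinearMap (wordSum (fun x y => ar x * h y + h x * ar y) (wordAct s⁻¹ r.1)) =
    wordSum (fun x y => ar x * slHom s (slSub s⁻¹ h y) + slHom s (slSub s⁻¹ h x) * ar y) r.1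
  have h1 := wordSum_wordAct (LinearMap.mul ℂ Lam) ar h s⁻¹ r.1
  have h2 := wordSum_wordAct (LinearMap.mul ℂ Lam) h ar s⁻¹ r.1
  simp only [LinearMap.mul_apply'] at h1 h2
  rw [wordSum_add, wordSum_add, h1, h2, map_add, wordSum_map, wordSum_map]
  simp only [AlgHom.toLinearMap_apply, map_mul, slHom_slSub_inv]

theorem tabAct_MB2 (s : SL3) (w : ℤ) {g : ↥T2 →ₗ[ℂ] Lam} (hg : g ∈ MB2 w) :
    tabAct s g ∈ MB2 w := by
  obtain ⟨h, hh, rfl⟩ := hg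
  refine ⟨fun x => slHom s (slSub s⁻¹ h x), fun x => ?_, (tabAct_dM1 s h).symm⟩
  have h1 : slSub s⁻¹ h x ∈ homog (1 + w) := by
    rcases x with p | p <;>
      exact Submodule.sum_mem _ fun j _ => Submodule.smul_mem _ _ (hh _).2.2
  have h2 : e (tgt x) * slSub s⁻¹ h x = slSub s⁻¹ h x := by
    rcases x with p | p <;> simp only [slSub, Finset.mul_sum, mul_smul_comm]
    · exact Finset.sum_congr rfl fun j _ => congrArg _ (hh (Sum.inl (p.1, j))).1
    · exact Finset.sum_congr rfl fun j _ => congrArg _ (hh (Sum.inr (p.1, j))).1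
  have h3 : slSub s⁻¹ h x * e (src x) = slSub s⁻¹ h x := by
    rcases x with p | p <;> simp only [slSub, Finset.sum_mul, smul_mul_assoc]
    · exact Finset.sum_congr rfl fun j _ => congrArg _ (hh (Sum.inl (p.1, j))).2.1
    · exact Finset.sum_congr rfl fun j _ => congrArg _ (hh (Sum.inr (p.1, j))).2.1
  refine ⟨?_, ?_, slHom_homog s _ h1⟩
  · rw [← slHom_e s, ← map_mul, h2]
  · rw [← slHom_e s, ← map_mul, h3]

/-! ### Cubes -/

/-- The cube of a vector, as a symmetric trilinear form. -/
def cube (v : Vec) : SymForm :=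
  ⟨(MultilinearMap.mkPiAlgebra ℂ (Fin 3) ℂ).compLinearMap fun _ => dotProductBilin ℂ ℂ v,
    fun σ u => by
      simp only [MultilinearMap.compLinearMap_apply, MultilinearMap.mkPiAlgebra_apply]
      exact Equiv.prod_comp σ fun i => dotProductBilin ℂ ℂ v (u i)⟩

theorem cube_apply (v : Vec) (u : Fin 3 → Vec) : (cube v).1 u = ∏ i, v ⬝ᵥ u i := rfl

theorem coeff_cube (v : Vec) (i j k : Fin 3) : coeff (cube v) i j k = v i * v j * v k := by
  rw [coeff, cube_apply, Fin.prod_univ_three]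
  simp

theorem pullback_cube (A : Matrix (Fin 3) (Fin 3) ℂ) (v : Vec) :
    pullback A (cube v) = cube (v ᵥ* A) := by
  refine Subtype.ext (MultilinearMap.ext fun u => ?_)
  change ∏ i, v ⬝ᵥ (A *ᵥ u i) = ∏ i, (v ᵥ* A) ⬝ᵥ u i
  simp only [Matrix.dotProduct_mulVec]

theorem span_cube : Submodule.span ℂ (Set.range cube) = ⊤ := by
  rw [eq_top_iff]
  intro D _
  set b : Fin 3 → Vec := fun i => Pi.single i 1
  -- Polarisation over the four sign patterns with product `1`: all terms other than the mixed
  -- product cancel, and that one appears `4 * 6 = 24` times.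
  have h : D = ∑ i, ∑ j, ∑ k, (coeff D i j k / 24) • (cube (b i + b j + b k) +
      cube (b i - b j - b k) + cube (-b i + b j - b k) + cube (-b i - b j + b k)) := by
    have hc : ∀ (i j k p q r : Fin 3), coeff (cube (b i + b j + b k) +
      cube (b i - b j - b k) + cube (-b i + b j - b k) + cube (-b i - b j + b k)) p q r =
      4 * (b i p * b j q * b k r + b i p * b k q * b j r + b j p * b i q * b k r +
        b j p * b k q * b i r + b k p * b i q * b j r + b k p * b j q * b i r) := by
      intro i j k p q r
      simp only [coeff_add, coeff_cube, Pi.add_apply, Pi.sub_apply, Pi.neg_apply]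
      ring
    refine SymForm.ext_coeff fun p q r => ?_
    have hs : ∀ F : Fin 3 → SymForm, coeff (∑ i, F i) p q r = ∑ i, coeff (F i) p q r := fun F => by
      simp only [Fin.sum_univ_three, coeff_add]
    simp only [hs, coeff_smul, hc]
    have hb : ∀ i p, b i p = if p = i then 1 else 0 := fun i p => Pi.single_apply _ _ _
    simp only [hb, mul_add, Finset.sum_add_distrib]
    simp only [mul_ite, mul_one, mul_zero, ite_mul, zero_mul, Finset.sum_ite_eq, Finset.mem_univ,
      if_true, ite_self]
    simp
    have e1 := coeff_swap01 D p q r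
    have e2 := coeff_swap12 D p q r
    have e3 := coeff_swap01 D p r q
    have e4 := coeff_swap12 D q p r
    have e5 := coeff_swap12 D r p q
    simp only [← e5, ← e4, ← e3, ← e2, ← e1]
    ring
  rw [h]
  have hm : ∀ v, cube v ∈ Submodule.span ℂ (Set.range cube) := fun v => Submodule.subset_span ⟨v, rfl⟩
  exact Submodule.sum_mem _ fun i _ => Submodule.sum_mem _ fun j _ => Submodule.sum_mem _ fun k _ =>
    Submodule.smul_mem _ _ (Submodule.add_mem _ (Submodule.add_mem _ (Submodule.add_mem _ (hm _) (hm _))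
      (hm _)) (hm _))

theorem cube_smul (c : ℂ) (v : Vec) : cube (c • v) = c ^ 3 • cube v := by
  refine SymForm.ext_coeff fun i j k => ?_
  simp only [coeff_smul, coeff_cube, Pi.smul_apply, smul_eq_mul]
  ring

/-- A space of symmetric forms which is stable under unimodular substitutions and contains the
cube of a coordinate is everything. -/
theorem eq_top_of_pullback {S : Submodule ℂ SymForm} (i : Fin 3)
    (hS : ∀ A : Matrix (Fin 3) (Fin 3) ℂ, A.det = 1 → ∀ D ∈ S, pullback A D ∈ S)
    (hi : cube (Pi.single i 1) ∈ S) : S = ⊤ := by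
  have h1 : ∀ u : Vec, u i = 1 → cube u ∈ S := fun u hu => by
    -- The identity with row `i` replaced by `u` is unimodular because `u i = 1`, and it carries the
    -- coordinate `i` to the linear form `u`.
    have hd : ((1 : Matrix (Fin 3) (Fin 3) ℂ).updateRow i u).det = 1 := by
      rw [Matrix.det_fin_three]
      fin_cases i <;> simp at hu <;> simp [Matrix.updateRow_apply, Matrix.one_apply, hu]
    have := hS _ hd _ hi
    rw [pullback_cube, Matrix.single_one_vecMul] at this
    convert this
    exact Matrix.updateRow_self.symm
  have h2 : ∀ u : Vec, u i ≠ 0 → cube u ∈ S := fun u hu => by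
    have : cube u = (u i) ^ 3 • cube ((u i)⁻¹ • u) := by
      rw [← cube_smul, smul_inv_smul₀ hu]
    rw [this]
    exact S.smul_mem _ (h1 _ (inv_mul_cancel₀ hu))
  have h3 : ∀ u : Vec, cube u ∈ S := fun u => by
    by_cases hu : u i = 0
    -- If `u i = 0`, move off this hyperplane in the direction `b`. The sums over `±b` and over
    -- `±2b` contain `6 u b²` and `24 u b²`, which cancel with the weights `4` and `-1`, leaving `6
    -- u³`.
    · have e : ∀ b : Vec, cube u = (1 / 6 : ℂ) • ((4 : ℂ) • (cube (u + b) + cube (u + (-1 : ℂ) • b)) -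
          (cube (u + (2 : ℂ) • b) + cube (u + (-2 : ℂ) • b))) := fun b => by
        refine SymForm.ext_coeff fun p q r => ?_
        rw [sub_eq_add_neg, ← neg_one_smul ℂ (cube (u + (2 : ℂ) • b) + _)]
        simp only [coeff_smul, coeff_add, coeff_cube, Pi.add_apply, Pi.smul_apply, smul_eq_mul]
        ring
      rw [e (Pi.single i 1)]
      refine S.smul_mem _ (S.sub_mem (S.smul_mem _ (S.add_mem (h2 _ ?_) (h2 _ ?_)))
        (S.add_mem (h2 _ ?_) (h2 _ ?_))) <;> simp [hu]
    · exact h2 u hu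
  rw [← top_le_iff, ← span_cube, Submodule.span_le]
  rintro _ ⟨v, rfl⟩
  exact h3 v

/-! ### Equivariance of the tables -/

/-- The combination of the arrows `z` with given coefficients. -/
def zv (t : Fin 2) (v : Vec) : Lam := ∑ a, v a • ar (Sum.inl (t, a))
/-- The combination of the arrows `w` with given coefficients. -/
def wv (t : Fin 2) (v : Vec) : Lam := ∑ a, v a • ar (Sum.inr (t, a))

theorem slHom_zv (s : SL3) (t : Fin 2) (v : Vec) : slHom s (zv t v) = zv t (v ᵥ* mat s⁻¹) := by
  simp only [zv, map_sum, map_smul, slHom_ar, slArrow, Finset.smul_sum, smul_smul, Matrix.vecMul,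
    dotProduct, Finset.sum_smul]
  exact Finset.sum_comm

theorem slHom_wv (s : SL3) (t : Fin 2) (v : Vec) : slHom s (wv t v) = wv t (mat s *ᵥ v) := by
  simp only [wv, map_sum, map_smul, slHom_ar, slArrow, Finset.smul_sum, smul_smul, Matrix.mulVec,
    dotProduct, Finset.sum_smul, mul_comm (v _)]
  exact Finset.sum_comm

theorem sum_smul_wv (c : Vec) (t : Fin 2) (F : Fin 3 → Vec) :
    ∑ l, c l • wv t (F l) = wv t fun p => ∑ l, c l * F l p := by
  simp only [wv, Finset.smul_sum, smul_smul, Finset.sum_smul]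
  exact Finset.sum_comm

theorem sum_smul_zv (c : Vec) (t : Fin 2) (F : Fin 3 → Vec) :
    ∑ l, c l • zv t (F l) = zv t fun p => ∑ l, c l * F l p := by
  simp only [zv, Finset.smul_sum, smul_smul, Finset.sum_smul]
  exact Finset.sum_comm

/-- The skew matrix of the cross product with a vector. -/
def epsVec (v : Vec) (i j : Fin 3) : ℂ := ∑ r, eps i j r * v r

/-- Invariance of the Levi-Civita symbol: contraction with three copies of `A` multiplies it by the
determinant. -/
theorem epsVec_vecMul {A : Matrix (Fin 3) (Fin 3) ℂ} (hA : A.det = 1) (v : Vec) (i j : Fin 3) :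
    ∑ k, ∑ l, (A i k * A j l) * epsVec (v ᵥ* A) k l = epsVec v i j := by
  rw [Matrix.det_fin_three] at hA
  have h : ∀ k, (v ᵥ* A) k = v 0 * A 0 k + v 1 * A 1 k + v 2 * A 2 k := fun k => by
    rw [Matrix.vecMul, dotProduct, Fin.sum_univ_three]
  simp only [epsVec, h, Fin.sum_univ_three, eps_eq]
  fin_cases i <;> fin_cases j <;> simp
  · ring
  · linear_combination v 2 * hA
  · linear_combination -v 1 * hA
  · linear_combination -v 2 * hA
  · ring
  · linear_combination v 0 * hA
  · linear_combination v 1 * hA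
  · linear_combination -v 0 * hA
  · ring

/-- On a cube the table factors into linear combinations of arrows, so its transformation under
`SL(3)` is read off from vectors. This suffices because cubes span. -/
theorem isG10_cube (v : Vec) (g : ↥T2 →ₗ[ℂ] Lam) : IsG10 (cube v) g ↔ HasValues g 0 0 0 0
    (fun i j => epsVec v i j • (zv 1 v * zv 0 v)) 0
    (fun i j => v i • (wv 1 (epsVec v j) * zv 1 v)) := by
  have h1 : (fun i j => ∑ r, ∑ k, ∑ l, (eps i j r * coeff (cube v) r k l) • zzP k l) =
      fun i j => epsVec v i j • (zv 1 v * zv 0 v) := by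
    funext i j
    simp only [epsVec, zv, Finset.sum_mul, Finset.mul_sum, smul_mul_assoc, mul_smul_comm,
      Finset.sum_smul, Finset.smul_sum, smul_smul, coeff_cube, zzP]
    simp only [Fin.sum_univ_three]
    module
  have h2 : (fun i j => ∑ r, ∑ k, ∑ l, (eps j l r * coeff (cube v) r i k) • wzP11 l k) =
      fun i j => v i • (wv 1 (epsVec v j) * zv 1 v) := by
    funext i j
    simp only [epsVec, zv, wv, Finset.sum_mul, Finset.mul_sum, smul_mul_assoc, mul_smul_comm,
      Finset.sum_smul, Finset.smul_sum, smul_smul, coeff_cube, wzP11]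
    simp only [Fin.sum_univ_three]
    module
  rw [IsG10, h1, h2]

theorem isG10dual_cube (v : Vec) (g : ↥T2 →ₗ[ℂ] Lam) : IsG10dual (cube v) g ↔ HasValues g 0 0 0 0
    0 (fun i j => -(epsVec v i j • (wv 0 v * wv 1 v)))
    (fun i j => v j • (wv 1 v * zv 1 (epsVec v i))) := by
  have h1 : (fun i j => -∑ r, ∑ k, ∑ l, (eps i j r * coeff (cube v) r k l) • wwP k l) =
      fun i j => -(epsVec v i j • (wv 0 v * wv 1 v)) := by
    funext i j
    simp only [epsVec, wv, Finset.sum_mul, Finset.mul_sum, smul_mul_assoc, mul_smul_comm,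
      Finset.sum_smul, Finset.smul_sum, smul_smul, coeff_cube, wwP]
    simp only [Fin.sum_univ_three]
    module
  have h2 : (fun i j => ∑ r, ∑ k, ∑ l, (eps r i k * coeff (cube v) r j l) • wzP11 l k) =
      fun i j => v j • (wv 1 v * zv 1 (epsVec v i)) := by
    funext i j
    simp only [eps_rotate _ i, epsVec, zv, wv, Finset.sum_mul, Finset.mul_sum, smul_mul_assoc, mul_smul_comm,
      Finset.sum_smul, Finset.smul_sum, smul_smul, coeff_cube, wzP11]
    simp only [Fin.sum_univ_three]
    module
  rw [IsG10dual, h1, h2]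

theorem tabAct_hasValues (s : SL3) {g : ↥T2 →ₗ[ℂ] Lam} {c d b a : Lam}
    {Z W T : Fin 3 → Fin 3 → Lam} (h : HasValues g c d b a Z W T) :
    HasValues (tabAct s g) (slHom s c) (slHom s d) (slHom s b) (slHom s a)
      (fun i j => ∑ k, ∑ l, (mat s i k * mat s j l) • slHom s (Z k l))
      (fun i j => ∑ k, ∑ l, (mat s⁻¹ k i * mat s⁻¹ l j) • slHom s (W k l))
      (fun i j => ∑ k, ∑ l, (mat s⁻¹ k i * mat s j l) • slHom s (T k l)) where
  on_zw11 := by rw [tabAct_apply, relAct_zw11, h.on_zw11]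
  on_wz11 := by rw [tabAct_apply, relAct_wz11, h.on_wz11]
  on_zw22 := by rw [tabAct_apply, relAct_zw22, h.on_zw22]
  on_wz00 := by rw [tabAct_apply, relAct_wz00, h.on_wz00]
  on_zz i j := by
    rw [tabAct_apply, relAct_zz, inv_inv]
    simp only [map_sum, map_smul, h.on_zz]
  on_ww i j := by
    rw [tabAct_apply, relAct_ww]
    simp only [map_sum, map_smul, h.on_ww]
  on_tf i j := by
    rw [tabAct_apply, relAct_tf, inv_inv]
    simp only [map_sum, map_smul, h.on_tf]

theorem mat_inv_mul (s : SL3) : mat s⁻¹ * mat s = 1 := by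
  rw [← mat_mul, inv_mul_cancel, mat_one]

theorem det_mat (s : SL3) : (mat s).det = 1 := s.2

theorem tabAct_isG10 (s : SL3) (v : Vec) {g : ↥T2 →ₗ[ℂ] Lam} (hg : IsG10 (cube v) g) :
    IsG10 (cube (v ᵥ* mat s⁻¹)) (tabAct s g) := by
  rw [isG10_cube] at hg ⊢
  convert tabAct_hasValues s hg using 1
  · rw [map_zero]
  · rw [map_zero]
  · rw [map_zero]
  · rw [map_zero]
  · funext i j
    simp only [map_smul, map_mul, slHom_zv, smul_smul, ← Finset.sum_smul]
    have := epsVec_vecMul (det_mat s) (v ᵥ* mat s⁻¹) i j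
    rw [Matrix.vecMul_vecMul, mat_inv_mul, Matrix.vecMul_one] at this
    rw [this]
  · funext i j
    simp
  · funext i j
    simp only [map_smul, map_mul, slHom_zv, slHom_wv]
    have h1 : ∀ k l, (mat s⁻¹ k i * mat s j l) • v k • (wv 1 (mat s *ᵥ epsVec v l) *
        zv 1 (v ᵥ* mat s⁻¹)) = (v k * mat s⁻¹ k i) • (mat s j l • wv 1 (mat s *ᵥ epsVec v l)) *
        zv 1 (v ᵥ* mat s⁻¹) := fun k l => by
      simp only [smul_mul_assoc, smul_smul]
      congr 1
      ring
    simp only [h1, ← Finset.sum_mul, ← Finset.smul_sum, ← Finset.sum_smul, sum_smul_wv]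
    rw [smul_mul_assoc]
    congr 3
    refine funext fun p => ?_
    have := epsVec_vecMul (det_mat s) (v ᵥ* mat s⁻¹) j p
    rw [Matrix.vecMul_vecMul, mat_inv_mul, Matrix.vecMul_one] at this
    rw [← this]
    simp only [Matrix.mulVec, dotProduct, Finset.mul_sum, mul_assoc]

theorem tabAct_isG10dual (s : SL3) (v : Vec) {g : ↥T2 →ₗ[ℂ] Lam} (hg : IsG10dual (cube v) g) :
    IsG10dual (cube (mat s *ᵥ v)) (tabAct s g) := by
  have hd : (mat s⁻¹)ᵀ.det = 1 := by rw [Matrix.det_transpose, det_mat]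
  have hv : (mat s *ᵥ v) ᵥ* (mat s⁻¹)ᵀ = v := by
    rw [Matrix.vecMul_transpose, Matrix.mulVec_mulVec, mat_inv_mul, Matrix.one_mulVec]
  rw [isG10dual_cube] at hg ⊢
  convert tabAct_hasValues s hg using 1
  · rw [map_zero]
  · rw [map_zero]
  · rw [map_zero]
  · rw [map_zero]
  · funext i j
    simp
  · funext i j
    simp only [map_smul, map_neg, map_mul, slHom_wv, smul_smul, ← Finset.sum_smul, smul_neg,
      Finset.sum_neg_distrib]
    have := epsVec_vecMul hd (mat s *ᵥ v) i j
    rw [hv] at this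
    rw [← this]
    rfl
  · funext i j
    simp only [map_smul, map_mul, slHom_zv, slHom_wv]
    have h1 : ∀ k l, (mat s⁻¹ k i * mat s j l) • v l • (wv 1 (mat s *ᵥ v) *
        zv 1 (epsVec v k ᵥ* mat s⁻¹)) = (mat s j l * v l) • (wv 1 (mat s *ᵥ v) *
        (mat s⁻¹ k i • zv 1 (epsVec v k ᵥ* mat s⁻¹))) := fun k l => by
      simp only [mul_smul_comm, smul_smul]
      congr 1
      ring
    simp only [h1, ← Finset.mul_sum, ← Finset.smul_sum, ← Finset.sum_smul, sum_smul_zv]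
    refine congrArg₂ (· • ·) rfl (congrArg (wv 1 (mat s *ᵥ v) * ·)
      (congrArg (zv 1) (funext fun p => ?_)))
    have := epsVec_vecMul hd (mat s *ᵥ v) i p
    rw [hv] at this
    rw [← this]
    simp only [Matrix.vecMul, dotProduct, Finset.mul_sum, mul_assoc, Matrix.transpose_apply]
    refine Finset.sum_congr rfl fun k _ => Finset.sum_congr rfl fun l _ => ?_
    ring

theorem slHom_sum_wz (s : SL3) (t t' : Fin 2) (V : Matrix (Fin 3) (Fin 3) ℂ) :
    slHom s (∑ i, ∑ j, V i j • (ar (Sum.inr (t, i)) * ar (Sum.inl (t', j)))) =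
      ∑ i, ∑ j, (mat s * V * mat s⁻¹) i j • (ar (Sum.inr (t, i)) * ar (Sum.inl (t', j))) := by
  simp only [map_add, map_smul, map_mul, slHom_ar, slArrow, Matrix.mul_apply, Fin.sum_univ_three,
    add_mul, mul_add, smul_mul_assoc, mul_smul_comm, smul_add]
  module

theorem slHom_sum_zw (s : SL3) (t t' : Fin 2) (V : Matrix (Fin 3) (Fin 3) ℂ) :
    slHom s (∑ i, ∑ j, V i j • (ar (Sum.inl (t', j)) * ar (Sum.inr (t, i)))) =
      ∑ i, ∑ j, (mat s * V * mat s⁻¹) i j • (ar (Sum.inl (t', j)) * ar (Sum.inr (t, i))) := by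
  simp only [map_add, map_smul, map_mul, slHom_ar, slArrow, Matrix.mul_apply, Fin.sum_univ_three,
    add_mul, mul_add, smul_mul_assoc, mul_smul_comm, smul_add]
  module

theorem zv_single (t : Fin 2) (j : Fin 3) : zv t (Pi.single j 1) = ar (Sum.inl (t, j)) := by
  rw [zv, Finset.sum_eq_single j] <;> simp +contextual [Pi.single_apply]

theorem wv_single (t : Fin 2) (j : Fin 3) : wv t (Pi.single j 1) = ar (Sum.inr (t, j)) := by
  rw [wv, Finset.sum_eq_single j] <;> simp +contextual [Pi.single_apply]

theorem isG8_iff (U X : Traceless) (g : ↥T2 →ₗ[ℂ] Lam) : IsG8 U X g ↔ HasValues g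
    (∑ i, ∑ j, U.1 i j • wzP11 i j) (-∑ i, ∑ j, U.1 i j • wzP11 i j)
    (∑ i, ∑ j, X.1 i j • zwP22 j i) (-∑ i, ∑ j, X.1 i j • wzP00 i j) 0 0
    (fun i j => wv 1 (fun k => ((3 : ℂ) • X.1 - U.1) k i) * zv 1 (Pi.single j 1) +
      wv 1 (Pi.single i 1) * zv 1 (((3 : ℂ) • X.1 - U.1) j) -
      (if i = j then (1 : ℂ) else 0) •
        ∑ k, ∑ l, ((2 : ℂ) • X.1 - (2 / 3 : ℂ) • U.1) k l • wzP11 k l) := by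
  rw [IsG8]
  simp only [zv_single, wv_single]
  simp only [zv, wv, Finset.sum_mul, Finset.mul_sum, smul_mul_assoc, mul_smul_comm]
  rfl

theorem tabAct_isG8 (s : SL3) (U X : Traceless) {g : ↥T2 →ₗ[ℂ] Lam} (hg : IsG8 U X g) :
    IsG8 (rep8 s U) (rep8 s X) (tabAct s g) := by
  rw [isG8_iff] at hg ⊢
  have hU : (rep8 s U).1 = mat s * U.1 * mat s⁻¹ := rfl
  have hX : (rep8 s X).1 = mat s * X.1 * mat s⁻¹ := rfl
  have hN : ∀ a b : ℂ, a • (rep8 s X).1 - b • (rep8 s U).1 = mat s * (a • X.1 - b • U.1) * mat s⁻¹ :=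
    fun a b => by
      rw [hU, hX, mul_sub, sub_mul, Matrix.mul_smul, Matrix.mul_smul, Matrix.smul_mul, Matrix.smul_mul]
  have hN1 := hN 3 1
  rw [one_smul, one_smul] at hN1
  convert tabAct_hasValues s hg using 1
  · exact (slHom_sum_wz s 1 1 U.1).symm
  · rw [map_neg]
    exact congrArg _ (slHom_sum_wz s 1 1 U.1).symm
  · exact (slHom_sum_zw s 1 1 X.1).symm
  · rw [map_neg]
    exact congrArg _ (slHom_sum_wz s 0 0 X.1).symm
  · funext i j
    simp
  · funext i j
    simp
  · funext i j
    rw [hN1, hN]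
    set N := (3 : ℂ) • X.1 - U.1
    set L := (2 : ℂ) • X.1 - (2 / 3 : ℂ) • U.1
    have hS : slHom s (∑ k, ∑ l, L k l • wzP11 k l) =
      ∑ k, ∑ l, (mat s * L * mat s⁻¹) k l • wzP11 k l := slHom_sum_wz s 1 1 L
    simp only [map_sub, map_add, map_mul, map_smul, slHom_wv, slHom_zv, hS, smul_sub, smul_add,
      Finset.sum_sub_distrib, Finset.sum_add_distrib]
    have h1 : ∀ A B : Fin 3 → Vec, ∑ k, ∑ l, (mat s⁻¹ k i * mat s j l) • (wv 1 (A k) * zv 1 (B l)) =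
        wv 1 (fun p => ∑ k, mat s⁻¹ k i * A k p) * zv 1 (fun p => ∑ l, mat s j l * B l p) := by
      intro A B
      rw [← sum_smul_wv, ← sum_smul_zv, Finset.sum_mul_sum]
      simp only [smul_mul_smul_comm]
    -- The Kronecker symbol is an invariant tensor.
    have h2 : ∑ k, ∑ l, (mat s⁻¹ k i * mat s j l) • (if k = l then (1 : ℂ) else 0) •
        ∑ k, ∑ l, (mat s * L * mat s⁻¹) k l • wzP11 k l = (if i = j then (1 : ℂ) else 0) •
        ∑ k, ∑ l, (mat s * L * mat s⁻¹) k l • wzP11 k l := by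
      simp only [smul_smul, ← Finset.sum_smul]
      congr 1
      simp only [mul_ite, mul_one, mul_zero, Finset.sum_ite_eq, Finset.mem_univ, if_true]
      simp only [mul_comm (mat s⁻¹ _ i), sum_mat_mul_inv, eq_comm]
    rw [h1 (fun k => mat s *ᵥ fun p => N p k) (fun l => Pi.single l 1 ᵥ* mat s⁻¹),
      h1 (fun k => mat s *ᵥ Pi.single k 1) (fun l => N l ᵥ* mat s⁻¹), h2]
    congr 2
    · congr 2
      · funext p
        simp only [Matrix.mul_apply, Matrix.mulVec, dotProduct, Fin.sum_univ_three]
        ring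
      · funext p
        simp only [Matrix.single_one_vecMul, Matrix.row_apply, sum_mat_mul_inv, Pi.single_apply, eq_comm]
    · congr 2
      · funext p
        have := sum_mat_mul_inv s p i
        simp only [Matrix.mulVec_single_one, Matrix.col_apply, mul_comm (mat s⁻¹ _ i), this, Pi.single_apply]
      · funext p
        simp only [Matrix.mul_apply, Matrix.vecMul, dotProduct, Fin.sum_univ_three]
        ring

theorem table10_zero : table10 0 = 0 := by
  have := table10_smul 0 0
  rwa [zero_smul, zero_smul] at this

theorem table10dual_zero : table10dual 0 = 0 := by
  have := table10dual_smul 0 0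
  rwa [zero_smul, zero_smul] at this

theorem table8_zero : table8 0 0 = 0 := by
  have := table8_smul 0 0 0
  rwa [zero_smul, zero_smul] at this

theorem SymForm.cube_induction {P : SymForm → Prop} (D : SymForm) (cube : ∀ v, P (cube v)) (zero : P 0)
    (add : ∀ D E, P D → P E → P (D + E)) (smul : ∀ (c : ℂ) D, P D → P (c • D)) : P D := by
  have hD : D ∈ Submodule.span ℂ (Set.range TP2.cube) := span_cube ▸ Submodule.mem_top
  induction hD using Submodule.span_induction with
  | mem D hD => obtain ⟨v, rfl⟩ := hD; exact cube v
  | zero => exact zero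
  | add D E _ _ hD hE => exact add D E hD hE
  | smul c D _ hD => exact smul c D hD

theorem tabAct_table10 (s : SL3) (D : SymForm) :
    tabAct s (table10 D) = table10 (rep10 s D) := by
  induction D using SymForm.cube_induction with
  | cube v =>
    have := tabAct_isG10 s v (table10_spec _)
    rw [← pullback_cube] at this
    exact this.unique (table10_spec _)
  | zero => rw [map_zero, table10_zero, map_zero]
  | add D E hD hE => rw [map_add, table10_add, table10_add, map_add, hD, hE]
  | smul c D hD => rw [map_smul, table10_smul, table10_smul, map_smul, hD]

theorem tabAct_table10dual (s : SL3) (D : SymForm) :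
    tabAct s (table10dual D) = table10dual (rep10dual s D) := by
  induction D using SymForm.cube_induction with
  | cube v =>
    have := tabAct_isG10dual s v (table10dual_spec _)
    rw [← Matrix.vecMul_transpose, ← pullback_cube] at this
    exact this.unique (table10dual_spec _)
  | zero => rw [map_zero, table10dual_zero, map_zero]
  | add D E hD hE => rw [map_add, table10dual_add, table10dual_add, map_add, hD, hE]
  | smul c D hD => rw [map_smul, table10dual_smul, table10dual_smul, map_smul, hD]

theorem tabAct_table8 (s : SL3) (U X : Traceless) :
    tabAct s (table8 U X) = table8 (rep8 s U) (rep8 s X) :=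
  (tabAct_isG8 s U X (table8_spec U X)).unique (table8_spec _ _)

/-- The representation of the statement. -/
def rep4 : Representation ℂ SL3 Sum4 := rep10.prod (rep10dual.prod (rep8.prod rep8))

theorem tabAct_table (s : SL3) (v : Sum4) : tabAct s (table v) = table (rep4 s v) := by
  rw [table_apply, map_add, map_add, tabAct_table10, tabAct_table10dual, tabAct_table8]
  rfl

/-! ### Every table comes from a cocycle -/

/-- The cochains on `T_2` which are cohomologous to the values of a Hochschild cocycle. -/
def liftable (w : ℤ) : Submodule ℂ (↥T2 →ₗ[ℂ] Lam) := (Z2 w).map evalT2 ⊔ MB2 w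

theorem mem_liftable {w : ℤ} {g : ↥T2 →ₗ[ℂ] Lam} :
    g ∈ liftable w ↔ ∃ f ∈ Z2 w, evalT2 f - g ∈ MB2 w := by
  rw [liftable, Submodule.mem_sup]
  constructor
  · rintro ⟨_, ⟨f, hf, rfl⟩, b, hb, rfl⟩
    exact ⟨f, hf, by rw [sub_add_cancel_left]; exact (MB2 w).neg_mem hb⟩
  · rintro ⟨f, hf, h⟩
    exact ⟨_, ⟨f, hf, rfl⟩, _, (MB2 w).neg_mem h, by abel⟩

theorem tabAct_liftable (s : SL3) {w : ℤ} {g : ↥T2 →ₗ[ℂ] Lam} (hg : g ∈ liftable w) :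
    tabAct s g ∈ liftable w := by
  obtain ⟨f, hf, h⟩ := mem_liftable.1 hg
  refine mem_liftable.2 ⟨cochainRep s f, cochainRep_Z2 w s hf, ?_⟩
  rw [← tabAct_evalT2, ← map_sub]
  exact tabAct_MB2 s w h

/-- The forms with liftable table are stable under `SL(3)` and contain the cube of the coordinate
`0`. -/
theorem table10_liftable (D : SymForm) : table10 D ∈ liftable 0 := by
  let L : SymForm →ₗ[ℂ] (↥T2 →ₗ[ℂ] Lam) :=
    { toFun := table10, map_add' := table10_add, map_smul' := table10_smul }
  have : (liftable 0).comap L = ⊤ := by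
    refine eq_top_of_pullback 0 (fun A hA D hD => ?_) ?_
    · let a : SL3 := ⟨A, hA⟩
      have h := tabAct_liftable a⁻¹ (w := 0) (g := table10 D) hD
      rw [tabAct_table10] at h
      change table10 (pullback (mat a⁻¹⁻¹) D) ∈ liftable 0 at h
      rwa [inv_inv] at h
    · refine mem_liftable.2 (exists_cocycle_G10 (fun i j k => ?_) (table10_spec _))
      rw [coeff_cube]
      simp only [Pi.single_apply, mul_ite, mul_one, mul_zero, ite_and]
      split_ifs <;> rfl
  have h : D ∈ (liftable 0).comap L := this ▸ Submodule.mem_top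
  exact h

theorem table10dual_liftable (D : SymForm) : table10dual D ∈ liftable 0 := by
  let L : SymForm →ₗ[ℂ] (↥T2 →ₗ[ℂ] Lam) :=
    { toFun := table10dual, map_add' := table10dual_add, map_smul' := table10dual_smul }
  have : (liftable 0).comap L = ⊤ := by
    refine eq_top_of_pullback 1 (fun A hA D hD => ?_) ?_
    -- On `10*` a group element acts by pullback along its transpose.
    · let a : SL3 := ⟨Aᵀ, by rw [Matrix.det_transpose, hA]⟩
      have h := tabAct_liftable a (w := 0) (g := table10dual D) hD
      rw [tabAct_table10dual] at h
      exact h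
    · refine mem_liftable.2 (exists_cocycle_G10dual (fun i j k => ?_) (table10dual_spec _))
      rw [coeff_cube]
      simp only [Pi.single_apply, mul_ite, mul_one, mul_zero, ite_and]
      split_ifs <;> rfl
  have h : D ∈ (liftable 0).comap L := this ▸ Submodule.mem_top
  exact h

/-- The pair `(U, X)` is the sum of `(3 X, X)`, given by central multiplication, and `(U - 3 X, 0)`,
given by the cup product. -/
theorem table8_liftable (U X : Traceless) : table8 U X ∈ liftable 0 := by
  have h : table8 U X = table8 ((3 : ℂ) • X) X + table8 (U - (3 : ℂ) • X) 0 := by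
    rw [← table8_add, add_sub_cancel, add_zero]
  rw [h]
  exact Submodule.add_mem _ (mem_liftable.2 (exists_cocycle_G8_center X (table8_spec _ _)))
    (mem_liftable.2 (exists_cocycle_G8_noncentral _ (table8_spec _ _)))

theorem table_liftable (v : Sum4) : table v ∈ liftable 0 :=
  Submodule.add_mem _ (Submodule.add_mem _ (table10_liftable _) (table10dual_liftable _))
    (table8_liftable _ _)

/-! ### Consequences of the cocycle condition on `T_2` -/

/-- The terms with `h` in the middle position cancel. The others contain a quadratic relation next
to `h`, on its right or on its left according to the two factorisations of an element of `T_3`. -/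
theorem MB2_le_MZ2 (w : ℤ) : MB2 w ≤ MZ2 w := by
  rintro _ ⟨h, hh, rfl⟩
  have hd : ∀ r : T2, dM1 h r = ∑ x, ∑ y, r.1 x y • (ar x * h y + h x * ar y) := fun _ => rfl
  refine ⟨⟨fun a b r hr => ⟨?_, ?_⟩, fun r => ?_⟩, fun p => ?_⟩
  · simp only [hd, Finset.mul_sum, mul_smul_comm]
    refine Finset.sum_congr rfl fun x _ => Finset.sum_congr rfl fun y _ => ?_
    by_cases h0 : r.1 x y = 0
    · simp [h0]
    · rw [← (hr x y h0).1, mul_add, ← mul_assoc, ← mul_assoc, e_tgt_mul_ar, (hh x).1]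
  · simp only [hd, Finset.sum_mul, smul_mul_assoc]
    refine Finset.sum_congr rfl fun x _ => Finset.sum_congr rfl fun y _ => ?_
    by_cases h0 : r.1 x y = 0
    · simp [h0]
    · rw [← (hr x y h0).2, add_mul, mul_assoc, mul_assoc, ar_mul_e_src, (hh y).2.1]
  · rw [hd]
    have har : ∀ x, ar x ∈ homog 1 := fun x => (mem_homog_iff _ _).2 (by rw [len_ar]; simp)
    refine Submodule.sum_mem _ fun x _ => Submodule.sum_mem _ fun y _ =>
      Submodule.smul_mem _ _ (Submodule.add_mem _ ?_ ?_)
    · exact mem_homog_of_eq (by ring) (mul_mem_homog (har x) (hh y).2.2)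
    · exact mem_homog_of_eq (by ring) (mul_mem_homog (hh x).2.2 (har y))
  · have B1 : ∑ x, ∑ y, ∑ z, p.1 x y z • (h x * ar y * ar z) = 0 := by
      refine Finset.sum_eq_zero fun x _ => ?_
      have := congrArg (h x * ·) (quad_rel_T2 _ (p.2.1 x))
      simpa only [Finset.mul_sum, mul_smul_comm, mul_zero, mul_assoc] using this
    have B3 : ∑ x, ∑ y, ∑ z, p.1 x y z • (ar x * ar y * h z) = 0 := by
      have h1 : ∀ z, ∑ x, ∑ y, p.1 x y z • (ar x * ar y * h z) = 0 := fun z => by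
        have := congrArg (· * h z) (quad_rel_T2 _ (p.2.2 z))
        simpa only [Finset.sum_mul, smul_mul_assoc, zero_mul] using this
      have h2 := Finset.sum_eq_zero fun z (_ : z ∈ Finset.univ) => h1 z
      rw [Finset.sum_comm] at h2
      rw [← h2]
      exact Finset.sum_congr rfl fun x _ => Finset.sum_comm
    have C1 : ∑ z, (∑ x, ∑ y, p.1 x y z • (ar x * h y + h x * ar y)) * ar z =
        ∑ x, ∑ y, ∑ z, p.1 x y z • ((ar x * h y + h x * ar y) * ar z) := by
      simp only [Finset.sum_mul, smul_mul_assoc]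
      rw [Finset.sum_comm]
      exact Finset.sum_congr rfl fun x _ => Finset.sum_comm
    have A : ∀ x y z, ar x * (ar y * h z + h y * ar z) - (ar x * h y + h x * ar y) * ar z =
        ar x * ar y * h z - h x * ar y * ar z := fun x y z => by
      rw [mul_add, add_mul]
      simp only [mul_assoc]
      abel
    simp only [hd]
    rw [C1]
    simp only [Finset.mul_sum, mul_smul_comm, ← Finset.sum_sub_distrib, ← smul_sub, A]
    simp only [smul_sub, Finset.sum_sub_distrib, B1, B3, sub_zero]

theorem liftable_le_MZ2 (w : ℤ) : liftable w ≤ MZ2 w := by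
  refine sup_le ?_ (MB2_le_MZ2 w)
  rintro _ ⟨f, hf, rfl⟩
  exact evalT2_mem hf

/-- The cocycle condition for a cubic element given by both of its factorisations, `∑ x L_x = ∑ R_z
z`. -/
theorem MZ2_cubic {w : ℤ} {g : ↥T2 →ₗ[ℂ] Lam} (hg : g ∈ MZ2 w) (L R : Arrow → T2)
    (h : ∀ x y z, (L x).1 y z = (R z).1 x y) : ∑ x, ar x * g (L x) = ∑ z, g (R z) * ar z := by
  have h1 : ∀ z, (fun x y => (L x).1 y z) = (R z).1 := fun z => funext fun x => funext fun y => h x y z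
  let p : T3 := ⟨fun x y z => (L x).1 y z, fun x => (L x).2, fun z => (h1 z).symm ▸ (R z).2⟩
  have h2 := sub_eq_zero.1 (hg.2 p)
  have h3 : ∀ z, (⟨fun x y => p.1 x y z, p.2.2 z⟩ : T2) = R z := fun z => Subtype.ext (h1 z)
  simp only [h3] at h2
  exact h2

theorem pair_apply (x y a b : Arrow) : pair x y a b = if a = x ∧ b = y then 1 else 0 := by
  rw [pair, Pi.single_apply]
  split_ifs with h1 h2 h2 <;> simp_all [Pi.single_apply]

theorem wzRel11_apply (x y : Arrow) : wzRel11 x y = match x, y with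
      | Sum.inr (1, k), Sum.inl (1, l) => if k = l then 1 else 0
      | _, _ => 0 := by
  rw [wzRel11]
  simp only [Finset.sum_apply, pair_apply]
  rcases x with ⟨s, k⟩ | ⟨s, k⟩ <;> rcases y with ⟨s', k'⟩ | ⟨s', k'⟩ <;> 
      fin_cases s <;> fin_cases s' <;> simp [eq_comm, ite_and]

theorem wzRel00_apply (x y : Arrow) : wzRel00 x y = match x, y with
      | Sum.inr (0, k), Sum.inl (0, l) => if k = l then 1 else 0
      | _, _ => 0 := by
  rw [wzRel00]
  simp only [Finset.sum_apply, pair_apply]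
  rcases x with ⟨s, k⟩ | ⟨s, k⟩ <;> rcases y with ⟨s', k'⟩ | ⟨s', k'⟩ <;> 
      fin_cases s <;> fin_cases s' <;> simp [eq_comm, ite_and]


theorem zwRel11_apply (x y : Arrow) : zwRel11 x y = match x, y with
      | Sum.inl (0, k), Sum.inr (0, l) => if k = l then 1 else 0
      | _, _ => 0 := by
  rw [zwRel11]
  simp only [Finset.sum_apply, pair_apply]
  rcases x with ⟨s, k⟩ | ⟨s, k⟩ <;> rcases y with ⟨s', k'⟩ | ⟨s', k'⟩ <;>
      fin_cases s <;> fin_cases s' <;> simp [eq_comm, ite_and]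

theorem zwRel22_apply (x y : Arrow) : zwRel22 x y = match x, y with
      | Sum.inl (1, k), Sum.inr (1, l) => if k = l then 1 else 0
      | _, _ => 0 := by
  rw [zwRel22]
  simp only [Finset.sum_apply, pair_apply]
  rcases x with ⟨s, k⟩ | ⟨s, k⟩ <;> rcases y with ⟨s', k'⟩ | ⟨s', k'⟩ <;>
      fin_cases s <;> fin_cases s' <;> simp [eq_comm, ite_and]

theorem zero_T2_apply (x y : Arrow) : (0 : T2).1 x y = 0 := rfl
theorem zzT_val (i j : Fin 3) : (zzT i j).1 = zzRel i j := rfl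
theorem wwT_val (i j : Fin 3) : (wwT i j).1 = wwRel i j := rfl
theorem wzT_val (i j : Fin 3) : (wzT i j).1 = wzRel i j := rfl
theorem wzT00_val : wzT00.1 = wzRel00 := rfl
theorem wzT11_val : wzT11.1 = wzRel11 := rfl
theorem zwT11_val : zwT11.1 = zwRel11 := rfl
theorem zwT22_val : zwT22.1 = zwRel22 := rfl

/-- The cubic elements `∑ w_k z^k z^i - ∑ w_k z^i z^k + ∑ z^i w_k z^k`. -/
theorem MZ2_cubic_z10 {w : ℤ} {g : ↥T2 →ₗ[ℂ] Lam} (hg : g ∈ MZ2 w) (i : Fin 3) :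
    ∑ k, ar (w12 k) * g (zzT k i) + ar (z10 i) * g wzT00 =
      g wzT11 * ar (z10 i) - ∑ k, g (wzT k i) * ar (z10 k) := by
  -- The two factorisations are `∑ w_k [z^k, z^i] + z^i (w·z)` and `(w·z) z^i - ∑ [w_k, z^i] z^k`.
  have := MZ2_cubic hg
    (fun x => match x with
      | Sum.inr (1, k) => zzT k i
      | Sum.inl (0, k) => if k = i then wzT00 else 0
      | _ => 0)
    (fun x => match x with
      | Sum.inl (0, k) => (if k = i then wzT11 else 0) - wzT k i
      | _ => 0) ?_
  · simp only [Fintype.sum_sum_type, Fintype.sum_prod_type, Fin.sum_univ_two] at this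
    simpa [apply_ite g, mul_ite, ite_mul, sub_mul, mul_sub, add_mul, mul_add, Finset.sum_sub_distrib,
      Finset.sum_add_distrib, add_comm] using this
  · rintro (⟨s, k⟩ | ⟨s, k⟩) (⟨s', k'⟩ | ⟨s', k'⟩) (⟨s'', k''⟩ | ⟨s'', k''⟩) <;>
      fin_cases s <;> fin_cases s' <;> fin_cases s'' <;> dsimp only [Fin.zero_eta, Fin.mk_one] <;>
      simp [zero_T2_apply, zzT_val, wzT_val, wzT00_val, wzT11_val, zzRel, wzRel, wzRel00_apply, wzRel11_apply, pair_apply,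
        apply_ite Subtype.val, ite_apply] <;>
      grind

/-- The cubic elements `∑ z^i z^k w_k - ∑ z^k z^i w_k + ∑ z^k w_k z^i`. -/
theorem MZ2_cubic_z21 {w : ℤ} {g : ↥T2 →ₗ[ℂ] Lam} (hg : g ∈ MZ2 w) (i : Fin 3) :
    ∑ k, g (zzT i k) * ar (w01 k) + g zwT22 * ar (z21 i) =
      ar (z21 i) * g zwT11 + ∑ k, ar (z21 k) * g (wzT k i) := by
  have := MZ2_cubic hg
    (fun x => match x with
      | Sum.inl (1, k) => (if k = i then zwT11 else 0) + wzT k i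
      | _ => 0)
    (fun x => match x with
      | Sum.inr (0, k) => zzT i k
      | Sum.inl (1, k) => if k = i then zwT22 else 0
      | _ => 0) ?_
  · simp only [Fintype.sum_sum_type, Fintype.sum_prod_type, Fin.sum_univ_two] at this
    simpa [apply_ite g, mul_ite, ite_mul, sub_mul, mul_sub, add_mul, mul_add, Finset.sum_sub_distrib,
      Finset.sum_add_distrib, add_comm] using this.symm
  · rintro (⟨s, k⟩ | ⟨s, k⟩) (⟨s', k'⟩ | ⟨s', k'⟩) (⟨s'', k''⟩ | ⟨s'', k''⟩) <;>
      fin_cases s <;> fin_cases s' <;> fin_cases s'' <;> dsimp only [Fin.zero_eta, Fin.mk_one] <;>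
      simp [zero_T2_apply, zzT_val, wzT_val, zwT22_val, zwT11_val, zzRel, wzRel, zwRel22_apply, zwRel11_apply, pair_apply,
        apply_ite Subtype.val, ite_apply] <;>
      grind

/-- The cubic elements `∑ w_i w_k z^k - ∑ w_k w_i z^k + ∑ w_k z^k w_i`. -/
theorem MZ2_cubic_w01 {w : ℤ} {g : ↥T2 →ₗ[ℂ] Lam} (hg : g ∈ MZ2 w) (i : Fin 3) :
    ∑ k, g (wwT i k) * ar (z21 k) + g wzT00 * ar (w01 i) =
      ar (w01 i) * g wzT11 - ∑ k, ar (w01 k) * g (wzT i k) := by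
  have := MZ2_cubic hg
    (fun x => match x with
      | Sum.inr (0, k) => (if k = i then wzT11 else 0) - wzT i k
      | _ => 0)
    (fun x => match x with
      | Sum.inl (1, k) => wwT i k
      | Sum.inr (0, k) => if k = i then wzT00 else 0
      | _ => 0) ?_
  · simp only [Fintype.sum_sum_type, Fintype.sum_prod_type, Fin.sum_univ_two] at this
    simpa [apply_ite g, mul_ite, ite_mul, sub_mul, mul_sub, add_mul, mul_add, Finset.sum_sub_distrib,
      Finset.sum_add_distrib, add_comm] using this.symm
  · rintro (⟨s, k⟩ | ⟨s, k⟩) (⟨s', k'⟩ | ⟨s', k'⟩) (⟨s'', k''⟩ | ⟨s'', k''⟩) <;>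
      fin_cases s <;> fin_cases s' <;> fin_cases s'' <;> dsimp only [Fin.zero_eta, Fin.mk_one] <;>
      simp [zero_T2_apply, wwT_val, wzT_val, wzT00_val, wzT11_val, wwRel, wzRel, wzRel00_apply, wzRel11_apply, pair_apply,
        apply_ite Subtype.val, ite_apply] <;>
      grind

/-! ### Elements of `Λ` of small path length -/

theorem mem_homog_two {a b : Fin 3} {x : Lam} (hx : x ∈ homog 2) (ha : e a * x = x)
    (hb : x * e b = x) :
    x ∈ Submodule.span ℂ {y | ∃ p q, tgt p = a ∧ src p = tgt q ∧ src q = b ∧ y = ar p * ar q} := by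
  set P := Submodule.span ℂ {y | ∃ p q, tgt p = a ∧ src p = tgt q ∧ src q = b ∧ y = ar p * ar q}
  suffices h : ∀ y ∈ lenPart 2, e a * y * e b ∈ P by
    have := h x (by rwa [lenPart_eq_homog])
    rwa [ha, hb] at this
  intro y hy
  rw [lenPart, pow_two, Submodule.span_mul_span, Submodule.span_mul_span] at hy
  induction hy using Submodule.span_induction with
  | mem y hy =>
    obtain ⟨_, ⟨c, rfl⟩, _, ⟨_, ⟨p, rfl⟩, _, ⟨q, rfl⟩, rfl⟩, rfl⟩ := hy
    change e a * (e c * (ar p * ar q)) * e b ∈ P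
    by_cases h1 : a = c
    swap
    · rw [← mul_assoc (e a), e_mul_e_of_ne h1]
      simp
    subst h1
    rw [← mul_assoc (e a), e_mul_self]
    by_cases h2 : tgt p = a
    swap
    · rw [← mul_assoc (e a), e_mul_ar_of_ne (Ne.symm h2)]
      simp
    by_cases h3 : src q = b
    swap
    · rw [mul_assoc, mul_assoc, ar_mul_e_of_ne h3]
      simp
    by_cases h4 : src p = tgt q
    swap
    · rw [ar_mul_ar_of_ne h4]
      simp
    subst h2 h3
    rw [← mul_assoc, e_tgt_mul_ar, mul_assoc, ar_mul_e_src]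
    exact Submodule.subset_span ⟨p, q, rfl, h4, rfl, rfl⟩
  | zero => simp
  | add y y' _ _ h h' =>
    rw [mul_add, add_mul]
    exact P.add_mem h h'
  | smul c y _ h =>
    rw [mul_smul_comm, smul_mul_assoc]
    exact P.smul_mem c h

theorem mem_homog_one {a b : Fin 3} {x : Lam} (hx : x ∈ homog 1) (ha : e a * x = x)
    (hb : x * e b = x) :
    x ∈ Submodule.span ℂ {y | ∃ p, tgt p = a ∧ src p = b ∧ y = ar p} := by
  set P := Submodule.span ℂ {y | ∃ p, tgt p = a ∧ src p = b ∧ y = ar p}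
  suffices h : ∀ y ∈ lenPart 1, e a * y * e b ∈ P by
    have := h x (by rwa [lenPart_eq_homog])
    rwa [ha, hb] at this
  intro y hy
  rw [lenPart, pow_one, Submodule.span_mul_span] at hy
  induction hy using Submodule.span_induction with
  | mem y hy =>
    obtain ⟨_, ⟨c, rfl⟩, _, ⟨p, rfl⟩, rfl⟩ := hy
    change e a * (e c * ar p) * e b ∈ P
    by_cases h1 : a = c
    swap
    · rw [← mul_assoc (e a), e_mul_e_of_ne h1]
      simp
    subst h1
    rw [← mul_assoc (e a), e_mul_self]
    by_cases h2 : tgt p = a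
    swap
    · rw [e_mul_ar_of_ne (Ne.symm h2)]
      simp
    by_cases h3 : src p = b
    swap
    · rw [mul_assoc, ar_mul_e_of_ne h3]
      simp
    subst h2 h3
    rw [e_tgt_mul_ar, ar_mul_e_src]
    exact Submodule.subset_span ⟨p, rfl, rfl, rfl⟩
  | zero => simp
  | add y y' _ _ h h' =>
    rw [mul_add, add_mul]
    exact P.add_mem h h'
  | smul c y _ h =>
    rw [mul_smul_comm, smul_mul_assoc]
    exact P.smul_mem c h

theorem exists_smul_e {a : Fin 3} {x : Lam} (hx : x ∈ homog 0) (ha : e a * x = x) :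
    ∃ c : ℂ, x = c • e a := by
  suffices h : ∀ y ∈ lenPart 0, ∃ c : ℂ, e a * y = c • e a by
    have := h x (by rwa [lenPart_eq_homog])
    rwa [ha] at this
  intro y hy
  rw [lenPart, pow_zero, mul_one] at hy
  induction hy using Submodule.span_induction with
  | mem y hy =>
    obtain ⟨c, rfl⟩ := hy
    by_cases h1 : a = c
    · exact ⟨1, by rw [← h1, e_mul_self, one_smul]⟩
    · exact ⟨0, by rw [e_mul_e_of_ne h1, zero_smul]⟩
  | zero => exact ⟨0, by simp⟩
  | add y y' _ _ h h' =>
    obtain ⟨c, h⟩ := h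
    obtain ⟨c', h'⟩ := h'
    exact ⟨c + c', by rw [mul_add, h, h', add_smul]⟩
  | smul s y _ h =>
    obtain ⟨c, h⟩ := h
    exact ⟨s * c, by rw [mul_smul_comm, h, smul_smul]⟩

theorem exists_coeff_two {F : Fin 3 → Fin 3 → Lam} {a b : Fin 3}
    (hF : ∀ p q, tgt p = a → src p = tgt q → src q = b → ∃ i j, ar p * ar q = F i j)
    {x : Lam} (hx : x ∈ homog 2) (ha : e a * x = x) (hb : x * e b = x) :
    ∃ c : Fin 3 → Fin 3 → ℂ, x = ∑ i, ∑ j, c i j • F i j := by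
  have h : x ∈ Submodule.span ℂ (Set.range fun p : Fin 3 × Fin 3 => F p.1 p.2) := by
    refine Submodule.span_mono ?_ (mem_homog_two hx ha hb)
    rintro _ ⟨p, q, h1, h2, h3, rfl⟩
    obtain ⟨i, j, h⟩ := hF p q h1 h2 h3
    exact ⟨(i, j), h.symm⟩
  obtain ⟨c, rfl⟩ := (Submodule.mem_span_range_iff_exists_fun ℂ).1 h
  exact ⟨fun i j => c (i, j), by rw [Fintype.sum_prod_type]⟩

theorem exists_coeff_one {F : Fin 3 → Lam} {a b : Fin 3}
    (hF : ∀ p, tgt p = a → src p = b → ∃ i, ar p = F i)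
    {x : Lam} (hx : x ∈ homog 1) (ha : e a * x = x) (hb : x * e b = x) :
    ∃ c : Fin 3 → ℂ, x = ∑ i, c i • F i := by
  have h : x ∈ Submodule.span ℂ (Set.range F) := by
    refine Submodule.span_mono ?_ (mem_homog_one hx ha hb)
    rintro _ ⟨p, h1, h2, rfl⟩
    obtain ⟨i, h⟩ := hF p h1 h2
    exact ⟨i, h.symm⟩
  obtain ⟨c, rfl⟩ := (Submodule.mem_span_range_iff_exists_fun ℂ).1 h
  exact ⟨c, rfl⟩

theorem exists_coeff_zz {x : Lam} (hx : x ∈ homog 2) (ha : e 2 * x = x) (hb : x * e 0 = x) :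
    ∃ c : Fin 3 → Fin 3 → ℂ, x = ∑ i, ∑ j, c i j • zzP i j := by
  refine exists_coeff_two ?_ hx ha hb
  rintro (⟨s, i⟩ | ⟨s, i⟩) (⟨t, j⟩ | ⟨t, j⟩) <;> fin_cases s <;> fin_cases t <;>
    simp [src, tgt, Fin.ext_iff]
  exact ⟨i, j, rfl⟩

theorem exists_coeff_ww {x : Lam} (hx : x ∈ homog 2) (ha : e 0 * x = x) (hb : x * e 2 = x) :
    ∃ c : Fin 3 → Fin 3 → ℂ, x = ∑ i, ∑ j, c i j • wwP i j := by
  refine exists_coeff_two ?_ hx ha hb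
  rintro (⟨s, i⟩ | ⟨s, i⟩) (⟨t, j⟩ | ⟨t, j⟩) <;> fin_cases s <;> fin_cases t <;>
    simp [src, tgt, Fin.ext_iff]
  exact ⟨i, j, rfl⟩

theorem exists_coeff_00 {x : Lam} (hx : x ∈ homog 2) (ha : e 0 * x = x) (hb : x * e 0 = x) :
    ∃ c : Fin 3 → Fin 3 → ℂ, x = ∑ i, ∑ j, c i j • wzP00 i j := by
  refine exists_coeff_two ?_ hx ha hb
  rintro (⟨s, i⟩ | ⟨s, i⟩) (⟨t, j⟩ | ⟨t, j⟩) <;> fin_cases s <;> fin_cases t <;>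
    simp [src, tgt, Fin.ext_iff]
  exact ⟨i, j, rfl⟩

theorem exists_coeff_22 {x : Lam} (hx : x ∈ homog 2) (ha : e 2 * x = x) (hb : x * e 2 = x) :
    ∃ c : Fin 3 → Fin 3 → ℂ, x = ∑ i, ∑ j, c i j • zwP22 j i := by
  refine exists_coeff_two ?_ hx ha hb
  rintro (⟨s, i⟩ | ⟨s, i⟩) (⟨t, j⟩ | ⟨t, j⟩) <;> fin_cases s <;> fin_cases t <;>
    simp [src, tgt, Fin.ext_iff]
  exact ⟨j, i, rfl⟩

theorem exists_coeff_11 {x : Lam} (hx : x ∈ homog 2) (ha : e 1 * x = x) (hb : x * e 1 = x) :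
    ∃ c : Fin 3 → Fin 3 → ℂ, x = ∑ i, ∑ j, c i j • wzP11 i j := by
  refine exists_coeff_two ?_ hx ha hb
  rintro (⟨s, i⟩ | ⟨s, i⟩) (⟨t, j⟩ | ⟨t, j⟩) <;> fin_cases s <;> fin_cases t <;>
    simp [src, tgt, Fin.ext_iff]
  · exact ⟨j, i, (rel_wz j i).symm⟩
  · exact ⟨i, j, rfl⟩

/-- Weight-zero cochains on `T_1` are given by four matrices. -/
theorem exists_coeff_M1 {h : Arrow → Lam} (hh : h ∈ M1 0) :
    ∃ A A' B B' : Fin 3 → Fin 3 → ℂ, (∀ i, h (z10 i) = ∑ l, A i l • ar (z10 l)) ∧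
      (∀ i, h (z21 i) = ∑ l, A' i l • ar (z21 l)) ∧ (∀ i, h (w01 i) = ∑ l, B i l • ar (w01 l)) ∧
      ∀ i, h (w12 i) = ∑ l, B' i l • ar (w12 l) := by
  have H : ∀ F : Fin 3 → Arrow, (∀ i p, tgt p = tgt (F i) → src p = src (F i) → ∃ l, p = F l) →
      ∃ A : Fin 3 → Fin 3 → ℂ, ∀ i, h (F i) = ∑ l, A i l • ar (F l) := fun F hF => by
    have := fun i => exists_coeff_one (F := fun l => ar (F l)) (fun p h1 h2 =>
      (hF i p h1 h2).imp fun l hl => congrArg ar hl) (hh (F i)).2.2 (hh (F i)).1 (hh (F i)).2.1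
    choose A hA using this
    exact ⟨A, hA⟩
  obtain ⟨A, hA⟩ := H z10 (by
    rintro i (⟨s, k⟩ | ⟨s, k⟩) <;> fin_cases s <;> simp [src, tgt, Fin.ext_iff])
  obtain ⟨A', hA'⟩ := H z21 (by
    rintro i (⟨s, k⟩ | ⟨s, k⟩) <;> fin_cases s <;> simp [src, tgt, Fin.ext_iff])
  obtain ⟨B, hB⟩ := H w01 (by
    rintro i (⟨s, k⟩ | ⟨s, k⟩) <;> fin_cases s <;> simp [src, tgt, Fin.ext_iff])
  obtain ⟨B', hB'⟩ := H w12 (by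
    rintro i (⟨s, k⟩ | ⟨s, k⟩) <;> fin_cases s <;> simp [src, tgt, Fin.ext_iff])
  exact ⟨A, A', B, B', hA, hA', hB, hB'⟩

/-! ### Evaluation at points of the cone -/

theorem conePoint {z w : Vec} (h : ∑ i, z i * w i = 0) : ConePoint z w :=
  ⟨fun _ _ => mul_comm _ _, fun _ _ => mul_comm _ _, fun _ _ => mul_comm _ _, h⟩

/-- The entries of the matrix representing an element of `Λ` at a point of the cone. -/
def ev {z w : Vec} (h : ∑ i, z i * w i = 0) (a b : Fin 3) : Lam →ₗ[ℂ] ℂ :=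
  Matrix.entryLinearMap ℂ ℂ a b ∘ₗ (matRep (conePoint h)).toLinearMap

section ev

variable {z w : Vec} (h : ∑ i, z i * w i = 0)

theorem ev_apply (a b : Fin 3) (x : Lam) : ev h a b x = matRep (conePoint h) x a b := rfl

theorem ev_ar_mul {p : Arrow} {a : Fin 3} (hp : tgt p = a) (b : Fin 3) (x : Lam) :
    ev h a b (ar p * x) = arrowVal z w p * ev h (src p) b x := by
  subst hp
  rw [ev_apply, map_mul, matRep_ar, arrowMat, Matrix.single_mul_apply_same, ev_apply]

theorem ev_mul_ar {p : Arrow} {b : Fin 3} (hp : src p = b) (a : Fin 3) (x : Lam) :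
    ev h a b (x * ar p) = ev h a (tgt p) x * arrowVal z w p := by
  subst hp
  rw [ev_apply, map_mul, matRep_ar, arrowMat, Matrix.mul_single_apply_same, ev_apply]

theorem ev_ar {p : Arrow} {a b : Fin 3} (hp : tgt p = a) (hq : src p = b) :
    ev h a b (ar p) = arrowVal z w p := by
  subst hp hq
  rw [ev_apply, matRep_ar, arrowMat, Matrix.single_apply_same]

theorem ev_zzP (i j : Fin 3) : ev h 2 0 (zzP i j) = z i * z j := by
  exact (ev_ar_mul h (p := z21 i) (a := 2) rfl 0 _).trans
    (congrArg _ (ev_ar h (p := z10 j) (b := 0) rfl rfl))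

theorem ev_wwP (i j : Fin 3) : ev h 0 2 (wwP i j) = w i * w j := by
  exact (ev_ar_mul h (p := w01 i) (a := 0) rfl 2 _).trans
    (congrArg _ (ev_ar h (p := w12 j) (b := 2) rfl rfl))

theorem ev_wzP11 (i j : Fin 3) : ev h 1 1 (wzP11 i j) = w i * z j := by
  exact (ev_ar_mul h (p := w12 i) (a := 1) rfl 1 _).trans
    (congrArg _ (ev_ar h (p := z21 j) (b := 1) rfl rfl))

theorem ev_wzP00 (i j : Fin 3) : ev h 0 0 (wzP00 i j) = w i * z j := by
  exact (ev_ar_mul h (p := w01 i) (a := 0) rfl 0 _).trans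
    (congrArg _ (ev_ar h (p := z10 j) (b := 0) rfl rfl))

theorem ev_zwP22 (i j : Fin 3) : ev h 2 2 (zwP22 i j) = z i * w j := by
  exact (ev_ar_mul h (p := z21 i) (a := 2) rfl 2 _).trans
    (congrArg _ (ev_ar h (p := w12 j) (b := 2) rfl rfl))

theorem ev_MZ2_z10 {k : ℤ} {g : ↥T2 →ₗ[ℂ] Lam} (hg : g ∈ MZ2 k) (i : Fin 3) :
    ∑ k, w k * ev h 2 0 (g (zzT k i)) + z i * ev h 0 0 (g wzT00) =
      ev h 1 1 (g wzT11) * z i - ∑ k, ev h 1 1 (g (wzT k i)) * z k := by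
  have := congrArg (ev h 1 0) (MZ2_cubic_z10 hg i)
  simp only [map_add, map_sub, map_sum] at this
  simp only [ev_ar_mul h (p := w12 _) (a := 1) rfl,
      ev_ar_mul h (p := z10 _) (a := 1) rfl,
      ev_mul_ar h (p := z10 _) (b := 0) rfl] at this
  exact this

theorem ev_MZ2_z21 {k : ℤ} {g : ↥T2 →ₗ[ℂ] Lam} (hg : g ∈ MZ2 k) (i : Fin 3) :
    ∑ k, ev h 2 0 (g (zzT i k)) * w k + ev h 2 2 (g zwT22) * z i =
      z i * ev h 1 1 (g zwT11) + ∑ k, z k * ev h 1 1 (g (wzT k i)) := by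
  have := congrArg (ev h 2 1) (MZ2_cubic_z21 hg i)
  simp only [map_add, map_sum] at this
  simp only [ev_ar_mul h (p := z21 _) (a := 2) rfl,
      ev_mul_ar h (p := w01 _) (b := 1) rfl,
      ev_mul_ar h (p := z21 _) (b := 1) rfl] at this
  exact this

theorem ev_MZ2_w01 {k : ℤ} {g : ↥T2 →ₗ[ℂ] Lam} (hg : g ∈ MZ2 k) (i : Fin 3) :
    ∑ k, ev h 0 2 (g (wwT i k)) * z k + ev h 0 0 (g wzT00) * w i =
      w i * ev h 1 1 (g wzT11) - ∑ k, w k * ev h 1 1 (g (wzT i k)) := by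
  have := congrArg (ev h 0 1) (MZ2_cubic_w01 hg i)
  simp only [map_add, map_sub, map_sum] at this
  simp only [ev_ar_mul h (p := w01 _) (a := 0) rfl,
      ev_mul_ar h (p := z21 _) (b := 1) rfl,
      ev_mul_ar h (p := w01 _) (b := 1) rfl] at this
  exact this

end ev

theorem sum_wzT : ∑ i, wzT i i = wzT11 - zwT11 := by
  refine Subtype.ext ?_
  rw [AddSubgroupClass.coe_sub, AddSubmonoidClass.coe_finset_sum]
  simp only [wzT_val, wzRel, Finset.sum_sub_distrib]
  rfl

theorem zzT_swap (i j : Fin 3) : zzT i j = -zzT j i := Subtype.ext (neg_sub _ _).symm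
theorem wwT_swap (i j : Fin 3) : wwT i j = -wwT j i := Subtype.ext (neg_sub _ _).symm

/-- At a nonzero point of the cone, the values of a cocycle on the four sums satisfy one relation. -/
theorem ev_MZ2_sums {k : ℤ} {g : ↥T2 →ₗ[ℂ] Lam} (hg : g ∈ MZ2 k) {z w : Vec}
    (h : ∑ i, z i * w i = 0) (i : Fin 3) :
    z i * (ev h 0 0 (g wzT00) + ev h 2 2 (g zwT22)) =
      z i * (ev h 1 1 (g zwT11) + ev h 1 1 (g wzT11)) := by
  have h1 := ev_MZ2_z10 h hg i
  have h2 := ev_MZ2_z21 h hg i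
  simp only [zzT_swap i, map_neg] at h2
  -- In the sum of the two cubic conditions the commutators of the `z` cancel by antisymmetry, and
  -- so do the values on `wzT`.
  have h3 : ∑ k, w k * ev h 2 0 (g (zzT k i)) + ∑ k, -ev h 2 0 (g (zzT k i)) * w k = 0 := by
    rw [← Finset.sum_add_distrib]
    exact Finset.sum_eq_zero fun k _ => by ring
  have h4 : ∑ k, z k * ev h 1 1 (g (wzT k i)) = ∑ k, ev h 1 1 (g (wzT k i)) * z k :=
    Finset.sum_congr rfl fun k _ => mul_comm _ _
  rw [h4] at h2
  linear_combination h1 + h2 - h3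

/-! ### Supports of the relations -/

theorem zzT_support {i j : Fin 3} (x y : Arrow) (h : (zzT i j).1 x y ≠ 0) :
    tgt x = 2 ∧ src y = 0 := by
  contrapose! h
  rw [zzT_val, zzRel]
  rcases x with ⟨s, k⟩ | ⟨s, k⟩ <;> rcases y with ⟨t, l⟩ | ⟨t, l⟩ <;> fin_cases s <;>
    fin_cases t <;> simp_all [pair_apply, src, tgt]

theorem wwT_support {i j : Fin 3} (x y : Arrow) (h : (wwT i j).1 x y ≠ 0) :
    tgt x = 0 ∧ src y = 2 := by
  contrapose! h
  rw [wwT_val, wwRel]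
  rcases x with ⟨s, k⟩ | ⟨s, k⟩ <;> rcases y with ⟨t, l⟩ | ⟨t, l⟩ <;> fin_cases s <;>
    fin_cases t <;> simp_all [pair_apply, src, tgt]

theorem wzT_support {i j : Fin 3} (x y : Arrow) (h : (wzT i j).1 x y ≠ 0) :
    tgt x = 1 ∧ src y = 1 := by
  contrapose! h
  rw [wzT_val, wzRel]
  rcases x with ⟨s, k⟩ | ⟨s, k⟩ <;> rcases y with ⟨t, l⟩ | ⟨t, l⟩ <;> fin_cases s <;>
    fin_cases t <;> simp_all [pair_apply, src, tgt]

theorem wzT11_support (x y : Arrow) (h : wzT11.1 x y ≠ 0) : tgt x = 1 ∧ src y = 1 := by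
  contrapose! h
  rw [wzT11_val, wzRel11_apply]
  rcases x with ⟨s, k⟩ | ⟨s, k⟩ <;> rcases y with ⟨t, l⟩ | ⟨t, l⟩ <;> fin_cases s <;>
    fin_cases t <;> simp_all [src, tgt]

theorem zwT11_support (x y : Arrow) (h : zwT11.1 x y ≠ 0) : tgt x = 1 ∧ src y = 1 := by
  contrapose! h
  rw [zwT11_val, zwRel11_apply]
  rcases x with ⟨s, k⟩ | ⟨s, k⟩ <;> rcases y with ⟨t, l⟩ | ⟨t, l⟩ <;> fin_cases s <;>
    fin_cases t <;> simp_all [src, tgt]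

theorem zwT22_support (x y : Arrow) (h : zwT22.1 x y ≠ 0) : tgt x = 2 ∧ src y = 2 := by
  contrapose! h
  rw [zwT22_val, zwRel22_apply]
  rcases x with ⟨s, k⟩ | ⟨s, k⟩ <;> rcases y with ⟨t, l⟩ | ⟨t, l⟩ <;> fin_cases s <;>
    fin_cases t <;> simp_all [src, tgt]

theorem wzT00_support (x y : Arrow) (h : wzT00.1 x y ≠ 0) : tgt x = 0 ∧ src y = 0 := by
  contrapose! h
  rw [wzT00_val, wzRel00_apply]
  rcases x with ⟨s, k⟩ | ⟨s, k⟩ <;> rcases y with ⟨t, l⟩ | ⟨t, l⟩ <;> fin_cases s <;>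
    fin_cases t <;> simp_all [src, tgt]

/-! ### Weight-zero coboundaries on `T_2` -/

/-- The weight-zero cochain on the arrows given by four matrices. -/
def linCochain (A A' B B' : Fin 3 → Fin 3 → ℂ) : Arrow → Lam
  | Sum.inl (0, i) => ∑ l, A i l • ar (z10 l)
  | Sum.inl (1, i) => ∑ l, A' i l • ar (z21 l)
  | Sum.inr (0, i) => ∑ l, B i l • ar (w01 l)
  | Sum.inr (1, i) => ∑ l, B' i l • ar (w12 l)

theorem exists_linCochain {h : Arrow → Lam} (hh : h ∈ M1 0) :
    ∃ A A' B B', h = linCochain A A' B B' := by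
  obtain ⟨A, A', B, B', h1, h2, h3, h4⟩ := exists_coeff_M1 hh
  refine ⟨A, A', B, B', funext ?_⟩
  rintro (⟨s, k⟩ | ⟨s, k⟩) <;> fin_cases s
  exacts [h1 k, h2 k, h3 k, h4 k]

theorem linCochain_mem (A A' B B' : Fin 3 → Fin 3 → ℂ) : linCochain A A' B B' ∈ M1 0 := by
  have har : ∀ x, ar x ∈ homog (1 + 0) := fun x => (mem_homog_iff _ _).2 (by rw [len_ar]; simp)
  have H : ∀ (F : Fin 3 → Arrow) (p : Arrow) (c : Fin 3 → ℂ),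
      (∀ l, tgt (F l) = tgt p) → (∀ l, src (F l) = src p) →
      e (tgt p) * ∑ l, c l • ar (F l) = ∑ l, c l • ar (F l) ∧
      (∑ l, c l • ar (F l)) * e (src p) = ∑ l, c l • ar (F l) ∧
      ∑ l, c l • ar (F l) ∈ homog (1 + 0) := fun F p c h1 h2 => by
    refine ⟨?_, ?_, Submodule.sum_mem _ fun l _ => Submodule.smul_mem _ _ (har _)⟩
    · simp only [Finset.mul_sum, mul_smul_comm]
      exact Finset.sum_congr rfl fun l _ => by rw [← h1 l, e_tgt_mul_ar]
    · simp only [Finset.sum_mul, smul_mul_assoc]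
      exact Finset.sum_congr rfl fun l _ => by rw [← h2 l, ar_mul_e_src]
  rintro (⟨s, k⟩ | ⟨s, k⟩) <;> fin_cases s
  exacts [H z10 _ _ (fun _ => rfl) (fun _ => rfl), H z21 _ _ (fun _ => rfl) (fun _ => rfl),
    H w01 _ _ (fun _ => rfl) (fun _ => rfl), H w12 _ _ (fun _ => rfl) (fun _ => rfl)]

section linCochain

variable (A A' B B' : Fin 3 → Fin 3 → ℂ)

theorem dM1_lin_zz (i j : Fin 3) : dM1 (linCochain A A' B B') (zzT i j) =
    (∑ l, A j l • zzP i l + ∑ l, A' i l • zzP l j) -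
      (∑ l, A i l • zzP j l + ∑ l, A' j l • zzP l i) := by
  rw [dM1_eq_wordMap, wordMap_zz]
  simp only [linCochain, Finset.mul_sum, Finset.sum_mul, mul_smul_comm, smul_mul_assoc, zzP]

theorem dM1_lin_ww (i j : Fin 3) : dM1 (linCochain A A' B B') (wwT i j) =
    (∑ l, B' j l • wwP i l + ∑ l, B i l • wwP l j) -
      (∑ l, B' i l • wwP j l + ∑ l, B j l • wwP l i) := by
  rw [dM1_eq_wordMap, wordMap_ww]
  simp only [linCochain, Finset.mul_sum, Finset.sum_mul, mul_smul_comm, smul_mul_assoc, wwP]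

theorem dM1_lin_wz (i j : Fin 3) : dM1 (linCochain A A' B B') (wzT i j) =
    (∑ l, A' j l • wzP11 i l + ∑ l, B' i l • wzP11 l j) -
      (∑ l, B i l • wzP11 l j + ∑ l, A j l • wzP11 i l) := by
  rw [dM1_eq_wordMap, wordMap_wz]
  simp only [linCochain, Finset.mul_sum, Finset.sum_mul, mul_smul_comm, smul_mul_assoc,
    fold_zw11, fold_wz11]

theorem dM1_lin_zw11 : dM1 (linCochain A A' B B') zwT11 =
    ∑ i, ∑ j, (A i j + B j i) • wzP11 i j := by
  rw [dM1_eq_wordMap, wordMap_zw11]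
  simp only [linCochain, Finset.mul_sum, Finset.sum_mul, mul_smul_comm, smul_mul_assoc,
    fold_zw11, add_smul, Finset.sum_add_distrib]
  rw [add_comm, Finset.sum_comm (f := fun i l => B i l • wzP11 l i)]

theorem dM1_lin_wz11 : dM1 (linCochain A A' B B') wzT11 =
    ∑ i, ∑ j, (A' i j + B' j i) • wzP11 i j := by
  rw [dM1_eq_wordMap, wordMap_wz11]
  simp only [linCochain, Finset.mul_sum, Finset.sum_mul, mul_smul_comm, smul_mul_assoc,
    fold_wz11, add_smul, Finset.sum_add_distrib]
  rw [Finset.sum_comm (f := fun i l => B' i l • wzP11 l i)]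

theorem dM1_lin_zw22 : dM1 (linCochain A A' B B') zwT22 =
    ∑ i, ∑ j, (A' i j + B' j i) • zwP22 j i := by
  rw [dM1_eq_wordMap, wordMap_zw22]
  simp only [linCochain, Finset.mul_sum, Finset.sum_mul, mul_smul_comm, smul_mul_assoc,
    fold_zw22, add_smul, Finset.sum_add_distrib]
  rw [add_comm, Finset.sum_comm (f := fun i l => B' i l • zwP22 i l)]

theorem dM1_lin_wz00 : dM1 (linCochain A A' B B') wzT00 =
    ∑ i, ∑ j, (A i j + B j i) • wzP00 i j := by
  rw [dM1_eq_wordMap, wordMap_wz00]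
  simp only [linCochain, Finset.mul_sum, Finset.sum_mul, mul_smul_comm, smul_mul_assoc,
    fold_wz00, add_smul, Finset.sum_add_distrib]
  rw [Finset.sum_comm (f := fun i l => B i l • wzP00 l i)]

end linCochain

theorem zzP_comm (i j : Fin 3) : zzP i j = zzP j i := rel_zz i j
theorem wwP_comm (i j : Fin 3) : wwP i j = wwP j i := rel_ww i j

/-! ### Forms vanishing on the cone -/

/-- A bilinear form vanishing on the cone is a multiple of its equation. Pairs of distinct basis
vectors kill the off-diagonal entries, and the points `(e_i + e_j, e_i - e_j)` equate the diagonal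
ones. -/
theorem eq_scalar_of_cone {c : Fin 3 → Fin 3 → ℂ}
    (hc : ∀ z w : Vec, ∑ i, z i * w i = 0 → ∑ i, ∑ j, c i j * (w i * z j) = 0) :
    ∃ s : ℂ, ∀ i j, c i j = if i = j then s else 0 := by
  have h1 : ∀ i j, i ≠ j → c i j = 0 := fun i j hij => by
    have := hc (Pi.single j 1) (Pi.single i 1) (by simp [Pi.single_apply, hij])
    simpa [Pi.single_apply] using this
  have h2 : ∀ i j, i ≠ j → c i i = c j j := fun i j hij => by
    have := hc (Pi.single i 1 + Pi.single j 1) (Pi.single i 1 - Pi.single j 1)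
      (by simp [Pi.single_apply, hij, add_mul, mul_sub, Finset.sum_add_distrib, hij.symm])
    simp [Pi.single_apply, mul_add, sub_mul, mul_sub, Finset.sum_add_distrib, h1 i j hij,
      h1 j i hij.symm] at this
    linear_combination this
  refine ⟨c 0 0, fun i j => ?_⟩
  split_ifs with h
  · subst h
    by_cases h0 : i = 0
    · rw [h0]
    · exact h2 i 0 h0
  · exact h1 i j h

theorem sum_wzP11_diag : ∑ i, wzP11 i i = 0 := rel_wz11
theorem sum_wzP00_diag : ∑ i, wzP00 i i = 0 := rel_wz00
theorem sum_zwP22_diag : ∑ i, zwP22 i i = 0 := rel_zw22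

theorem sum_scalar_smul {F : Fin 3 → Fin 3 → Lam} (hF : ∑ i, F i i = 0)
    {c d : Fin 3 → Fin 3 → ℂ} {s : ℂ} (hc : ∀ i j, c i j - d i j = if i = j then s else 0) :
    ∑ i, ∑ j, c i j • F i j = ∑ i, ∑ j, d i j • F i j := by
  rw [← sub_eq_zero]
  simp only [← Finset.sum_sub_distrib, ← sub_smul, hc, ite_smul, zero_smul, Finset.sum_ite_eq,
    Finset.mem_univ, if_true, ← Finset.smul_sum, hF, smul_zero]

theorem SymForm.exists_coeff {d : Fin 3 → Fin 3 → Fin 3 → ℂ} (h1 : ∀ i j k, d i j k = d j i k)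
    (h2 : ∀ i j k, d i j k = d i k j) : ∃ D : SymForm, ∀ i j k, coeff D i j k = d i j k := by
  -- The two adjacent transpositions generate all permutations of the three slots.
  have hd : ∀ (σ : Equiv.Perm (Fin 3)) (t : Fin 3 → Fin 3),
      d (t (σ 0)) (t (σ 1)) (t (σ 2)) = d (t 0) (t 1) (t 2) := fun σ t => by
    have e1 : σ 0 ≠ σ 1 := by simp
    have e2 : σ 0 ≠ σ 2 := by simp
    have e3 : σ 1 ≠ σ 2 := by simp
    generalize σ 0 = a at *
    generalize σ 1 = b at *
    generalize σ 2 = c at *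
    fin_cases a <;> fin_cases b <;> fin_cases c <;> grind
  refine ⟨⟨∑ t : Fin 3 → Fin 3, d (t 0) (t 1) (t 2) •
    (MultilinearMap.mkPiAlgebra ℂ (Fin 3) ℂ).compLinearMap fun i => LinearMap.proj (t i),
    fun σ v => ?_⟩, fun i j k => ?_⟩
  · simp only [MultilinearMap.sum_apply, smul_apply, MultilinearMap.compLinearMap_apply,
      MultilinearMap.mkPiAlgebra_apply, LinearMap.proj_apply]
    refine Fintype.sum_equiv (Equiv.arrowCongr σ (Equiv.refl _)) _ _ fun t => ?_
    have := hd σ (t ∘ σ.symm)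
    simp only [Function.comp, Equiv.symm_apply_apply] at this
    simp only [Equiv.arrowCongr_apply, Function.comp, Equiv.refl_apply]
    rw [this]
    congr 1
    refine Fintype.prod_equiv σ _ _ fun i => ?_
    simp
  · rw [coeff]
    simp only [MultilinearMap.sum_apply, smul_apply, MultilinearMap.compLinearMap_apply,
      MultilinearMap.mkPiAlgebra_apply, LinearMap.proj_apply]
    rw [Finset.sum_eq_single ![i, j, k]]
    · simp [Fin.prod_univ_three]
    · intro t _ ht
      rw [smul_eq_zero]
      right
      by_contra h0
      apply ht
      have h3 := fun s => (Finset.prod_ne_zero_iff.1 h0) s (Finset.mem_univ s)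
      have a0 := h3 0
      have a1 := h3 1
      have a2 := h3 2
      simp [Pi.single_apply] at a0 a1 a2
      ext s
      fin_cases s <;> simp [*]
    · simp

/-- Every antisymmetric family of quadratic expressions is the sum of a part given by a symmetric
form and a part given by a matrix. -/
theorem exists_quadratic_decomposition {P F : Fin 3 → Fin 3 → Lam} (hP : ∀ i j, P i j = P j i)
    (hF : ∀ i j, F i j = -F j i)
    (hc : ∀ i j, ∃ c : Fin 3 → Fin 3 → ℂ, F i j = ∑ k, ∑ l, c k l • P k l) :
    ∃ (D : SymForm) (M : Fin 3 → Fin 3 → ℂ), ∀ i j, F i j =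
      ∑ r, ∑ k, ∑ l, (eps i j r * coeff D r k l) • P k l +
        (∑ l, M j l • P i l - ∑ l, M i l • P j l) := by
  choose c hc using hc
  -- The antisymmetric pair is encoded by the third index `r`, with the cyclic pair `(r + 1, r +
  -- 2)`, and the quadratic coefficients are symmetrised in `k, l`.
  let Z : Fin 3 → Fin 3 → Fin 3 → ℂ := fun r k l =>
    1 / 2 * (c (r + 1) (r + 2) k l + c (r + 1) (r + 2) l k)
  have hZ : ∀ r k l, Z r k l = Z r l k := fun r k l => by simp only [Z, add_comm]
  -- `D` is the total symmetrisation of `Z`. The remainder has mixed symmetry, and its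
  -- antisymmetrisation in `r` and one of the other indices is encoded by the matrix chosen below.
  obtain ⟨D, hD⟩ := SymForm.exists_coeff (d := fun r k l => 1 / 3 * (Z r k l + Z k r l + Z l r k))
    (fun i j k => by rw [hZ k i j]; ring) (fun i j k => by rw [hZ i j k]; ring)
  refine ⟨D, fun q l => 2 / 3 * (Z (q + 1) (q + 2) l - Z (q + 2) (q + 1) l), ?_⟩
  have hZF : ∀ r, F (r + 1) (r + 2) = ∑ k, ∑ l, Z r k l • P k l := fun r => by
    rw [hc]
    simp only [Z, Fin.sum_univ_three, hP 1 0, hP 2 0, hP 2 1]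
    module
  clear_value Z
  have h01 := hZF 2
  have h12 := hZF 0
  have h20 := hZF 1
  simp only [Fin.isValue, Fin.reduceAdd] at h01 h12 h20
  have h00 : ∀ i, F i i = 0 := fun i => by
    have : (2 : ℂ) • F i i = 0 := by
      rw [two_smul]
      nth_rewrite 1 [hF i i]
      exact neg_add_cancel _
    exact (smul_eq_zero_iff_right two_ne_zero).1 this
  intro i j
  fin_cases i <;> fin_cases j
  all_goals
    simp only [Fin.zero_eta, Fin.mk_one, Fin.reduceFinMk, h00, hF 1 0, hF 2 1, hF 0 2, h01, h12,
      h20, hD, eps_eq, Fin.sum_univ_three, hP 1 0, hP 2 0, hP 2 1, Fin.isValue, Fin.reduceAdd,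
      hZ _ 1 0, hZ _ 2 0, hZ _ 2 1]
    simp [-mul_eq_zero]
    try module

/-! ### Tables which are coboundaries vanish -/

/-- A ternary cubic has ten coefficients, and its values at the ten points below determine them. -/
theorem symForm_eq_zero {D : SymForm}
    (h : ∀ z : Vec, ∑ r, ∑ k, ∑ l, coeff D r k l * (z r * (z k * z l)) = 0) : D = 0 := by
  have h01 := coeff_swap01 D
  have h12 := coeff_swap12 D
  refine SymForm.ext_coeff fun i j k => ?_
  change coeff D i j k = 0
  have q1 := h ![1, 0, 0]
  have q2 := h ![0, 1, 0]
  have q3 := h ![0, 0, 1]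
  have q4 := h ![1, 1, 0]
  have q5 := h ![1, -1, 0]
  have q6 := h ![1, 0, 1]
  have q7 := h ![1, 0, -1]
  have q8 := h ![0, 1, 1]
  have q9 := h ![0, 1, -1]
  have q10 := h ![1, 1, 1]
  simp [Fin.sum_univ_three, h01 1 0, h01 2 0, h01 2 1, h12 _ 1 0, h12 _ 2 0, h12 _ 2 1] at q1 q2 q3
  simp [Fin.sum_univ_three, h01 1 0, h01 2 0, h01 2 1, h12 _ 1 0, h12 _ 2 0, h12 _ 2 1, q1, q2, q3] at q4 q5 q6 q7 q8 q9 q10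
  have r1 : coeff D 0 0 1 = 0 := by linear_combination (1 / 6 : ℂ) * (q4 - q5)
  have r2 : coeff D 0 1 1 = 0 := by linear_combination (1 / 6 : ℂ) * (q4 + q5)
  have r3 : coeff D 0 0 2 = 0 := by linear_combination (1 / 6 : ℂ) * (q6 - q7)
  have r4 : coeff D 0 2 2 = 0 := by linear_combination (1 / 6 : ℂ) * (q6 + q7)
  have r5 : coeff D 1 1 2 = 0 := by linear_combination (1 / 6 : ℂ) * (q8 - q9)
  have r6 : coeff D 1 2 2 = 0 := by linear_combination (1 / 6 : ℂ) * (q8 + q9)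
  have r7 : coeff D 0 1 2 = 0 := by
    linear_combination (1 / 6 : ℂ) * q10 - (1 / 2 : ℂ) * (r1 + r2 + r3 + r4 + r5 + r6)
  fin_cases i <;> fin_cases j <;> fin_cases k <;>
    simp [h01 1 0, h01 2 0, h01 2 1, h12 _ 1 0, h12 _ 2 0, h12 _ 2 1, *]

/-- A cubic expression given by a symmetric form and a matrix vanishes only if the form is zero and
the matrix is scalar. -/
theorem quadratic_decomposition_unique {D : SymForm} {M : Fin 3 → Fin 3 → ℂ}
    (h : ∀ (z : Vec) (i j : Fin 3), ∑ r, ∑ k, ∑ l, (eps i j r * coeff D r k l) * (z k * z l) =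
      ∑ l, M j l * (z i * z l) - ∑ l, M i l * (z j * z l)) :
    D = 0 ∧ ∃ s : ℂ, ∀ i j, M i j = if i = j then s else 0 := by
  have hD : D = 0 := by
    refine symForm_eq_zero fun z => ?_
    have h0 := h z 1 2
    have h1 := h z 2 0
    have h2 := h z 0 1
    simp [eps_eq, Fin.sum_univ_three, -mul_eq_zero] at h0 h1 h2
    simp only [Fin.sum_univ_three]
    -- Contraction with `z` removes the matrix terms, which are antisymmetric in their index pair
    -- and each contain a factor `z`; only the cubic form of `D` survives.
    linear_combination z 0 * h0 + z 1 * h1 + z 2 * h2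
  refine ⟨hD, M 0 0, fun i j => ?_⟩
  have hz : ∀ r k l, coeff D r k l = 0 := fun r k l => by rw [hD]; rfl
  simp only [hz, mul_zero, zero_mul, Finset.sum_const_zero] at h
  have h1 : ∀ i j, i ≠ j → M i j = 0 := fun i j hij => by
    have := h (Pi.single j 1) j i
    simpa [Pi.single_apply, hij] using this.symm
  have h2 : ∀ i j, i ≠ j → M i i = M j j := fun i j hij => by
    have := h (Pi.single i 1 + Pi.single j 1) j i
    simp [Pi.single_apply, hij, hij.symm, mul_add, Finset.sum_add_distrib, h1 i j hij,
      h1 j i hij.symm] at this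
    linear_combination -this
  split_ifs with hij
  · subst hij
    by_cases h0 : i = 0
    · rw [h0]
    · exact h2 i 0 h0
  · exact h1 i j hij

theorem traceless_eq_zero {U : Traceless} {s : ℂ} (h : ∀ i j, U.1 i j = if i = j then s else 0) :
    U = 0 := by
  have ht : U.1.trace = 0 := U.2
  simp [Matrix.trace, Fin.sum_univ_three, h] at ht
  refine Subtype.ext (Matrix.ext fun i j => ?_)
  have hs : s = 0 := ht
  rw [h, hs, ite_self]
  rfl

/-- Points with `w = 0` or `z = 0` isolate the commutators of the `z` or of the `w`: the symmetric
forms vanish, and `A - A'` and `B' - B` are scalar. Modulo scalars, `A + Bᵀ` is then `U` while `A' +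
B'ᵀ` is both `-U` and `X`. So `U` and `X` are scalar, and they are traceless. -/
theorem table_eq_zero {v : Sum4} (hv : table v ∈ MB2 0) : v = 0 := by
  obtain ⟨D, E, U, X⟩ := v
  obtain ⟨h, hh, hd⟩ := hv
  obtain ⟨A, A', B, B', rfl⟩ := exists_linCochain hh
  have hd' : ∀ r, dM1 (linCochain A A' B B') r = table10 D r + table10dual E r + table8 U X r :=
    fun r => by rw [hd, table_apply]; rfl
  have K10 := table10_spec D
  have K10d := table10dual_spec E
  have K8 := table8_spec U X
  have hw0 : ∀ z : Vec, ∑ i, z i * (0 : Vec) i = 0 := fun z => by simp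
  have h0w : ∀ w : Vec, ∑ i, (0 : Vec) i * w i = 0 := fun z => by simp
  obtain ⟨rfl, s, hs⟩ : D = 0 ∧ ∃ s : ℂ, ∀ i j, A i j - A' i j = if i = j then s else 0 := by
    refine quadratic_decomposition_unique fun z i j => ?_
    have := congrArg (ev (hw0 z) 2 0) (hd' (zzT i j))
    rw [dM1_lin_zz, K10.on_zz, K10d.on_zz, K8.on_zz] at this
    simp only [map_add, map_sub, map_sum, map_smul, ev_zzP, smul_eq_mul, Pi.zero_apply, map_zero,
      add_zero] at this
    rw [← this]
    simp only [Fin.sum_univ_three]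
    ring
  obtain ⟨hE, t, ht⟩ : -E = 0 ∧ ∃ s : ℂ, ∀ i j, B' i j - B i j = if i = j then s else 0 := by
    refine quadratic_decomposition_unique fun w i j => ?_
    have := congrArg (ev (h0w w) 0 2) (hd' (wwT i j))
    rw [dM1_lin_ww, K10.on_ww, K10d.on_ww, K8.on_ww] at this
    simp only [map_add, map_sub, map_sum, map_smul, ev_wwP, smul_eq_mul, Pi.zero_apply, map_zero,
      add_zero, zero_add, map_neg] at this
    have hn : ∀ r k l, coeff (-E) r k l = -coeff E r k l := fun _ _ _ => rfl
    simp only [hn, mul_neg, neg_mul, Finset.sum_neg_distrib]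
    rw [← this]
    simp only [Fin.sum_univ_three]
    ring
  obtain rfl := neg_eq_zero.1 hE
  have c11 : ∃ s : ℂ, ∀ i j, A i j + B j i - U.1 i j = if i = j then s else 0 := by
    refine eq_scalar_of_cone fun z w h => ?_
    have := congrArg (ev h 1 1) (hd' zwT11)
    rw [dM1_lin_zw11, K10.on_zw11, K10d.on_zw11, K8.on_zw11] at this
    simp only [map_add, map_sum, map_smul, ev_wzP11, smul_eq_mul, zero_add] at this
    simp only [sub_mul, Finset.sum_sub_distrib, this, map_zero, zero_add, sub_self]
  have d11 : ∃ s : ℂ, ∀ i j, A' i j + B' j i + U.1 i j = if i = j then s else 0 := by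
    refine eq_scalar_of_cone fun z w h => ?_
    have := congrArg (ev h 1 1) (hd' wzT11)
    rw [dM1_lin_wz11, K10.on_wz11, K10d.on_wz11, K8.on_wz11] at this
    simp only [map_add, map_sum, map_smul, ev_wzP11, smul_eq_mul, zero_add, map_neg] at this
    simp only [add_mul (_ + _), Finset.sum_add_distrib, this, map_zero, zero_add, neg_add_cancel]
  have b22 : ∃ s : ℂ, ∀ i j, A' i j + B' j i - X.1 i j = if i = j then s else 0 := by
    refine eq_scalar_of_cone fun z w h => ?_
    have := congrArg (ev h 2 2) (hd' zwT22)
    rw [dM1_lin_zw22, K10.on_zw22, K10d.on_zw22, K8.on_zw22] at this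
    simp only [map_add, map_sum, map_smul, ev_zwP22, smul_eq_mul, zero_add] at this
    simp only [sub_mul, Finset.sum_sub_distrib, mul_comm (w _), this, map_zero, zero_add, sub_self]
  obtain ⟨s1, c11⟩ := c11
  obtain ⟨s2, d11⟩ := d11
  obtain ⟨s3, b22⟩ := b22
  have hU : U = 0 := traceless_eq_zero (s := (s2 - s1 + s - t) / 2) fun i j => by
    have e1 := c11 i j
    have e2 := d11 i j
    have e3 := hs i j
    have e4 := ht j i
    by_cases hij : i = j
    · subst hij
      simp only [if_true] at *
      linear_combination (e2 - e1 + e3 - e4) / 2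
    · simp only [hij, Ne.symm hij, if_false] at *
      linear_combination (e2 - e1 + e3 - e4) / 2
  have hX : X = 0 := traceless_eq_zero (s := s2 - s3) fun i j => by
    have e2 := d11 i j
    have e3 := b22 i j
    rw [hU] at e2
    by_cases hij : i = j
    · subst hij
      simp only [if_true] at *
      simp at e2
      linear_combination e2 - e3
    · simp only [hij, Ne.symm hij, if_false] at *
      simp at e2
      linear_combination e2 - e3
  rw [hU, hX]
  rfl

/-! ### Matrices of bilinear forms annihilated by the coordinates on the cone -/

theorem Fin.sum_univ_of_distinct {M : Type*} [AddCommMonoid M] (f : Fin 3 → M) {a b c : Fin 3}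
    (hab : a ≠ b) (hac : a ≠ c) (hbc : b ≠ c) : ∑ i, f i = f a + f b + f c := by
  have h : (Finset.univ : Finset (Fin 3)) = {a, b, c} := by
    revert a b c
    decide
  rw [h, Finset.sum_insert (by simp [hab, hac]), Finset.sum_insert (by simp [hbc]),
    Finset.sum_singleton, add_assoc]

/-- The array `G` is a matrix of bilinear functions on the cone, of trace zero and annihilated by
`z` and by `w`; it has to be `q w_k z_i` modulo the equation of the cone, and `s` records the
multiples of that equation. Coordinate points determine the coefficients with `l ≠ m` up to one
number for each pair; points on coordinate planes and the trace make these numbers equal. -/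
theorem eq_rank_one_of_cone {G : Fin 3 → Fin 3 → Fin 3 → Fin 3 → ℂ}
    (h1 : ∀ z w : Vec, ∑ i, z i * w i = 0 → ∀ i,
      ∑ k, z k * ∑ l, ∑ m, G k i l m * (w l * z m) = 0)
    (h2 : ∀ z w : Vec, ∑ i, z i * w i = 0 → ∀ i,
      ∑ k, w k * ∑ l, ∑ m, G i k l m * (w l * z m) = 0)
    (h3 : ∀ z w : Vec, ∑ i, z i * w i = 0 → ∑ k, ∑ l, ∑ m, G k k l m * (w l * z m) = 0) :
    ∃ (q : ℂ) (s : Fin 3 → Fin 3 → ℂ), ∀ k i l m,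
      G k i l m = (if k = l ∧ i = m then q else 0) + if l = m then s k i else 0 := by
  have a1 : ∀ l m, l ≠ m → ∀ i, G m i l m = 0 := fun l m hlm i => by
    simpa [Pi.single_apply] using h1 (Pi.single m 1) (Pi.single l 1)
      (by simp [Pi.single_apply, hlm]) i
  have a2 : ∀ l m, l ≠ m → ∀ i, G i l l m = 0 := fun l m hlm i => by
    simpa [Pi.single_apply] using h2 (Pi.single m 1) (Pi.single l 1)
      (by simp [Pi.single_apply, hlm]) i
  have a0 : ∀ l m, l ≠ m → ∑ k, G k k l m = 0 := fun l m hlm => by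
    simpa [Pi.single_apply] using h3 (Pi.single m 1) (Pi.single l 1)
      (by simp [Pi.single_apply, hlm])
  have a3 : ∀ l m p, l ≠ m → l ≠ p → m ≠ p → G p p l m = 0 := fun l m p hlm hlp hmp => by
    have := a0 l m hlm
    rwa [Fin.sum_univ_of_distinct _ hlm hlp hmp, a1 l m hlm, a2 l m hlm, zero_add, zero_add] at this
  have a4 : ∀ l m p, l ≠ m → l ≠ p → m ≠ p → G p m l m = 0 := fun l m p hlm hlp hmp => by
    have := h1 (Pi.single m 1 + Pi.single p 1) (Pi.single l 1)
      (by simp [Pi.single_apply, hlm, hlp]) m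
    simpa [Pi.single_apply, add_mul, mul_add, Finset.sum_add_distrib, a1 l m hlm, a1 l p hlp,
      a3 l p m hlp hlm hmp.symm] using this
  have a5 : ∀ l m p, l ≠ m → l ≠ p → m ≠ p → G l p l m = 0 := fun l m p hlm hlp hmp => by
    have := h2 (Pi.single m 1) (Pi.single l 1 + Pi.single p 1)
      (by simp [Pi.single_apply, hlm.symm, hmp]) l
    simpa [Pi.single_apply, add_mul, mul_add, Finset.sum_add_distrib, a2 l m hlm, a2 p m hmp.symm,
      a3 p m l hmp.symm hlp.symm hlm.symm] using this
  have off : ∀ k i l m, l ≠ m → G k i l m = if k = l ∧ i = m then G l m l m else 0 := by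
    intro k i l m hlm
    by_cases hk : k = l
    · subst hk
      by_cases hi : i = m
      · simp [hi]
      · by_cases hik : i = k
        · simp [hik, a2 k m hlm, hlm]
        · simp [hi, a5 k m i hlm (Ne.symm hik) (Ne.symm hi)]
    · by_cases hkm : k = m
      · simp [hkm, a1 l m hlm, hlm.symm]
      · by_cases hi : i = m
        · simp [hi, hk, a4 l m k hlm (Ne.symm hk) (Ne.symm hkm)]
        · by_cases hil : i = l
          · simp [hil, hlm, a2 l m hlm]
          · obtain rfl : i = k := by omega
            simp [hi, a3 l m i hlm (Ne.symm hk) (Ne.symm hkm)]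
  -- Test points in a coordinate plane with `w` orthogonal to `z`; comparing `t = 1` with `t = -1`
  -- separates the powers of `t`.
  have cone : ∀ (k m : Fin 3) (t : ℂ), k ≠ m → ∑ i, (Pi.single k 1 + t • Pi.single m 1 : Vec) i *
      (t • Pi.single k 1 - Pi.single m 1 : Vec) i = 0 := fun k m t hkm => by
    simp [Pi.single_apply, add_mul, mul_sub, Finset.sum_add_distrib, hkm, hkm.symm]
  have hE : ∀ (k m : Fin 3) (t : ℂ) (x i : Fin 3), ∑ l, ∑ m', G x i l m' *
      ((t • Pi.single k 1 - Pi.single m 1 : Vec) l * (Pi.single k 1 + t • Pi.single m 1 : Vec) m') =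
      t * G x i k k - t * G x i m m + t ^ 2 * G x i k m - G x i m k := fun k m t x i => by
    simp [Pi.single_apply, sub_mul, mul_add, mul_sub, Finset.sum_add_distrib]
    ring
  have b1 : ∀ k m, k ≠ m → ∀ i, G k i k k - G k i m m = G m i m k := fun k m hkm i => by
    have H : ∀ t : ℂ, _ := fun t => h1 _ _ (cone k m t hkm) i
    simp only [hE] at H
    have e1 := H 1
    have e2 := H (-1)
    simp [Pi.single_apply, add_mul, Finset.sum_add_distrib, a1 m k hkm.symm, a1 k m hkm] at e1 e2
    linear_combination (e1 - e2) / 2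
  have b2 : ∀ k m, k ≠ m → ∀ i, G i k k k - G i k m m = G i m k m := fun k m hkm i => by
    have H : ∀ t : ℂ, _ := fun t => h2 _ _ (cone k m t hkm) i
    simp only [hE] at H
    have e1 := H 1
    have e2 := H (-1)
    simp [Pi.single_apply, sub_mul, Finset.sum_add_distrib, a2 m k hkm.symm, a2 k m hkm] at e1 e2
    linear_combination (e1 + e2) / 2
  have sym : ∀ k m, k ≠ m → G m k m k = G k m k m := fun k m hkm => by
    rw [← b1 k m hkm, b2 k m hkm]
  -- The trace condition compares the numbers of different pairs; `sym` by itself relates only `(k,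
  -- m)` to `(m, k)`.
  have tr : ∀ k m p, k ≠ m → k ≠ p → m ≠ p → G m p m p = G k p k p := fun k m p hkm hkp hmp => by
    have H := h3 _ _ (cone k m 1 hkm)
    simp only [hE] at H
    have e1 := a0 k m hkm
    have e2 := a0 m k hkm.symm
    rw [Fin.sum_univ_of_distinct _ hkm hkp hmp] at H e1 e2
    linear_combination H - e1 + e2 - b1 k m hkm k + b1 m k hkm.symm m + b1 p k hkp.symm p -
      b1 p m hmp.symm p - sym k m hkm
  have all : ∀ l m, l ≠ m → G l m l m = G 0 1 0 1 := by
    have t1 := tr 0 1 2 (by decide) (by decide) (by decide)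
    have t2 := tr 0 2 1 (by decide) (by decide) (by decide)
    have t3 := tr 1 2 0 (by decide) (by decide) (by decide)
    have s1 := sym 0 1 (by decide)
    have s2 := sym 0 2 (by decide)
    have s3 := sym 1 2 (by decide)
    intro l m hlm
    fin_cases l <;> fin_cases m <;>
      first
        | exact absurd rfl hlm
        | rfl
        | exact s1
        | exact t2
        | exact s3.symm.trans t2
        | exact t3.trans s1
        | exact s2.symm.trans (t3.trans s1)
  refine ⟨G 0 1 0 1, fun k i => G k i k k - if k = i then G 0 1 0 1 else 0, fun k i l m => ?_⟩
  by_cases hlm : l = m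
  · subst hlm
    by_cases hkl : k = l
    · subst hkl
      simp [eq_comm]
    · have := b1 k l hkl i
      rw [off l i l k (Ne.symm hkl), all l k (Ne.symm hkl)] at this
      simp only [hkl, if_true, false_and, if_false, zero_add]
      simp only [true_and, eq_comm (a := i)] at this
      linear_combination -this
  · rw [off k i l m hlm, all l m hlm, if_neg hlm, add_zero]

/-! ### Cocycles of weight zero on `T_2` -/

theorem exists_traceless (c : Fin 3 → Fin 3 → ℂ) :
    ∃ (U : Traceless) (s : ℂ), ∀ i j, c i j - U.1 i j = if i = j then s else 0 := by
  refine ⟨⟨(Matrix.of c : Matrix (Fin 3) (Fin 3) ℂ) - ((1 / 3 : ℂ) * (Matrix.of c : Matrix (Fin 3) (Fin 3) ℂ).trace) • 1, ?_⟩,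
    (1 / 3 : ℂ) * (Matrix.of c : Matrix (Fin 3) (Fin 3) ℂ).trace, fun i j => ?_⟩
  · change Matrix.trace (_ : Matrix (Fin 3) (Fin 3) ℂ) = 0
    rw [Matrix.trace_sub, Matrix.trace_smul, Matrix.trace_one]
    simp
    ring
  · simp [Matrix.one_apply]

theorem MZ2_reduce_quadratic {g : ↥T2 →ₗ[ℂ] Lam} (hg : g ∈ MZ2 0) :
    ∃ v, ∃ f ∈ MB2 0, (∀ i j, (g - table v - f) (zzT i j) = 0) ∧
      ∀ i j, (g - table v - f) (wwT i j) = 0 := by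
  obtain ⟨D, M, hD⟩ := exists_quadratic_decomposition (F := fun i j => g (zzT i j)) zzP_comm
    (fun i j => by rw [zzT_swap, map_neg])
    (fun i j => exists_coeff_zz (hg.1.2 _) (hg.1.1 2 0 _ zzT_support).1 (hg.1.1 2 0 _ zzT_support).2)
  obtain ⟨E, N, hE⟩ := exists_quadratic_decomposition (F := fun i j => g (wwT i j)) wwP_comm
    (fun i j => by rw [wwT_swap, map_neg])
    (fun i j => exists_coeff_ww (hg.1.2 _) (hg.1.1 0 2 _ wwT_support).1 (hg.1.1 0 2 _ wwT_support).2)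
  have hn : ∀ r k l, coeff (-E) r k l = -coeff E r k l := fun _ _ _ => rfl
  -- The sign of `E` matches the minus sign in the table of `10*`.
  refine ⟨(D, -E, 0, 0), _, ⟨_, linCochain_mem M 0 0 N, rfl⟩, fun i j => ?_, fun i j => ?_⟩
  · rw [LinearMap.sub_apply, LinearMap.sub_apply, table_apply, dM1_lin_zz, hD,
      LinearMap.add_apply, LinearMap.add_apply, (table10_spec _).on_zz, (table10dual_spec _).on_zz,
      (table8_spec _ _).on_zz]
    simp
  · rw [LinearMap.sub_apply, LinearMap.sub_apply, table_apply, dM1_lin_ww, hE,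
      LinearMap.add_apply, LinearMap.add_apply, (table10_spec _).on_ww, (table10dual_spec _).on_ww,
      (table8_spec _ _).on_ww]
    simp [hn]

/-- By `ev_MZ2_sums` the matrices of the four contractions satisfy `a + b = c + d` modulo scalars.
The mean of `c` and `d` is the contribution of a coboundary to all four, and what is left is `U`,
`-U`, `X`, `-X` modulo scalars. -/
theorem MZ2_reduce_sums {g : ↥T2 →ₗ[ℂ] Lam} (hg : g ∈ MZ2 0) (hz : ∀ i j, g (zzT i j) = 0)
    (hw : ∀ i j, g (wwT i j) = 0) :
    ∃ v, ∃ f ∈ MB2 0, (∀ i j, (g - table v - f) (zzT i j) = 0) ∧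
      (∀ i j, (g - table v - f) (wwT i j) = 0) ∧ (g - table v - f) zwT11 = 0 ∧
      (g - table v - f) wzT11 = 0 ∧ (g - table v - f) zwT22 = 0 ∧ (g - table v - f) wzT00 = 0 := by
  obtain ⟨c, hc⟩ := exists_coeff_11 (hg.1.2 zwT11) (hg.1.1 1 1 _ zwT11_support).1
    (hg.1.1 1 1 _ zwT11_support).2
  obtain ⟨d, hd⟩ := exists_coeff_11 (hg.1.2 wzT11) (hg.1.1 1 1 _ wzT11_support).1
    (hg.1.1 1 1 _ wzT11_support).2
  obtain ⟨b, hb⟩ := exists_coeff_22 (hg.1.2 zwT22) (hg.1.1 2 2 _ zwT22_support).1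
    (hg.1.1 2 2 _ zwT22_support).2
  obtain ⟨a, ha⟩ := exists_coeff_00 (hg.1.2 wzT00) (hg.1.1 0 0 _ wzT00_support).1
    (hg.1.1 0 0 _ wzT00_support).2
  obtain ⟨s, hs⟩ : ∃ s : ℂ, ∀ i j, a i j + b i j - c i j - d i j = if i = j then s else 0 := by
    refine eq_scalar_of_cone fun z w h => ?_
    by_cases h0 : z = 0
    · simp [h0]
    · obtain ⟨i, hi⟩ := Function.ne_iff.1 h0
      have := mul_left_cancel₀ hi (ev_MZ2_sums hg h i)
      rw [ha, hb, hc, hd] at this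
      simp only [map_sum, map_smul, ev_wzP00, ev_wzP11, ev_zwP22, smul_eq_mul, mul_comm (z _)]
        at this
      simp only [sub_mul, add_mul, Finset.sum_add_distrib, Finset.sum_sub_distrib]
      linear_combination this
  -- Using the same matrix `t` for both levels of the `z` keeps the values on their commutators
  -- zero.
  let t : Fin 3 → Fin 3 → ℂ := fun i j => (c i j + d i j) / 2
  obtain ⟨U, u, hU⟩ := exists_traceless fun i j => (c i j - d i j) / 2
  obtain ⟨X, x, hX⟩ := exists_traceless fun i j => b i j - t i j
  refine ⟨(0, 0, U, X), _, ⟨_, linCochain_mem t t 0 0, rfl⟩, fun i j => ?_, fun i j => ?_, ?_, ?_,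
    ?_, ?_⟩ <;>
    rw [LinearMap.sub_apply, LinearMap.sub_apply, table_apply, LinearMap.add_apply,
      LinearMap.add_apply, table10_zero, table10dual_zero, LinearMap.zero_apply, zero_add, zero_add]
  · rw [dM1_lin_zz, hz, (table8_spec _ _).on_zz]
    simp only [zzP_comm _ i, zzP_comm _ j, Pi.zero_apply, sub_self, zero_sub]
    rw [add_comm, sub_self, neg_zero]
  · rw [dM1_lin_ww, hw, (table8_spec _ _).on_ww]
    simp
  · rw [dM1_lin_zw11, hc, (table8_spec _ _).on_zw11, sub_sub, sub_eq_zero]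
    simp only [← Finset.sum_add_distrib, ← add_smul]
    refine sum_scalar_smul sum_wzP11_diag (s := u) fun i j => ?_
    rw [← hU]
    simp only [t, Pi.zero_apply]
    ring
  · rw [dM1_lin_wz11, hd, (table8_spec _ _).on_wz11, sub_sub, sub_eq_zero]
    simp only [← Finset.sum_neg_distrib, ← neg_smul, ← Finset.sum_add_distrib, ← add_smul]
    refine sum_scalar_smul sum_wzP11_diag (s := -u) fun i j => ?_
    have e1 := hU i j
    simp only [t, Pi.zero_apply]
    split_ifs at * <;> linear_combination -e1
  · rw [dM1_lin_zw22, hb, (table8_spec _ _).on_zw22, sub_sub, sub_eq_zero]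
    simp only [← Finset.sum_add_distrib, ← add_smul]
    refine sum_scalar_smul (F := fun i j => zwP22 j i) sum_zwP22_diag (s := x) fun i j => ?_
    rw [← hX]
    simp only [t, Pi.zero_apply]
    ring
  · rw [dM1_lin_wz00, ha, (table8_spec _ _).on_wz00, sub_sub, sub_eq_zero]
    simp only [← Finset.sum_neg_distrib, ← neg_smul, ← Finset.sum_add_distrib, ← add_smul]
    refine sum_scalar_smul sum_wzP00_diag (s := s - x) fun i j => ?_
    have e1 := hs i j
    have e2 := hX i j
    simp only [t, Pi.zero_apply] at e2 ⊢
    split_ifs at * <;> linear_combination e1 - e2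

/-- Only the values on the commutators `[w_k, z^i]` remain, and the three cubic conditions put them
in the form `q w_k z^i`. Rescaling the arrows `z` from node `1` to node `2` produces this coboundary
without changing any other value. -/
theorem MZ2_mem_MB2 {g : ↥T2 →ₗ[ℂ] Lam} (hg : g ∈ MZ2 0) (hz : ∀ i j, g (zzT i j) = 0)
    (hw : ∀ i j, g (wwT i j) = 0) (hc : g zwT11 = 0) (hd : g wzT11 = 0) (hb : g zwT22 = 0)
    (ha : g wzT00 = 0) : g ∈ MB2 0 := by
  have H := fun k i => exists_coeff_11 (hg.1.2 (wzT k i)) (hg.1.1 1 1 _ wzT_support).1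
    (hg.1.1 1 1 _ wzT_support).2
  choose G hG using H
  have hev : ∀ (z w : Vec) (h : ∑ i, z i * w i = 0) (k i : Fin 3),
      ev h 1 1 (g (wzT k i)) = ∑ l, ∑ m, G k i l m * (w l * z m) := fun z w h k i => by
    rw [hG]
    simp only [map_sum, map_smul, ev_wzP11, smul_eq_mul]
  obtain ⟨q, s, hq⟩ := eq_rank_one_of_cone (G := G)
    (fun z w h i => by
      have := ev_MZ2_z21 h hg i
      simp only [hev, hz, hc, hb, map_zero, zero_mul, mul_zero, Finset.sum_const_zero,
        zero_add] at this
      exact this.symm)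
    (fun z w h i => by
      have := ev_MZ2_w01 h hg i
      simp only [hev, hw, ha, hd, map_zero, zero_mul, mul_zero, Finset.sum_const_zero,
        zero_add, zero_sub] at this
      exact neg_eq_zero.1 this.symm)
    (fun z w h => by
      have := congrArg (ev h 1 1) (congrArg g sum_wzT)
      simpa only [map_sum, map_sub, hc, hd, map_zero, sub_zero, hev] using this)
  refine ⟨_, linCochain_mem 0 (fun i j => if i = j then q else 0) 0 0, ?_⟩
  refine T2_hom_ext ?_ ?_ ?_ ?_ (fun i j => ?_) (fun i j => ?_) fun i j => ?_
  · rw [dM1_lin_zw11, hc]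
    simp
  · rw [dM1_lin_wz11, hd]
    simp [← Finset.smul_sum, sum_wzP11_diag]
  · rw [dM1_lin_zw22, hb]
    simp [← Finset.smul_sum, sum_zwP22_diag]
  · rw [dM1_lin_wz00, ha]
    simp
  · rw [dM1_lin_zz, hz]
    simp [zzP_comm i j]
  · rw [dM1_lin_ww, hw]
    simp
  · rw [dM1_lin_wz, hG]
    have : ∑ l, ∑ m, G i j l m • wzP11 l m =
        ∑ l, ∑ m, (if i = l ∧ j = m then q else 0) • wzP11 l m :=
      sum_scalar_smul sum_wzP11_diag (s := s i j) fun l m => by rw [hq]; ring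
    rw [this]
    simp [ite_and]

theorem exists_sub_table_mem {g : ↥T2 →ₗ[ℂ] Lam} (hg : g ∈ MZ2 0) :
    ∃ v, g - table v ∈ MB2 0 := by
  have hmem : ∀ {g : ↥T2 →ₗ[ℂ] Lam} (_ : g ∈ MZ2 0) (v : Sum4) {f} (_ : f ∈ MB2 0),
      g - table v - f ∈ MZ2 0 := fun hg v f hf =>
    Submodule.sub_mem _ (Submodule.sub_mem _ hg (liftable_le_MZ2 0 (table_liftable v)))
      (MB2_le_MZ2 0 hf)
  obtain ⟨v₁, f₁, hf₁, hz, hw⟩ := MZ2_reduce_quadratic hg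
  have hg₁ := hmem hg v₁ hf₁
  obtain ⟨v₂, f₂, hf₂, hz₂, hw₂, hc, hd, hb, ha⟩ := MZ2_reduce_sums hg₁ hz hw
  have hg₂ := MZ2_mem_MB2 (hmem hg₁ v₂ hf₂) hz₂ hw₂ hc hd hb ha
  refine ⟨v₁ + v₂, ?_⟩
  have := Submodule.add_mem _ (Submodule.add_mem _ hf₁ hf₂) hg₂
  convert this using 1
  rw [map_add]
  abel

/-! ### Cocycles of weight `-2` on `T_2` -/

/-- A cochain of weight `-2` on the arrows would take values in length `-1`. -/
theorem MB2_neg_two : MB2 (-2) = ⊥ := by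
  rw [eq_bot_iff]
  rintro _ ⟨h, hh, rfl⟩
  have : h = 0 := funext fun x => by
    have := (hh x).2.2
    rwa [homog, if_neg (by norm_num), Submodule.mem_bot] at this
  rw [this, map_zero]
  exact Submodule.zero_mem _

/-- The table of `g_{∅,0}`. -/
def tableG0 : ↥T2 →ₗ[ℂ] Lam :=
  tableMap (e 1) (-e 1) ((1 / 3 : ℂ) • e 2) (-((1 / 3 : ℂ) • e 0)) 0 0 0

theorem tableG0_spec : IsG0 tableG0 := tableMap_hasValues _ _ _ _ (by simp) (by simp) (by simp)

/-- The table of `g_{∅,1}`. -/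
def tableG1 : ↥T2 →ₗ[ℂ] Lam := tableMap (e 1) (e 1) (e 2) (e 0) 0 0 0

theorem tableG1_spec : IsG1 tableG1 := tableMap_hasValues _ _ _ _ (by simp) (by simp) (by simp)

theorem ev_e {z w : Vec} (h : ∑ i, z i * w i = 0) (a : Fin 3) : ev h a a (e a) = 1 := by
  rw [ev_apply, matRep_e, Matrix.single_apply_same]

theorem e_ne_zero (a : Fin 3) : e a ≠ 0 := fun h => by
  have := ev_e (z := 0) (w := 0) (by simp) a
  rw [h, map_zero] at this
  exact zero_ne_one this

theorem eq_zero_of_homog_zero {a b : Fin 3} (hab : a ≠ b) {x : Lam} (hx : x ∈ homog 0)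
    (ha : e a * x = x) (hb : x * e b = x) : x = 0 := by
  obtain ⟨c, rfl⟩ := exists_smul_e hx ha
  rw [← hb, smul_mul_assoc, e_mul_e_of_ne hab, smul_zero]

/-- The tables of weight `-2`. -/
def tableG : (Fin 2 → ℂ) →ₗ[ℂ] (↥T2 →ₗ[ℂ] Lam) :=
  (LinearMap.proj 0).smulRight tableG0 + (LinearMap.proj 1).smulRight tableG1

theorem tableG_apply (v : Fin 2 → ℂ) : tableG v = v 0 • tableG0 + v 1 • tableG1 := rfl

theorem tableG_eq_zero {v : Fin 2 → ℂ} (hv : tableG v ∈ MB2 (-2)) : v = 0 := by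
  rw [MB2_neg_two, Submodule.mem_bot] at hv
  have h1 := LinearMap.congr_fun hv zwT11
  have h2 := LinearMap.congr_fun hv wzT11
  rw [tableG_apply, LinearMap.add_apply, LinearMap.smul_apply, LinearMap.smul_apply,
    tableG0_spec.on_zw11, tableG1_spec.on_zw11, ← add_smul] at h1
  rw [tableG_apply, LinearMap.add_apply, LinearMap.smul_apply, LinearMap.smul_apply,
    tableG0_spec.on_wz11, tableG1_spec.on_wz11, smul_neg, ← neg_smul, ← add_smul] at h2
  have e1 := (smul_eq_zero_iff_left (e_ne_zero 1)).1 h1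
  have e2 := (smul_eq_zero_iff_left (e_ne_zero 1)).1 h2
  funext i
  fin_cases i
  · change v 0 = 0
    linear_combination (e1 - e2) / 2
  · change v 1 = 0
    linear_combination (e1 + e2) / 2

theorem tableG_liftable (v : Fin 2 → ℂ) : tableG v ∈ liftable (-2) :=
  Submodule.add_mem _
    (Submodule.smul_mem _ _ (mem_liftable.2 (exists_cocycle_G0 tableG0_spec)))
    (Submodule.smul_mem _ _ (mem_liftable.2 (exists_cocycle_G1 tableG1_spec)))

theorem exists_sub_tableG_mem {g : ↥T2 →ₗ[ℂ] Lam} (hg : g ∈ MZ2 (-2)) :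
    ∃ v, g - tableG v ∈ MB2 (-2) := by
  have hz : ∀ i j, g (zzT i j) = 0 := fun i j =>
    eq_zero_of_homog_zero (a := 2) (b := 0) (by decide) (hg.1.2 _) (hg.1.1 2 0 _ zzT_support).1
      (hg.1.1 2 0 _ zzT_support).2
  have hw : ∀ i j, g (wwT i j) = 0 := fun i j =>
    eq_zero_of_homog_zero (a := 0) (b := 2) (by decide) (hg.1.2 _) (hg.1.1 0 2 _ wwT_support).1
      (hg.1.1 0 2 _ wwT_support).2
  obtain ⟨α, ha⟩ := exists_smul_e (a := 0) (hg.1.2 wzT00) (hg.1.1 0 0 _ wzT00_support).1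
  obtain ⟨β, hb⟩ := exists_smul_e (a := 2) (hg.1.2 zwT22) (hg.1.1 2 2 _ zwT22_support).1
  obtain ⟨γ, hc⟩ := exists_smul_e (a := 1) (hg.1.2 zwT11) (hg.1.1 1 1 _ zwT11_support).1
  obtain ⟨δ, hd⟩ := exists_smul_e (a := 1) (hg.1.2 wzT11) (hg.1.1 1 1 _ wzT11_support).1
  have hG : ∀ k i, ∃ G : ℂ, g (wzT k i) = G • e 1 := fun k i =>
    exists_smul_e (a := 1) (hg.1.2 (wzT k i)) (hg.1.1 1 1 _ wzT_support).1
  choose G hG using hG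
  have h0 : ∀ z : Vec, ∑ i, z i * (0 : Vec) i = 0 := fun z => by simp
  -- The cubic condition at `z = e_k`, `w = 0`. With the trace (`h2`) and the relation between the
  -- four contractions (`h3`), two of the four scalars remain free.
  have h1 : ∀ k i, G k i = if k = i then δ - α else 0 := fun k i => by
    have := ev_MZ2_z10 (h0 (Pi.single k 1)) hg i
    simp only [hz, ha, hd, hG, map_zero, map_smul, ev_e, smul_eq_mul, mul_one, mul_zero,
      Finset.sum_const_zero, zero_add] at this
    simp [Pi.single_apply] at this
    split_ifs with hki
    · subst hki
      simp at this
      linear_combination this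
    · simp [Ne.symm hki] at this
      exact this
  have h2 := congrArg (ev (h0 0) 1 1) (congrArg g sum_wzT)
  have h3 := ev_MZ2_sums hg (h0 (Pi.single 0 1)) 0
  simp [hc, hd, hG, h1, ev_e, Fin.sum_univ_three] at h2
  simp [ha, hb, hc, hd, ev_e] at h3
  refine ⟨![(γ - δ) / 2, (γ + δ) / 2], ?_⟩
  rw [MB2_neg_two, Submodule.mem_bot, sub_eq_zero, tableG_apply]
  have K := (tableG0_spec.smul ((γ - δ) / 2)).add (tableG1_spec.smul ((γ + δ) / 2))
  refine T2_hom_ext ?_ ?_ ?_ ?_ (fun i j => ?_) (fun i j => ?_) fun i j => ?_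
  · rw [hc]
    refine Eq.trans ?_ K.on_zw11.symm
    module
  · rw [hd]
    refine Eq.trans ?_ K.on_wz11.symm
    module
  · rw [hb]
    refine Eq.trans ?_ K.on_zw22.symm
    rw [smul_smul, ← add_smul]
    congr 1
    linear_combination h3 + h2 / 3
  · rw [ha]
    refine Eq.trans ?_ K.on_wz00.symm
    rw [smul_neg, ← neg_smul, smul_smul, ← add_smul]
    congr 1
    linear_combination - h2 / 3
  · rw [hz]
    refine Eq.trans ?_ (K.on_zz i j).symm
    simp
  · rw [hw]
    refine Eq.trans ?_ (K.on_ww i j).symm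
    simp
  · rw [hG, h1]
    change _ = (((γ - δ) / 2) • tableG0 + ((γ + δ) / 2) • tableG1) (wzT i j)
    rw [wzT_eq, map_add, map_smul, map_sub, K.on_tf, K.on_wz11, K.on_zw11]
    split_ifs
    · simp only [Pi.add_apply, Pi.smul_apply, Pi.zero_apply, smul_zero, zero_add]
      have : δ - α = (1 / 3 : ℂ) * (δ - γ) := by linear_combination h2 / 3
      rw [this]
      module
    · simp

/-! ### Cohomology in terms of tables -/

theorem cmp_mk {w : ℤ} {f : Lam →ₗ[ℂ] Lam →ₗ[ℂ] Lam} (hf : f ∈ Z2 w) :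
    cmp w (Submodule.Quotient.mk ⟨f, hf⟩) = mclass ⟨evalT2 f, evalT2_mem hf⟩ := rfl

theorem mclass_eq {w : ℤ} {g g' : MZ2 w} (h : g.1 - g'.1 ∈ MB2 w) : mclass g = mclass g' :=
  (Submodule.Quotient.eq _).2 h

theorem mclass_eq_iff {w : ℤ} {g g' : MZ2 w} : mclass g = mclass g' ↔ g.1 - g'.1 ∈ MB2 w :=
  Submodule.Quotient.eq _

section Tables

variable {w : ℤ} {V : Type*} [AddCommGroup V] [Module ℂ V] (τ : V →ₗ[ℂ] (↥T2 →ₗ[ℂ] Lam))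

/-- Every class on `T_2` is the class of a table, and every table lifts to a Hochschild cocycle. -/
theorem cmp_surjective (hl : ∀ v, τ v ∈ liftable w)
    (hs : ∀ g ∈ MZ2 w, ∃ v, g - τ v ∈ MB2 w) : Function.Surjective (cmp w) := by
  intro y
  obtain ⟨g, rfl⟩ := Submodule.Quotient.mk_surjective _ y
  obtain ⟨v, hv⟩ := hs g.1 g.2
  obtain ⟨f, hf, hfv⟩ := mem_liftable.1 (hl v)
  refine ⟨Submodule.Quotient.mk ⟨f, hf⟩, ?_⟩
  rw [cmp_mk]
  refine mclass_eq ?_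
  have := Submodule.sub_mem _ hfv hv
  convert this using 1
  change evalT2 f - g.1 = _
  abel

/-- Classes of the cocycles given by a family of tables. -/
def tableClass (hl : ∀ v, τ v ∈ liftable w) : V →ₗ[ℂ] MH2 w :=
  ((MB2 w).submoduleOf (MZ2 w)).mkQ ∘ₗ τ.codRestrict (MZ2 w) fun v => liftable_le_MZ2 w (hl v)

theorem tableClass_apply (hl : ∀ v, τ v ∈ liftable w) (v : V) :
    tableClass τ hl v = mclass ⟨τ v, liftable_le_MZ2 w (hl v)⟩ := rfl

theorem tableClass_bijective (hl : ∀ v, τ v ∈ liftable w) (hi : ∀ v, τ v ∈ MB2 w → v = 0)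
    (hs : ∀ g ∈ MZ2 w, ∃ v, g - τ v ∈ MB2 w) : Function.Bijective (tableClass τ hl) := by
  refine ⟨(injective_iff_map_eq_zero _).2 fun v hv => hi v ?_, fun y => ?_⟩
  · rw [tableClass_apply] at hv
    have h0 : mclass ⟨τ v, liftable_le_MZ2 w (hl v)⟩ = mclass (0 : MZ2 w) := hv
    rw [mclass_eq_iff] at h0
    rwa [← sub_zero (τ v)]
  · obtain ⟨g, rfl⟩ := Submodule.Quotient.mk_surjective _ y
    obtain ⟨v, hv⟩ := hs g.1 g.2
    exact ⟨v, (mclass_eq hv).symm⟩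

/-- Hochschild cohomology in terms of a family of tables. -/
def tableEquiv (hl : ∀ v, τ v ∈ liftable w) (hi : ∀ v, τ v ∈ MB2 w → v = 0)
    (hs : ∀ g ∈ MZ2 w, ∃ v, g - τ v ∈ MB2 w) : V ≃ₗ[ℂ] HH2 w :=
  (LinearEquiv.ofBijective _ (tableClass_bijective τ hl hi hs)).trans
    (LinearEquiv.ofBijective (cmp w) ⟨cmp_injective w, cmp_surjective τ hl hs⟩).symm

theorem cmp_tableEquiv (hl : ∀ v, τ v ∈ liftable w) (hi : ∀ v, τ v ∈ MB2 w → v = 0)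
    (hs : ∀ g ∈ MZ2 w, ∃ v, g - τ v ∈ MB2 w) (v : V) :
    cmp w (tableEquiv τ hl hi hs v) = mclass ⟨τ v, liftable_le_MZ2 w (hl v)⟩ :=
  (LinearEquiv.ofBijective (cmp w) ⟨cmp_injective w, cmp_surjective τ hl hs⟩).apply_symm_apply _

end Tables

/-- Equivariance of the comparison map, stated on representatives so that no representation on `MH2`
is needed. -/
theorem cmp_hhRep (w : ℤ) (s : SL3) {x : HH2 w} {g g' : MZ2 w} (hx : cmp w x = mclass g)
    (hg : g'.1 = tabAct s g.1) : cmp w (hhRep w s x) = mclass g' := by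
  obtain ⟨⟨f, hf⟩, rfl⟩ := Submodule.Quotient.mk_surjective _ x
  have h1 : hhRep w s (Submodule.Quotient.mk ⟨f, hf⟩) =
      Submodule.Quotient.mk ⟨cochainRep s f, cochainRep_Z2 w s hf⟩ := rfl
  rw [h1, cmp_mk]
  rw [cmp_mk, mclass_eq_iff] at hx
  refine mclass_eq ?_
  have := tabAct_MB2 s w hx
  rw [map_sub, tabAct_evalT2] at this
  rw [hg]
  exact this

/-- The weight-zero part of the second Hochschild cohomology as a representation. -/
def repEquiv : Representation.Equiv rep4 (hhRep 0) :=
  Representation.Equiv.mk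
    (tableEquiv table table_liftable (fun _ => table_eq_zero) fun _ => exists_sub_table_mem)
    -- Equivariance is tested after the injective comparison map, where it is the equivariance of
    -- the tables.
    fun s => LinearMap.ext fun v => cmp_injective 0 <| by
      refine (cmp_tableEquiv table table_liftable (fun _ => table_eq_zero)
        (fun _ => exists_sub_table_mem) (rep4 s v)).trans ?_
      exact (cmp_hhRep 0 s (cmp_tableEquiv table table_liftable (fun _ => table_eq_zero)
        (fun _ => exists_sub_table_mem) v) (tabAct_table s v).symm).symm

theorem cmp_repEquiv (v : Sum4) :
    cmp 0 (repEquiv v) = mclass ⟨table v, liftable_le_MZ2 0 (table_liftable v)⟩ :=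
  cmp_tableEquiv table table_liftable (fun _ => table_eq_zero) (fun _ => exists_sub_table_mem) v

/-- The classes of `g_{∅,0}` and `g_{∅,1}` as coordinates on the part of weight `-2`. -/
def weightNegTwoEquiv : (Fin 2 → ℂ) ≃ₗ[ℂ] HH2 (-2) :=
  tableEquiv tableG tableG_liftable (fun _ => tableG_eq_zero) fun _ => exists_sub_tableG_mem

theorem cmp_weightNegTwoEquiv (v : Fin 2 → ℂ) :
    cmp (-2) (weightNegTwoEquiv v) = mclass ⟨tableG v, liftable_le_MZ2 (-2) (tableG_liftable v)⟩ :=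
  cmp_tableEquiv tableG tableG_liftable (fun _ => tableG_eq_zero)
    (fun _ => exists_sub_tableG_mem) v

end TP2

end

theorem mainTheorem3 :
    (Function.Bijective (TP2.cmp (-2)) ∧ Function.Bijective (TP2.cmp 0)) ∧
    (Module.finrank ℂ (TP2.HH2 (-2)) = 2 ∧
      ∃ (b : Module.Basis (Fin 2) ℂ (TP2.HH2 (-2))) (g₀ g₁ : TP2.MZ2 (-2)),
        TP2.IsG0 g₀.1 ∧ TP2.IsG1 g₁.1 ∧
        TP2.cmp (-2) (b 0) = TP2.mclass g₀ ∧ TP2.cmp (-2) (b 1) = TP2.mclass g₁) ∧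
    ∃ Φ : Representation.Equiv
        (TP2.rep10.prod (TP2.rep10dual.prod (TP2.rep8.prod TP2.rep8))) (TP2.hhRep 0),
      (∀ D : TP2.SymForm, ∃ g : TP2.MZ2 0, TP2.IsG10 D g.1 ∧
        TP2.cmp 0 (Φ (D, 0, 0, 0)) = TP2.mclass g) ∧
      (∀ D : TP2.SymForm, ∃ g : TP2.MZ2 0, TP2.IsG10dual D g.1 ∧
        TP2.cmp 0 (Φ (0, D, 0, 0)) = TP2.mclass g) ∧
      (∀ U X : TP2.Traceless, ∃ g : TP2.MZ2 0, TP2.IsG8 U X g.1 ∧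
        TP2.cmp 0 (Φ (0, 0, U, X)) = TP2.mclass g) := by
  refine ⟨⟨⟨TP2.cmp_injective _, TP2.cmp_surjective TP2.tableG TP2.tableG_liftable fun _ =>
      TP2.exists_sub_tableG_mem⟩, TP2.cmp_injective _, TP2.cmp_surjective TP2.table
      TP2.table_liftable fun _ => TP2.exists_sub_table_mem⟩, ⟨?_, ?_⟩, TP2.repEquiv,
    fun D => ?_, fun D => ?_, fun U X => ?_⟩
  · rw [← TP2.weightNegTwoEquiv.finrank_eq, Module.finrank_fin_fun]
  · refine ⟨(Pi.basisFun ℂ (Fin 2)).map TP2.weightNegTwoEquiv, ⟨_, TP2.liftable_le_MZ2 (-2)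
      (TP2.tableG_liftable (Pi.single 0 1))⟩, ⟨_, TP2.liftable_le_MZ2 (-2)
      (TP2.tableG_liftable (Pi.single 1 1))⟩, ?_, ?_, ?_, ?_⟩
    · simpa [TP2.tableG_apply] using TP2.tableG0_spec
    · simpa [TP2.tableG_apply] using TP2.tableG1_spec
    · rw [Module.Basis.map_apply, Pi.basisFun_apply]
      exact TP2.cmp_weightNegTwoEquiv _
    · rw [Module.Basis.map_apply, Pi.basisFun_apply]
      exact TP2.cmp_weightNegTwoEquiv _
  · refine ⟨_, ?_, TP2.cmp_repEquiv _⟩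
    simpa [TP2.table_apply, TP2.table10dual_zero, TP2.table8_zero] using TP2.table10_spec D
  · refine ⟨_, ?_, TP2.cmp_repEquiv _⟩
    simpa [TP2.table_apply, TP2.table10_zero, TP2.table8_zero] using TP2.table10dual_spec D
  · refine ⟨_, ?_, TP2.cmp_repEquiv _⟩
    simpa [TP2.table_apply, TP2.table10_zero, TP2.table10dual_zero] using TP2.table8_spec U X
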